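/- Let $d\ge 5$ be an odd integer, let $p>\frac{d+3}{d-1}$ be real, and put $m_d=\frac{d+1}{2}$ and $c_p=\left[\frac{2(p+1)}{(p-1)^2}\right]^{1/(p-1)}$. For $m\in\mathbb N_0$ let $H^m_r(\mathbb B^d)$ be the space of functions $u:(0,1)\to\mathbb C$ (up to equality almost everywhere) such that the radial function $u(|\cdot|)$ belongs to the Sobolev space $H^m(\mathbb B^d)$ on the open unit ball of $\mathbb R^d$, with norm $\|u(|\cdot|)\|_{H^m(\mathbb B^d)}=\big(\sum_{|\alpha|\le m}\|\partial^\alpha u(|\cdot|)\|_{L^2(\mathbb B^d)}^2\big)^{1/2}$. Let $\mathcal H=H_r^{m_d}(\mathbb B^d)\times H_r^{m_d-1}(\mathbb B^d)$ with the norm $\|(u_1,u_2)\|^2=\|u_1(|\cdot|)\|_{H^{m_d}(\mathbb B^d)}^2+\|u_2(|\cdot|)\|_{H^{m_d-1}(\mathbb B^d)}^2$. Write $$D_d u(\rho)=\Big(\rho^{-1}\tfrac{d}{d\rho}\Big)^{\frac{d-3}{2}}\big(\rho^{d-2}u(\rho)\big),\qquad \Delta_\rho u=u''+\tfrac{d-1}{\rho}u',\qquad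 \Lambda u=-\rho u'.$$ Let $\tilde{\mathbf L}_0$ be the operator on $\mathcal H$ given by $$\tilde{\mathbf L}_0\begin{pmatrix}u_1\\u_2\end{pmatrix}=\begin{pmatrix}u_2+\Lambda u_1-\frac{2}{p-1}u_1\\ \Delta_\rho u_1+\Lambda u_2-\frac{p+1}{p-1}u_2\end{pmatrix}$$ with domain $$\mathcal D(\tilde{\mathbf L}_0)=\{\mathbf u\in\mathcal H\cap C^\infty(0,1)^2:\ D_du_1\in C^3[0,1],\ D_du_2\in C^2[0,1],\ [D_du_1]''(0)=0\}.$$ Then $\tilde{\mathbf L}_0$ is closable. Let $\mathbf L_0$ be its closure, and let $\mathbf L=\mathbf L_0+\mathbf L'$ with $\mathcal D(\mathbf L)=\mathcal D(\mathbf L_0)$ and $\mathbf L'(u_1,u_2)=(0,\,p\,c_p^{p-1}u_1)$. The following hold. 1. Every $\lambda$ in the spectrum $\sigma(\mathbf L)$ satisfies $\lambda=1$ or $\mathrm{Re}\,\lambda\le\max\{-\tfrac{2}{p-1},-1\}$. 2. $\lambda=1$ is an eigenvalue of $\mathbf L$, and its eigenspace $\ker(1-\mathbf L)$ is spanned by the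 constant function $\mathbf g=\big(1,\tfrac{p+1}{p-1}\big)$. -/

import Mathlib

namespace LinearizedWave

noncomputable section

open MeasureTheory Set
open scoped ContDiff

/-! ### Sobolev spaces on the unit ball -/

/-- Euclidean space `ℝᵈ`. -/
abbrev Space (d : ℕ) : Type := EuclideanSpace ℝ (Fin d)

/-- The open unit ball of `ℝᵈ`. -/
abbrev unitBall (d : ℕ) : Set (Space d) := Metric.ball (0 : Space d) 1

/-- Lebesgue measure on the open unit ball of `ℝᵈ`. -/
abbrev ballMeasure (d : ℕ) : Measure (Space d) := volume.restrict (unitBall d)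

/-- The multi-indices `α ∈ ℕᵈ` of order `|α| ≤ m`. -/
def multiIndices (d m : ℕ) : Finset (Fin d → ℕ) :=
  (Fintype.piFinset fun _ : Fin d => Finset.range (m + 1)).filter fun α => ∑ i, α i ≤ m

theorem mem_multiIndices {d m : ℕ} {α : Fin d → ℕ} :
    α ∈ multiIndices d m ↔ ∑ i, α i ≤ m := by
  simp only [multiIndices, Finset.mem_filter, Fintype.mem_piFinset, Finset.mem_range,
    and_iff_right_iff_imp]
  intro h i
  have := Finset.single_le_sum (f := α) (fun j _ => Nat.zero_le _) (Finset.mem_univ i)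
  omega

/-- The multi-index `0`. -/
def zeroIndex (d m : ℕ) : multiIndices d m := ⟨0, mem_multiIndices.2 (by simp)⟩

/-- The classical partial derivative `∂ᵢ φ`. -/
def partialDeriv {d : ℕ} (i : Fin d) (φ : Space d → ℝ) : Space d → ℝ :=
  fun x => fderiv ℝ φ x (EuclideanSpace.single i 1)

/-- The classical derivative `∂^α φ` for a multi-index `α`. -/
def multiDeriv {d : ℕ} (α : Fin d → ℕ) (φ : Space d → ℝ) : Space d → ℝ :=
  (List.finRange d).foldr (fun i ψ => (partialDeriv i)^[α i] ψ) φ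

/-- Test functions on the unit ball: real-valued, smooth, with compact support in the ball. -/
structure IsTestFunction {d : ℕ} (φ : Space d → ℝ) : Prop where
  contDiff : ContDiff ℝ ∞ φ
  compactSupport : HasCompactSupport φ
  tsupport_subset : tsupport φ ⊆ unitBall d

/-- `v` is the weak derivative `∂^α u` on the unit ball. -/
def IsWeakDeriv {d : ℕ} (α : Fin d → ℕ) (u v : Space d → ℂ) : Prop :=
  ∀ φ : Space d → ℝ, IsTestFunction φ →
    ∫ x, multiDeriv α φ x • u x ∂ballMeasure d =
      (-1 : ℂ) ^ (∑ i, α i) * ∫ x, φ x • v x ∂ballMeasure d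

/-- Families of `L²` functions on the unit ball indexed by the multi-indices of order at most `m`,
with norm `(∑_{|α| ≤ m} ‖U_α‖²_{L²})^{1/2}`. -/
abbrev Jet (d m : ℕ) : Type :=
  PiLp 2 fun _ : multiIndices d m => Lp ℂ 2 (ballMeasure d)

theorem contDiff_multiDeriv {d : ℕ} (α : Fin d → ℕ) {φ : Space d → ℝ} (hφ : ContDiff ℝ ∞ φ)
    (hc : HasCompactSupport φ) :
    ContDiff ℝ ∞ (multiDeriv α φ) ∧ HasCompactSupport (multiDeriv α φ) := by
  have h1 : ∀ (i : Fin d) (ψ : Space d → ℝ), (ContDiff ℝ ∞ ψ ∧ HasCompactSupport ψ) →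
      (ContDiff ℝ ∞ (partialDeriv i ψ) ∧ HasCompactSupport (partialDeriv i ψ)) := by
    intro i ψ h
    exact ⟨(h.1.fderiv_right (m := ∞) le_rfl).clm_apply contDiff_const, h.2.fderiv_apply ℝ _⟩
  have h2 : ∀ (i : Fin d) (n : ℕ) (ψ : Space d → ℝ), (ContDiff ℝ ∞ ψ ∧ HasCompactSupport ψ) →
      (ContDiff ℝ ∞ ((partialDeriv i)^[n] ψ) ∧ HasCompactSupport ((partialDeriv i)^[n] ψ)) := by
    intro i n ψ h
    induction n with
    | zero => exact h
    | succ n ih =>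
      rw [Function.iterate_succ_apply']
      exact h1 _ _ ih
  unfold multiDeriv
  induction List.finRange d with
  | nil => exact ⟨hφ, hc⟩
  | cons i l ih => exact h2 _ _ _ ih

theorem integrable_smul_Lp {d : ℕ} {ψ : Space d → ℝ} (hψ : Continuous ψ)
    (hc : HasCompactSupport ψ) (u : Lp ℂ 2 (ballMeasure d)) :
    Integrable (fun x => ψ x • u x) (ballMeasure d) := by
  have : IsFiniteMeasure (ballMeasure d) := ⟨by
    rw [Measure.restrict_apply_univ]; exact measure_ball_lt_top⟩
  have hu : Integrable u (ballMeasure d) := (Lp.memLp u).integrable (by norm_num)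
  exact hu.locallyIntegrable.integrable_smul_left_of_hasCompactSupport hψ hc

/-- The Sobolev space `Hᵐ(𝔹ᵈ)`: a function `u ∈ L²(𝔹ᵈ)` all of whose weak derivatives `∂^α u`,
`|α| ≤ m`, exist and lie in `L²(𝔹ᵈ)` is identified with the family `(∂^α u)_{|α| ≤ m}`. The norm
inherited from `Jet d m` is the standard norm `‖u‖² = ∑_{|α| ≤ m} ‖∂^α u‖²_{L²}`. -/
def sobolev (d m : ℕ) : Submodule ℂ (Jet d m) where
  carrier := {U | ∀ α : multiIndices d m, IsWeakDeriv α.1 (U (zeroIndex d m)) (U α)}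
  zero_mem' := by
    intro α φ hφ
    have h0 : ∀ β : multiIndices d m, ∀ ψ : Space d → ℝ,
        ∫ x, ψ x • ((0 : Jet d m) β : Space d → ℂ) x ∂ballMeasure d = 0 := by
      intro β ψ
      apply integral_eq_zero_of_ae
      have : ((0 : Jet d m) β : Space d → ℂ) =ᵐ[ballMeasure d] 0 :=
        Lp.coeFn_zero ℂ 2 (ballMeasure d)
      filter_upwards [this] with x hx
      rw [hx, Pi.zero_apply, smul_zero]
    rw [h0, h0, mul_zero]
  add_mem' := by
    intro U V hU hV α φ hφ
    have hd := contDiff_multiDeriv α.1 hφ.contDiff hφ.compactSupport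
    have key : ∀ β : multiIndices d m, ∀ ψ : Space d → ℝ, Continuous ψ → HasCompactSupport ψ →
        ∫ x, ψ x • ((U + V) β : Space d → ℂ) x ∂ballMeasure d =
          ∫ x, ψ x • (U β : Space d → ℂ) x ∂ballMeasure d +
            ∫ x, ψ x • (V β : Space d → ℂ) x ∂ballMeasure d := by
      intro β ψ h1 h2
      rw [← integral_add (integrable_smul_Lp h1 h2 _) (integrable_smul_Lp h1 h2 _)]
      apply integral_congr_ae
      have : ((U + V) β : Space d → ℂ) =ᵐ[ballMeasure d] (U β : Space d → ℂ) + V β :=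
        Lp.coeFn_add (U β) (V β)
      filter_upwards [this] with x hx
      rw [hx, Pi.add_apply, smul_add]
    rw [key _ _ hd.1.continuous hd.2, key _ _ hφ.contDiff.continuous hφ.compactSupport,
      hU α φ hφ, hV α φ hφ, mul_add]
  smul_mem' := by
    intro c U hU α φ hφ
    have key : ∀ β : multiIndices d m, ∀ ψ : Space d → ℝ,
        ∫ x, ψ x • ((c • U) β : Space d → ℂ) x ∂ballMeasure d =
          c * ∫ x, ψ x • (U β : Space d → ℂ) x ∂ballMeasure d := by
      intro β ψ
      rw [← integral_const_mul]
      apply integral_congr_ae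
      have : ((c • U) β : Space d → ℂ) =ᵐ[ballMeasure d] c • (U β : Space d → ℂ) :=
        Lp.coeFn_smul c (U β)
      filter_upwards [this] with x hx
      rw [hx, Pi.smul_apply, smul_eq_mul, mul_smul_comm]
    rw [key, key, hU α φ hφ]
    ring

/-- The families whose underlying function (the entry at `α = 0`) is radial, that is, of the form
`ξ ↦ u(|ξ|)` almost everywhere on the ball. -/
def radialJet (d m : ℕ) : Submodule ℂ (Jet d m) where
  carrier := {U | ∃ u : ℝ → ℂ, U (zeroIndex d m) =ᵐ[ballMeasure d] fun x => u ‖x‖}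
  zero_mem' := ⟨0, Lp.coeFn_zero ℂ 2 (ballMeasure d)⟩
  add_mem' := by
    rintro U V ⟨u, hu⟩ ⟨v, hv⟩
    refine ⟨u + v, ?_⟩
    have : ((U + V) (zeroIndex d m) : Space d → ℂ) =ᵐ[ballMeasure d]
        (U (zeroIndex d m) : Space d → ℂ) + V (zeroIndex d m) := Lp.coeFn_add _ _
    filter_upwards [this, hu, hv] with x h1 h2 h3
    rw [h1, Pi.add_apply, h2, h3, Pi.add_apply]
  smul_mem' := by
    rintro c U ⟨u, hu⟩
    refine ⟨c • u, ?_⟩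
    have : ((c • U) (zeroIndex d m) : Space d → ℂ) =ᵐ[ballMeasure d]
        c • (U (zeroIndex d m) : Space d → ℂ) := Lp.coeFn_smul _ _
    filter_upwards [this, hu] with x h1 h2
    rw [h1, Pi.smul_apply, h2, Pi.smul_apply]

/-- The radial Sobolev space `Hᵐ_r(𝔹ᵈ)`, with the norm of `Hᵐ(𝔹ᵈ)`. -/
abbrev radialSobolev (d m : ℕ) : Submodule ℂ (Jet d m) := sobolev d m ⊓ radialJet d m

/-- `U ∈ Hᵐ_r(𝔹ᵈ)` is the function `ξ ↦ u(|ξ|)`. -/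
def Represents {d m : ℕ} (u : ℝ → ℂ) (U : radialSobolev d m) : Prop :=
  U.1 (zeroIndex d m) =ᵐ[ballMeasure d] fun x => u ‖x‖

/-- The inclusion `Hᵐ_r(𝔹ᵈ) → Hⁿ_r(𝔹ᵈ)` for `n ≤ m`; it keeps the underlying function. -/
def inclusion (d : ℕ) {n m : ℕ} (h : n ≤ m) : radialSobolev d m →ₗ[ℂ] radialSobolev d n where
  toFun U := ⟨WithLp.toLp 2 fun α =>
      U.1 ⟨α.1, mem_multiIndices.2 ((mem_multiIndices.1 α.2).trans h)⟩,
    fun α => U.2.1 ⟨α.1, mem_multiIndices.2 ((mem_multiIndices.1 α.2).trans h)⟩, U.2.2⟩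
  map_add' _ _ := rfl
  map_smul' _ _ := rfl

/-- The order `m_d = (d + 1) / 2` (an integer, as `d` will be odd). -/
def order (d : ℕ) : ℕ := (d + 1) / 2

/-- The Hilbert space `𝓗 = H_r^{m_d}(𝔹ᵈ) × H_r^{m_d - 1}(𝔹ᵈ)` with the norm
`‖(u₁, u₂)‖² = ‖u₁‖² + ‖u₂‖²`. -/
abbrev EnergySpace (d : ℕ) : Type :=
  WithLp 2 (radialSobolev d (order d) × radialSobolev d (order d - 1))

/-- `U ∈ 𝓗` is the pair of functions `(u₁, u₂)` of the radial variable. -/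
def RepresentsPair {d : ℕ} (u₁ u₂ : ℝ → ℂ) (U : EnergySpace d) : Prop :=
  Represents u₁ U.fst ∧ Represents u₂ U.snd

/-! ### Differential operators in the radial variable -/

/-- The operator `ρ⁻¹ d/dρ`. -/
def invRhoDeriv (u : ℝ → ℂ) : ℝ → ℂ := fun ρ => (ρ : ℂ)⁻¹ * deriv u ρ

/-- `D_d u = (ρ⁻¹ d/dρ)^{(d - 3) / 2} (ρ^{d - 2} u)`, for odd `d ≥ 5`. -/
def dOp (d : ℕ) (u : ℝ → ℂ) : ℝ → ℂ :=
  invRhoDeriv^[(d - 3) / 2] fun ρ => (ρ : ℂ) ^ (d - 2) * u ρ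

/-- The radial Laplace operator `Δ_ρ u = u'' + (d - 1) / ρ u'`. -/
def radialLaplacian (d : ℕ) (u : ℝ → ℂ) : ℝ → ℂ :=
  fun ρ => deriv (deriv u) ρ + ((d : ℂ) - 1) / ρ * deriv u ρ

/-- The dilation operator `Λ u = -ρ u'`. -/
def dilation (u : ℝ → ℂ) : ℝ → ℂ := fun ρ => -(ρ * deriv u ρ)

/-- First component of the free operator: `u₂ + Λ u₁ - 2 / (p - 1) u₁`. -/
def freeFst (p : ℝ) (u₁ u₂ : ℝ → ℂ) : ℝ → ℂ :=
  fun ρ => u₂ ρ + dilation u₁ ρ - (2 / ((p : ℂ) - 1)) * u₁ ρ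

/-- Second component of the free operator: `Δ_ρ u₁ + Λ u₂ - (p + 1) / (p - 1) u₂`. -/
def freeSnd (d : ℕ) (p : ℝ) (u₁ u₂ : ℝ → ℂ) : ℝ → ℂ :=
  fun ρ => radialLaplacian d u₁ ρ + dilation u₂ ρ - (((p : ℂ) + 1) / ((p : ℂ) - 1)) * u₂ ρ

/-- The regularity and boundary conditions in the domain of the free operator: `u₁, u₂` are smooth
on `(0, 1)`, `D_d u₁ ∈ C³[0, 1]`, `D_d u₂ ∈ C²[0, 1]` and `[D_d u₁]''(0) = 0`. -/
structure IsCore (d : ℕ) (u₁ u₂ : ℝ → ℂ) : Prop where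
  smooth_fst : ContDiffOn ℝ ∞ u₁ (Ioo 0 1)
  smooth_snd : ContDiffOn ℝ ∞ u₂ (Ioo 0 1)
  dOp_fst : ∃ w : ℝ → ℂ, EqOn w (dOp d u₁) (Ioo 0 1) ∧ ContDiffOn ℝ 3 w (Icc 0 1) ∧
    iteratedDerivWithin 2 w (Icc 0 1) 0 = 0
  dOp_snd : ∃ w : ℝ → ℂ, EqOn w (dOp d u₂) (Ioo 0 1) ∧ ContDiffOn ℝ 2 w (Icc 0 1)

theorem smooth_deriv {u : ℝ → ℂ} (hu : ContDiffOn ℝ ∞ u (Ioo 0 1)) :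
    ContDiffOn ℝ ∞ (deriv u) (Ioo 0 1) :=
  ((contDiffOn_infty_iff_deriv_of_isOpen isOpen_Ioo).1 hu).2

theorem smooth_diffAt {u : ℝ → ℂ} (hu : ContDiffOn ℝ ∞ u (Ioo 0 1)) {ρ : ℝ}
    (hρ : ρ ∈ Ioo (0 : ℝ) 1) : DifferentiableAt ℝ u ρ :=
  (hu.contDiffAt (isOpen_Ioo.mem_nhds hρ)).differentiableAt (by simp)

theorem eqOn_deriv {u v : ℝ → ℂ} (h : EqOn u v (Ioo 0 1)) :
    EqOn (deriv u) (deriv v) (Ioo 0 1) := fun _ hρ =>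
  (h.eventuallyEq_of_mem (isOpen_Ioo.mem_nhds hρ)).deriv_eq

theorem deriv_comb {u v : ℝ → ℂ} (hu : ContDiffOn ℝ ∞ u (Ioo 0 1))
    (hv : ContDiffOn ℝ ∞ v (Ioo 0 1)) (c : ℂ) :
    EqOn (deriv (c • u + v)) (c • deriv u + deriv v) (Ioo 0 1) := by
  intro ρ hρ
  rw [deriv_add ((smooth_diffAt hu hρ).const_smul c) (smooth_diffAt hv hρ),
    deriv_const_smul c (smooth_diffAt hu hρ)]
  rfl

theorem smooth_comb {u v : ℝ → ℂ} (hu : ContDiffOn ℝ ∞ u (Ioo 0 1))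
    (hv : ContDiffOn ℝ ∞ v (Ioo 0 1)) (c : ℂ) : ContDiffOn ℝ ∞ (c • u + v) (Ioo 0 1) :=
  (hu.const_smul c).add hv

theorem deriv_deriv_comb {u v : ℝ → ℂ} (hu : ContDiffOn ℝ ∞ u (Ioo 0 1))
    (hv : ContDiffOn ℝ ∞ v (Ioo 0 1)) (c : ℂ) :
    EqOn (deriv (deriv (c • u + v))) (c • deriv (deriv u) + deriv (deriv v)) (Ioo 0 1) :=
  (eqOn_deriv (deriv_comb hu hv c)).trans (deriv_comb (smooth_deriv hu) (smooth_deriv hv) c)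

theorem smooth_invRhoDeriv {u : ℝ → ℂ} (hu : ContDiffOn ℝ ∞ u (Ioo 0 1)) :
    ContDiffOn ℝ ∞ (invRhoDeriv u) (Ioo 0 1) := by
  refine ContDiffOn.mul (ContDiffOn.inv ?_ ?_) (smooth_deriv hu)
  · exact Complex.ofRealCLM.contDiff.contDiffOn
  · intro ρ hρ
    exact Complex.ofReal_ne_zero.2 hρ.1.ne'

theorem iterate_comb (n : ℕ) {u v f : ℝ → ℂ} (hu : ContDiffOn ℝ ∞ u (Ioo 0 1))
    (hv : ContDiffOn ℝ ∞ v (Ioo 0 1)) (c : ℂ) (hf : EqOn f (c • u + v) (Ioo 0 1)) :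
    EqOn (invRhoDeriv^[n] f) (c • invRhoDeriv^[n] u + invRhoDeriv^[n] v) (Ioo 0 1) := by
  induction n generalizing u v f with
  | zero => exact hf
  | succ n ih =>
    simp only [Function.iterate_succ_apply]
    refine ih (smooth_invRhoDeriv hu) (smooth_invRhoDeriv hv) ?_
    intro ρ hρ
    simp only [invRhoDeriv, Pi.add_apply, Pi.smul_apply, smul_eq_mul]
    rw [eqOn_deriv hf hρ, deriv_comb hu hv c hρ]
    simp only [Pi.add_apply, Pi.smul_apply, smul_eq_mul]
    ring

theorem dOp_comb (d : ℕ) {u v : ℝ → ℂ} (hu : ContDiffOn ℝ ∞ u (Ioo 0 1))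
    (hv : ContDiffOn ℝ ∞ v (Ioo 0 1)) (c : ℂ) :
    EqOn (dOp d (c • u + v)) (c • dOp d u + dOp d v) (Ioo 0 1) := by
  have hp : ContDiffOn ℝ ∞ (fun ρ : ℝ => (ρ : ℂ) ^ (d - 2)) (Ioo 0 1) :=
    (Complex.ofRealCLM.contDiff.pow (d - 2)).contDiffOn
  refine iterate_comb _ (hp.mul hu) (hp.mul hv) c ?_
  intro ρ _
  simp only [Pi.add_apply, Pi.smul_apply, smul_eq_mul]
  ring

theorem IsCore.comb {d : ℕ} {u₁ u₂ v₁ v₂ : ℝ → ℂ} (hu : IsCore d u₁ u₂) (hv : IsCore d v₁ v₂)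
    (c : ℂ) : IsCore d (c • u₁ + v₁) (c • u₂ + v₂) := by
  obtain ⟨w, hw1, hw2, hw3⟩ := hu.dOp_fst
  obtain ⟨z, hz1, hz2, hz3⟩ := hv.dOp_fst
  obtain ⟨w', hw'1, hw'2⟩ := hu.dOp_snd
  obtain ⟨z', hz'1, hz'2⟩ := hv.dOp_snd
  have h0 : (0 : ℝ) ∈ Icc (0 : ℝ) 1 := ⟨le_rfl, zero_le_one⟩
  have hU : UniqueDiffOn ℝ (Icc (0 : ℝ) 1) := uniqueDiffOn_Icc zero_lt_one
  refine ⟨smooth_comb hu.1 hv.1 c, smooth_comb hu.2 hv.2 c, ⟨c • w + z, ?_, ?_, ?_⟩,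
    ⟨c • w' + z', ?_, ?_⟩⟩
  · intro ρ hρ
    rw [dOp_comb d hu.1 hv.1 c hρ]
    simp only [Pi.add_apply, Pi.smul_apply, hw1 hρ, hz1 hρ]
  · exact (hw2.const_smul c).add hz2
  · have e1 : ContDiffWithinAt ℝ 2 (c • w) (Icc 0 1) 0 :=
      ((hw2.const_smul c) 0 h0).of_le (by norm_num)
    have e2 : ContDiffWithinAt ℝ 2 z (Icc 0 1) 0 := (hz2 0 h0).of_le (by norm_num)
    have e3 : ContDiffWithinAt ℝ 2 w (Icc 0 1) 0 := (hw2 0 h0).of_le (by norm_num)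
    rw [iteratedDerivWithin_add h0 hU (by exact_mod_cast e1) (by exact_mod_cast e2),
      iteratedDerivWithin_const_smul h0 hU c (by exact_mod_cast e3), hw3, hz3]
    simp
  · intro ρ hρ
    rw [dOp_comb d hu.2 hv.2 c hρ]
    simp only [Pi.add_apply, Pi.smul_apply, hw'1 hρ, hz'1 hρ]
  · exact (hw'2.const_smul c).add hz'2

theorem isCore_zero (d : ℕ) : IsCore d 0 0 := by
  have h : ∀ n, invRhoDeriv^[n] (0 : ℝ → ℂ) = 0 := by
    intro n
    induction n with
    | zero => rfl
    | succ n ih =>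
      rw [Function.iterate_succ_apply', ih]
      funext ρ
      simp [invRhoDeriv]
  have h' : dOp d 0 = 0 := by
    have e : (fun ρ : ℝ => (ρ : ℂ) ^ (d - 2) * (0 : ℝ → ℂ) ρ) = 0 := by
      funext ρ
      simp
    rw [dOp, e, h]
  refine ⟨contDiffOn_const, contDiffOn_const, ⟨0, ?_, contDiffOn_const, ?_⟩,
    ⟨0, ?_, contDiffOn_const⟩⟩
  · rw [h']; exact fun _ _ => rfl
  · change iteratedDerivWithin 2 (fun _ : ℝ => (0 : ℂ)) (Icc 0 1) 0 = 0
    simp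
  · rw [h']; exact fun _ _ => rfl

theorem ae_mem_Ioo {d : ℕ} (hd : d ≠ 0) :
    ∀ᵐ x ∂ballMeasure d, ‖x‖ ∈ Ioo (0 : ℝ) 1 := by
  have : Nonempty (Fin d) := ⟨⟨0, Nat.pos_of_ne_zero hd⟩⟩
  have h0 : ∀ᵐ x ∂ballMeasure d, x ≠ 0 := by
    apply ae_restrict_of_ae
    simp [ae_iff]
  filter_upwards [h0, ae_restrict_mem measurableSet_ball] with x hx hx1
  exact ⟨norm_pos_iff.2 hx, by simpa using hx1⟩

theorem Represents.comb {d m : ℕ} {u v : ℝ → ℂ} {U V : radialSobolev d m} (hu : Represents u U)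
    (hv : Represents v V) (c : ℂ) : Represents (c • u + v) (c • U + V) := by
  have e1 : ((c • U + V : radialSobolev d m).1 (zeroIndex d m) : Space d → ℂ) =ᵐ[ballMeasure d]
      (((c • U.1 (zeroIndex d m) : Lp ℂ 2 (ballMeasure d)) : Space d → ℂ) +
        (V.1 (zeroIndex d m) : Space d → ℂ)) := Lp.coeFn_add _ _
  have e2 : (((c • U.1 (zeroIndex d m) : Lp ℂ 2 (ballMeasure d))) : Space d → ℂ)
      =ᵐ[ballMeasure d] c • (U.1 (zeroIndex d m) : Space d → ℂ) := Lp.coeFn_smul _ _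
  unfold Represents at *
  filter_upwards [e1, e2, hu, hv] with x h1 h2 h3 h4
  rw [h1, Pi.add_apply, h2, Pi.smul_apply, h3, h4]
  rfl

theorem Represents.congr {d m : ℕ} (hd : d ≠ 0) {u v : ℝ → ℂ} {U : radialSobolev d m}
    (hu : Represents u U) (h : EqOn u v (Ioo 0 1)) : Represents v U := by
  unfold Represents at *
  filter_upwards [hu, ae_mem_Ioo hd] with x h1 h2
  rw [h1, h h2]

theorem represents_zero (d m : ℕ) : Represents 0 (0 : radialSobolev d m) :=
  Lp.coeFn_zero ℂ 2 (ballMeasure d)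

/-- A continuous function of the radial variable that represents `0` vanishes on `(0, 1)`. -/
theorem Represents.eqOn_zero {d m : ℕ} (hd : d ≠ 0) {u : ℝ → ℂ}
    (hc : ContinuousOn u (Ioo 0 1)) (h : Represents u (0 : radialSobolev d m)) :
    EqOn u 0 (Ioo 0 1) := by
  have hz : ∀ᵐ x ∂ballMeasure d, u ‖x‖ = 0 := by
    have h0 := represents_zero d m
    unfold Represents at h h0
    filter_upwards [h, h0] with x h1 h2
    rw [← h1, h2]
    rfl
  by_contra hne
  obtain ⟨ρ, hρ, hρ'⟩ : ∃ ρ ∈ Ioo (0 : ℝ) 1, u ρ ≠ 0 := by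
    simpa [EqOn, and_assoc] using hne
  have hopen : IsOpen (Ioo (0 : ℝ) 1 ∩ u ⁻¹' {0}ᶜ) :=
    hc.isOpen_inter_preimage isOpen_Ioo isOpen_compl_singleton
  have hopen' : IsOpen ((fun x : Space d => ‖x‖) ⁻¹' (Ioo (0 : ℝ) 1 ∩ u ⁻¹' {0}ᶜ)) :=
    hopen.preimage continuous_norm
  have hnon : ((fun x : Space d => ‖x‖) ⁻¹' (Ioo (0 : ℝ) 1 ∩ u ⁻¹' {0}ᶜ)).Nonempty := by
    refine ⟨EuclideanSpace.single ⟨0, Nat.pos_of_ne_zero hd⟩ ρ, ?_⟩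
    have : ‖(EuclideanSpace.single ⟨0, Nat.pos_of_ne_zero hd⟩ ρ : Space d)‖ = ρ := by
      rw [PiLp.norm_single, Real.norm_of_nonneg hρ.1.le]
    simp only [mem_preimage, this]
    exact ⟨hρ, hρ'⟩
  have hpos := hopen'.measure_pos (volume : Measure (Space d)) hnon
  have hzero : (ballMeasure d) ((fun x : Space d => ‖x‖) ⁻¹' (Ioo (0 : ℝ) 1 ∩ u ⁻¹' {0}ᶜ)) = 0 := by
    refine measure_mono_null ?_ (ae_iff.1 hz)
    intro x hx
    exact hx.2
  rw [Measure.restrict_apply hopen'.measurableSet, inter_eq_left.2] at hzero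
  · exact hpos.ne' hzero
  · intro x hx
    have := hx.1.2
    simpa using this

/-- An element of the radial Sobolev space is determined by its underlying function. -/
theorem Represents.eq_zero {d m : ℕ} {U : radialSobolev d m} (h : Represents 0 U) : U = 0 := by
  apply Subtype.ext
  apply PiLp.ext
  intro α
  apply Lp.ext
  refine Filter.EventuallyEq.trans ?_ (Lp.coeFn_zero ℂ 2 (ballMeasure d)).symm
  have : IsFiniteMeasure (ballMeasure d) := ⟨by
    rw [Measure.restrict_apply_univ]; exact measure_ball_lt_top⟩
  have hu : Integrable (U.1 α) (ballMeasure d) := (Lp.memLp (U.1 α)).integrable (by norm_num)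
  have key := Metric.isOpen_ball.ae_eq_zero_of_integral_contDiff_smul_eq_zero
    (μ := (volume : Measure (Space d))) (U := unitBall d) (f := U.1 α)
    (IntegrableOn.locallyIntegrableOn hu) ?_
  · exact (ae_restrict_iff' measurableSet_ball).2 key
  · intro φ h1 h2 h3
    have hφ : IsTestFunction φ := ⟨h1, h2, h3⟩
    have e := U.2.1 α φ hφ
    have e0 : ∫ x, multiDeriv α.1 φ x • (U.1 (zeroIndex d m) : Space d → ℂ) x ∂ballMeasure d
        = 0 := by
      apply integral_eq_zero_of_ae
      filter_upwards [h] with x hx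
      rw [hx]
      simp
    rw [e0] at e
    have e' : ∫ x, φ x • (U.1 α : Space d → ℂ) x ∂ballMeasure d = 0 := by
      rcases mul_eq_zero.1 e.symm with h' | h'
      · exact absurd h' (pow_ne_zero _ (by norm_num))
      · exact h'
    rw [← e', setIntegral_eq_integral_of_forall_compl_eq_zero]
    intro x hx
    have : φ x = 0 := by
      by_contra hne
      exact hx (h3 (subset_tsupport _ hne))
    rw [this, zero_smul]

/-! ### The operators -/

theorem freeFst_comb (p : ℝ) {u₁ u₂ v₁ v₂ : ℝ → ℂ} (hu₁ : ContDiffOn ℝ ∞ u₁ (Ioo 0 1))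
    (hv₁ : ContDiffOn ℝ ∞ v₁ (Ioo 0 1)) (c : ℂ) :
    EqOn (c • freeFst p u₁ u₂ + freeFst p v₁ v₂)
      (freeFst p (c • u₁ + v₁) (c • u₂ + v₂)) (Ioo 0 1) := by
  intro ρ hρ
  simp only [freeFst, dilation, Pi.add_apply, Pi.smul_apply, smul_eq_mul, deriv_comb hu₁ hv₁ c hρ]
  ring

theorem freeSnd_comb (d : ℕ) (p : ℝ) {u₁ u₂ v₁ v₂ : ℝ → ℂ} (hu₁ : ContDiffOn ℝ ∞ u₁ (Ioo 0 1))
    (hu₂ : ContDiffOn ℝ ∞ u₂ (Ioo 0 1)) (hv₁ : ContDiffOn ℝ ∞ v₁ (Ioo 0 1))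
    (hv₂ : ContDiffOn ℝ ∞ v₂ (Ioo 0 1)) (c : ℂ) :
    EqOn (c • freeSnd d p u₁ u₂ + freeSnd d p v₁ v₂)
      (freeSnd d p (c • u₁ + v₁) (c • u₂ + v₂)) (Ioo 0 1) := by
  intro ρ hρ
  simp only [freeSnd, radialLaplacian, dilation, Pi.add_apply, Pi.smul_apply, smul_eq_mul,
    deriv_comb hu₁ hv₁ c hρ, deriv_comb hu₂ hv₂ c hρ, deriv_deriv_comb hu₁ hv₁ c hρ]
  ring

theorem freeFst_zero (p : ℝ) : freeFst p 0 0 = 0 := by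
  funext ρ
  simp [freeFst, dilation]

theorem freeSnd_zero (d : ℕ) (p : ℝ) : freeSnd d p 0 0 = 0 := by
  have h : deriv (0 : ℝ → ℂ) = 0 := by
    funext ρ
    simp
  funext ρ
  simp [freeSnd, dilation, radialLaplacian, h]

/-- `(U, F) ∈ 𝓗 × 𝓗` is such that `U = (u₁, u₂)` lies in the domain of the free operator and `F` is
the image of `U`. -/
def IsFreePair (d : ℕ) (p : ℝ) (U F : EnergySpace d) : Prop :=
  ∃ u₁ u₂ : ℝ → ℂ, IsCore d u₁ u₂ ∧ RepresentsPair u₁ u₂ U ∧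
    RepresentsPair (freeFst p u₁ u₂) (freeSnd d p u₁ u₂) F

theorem isFreePair_zero (d : ℕ) (p : ℝ) : IsFreePair d p 0 0 := by
  refine ⟨0, 0, isCore_zero d, ⟨represents_zero _ _, represents_zero _ _⟩, ?_, ?_⟩
  · rw [freeFst_zero]; exact represents_zero _ _
  · rw [freeSnd_zero]; exact represents_zero _ _

theorem IsFreePair.comb {d : ℕ} (hd : d ≠ 0) {p : ℝ} {U F V G : EnergySpace d}
    (h : IsFreePair d p U F) (h' : IsFreePair d p V G) (c : ℂ) :
    IsFreePair d p (c • U + V) (c • F + G) := by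
  obtain ⟨u₁, u₂, hu, hU, hF⟩ := h
  obtain ⟨v₁, v₂, hv, hV, hG⟩ := h'
  exact ⟨c • u₁ + v₁, c • u₂ + v₂, hu.comb hv c, ⟨hU.1.comb hV.1 c, hU.2.comb hV.2 c⟩,
    (hF.1.comb hG.1 c).congr hd (freeFst_comb p hu.1 hv.1 c),
    (hF.2.comb hG.2 c).congr hd (freeSnd_comb d p hu.1 hu.2 hv.1 hv.2 c)⟩

/-- The image under the free operator is unique. -/
theorem IsFreePair.eq_zero {d : ℕ} (hd : d ≠ 0) {p : ℝ} {F : EnergySpace d}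
    (h : IsFreePair d p 0 F) : F = 0 := by
  obtain ⟨u₁, u₂, hu, hU, hF⟩ := h
  have h1 : EqOn u₁ 0 (Ioo 0 1) := Represents.eqOn_zero hd hu.1.continuousOn hU.1
  have h2 : EqOn u₂ 0 (Ioo 0 1) := Represents.eqOn_zero hd hu.2.continuousOn hU.2
  have hz : deriv (0 : ℝ → ℂ) = 0 := by
    funext ρ
    simp
  have d1 : EqOn (deriv u₁) 0 (Ioo 0 1) := by simpa [hz] using eqOn_deriv h1
  have d2 : EqOn (deriv u₂) 0 (Ioo 0 1) := by simpa [hz] using eqOn_deriv h2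
  have d3 : EqOn (deriv (deriv u₁)) 0 (Ioo 0 1) := by simpa [hz] using eqOn_deriv d1
  have e1 : F.fst = 0 := by
    refine (hF.1.congr hd ?_).eq_zero
    intro ρ hρ
    simp [freeFst, dilation, h1 hρ, h2 hρ, d1 hρ]
  have e2 : F.snd = 0 := by
    refine (hF.2.congr hd ?_).eq_zero
    intro ρ hρ
    simp [freeSnd, dilation, radialLaplacian, h2 hρ, d1 hρ, d2 hρ, d3 hρ]
  exact (WithLp.ofLp_injective 2) (Prod.ext e1 e2)

/-- The graph of the free operator. -/
def freeGraph (d : ℕ) [NeZero d] (p : ℝ) : Submodule ℂ (EnergySpace d × EnergySpace d) where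
  carrier := {q | IsFreePair d p q.1 q.2}
  zero_mem' := isFreePair_zero d p
  add_mem' := by
    intro a b ha hb
    have := IsFreePair.comb (NeZero.ne d) ha hb 1
    rwa [one_smul, one_smul] at this
  smul_mem' := by
    intro c a ha
    have := IsFreePair.comb (NeZero.ne d) ha (isFreePair_zero d p) c
    rwa [add_zero, add_zero] at this

/-- The free operator `L̃₀(u₁, u₂) = (u₂ + Λ u₁ - 2/(p-1) u₁, Δ_ρ u₁ + Λ u₂ - (p+1)/(p-1) u₂)` with
domain `{u ∈ 𝓗 ∩ C^∞(0,1)² : D_d u₁ ∈ C³[0,1], D_d u₂ ∈ C²[0,1], [D_d u₁]''(0) = 0}`, as an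
unbounded operator on `𝓗`. (For such `u` the image `L̃₀ u` automatically lies in `𝓗`, since the
functions `D_d (L̃₀ u)ⱼ` are of class `C²` resp. `C¹` on `[0,1]` and vanish at `0`.) -/
def freeOp (d : ℕ) [NeZero d] (p : ℝ) : EnergySpace d →ₗ.[ℂ] EnergySpace d :=
  (freeGraph d p).toLinearPMap

/-- The graph of `freeOp` is what it should be. -/
theorem mem_graph_freeOp {d : ℕ} [NeZero d] {p : ℝ} {U F : EnergySpace d} :
    (U, F) ∈ (freeOp d p).graph ↔ IsFreePair d p U F := by
  rw [freeOp, Submodule.toLinearPMap_graph_eq]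
  · rfl
  · rintro ⟨U, F⟩ h (rfl : U = 0)
    exact IsFreePair.eq_zero (NeZero.ne d) h

/-- The constant `c_p = (2 (p + 1) / (p - 1)²)^{1 / (p - 1)}`. -/
def profileConst (p : ℝ) : ℝ := (2 * (p + 1) / (p - 1) ^ 2) ^ (1 / (p - 1))

/-- The potential term `L'(u₁, u₂) = (0, p c_p^{p - 1} u₁)`, defined on all of `𝓗`. -/
def potentialOp (d : ℕ) (p : ℝ) : EnergySpace d →ₗ[ℂ] EnergySpace d where
  toFun U := WithLp.toLp 2
    (0, ((p * profileConst p ^ (p - 1) : ℝ) : ℂ) • inclusion d (Nat.sub_le (order d) 1) U.fst)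
  map_add' U V := by
    apply WithLp.ofLp_injective 2
    refine Prod.ext (by simp) ?_
    simp [smul_add]
  map_smul' c U := by
    apply WithLp.ofLp_injective 2
    refine Prod.ext (by simp) ?_
    simp [smul_comm c]

/-- The linearized operator `L = L₀ + L'` with domain `D(L) = D(L₀)`, where `L₀` is the closure of
the free operator `L̃₀`. -/
def linearizedOp (d : ℕ) [NeZero d] (p : ℝ) : EnergySpace d →ₗ.[ℂ] EnergySpace d :=
  potentialOp d p +ᵥ (freeOp d p).closure

/-! ### Spectrum of an unbounded operator -/

/-- `μ` lies in the resolvent set of `A` if `μ - A` maps the domain of `A` bijectively onto the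
whole space and has a bounded inverse. -/
def InResolventSet {E : Type*} [NormedAddCommGroup E] [NormedSpace ℂ E] (A : E →ₗ.[ℂ] E)
    (μ : ℂ) : Prop :=
  ∃ R : E →L[ℂ] E, (∀ x : A.domain, R (μ • (x : E) - A x) = x) ∧
    ∀ y : E, ∃ x : A.domain, (x : E) = R y ∧ μ • (x : E) - A x = y

/-- The spectrum of an unbounded operator. -/
def spectrumOf {E : Type*} [NormedAddCommGroup E] [NormedSpace ℂ E] (A : E →ₗ.[ℂ] E) : Set ℂ :=
  {μ | ¬ InResolventSet A μ}

/-- The eigenspace `ker (μ - A) = {x ∈ D(A) : A x = μ x}`. -/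
def eigenspaceOf {E : Type*} [NormedAddCommGroup E] [NormedSpace ℂ E] (A : E →ₗ.[ℂ] E) (μ : ℂ) :
    Submodule ℂ E :=
  A.graph.comap (LinearMap.id.prod (μ • LinearMap.id))

theorem mem_eigenspaceOf {E : Type*} [NormedAddCommGroup E] [NormedSpace ℂ E] {A : E →ₗ.[ℂ] E}
    {μ : ℂ} {x : E} : x ∈ eigenspaceOf A μ ↔ ∃ y : A.domain, (y : E) = x ∧ A y = μ • x := by
  simp [eigenspaceOf, LinearPMap.mem_graph_iff]

/-- `μ` is an eigenvalue of `A`. -/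
def IsEigenvalue {E : Type*} [NormedAddCommGroup E] [NormedSpace ℂ E] (A : E →ₗ.[ℂ] E)
    (μ : ℂ) : Prop :=
  ∃ x ∈ eigenspaceOf A μ, x ≠ 0

end

end LinearizedWave

/-!
Throughout `d = 2 K + 3` and `s = 2 / (p - 1)`. The proof works on the dense subspace of pairs
`(F(ρ²), G(ρ²))` with polynomials `F`, `G`, which both operators preserve; everything that is needed
of the closure of the free operator is obtained by approximation from this core.

*Half line.* The operator `D_d` conjugates the radial Laplacian to `d²/dρ²` (`dOp_radialLaplacian`).
With `qⱼ = D_d uⱼ` the pair `z₁ = q₁''`, `z₂ = q₂'` satisfies the one-dimensional wave system in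
self-similar variables, and multiplying by the conjugates and integrating over `(0, 1)` gives
dissipativity: the boundary term at `ρ = 1` is `|z₁ - z₂|² / 2 ≥ 0` (`wave_energy_estimate`). The
constants lost by differentiating are recovered from the functional `q₁'(1) + q₂(1)`, which
`μ - L₀` multiplies by `μ + s`. Together they form `waveEnergy`, and the resolvent of the free
operator is bounded in it by a multiple of `1 / (Re μ + s)` (`waveEnergy_resolvent_le`).

*Equivalence of norms.* `D_d` and its derivatives are products of shifted Euler operators
`ρ d/dρ + c` with `c > 1/2`, which Hardy's inequality inverts on `L²(0, 1)`
(`chain_le_of_half_lt`). Conversely a Sobolev function controls the derivatives `(ρ⁻¹ d/dρ)ʲ u` with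
weights, as `zʲ (ρ⁻¹ d/dρ)ʲ u = (∂_a + i ∂_b)ʲ u` for `z = x_a + i x_b`
(`intervalNorm_iterate_invRhoDeriv_le`), and Hardy's inequality with `c ≤ 0` removes the weights
(`chain_le_of_nonpos`). Hence `waveEnergy` is equivalent to the norm of the energy space
(`enorm_energyJet_le`, `waveEnergy_le`).

*Core.* Averages over dilations are smooth on `(0, 1)` and approximate any radial Sobolev function,
and for such functions polynomial approximation takes place in `L²(0, 1)` after applying the Euler
operators, which are invertible on polynomials (`denseRange_energyJet`). The same idea in the graph
norm, where the regularity and boundary conditions of the domain enter, shows that the polynomial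
pairs are a core (`graph_freeOp_subset`).

*Spectrum.* On polynomials the resolvent equation is triangular in the monomial basis, with diagonal
entries `(2 k + μ + s + 1) (2 k + μ + s) - (s + 1) (s + 2) = (μ + 2 k - 1) (μ + 2 k + 2 s + 2)`
(`surjective_resolvent`, `spectral_diagonal_ne`), so that for `Re μ > max (-s) (-1)` it is solvable
unless `k = 0` and `μ = 1`. The potential `B` has compact adjoint, as it loses one derivative
(`isCompactOperator_adjoint_potential`); hence `1 - B R(μ)`, with `R(μ)` the free resolvent, is
invertible as soon as its range contains the polynomials (`HasResolventCore.inResolventSet`). At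
`μ = 1` a rank one perturbation makes the equation solvable (`surjective_resolvent_one`), and this
bounds the dimension of the eigenspace by one (`HasResolventCore.eigenspace_eq_span`).
-/

namespace LinearizedWave

noncomputable section

open MeasureTheory Set Filter Polynomial
open scoped ContDiff ENNReal NNReal Topology ComplexConjugate Convolution

/-! ### Euler operators on the unit interval -/

/-- The `L²(0, 1)` norm of a function of the radial variable, with values in `[0, ∞]`. -/
def intervalNorm (f : ℝ → ℂ) : ℝ≥0∞ := eLpNorm f 2 (volume.restrict (Ioo (0 : ℝ) 1))

/-- The shifted Euler operator `u ↦ ρ u' + c u`. -/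
def euler (c : ℝ) (u : ℝ → ℂ) : ℝ → ℂ := fun ρ => ρ * deriv u ρ + c * u ρ

theorem eLpNorm_two_sq {α : Type*} [MeasurableSpace α] (μ : Measure α) (f : α → ℂ) :
    eLpNorm f 2 μ ^ 2 = ∫⁻ x, ‖f x‖ₑ ^ 2 ∂μ := by
  rw [eLpNorm_eq_lintegral_rpow_enorm_toReal (by norm_num) (by norm_num)]
  simp only [ENNReal.toReal_ofNat, one_div]
  rw [← ENNReal.rpow_natCast, ← ENNReal.rpow_mul]
  simp

theorem intervalNorm_sq (f : ℝ → ℂ) :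
    intervalNorm f ^ 2 = ∫⁻ ρ in Ioo (0 : ℝ) 1, ‖f ρ‖ₑ ^ 2 := eLpNorm_two_sq _ f

theorem intervalNorm_congr {f g : ℝ → ℂ} (h : EqOn f g (Ioo 0 1)) :
    intervalNorm f = intervalNorm g :=
  eLpNorm_congr_ae ((ae_restrict_mem measurableSet_Ioo).mono fun _ hρ => h hρ)

theorem intervalNorm_le_of_sq_le {f g : ℝ → ℂ} {C : ℝ} (hC : 0 ≤ C)
    (h : intervalNorm f ^ 2 ≤ ENNReal.ofReal (C ^ 2) * intervalNorm g ^ 2) :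
    intervalNorm f ≤ ENNReal.ofReal C * intervalNorm g := by
  rw [← ENNReal.pow_le_pow_left_iff two_ne_zero, mul_pow, ← ENNReal.ofReal_pow hC]
  exact h

theorem aestronglyMeasurable_of_continuousOn {f : ℝ → ℂ} (hf : ContinuousOn f (Ioo 0 1)) :
    AEStronglyMeasurable f (volume.restrict (Ioo (0 : ℝ) 1)) :=
  hf.aestronglyMeasurable measurableSet_Ioo

theorem intervalNorm_add_le {f g : ℝ → ℂ} (hf : ContinuousOn f (Ioo 0 1))
    (hg : ContinuousOn g (Ioo 0 1)) :
    intervalNorm (f + g) ≤ intervalNorm f + intervalNorm g :=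
  eLpNorm_add_le (aestronglyMeasurable_of_continuousOn hf)
    (aestronglyMeasurable_of_continuousOn hg) (by norm_num)

theorem intervalNorm_smul (c : ℂ) (f : ℝ → ℂ) :
    intervalNorm (c • f) = ‖c‖ₑ * intervalNorm f := eLpNorm_const_smul c f 2 _

/-- Bounds that are uniform over compactly contained intervals pass to `(0, 1)`, by monotone
convergence. -/
theorem setLIntegral_Ioo_le_of_forall {F : ℝ → ℝ≥0∞} {B : ℝ≥0∞}
    (h : ∀ a b : ℝ, 0 < a → a ≤ 1 / 2 → 3 / 4 ≤ b → b < 1 → ∫⁻ ρ in Ioo a b, F ρ ≤ B) :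
    ∫⁻ ρ in Ioo (0 : ℝ) 1, F ρ ≤ B := by
  let s : ℕ → Set ℝ := fun n => Ioo (1 / ((n : ℝ) + 4)) (1 - 1 / ((n : ℝ) + 4))
  have hpos : ∀ n : ℕ, (0 : ℝ) < 1 / ((n : ℝ) + 4) := fun n => by positivity
  have hle : ∀ n : ℕ, 1 / ((n : ℝ) + 4) ≤ 1 / 4 := fun n => by
    apply one_div_le_one_div_of_le <;> norm_num
  have hs : Monotone s := by
    intro n k hnk
    have : 1 / ((k : ℝ) + 4) ≤ 1 / ((n : ℝ) + 4) := by
      apply one_div_le_one_div_of_le (by positivity)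
      have : (n : ℝ) ≤ k := by exact_mod_cast hnk
      linarith
    exact Ioo_subset_Ioo this (by linarith)
  have hU : ⋃ n, s n = Ioo (0 : ℝ) 1 := by
    ext ρ
    simp only [mem_iUnion, s, mem_Ioo]
    constructor
    · rintro ⟨n, h1, h2⟩
      exact ⟨(hpos n).trans h1, by linarith [hpos n]⟩
    · rintro ⟨h1, h2⟩
      obtain ⟨n, hn⟩ := exists_nat_one_div_lt (lt_min h1 (sub_pos.2 h2))
      have : 1 / ((n : ℝ) + 4) ≤ 1 / ((n : ℝ) + 1) := by
        apply one_div_le_one_div_of_le (by positivity); linarith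
      have h3 := lt_min_iff.1 (this.trans_lt hn)
      exact ⟨n, h3.1, by linarith [h3.2]⟩
  rw [← hU, setLIntegral_iUnion_of_directed _ (directed_of_isDirected_le hs)]
  refine iSup_le fun n => h _ _ (hpos n) ?_ ?_ ?_
  · linarith [hle n]
  · linarith [hle n]
  · linarith [hpos n]

theorem Icc_subset_unit {a b : ℝ} (ha : 0 < a) (hb : b < 1) : Icc a b ⊆ Ioo (0 : ℝ) 1 :=
  fun _ hx => ⟨ha.trans_le hx.1, hx.2.trans_lt hb⟩

theorem setLIntegral_enorm_sq {f : ℝ → ℂ} (hf : ContinuousOn f (Ioo 0 1)) {a b : ℝ} (ha : 0 < a)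
    (hab : a ≤ b) (hb : b < 1) :
    ∫⁻ ρ in Ioo a b, ‖f ρ‖ₑ ^ 2 = ENNReal.ofReal (∫ ρ in a..b, ‖f ρ‖ ^ 2) := by
  have hc : ContinuousOn (fun ρ => ‖f ρ‖ ^ 2) (Icc a b) :=
    ((hf.mono (Icc_subset_unit ha hb)).norm).pow 2
  rw [intervalIntegral.integral_of_le hab, ofReal_integral_eq_lintegral_ofReal
    ((hc.integrableOn_Icc).mono_set Ioc_subset_Icc_self)
    (ae_of_all _ fun _ => by positivity), Measure.restrict_congr_set Ioo_ae_eq_Ioc]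
  refine lintegral_congr fun ρ => ?_
  rw [ENNReal.ofReal_pow (norm_nonneg _), ofReal_norm]

theorem smooth_euler {u : ℝ → ℂ} (hu : ContDiffOn ℝ ∞ u (Ioo 0 1)) (c : ℝ) :
    ContDiffOn ℝ ∞ (euler c u) (Ioo 0 1) :=
  (Complex.ofRealCLM.contDiff.contDiffOn.mul (smooth_deriv hu)).add (contDiffOn_const.mul hu)

theorem euler_congr {u v : ℝ → ℂ} (h : EqOn u v (Ioo 0 1)) (c : ℝ) :
    EqOn (euler c u) (euler c v) (Ioo 0 1) := by
  intro ρ hρ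
  simp only [euler, eqOn_deriv h hρ, h hρ]

/-- The energy identity behind all Hardy-type inequalities below: the derivative of `ρ |h|²`. -/
theorem energy_identity {h : ℝ → ℂ} (hh : ContDiffOn ℝ ∞ h (Ioo 0 1)) (c : ℝ) {a b : ℝ}
    (ha : 0 < a) (hab : a ≤ b) (hb : b < 1) :
    (1 - 2 * c) * (∫ ρ in a..b, ‖h ρ‖ ^ 2)
      + ∫ ρ in a..b, 2 * (conj (h ρ) * euler c h ρ).re = b * ‖h b‖ ^ 2 - a * ‖h a‖ ^ 2 := by
  have hsub := Icc_subset_unit ha hb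
  have hder : ∀ ρ ∈ uIcc a b, HasDerivAt (fun ρ => ρ * ‖h ρ‖ ^ 2)
      ((1 - 2 * c) * ‖h ρ‖ ^ 2 + 2 * (conj (h ρ) * euler c h ρ).re) ρ := by
    intro ρ hρ
    rw [uIcc_of_le hab] at hρ
    have h1 := (smooth_diffAt hh (hsub hρ)).hasDerivAt
    have h2 := (hasDerivAt_id ρ).mul h1.norm_sq
    refine h2.congr_deriv ?_
    simp only [id, euler, Complex.inner, Complex.sq_norm, Complex.normSq_apply, Complex.mul_re,
      Complex.conj_re, Complex.conj_im, Complex.add_re, Complex.add_im, Complex.mul_im,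
      Complex.ofReal_re, Complex.ofReal_im]
    ring
  have hc : ContinuousOn h (Icc a b) := hh.continuousOn.mono hsub
  have hc' : ContinuousOn (euler c h) (Icc a b) := (smooth_euler hh c).continuousOn.mono hsub
  have i1 : IntervalIntegrable (fun ρ => ‖h ρ‖ ^ 2) volume a b :=
    ContinuousOn.intervalIntegrable (by rw [uIcc_of_le hab]; exact hc.norm.pow 2)
  have i2 : IntervalIntegrable (fun ρ => 2 * (conj (h ρ) * euler c h ρ).re) volume a b := by
    refine ContinuousOn.intervalIntegrable ?_
    rw [uIcc_of_le hab]
    exact continuousOn_const.mul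
      (Complex.continuous_re.comp_continuousOn ((Complex.continuous_conj.comp_continuousOn hc).mul hc'))
  rw [← intervalIntegral.integral_const_mul, ← intervalIntegral.integral_add (i1.const_mul _) i2]
  exact intervalIntegral.integral_eq_sub_of_hasDerivAt hder ((i1.const_mul _).add i2)

theorem two_re_mul_le (z w : ℂ) {t : ℝ} (ht : 0 < t) :
    |2 * (conj z * w).re| ≤ t * ‖z‖ ^ 2 + t⁻¹ * ‖w‖ ^ 2 := by
  have h1 : |(conj z * w).re| ≤ ‖z‖ * ‖w‖ := by
    refine (Complex.abs_re_le_norm _).trans ?_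
    rw [norm_mul, Complex.norm_conj]
  rw [abs_mul, abs_two]
  have h2 : t * ‖z‖ ^ 2 + t⁻¹ * ‖w‖ ^ 2 - 2 * (‖z‖ * ‖w‖) = t⁻¹ * (t * ‖z‖ - ‖w‖) ^ 2 := by
    field_simp
    ring
  have h3 : 0 ≤ t⁻¹ * (t * ‖z‖ - ‖w‖) ^ 2 := by positivity
  linarith

theorem abs_integral_two_re_le {h g : ℝ → ℂ} (hh : ContinuousOn h (Ioo 0 1))
    (hg : ContinuousOn g (Ioo 0 1)) {a b t : ℝ} (ha : 0 < a) (hab : a ≤ b) (hb : b < 1)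
    (ht : 0 < t) :
    |∫ ρ in a..b, 2 * (conj (h ρ) * g ρ).re| ≤
      t * (∫ ρ in a..b, ‖h ρ‖ ^ 2) + t⁻¹ * ∫ ρ in a..b, ‖g ρ‖ ^ 2 := by
  have hsub := Icc_subset_unit ha hb
  have hc := hh.mono hsub
  have hc' := hg.mono hsub
  have i1 : IntervalIntegrable (fun ρ => ‖h ρ‖ ^ 2) volume a b :=
    ContinuousOn.intervalIntegrable (by rw [uIcc_of_le hab]; exact hc.norm.pow 2)
  have i2 : IntervalIntegrable (fun ρ => ‖g ρ‖ ^ 2) volume a b :=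
    ContinuousOn.intervalIntegrable (by rw [uIcc_of_le hab]; exact hc'.norm.pow 2)
  rw [← intervalIntegral.integral_const_mul, ← intervalIntegral.integral_const_mul,
    ← intervalIntegral.integral_add (i1.const_mul _) (i2.const_mul _)]
  rw [← Real.norm_eq_abs]
  refine intervalIntegral.norm_integral_le_of_norm_le hab (ae_of_all _ fun ρ _ => ?_)
    ((i1.const_mul _).add (i2.const_mul _))
  exact two_re_mul_le _ _ ht

theorem integral_sq_le_toReal {f : ℝ → ℂ} (hf : ContinuousOn f (Ioo 0 1))
    (hN : intervalNorm f ≠ ⊤) {a b : ℝ} (ha : 0 < a) (hab : a ≤ b) (hb : b < 1) :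
    ∫ ρ in a..b, ‖f ρ‖ ^ 2 ≤ (intervalNorm f).toReal ^ 2 := by
  have h1 : ENNReal.ofReal (∫ ρ in a..b, ‖f ρ‖ ^ 2) ≤ intervalNorm f ^ 2 := by
    rw [intervalNorm_sq, ← setLIntegral_enorm_sq hf ha hab hb]
    exact lintegral_mono_set (Ioo_subset_Ioo ha.le hb.le)
  rw [← ENNReal.toReal_pow]
  exact (ENNReal.ofReal_le_iff_le_toReal (ENNReal.pow_ne_top hN)).1 h1

/-- A square integrable function on `(0, 1)` satisfies `ε |h(ε)|² → 0` along a sequence. -/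
theorem exists_small_boundary {h : ℝ → ℂ} (hh : ContinuousOn h (Ioo 0 1))
    (hN : intervalNorm h ≠ ⊤) {a δ : ℝ} (ha : 0 < a) (ha1 : a < 1) (hδ : 0 < δ) :
    ∃ ε, 0 < ε ∧ ε < a ∧ ε * ‖h ε‖ ^ 2 ≤ δ := by
  by_contra! hcon
  set B := (intervalNorm h).toReal ^ 2
  -- otherwise `|h|² ≥ δ / ε`, whose integral over `(ε, a)` diverges
  have key : ∀ ε, 0 < ε → ε < a → δ * Real.log (a / 2 / ε) ≤ B := by
    intro ε h0 h1
    by_cases hε : a / 2 ≤ ε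
    · have : Real.log (a / 2 / ε) ≤ 0 :=
        Real.log_nonpos (by positivity) ((div_le_one h0).2 hε)
      exact (mul_nonpos_of_nonneg_of_nonpos hδ.le this).trans (by positivity)
    push Not at hε
    refine le_trans ?_ (integral_sq_le_toReal hh hN h0 hε.le (by linarith))
    rw [← integral_one_div_of_pos h0 (by positivity), ← intervalIntegral.integral_const_mul]
    have hsub := Icc_subset_unit h0 (show a / 2 < 1 by linarith)
    refine intervalIntegral.integral_mono_on hε.le ?_ ?_ ?_
    · refine ContinuousOn.intervalIntegrable ?_
      rw [uIcc_of_le hε.le]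
      exact continuousOn_const.mul (continuousOn_const.div continuousOn_id
        fun x hx => (hsub hx).1.ne')
    · refine ContinuousOn.intervalIntegrable ?_
      rw [uIcc_of_le hε.le]
      exact (hh.mono hsub).norm.pow 2
    · intro ρ hρ
      have hρ0 := (hsub hρ).1
      have := hcon ρ hρ0 (by linarith [hρ.2])
      rw [mul_one_div, div_le_iff₀ hρ0]
      linarith
  have h1 := key (a / 2 * Real.exp (-((B + 1) / δ))) (by positivity) (by
    have : Real.exp (-((B + 1) / δ)) ≤ 1 := Real.exp_le_one_iff.2 (by
      have : 0 ≤ (B + 1) / δ := by positivity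
      linarith)
    nlinarith)
  have h2 : a / 2 / (a / 2 * Real.exp (-((B + 1) / δ))) = Real.exp ((B + 1) / δ) := by
    rw [Real.exp_neg]
    field_simp
  rw [h2, Real.log_exp, mul_div_cancel₀ _ hδ.ne'] at h1
  linarith

/-- Hardy's inequality in the direction that inverts an Euler operator with `c > 1/2`. -/
theorem intervalNorm_le_euler {h : ℝ → ℂ} (hh : ContDiffOn ℝ ∞ h (Ioo 0 1)) {c : ℝ}
    (hc : 1 / 2 < c) (hN : intervalNorm h ≠ ⊤) :
    intervalNorm h ≤ ENNReal.ofReal (c - 1 / 2)⁻¹ * intervalNorm (euler c h) := by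
  have hκ : 0 < c - 1 / 2 := by linarith
  by_cases hG : intervalNorm (euler c h) = ⊤
  · rw [hG, ENNReal.mul_top]
    · exact le_top
    · simpa using hκ
  refine intervalNorm_le_of_sq_le (by positivity) ?_
  rw [intervalNorm_sq h]
  refine setLIntegral_Ioo_le_of_forall fun a b ha ha' hb hb1 => ?_
  rw [setLIntegral_enorm_sq hh.continuousOn ha (by linarith) hb1]
  rw [← ENNReal.ofReal_toReal hG, ← ENNReal.ofReal_pow (by positivity),
    ← ENNReal.ofReal_mul (by positivity)]
  apply ENNReal.ofReal_le_ofReal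
  refine le_of_forall_pos_le_add fun δ hδ => ?_
  obtain ⟨ε, h0, h1, h2⟩ := exists_small_boundary hh.continuousOn hN ha (by linarith)
    (show 0 < δ * (c - 1 / 2) by positivity)
  have hcE := (smooth_euler hh c).continuousOn
  have e1 := energy_identity hh c h0 (show ε ≤ b by linarith) hb1
  have e2 := abs_le.1 (abs_integral_two_re_le hh.continuousOn hcE h0 (show ε ≤ b by linarith) hb1 hκ)
  have e3 := integral_sq_le_toReal hcE hG h0 (show ε ≤ b by linarith) hb1
  have e4 : ∫ ρ in a..b, ‖h ρ‖ ^ 2 ≤ ∫ ρ in ε..b, ‖h ρ‖ ^ 2 := by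
    refine intervalIntegral.integral_mono_interval h1.le (by linarith) le_rfl
      (ae_of_all _ fun _ => by positivity) ?_
    refine ContinuousOn.intervalIntegrable ?_
    rw [uIcc_of_le (by linarith)]
    exact (hh.continuousOn.mono (Icc_subset_unit h0 hb1)).norm.pow 2
  have e5 : 0 ≤ b * ‖h b‖ ^ 2 := by have : 0 < b := by linarith
                                    positivity
  set X := ∫ ρ in ε..b, ‖h ρ‖ ^ 2
  set G := ∫ ρ in ε..b, ‖euler c h ρ‖ ^ 2
  have e6 : (c - 1 / 2) * X ≤ δ * (c - 1 / 2) + (c - 1 / 2)⁻¹ * (intervalNorm (euler c h)).toReal ^ 2 := by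
    have := mul_le_mul_of_nonneg_left e3 (inv_pos.2 hκ).le
    nlinarith
  have e7 : X ≤ δ + (c - 1 / 2)⁻¹ ^ 2 * (intervalNorm (euler c h)).toReal ^ 2 := by
    rw [← mul_le_mul_iff_right₀ hκ]
    refine e6.trans (le_of_eq ?_)
    generalize c - 1 / 2 = κ at hκ
    field_simp
  linarith

/-- Hardy's inequality in the direction that loses a power of `ρ`; no condition at `ρ = 0` is
needed, but a lower order term with an arbitrary weight controls the function near `ρ = 1`. -/
theorem intervalNorm_le_euler_add {h : ℝ → ℂ} (hh : ContDiffOn ℝ ∞ h (Ioo 0 1)) {c : ℝ}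
    (hc : c ≤ 0) (M : ℕ) :
    intervalNorm h ^ 2 ≤ 4 * intervalNorm (euler c h) ^ 2
        + ENNReal.ofReal (9 * 4 ^ M) * intervalNorm (fun ρ => (ρ : ℂ) ^ M * h ρ) ^ 2 := by
  set w : ℝ → ℂ := fun ρ => (ρ : ℂ) ^ M * h ρ
  have hw : ContinuousOn w (Ioo 0 1) :=
    ((Complex.continuous_ofReal.pow M).continuousOn).mul hh.continuousOn
  have hcE := (smooth_euler hh c).continuousOn
  by_cases hG : intervalNorm (euler c h) = ⊤
  · simp [hG, ENNReal.mul_top]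
  by_cases hW : intervalNorm w = ⊤
  · rw [hW]
    simp [ENNReal.mul_top]
  have hhw : ∀ ρ : ℝ, 1 / 2 ≤ ρ → ‖h ρ‖ ^ 2 ≤ 4 ^ M * ‖w ρ‖ ^ 2 := by
    intro ρ hρ
    have h1 : (1 : ℝ) ≤ 4 ^ M * (ρ ^ M) ^ 2 := by
      rw [← pow_mul, mul_comm M, pow_mul, ← mul_pow]
      exact one_le_pow₀ (by nlinarith)
    simp only [w, norm_mul, norm_pow, Complex.norm_real, Real.norm_eq_abs,
      abs_of_nonneg (show 0 ≤ ρ by linarith)]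
    calc ‖h ρ‖ ^ 2 = 1 * ‖h ρ‖ ^ 2 := (one_mul _).symm
      _ ≤ (4 ^ M * (ρ ^ M) ^ 2) * ‖h ρ‖ ^ 2 := by gcongr
      _ = _ := by ring
  rw [intervalNorm_sq h]
  refine setLIntegral_Ioo_le_of_forall fun a b ha ha' hb hb1 => ?_
  rw [setLIntegral_enorm_sq hh.continuousOn ha (by linarith) hb1]
  rw [← ENNReal.ofReal_toReal hG, ← ENNReal.ofReal_toReal hW, ← ENNReal.ofReal_pow (by positivity),
    ← ENNReal.ofReal_pow (by positivity), ← ENNReal.ofReal_mul (by positivity),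
    show (4 : ℝ≥0∞) = ENNReal.ofReal 4 by simp, ← ENNReal.ofReal_mul (by positivity),
    ← ENNReal.ofReal_add (by positivity) (by positivity)]
  apply ENNReal.ofReal_le_ofReal
  have cont : ∀ x y : ℝ, 0 < x → x ≤ y → y < 1 →
      IntervalIntegrable (fun ρ => ‖h ρ‖ ^ 2) volume x y := by
    intro x y h0 h1 h2
    refine ContinuousOn.intervalIntegrable ?_
    rw [uIcc_of_le h1]
    exact (hh.continuousOn.mono (Icc_subset_unit h0 h2)).norm.pow 2
  have contw : ∀ x y : ℝ, 0 < x → x ≤ y → y < 1 →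
      IntervalIntegrable (fun ρ => ‖w ρ‖ ^ 2) volume x y := by
    intro x y h0 h1 h2
    refine ContinuousOn.intervalIntegrable ?_
    rw [uIcc_of_le h1]
    exact (hw.mono (Icc_subset_unit h0 h2)).norm.pow 2
  set W := (intervalNorm w).toReal ^ 2
  have far : ∀ x y : ℝ, 1 / 2 ≤ x → x ≤ y → y < 1 → ∫ ρ in x..y, ‖h ρ‖ ^ 2 ≤ 4 ^ M * W := by
    intro x y h0 h1 h2
    have e := integral_sq_le_toReal hw hW (show 0 < x by linarith) h1 h2
    calc ∫ ρ in x..y, ‖h ρ‖ ^ 2 ≤ ∫ ρ in x..y, 4 ^ M * ‖w ρ‖ ^ 2 :=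
          intervalIntegral.integral_mono_on h1 (cont x y (by linarith) h1 h2)
            ((contw x y (by linarith) h1 h2).const_mul _) fun ρ hρ => hhw ρ (h0.trans hρ.1)
      _ = 4 ^ M * ∫ ρ in x..y, ‖w ρ‖ ^ 2 := intervalIntegral.integral_const_mul _ _
      _ ≤ 4 ^ M * W := by gcongr
  -- a good cutting point, found by averaging over `[1/2, 3/4]`
  obtain ⟨r, hr1, hr2, hr⟩ : ∃ r : ℝ, 1 / 2 ≤ r ∧ r ≤ 3 / 4 ∧ ‖h r‖ ^ 2 ≤ 4 * (4 ^ M * W) := by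
    by_contra! hcon
    have e1 := far (1 / 2) (3 / 4) le_rfl (by norm_num) (by norm_num)
    have e2 : ∫ _ρ in (1 / 2 : ℝ)..(3 / 4), 4 * (4 ^ M * W) < ∫ ρ in (1 / 2 : ℝ)..(3 / 4), ‖h ρ‖ ^ 2 := by
      refine intervalIntegral.integral_lt_integral_of_continuousOn_of_le_of_exists_lt (by norm_num)
        continuousOn_const ((hh.continuousOn.mono
          (Icc_subset_unit (by norm_num) (by norm_num))).norm.pow 2)
        (fun x hx => (hcon x hx.1.le hx.2).le) ⟨1 / 2, ⟨le_rfl, by norm_num⟩, hcon _ le_rfl (by norm_num)⟩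
    rw [intervalIntegral.integral_const] at e2
    norm_num at e2 e1
    linarith
  have e1 := energy_identity hh c ha (show a ≤ r by linarith) (by linarith)
  have e2 := abs_le.1 (abs_integral_two_re_le hh.continuousOn hcE ha (show a ≤ r by linarith)
    (by linarith) (show (0 : ℝ) < 1 / 2 by norm_num))
  have e3 := integral_sq_le_toReal hcE hG ha (show a ≤ r by linarith) (by linarith)
  have e4 := far r b hr1 (by linarith) hb1
  have e5 := intervalIntegral.integral_add_adjacent_intervals (cont a r ha (by linarith) (by linarith))
    (cont r b (by linarith) (by linarith) hb1)
  have e6 : 0 ≤ a * ‖h a‖ ^ 2 := by positivity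
  have e7 : r * ‖h r‖ ^ 2 ≤ 4 * (4 ^ M * W) :=
    (mul_le_of_le_one_left (by positivity) (by linarith)).trans hr
  have e8 : 0 ≤ ∫ ρ in a..r, ‖h ρ‖ ^ 2 :=
    intervalIntegral.integral_nonneg (by linarith) fun _ _ => by positivity
  set X := ∫ ρ in a..r, ‖h ρ‖ ^ 2
  have e9 : 0 ≤ -(c * X) := by nlinarith
  rw [← e5]
  rw [show ((1 : ℝ) / 2)⁻¹ = 2 by norm_num] at e2
  linarith [e2.1]

/-! ### Products of Euler operators and the operator `D_d` -/

/-- The product `(E + c₍ₙ₋₁₎) ⋯ (E + c₀) u` of shifted Euler operators, where `E = ρ d/dρ`. -/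
def chain (c : ℕ → ℝ) : ℕ → (ℝ → ℂ) → ℝ → ℂ
  | 0, u => u
  | n + 1, u => euler (c n) (chain c n u)

theorem smooth_chain {u : ℝ → ℂ} (hu : ContDiffOn ℝ ∞ u (Ioo 0 1)) (c : ℕ → ℝ) (n : ℕ) :
    ContDiffOn ℝ ∞ (chain c n u) (Ioo 0 1) := by
  induction n with
  | zero => exact hu
  | succ n ih => exact smooth_euler ih _

theorem chain_congr {u v : ℝ → ℂ} (h : EqOn u v (Ioo 0 1)) (c : ℕ → ℝ) (n : ℕ) :
    EqOn (chain c n u) (chain c n v) (Ioo 0 1) := by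
  induction n with
  | zero => exact h
  | succ n ih => exact euler_congr ih _

theorem euler_comb {u v : ℝ → ℂ} (hu : ContDiffOn ℝ ∞ u (Ioo 0 1))
    (hv : ContDiffOn ℝ ∞ v (Ioo 0 1)) (a : ℂ) (c : ℝ) :
    EqOn (euler c (a • u + v)) (a • euler c u + euler c v) (Ioo 0 1) := by
  intro ρ hρ
  simp only [euler, deriv_comb hu hv a hρ, Pi.add_apply, Pi.smul_apply, smul_eq_mul]
  ring

theorem chain_comb {u v : ℝ → ℂ} (hu : ContDiffOn ℝ ∞ u (Ioo 0 1))
    (hv : ContDiffOn ℝ ∞ v (Ioo 0 1)) (a : ℂ) (c : ℕ → ℝ) (n : ℕ) :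
    EqOn (chain c n (a • u + v)) (a • chain c n u + chain c n v) (Ioo 0 1) := by
  induction n with
  | zero => exact fun _ _ => rfl
  | succ n ih =>
    exact (euler_congr ih _).trans (euler_comb (smooth_chain hu c n) (smooth_chain hv c n) a _)

theorem chain_sub {u v : ℝ → ℂ} (hu : ContDiffOn ℝ ∞ u (Ioo 0 1))
    (hv : ContDiffOn ℝ ∞ v (Ioo 0 1)) (c : ℕ → ℝ) (n : ℕ) :
    EqOn (chain c n (u - v)) (chain c n u - chain c n v) (Ioo 0 1) := by
  have h := chain_comb hv hu (-1) c n
  have e : u - v = (-1 : ℂ) • v + u := by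
    rw [neg_one_smul]; ring
  have e' : chain c n u - chain c n v = (-1 : ℂ) • chain c n v + chain c n u := by
    rw [neg_one_smul]; ring
  rw [e, e']
  exact h

theorem deriv_euler {u : ℝ → ℂ} (hu : ContDiffOn ℝ ∞ u (Ioo 0 1)) (c : ℝ) :
    EqOn (deriv (euler c u)) (euler (c + 1) (deriv u)) (Ioo 0 1) := by
  intro ρ hρ
  have h1 : HasDerivAt (fun ρ : ℝ => (ρ : ℂ)) 1 ρ := Complex.ofRealCLM.hasDerivAt
  have h2 := (h1.mul (smooth_diffAt (smooth_deriv hu) hρ).hasDerivAt).add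
    ((smooth_diffAt hu hρ).hasDerivAt.const_mul (c : ℂ))
  refine h2.deriv.trans ?_
  simp only [euler, Complex.ofReal_add, Complex.ofReal_one]
  ring

theorem deriv_chain {u : ℝ → ℂ} (hu : ContDiffOn ℝ ∞ u (Ioo 0 1)) (c : ℕ → ℝ) (n : ℕ) :
    EqOn (deriv (chain c n u)) (chain (fun i => c i + 1) n (deriv u)) (Ioo 0 1) := by
  induction n with
  | zero => exact fun _ _ => rfl
  | succ n ih => exact (deriv_euler (smooth_chain hu c n) _).trans (euler_congr ih _)

theorem euler_comm {u : ℝ → ℂ} (hu : ContDiffOn ℝ ∞ u (Ioo 0 1)) (a b : ℝ) :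
    EqOn (euler a (euler b u)) (euler b (euler a u)) (Ioo 0 1) := by
  intro ρ hρ
  have h1 := deriv_euler hu a hρ
  have h2 := deriv_euler hu b hρ
  simp only [euler, Complex.ofReal_add, Complex.ofReal_one] at h1 h2 ⊢
  rw [h1, h2]
  ring

theorem chain_euler {u : ℝ → ℂ} (hu : ContDiffOn ℝ ∞ u (Ioo 0 1)) (c : ℕ → ℝ) (n : ℕ) (a : ℝ) :
    EqOn (chain c n (euler a u)) (euler a (chain c n u)) (Ioo 0 1) := by
  induction n with
  | zero => exact fun _ _ => rfl
  | succ n ih => exact (euler_congr ih _).trans (euler_comm (smooth_chain hu c n) _ _)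

theorem chain_succ_eq (c : ℕ → ℝ) (n : ℕ) (u : ℝ → ℂ) :
    chain c (n + 1) u = chain (fun i => c (i + 1)) n (euler (c 0) u) := by
  induction n with
  | zero => rfl
  | succ n ih =>
    change euler (c (n + 1)) (chain c (n + 1) u) = _
    rw [ih]
    rfl

/-- All products of `n` shifted Euler operators control each other, if their partial products are
controlled as well: a family of such partial products spans the polynomials in `E`. -/
theorem chain_transfer (c c' : ℕ → ℝ) (n : ℕ) :
    ∃ C : ℝ≥0, ∀ u : ℝ → ℂ, ContDiffOn ℝ ∞ u (Ioo 0 1) → ∀ B : ℝ≥0∞,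
      (∀ i ≤ n, intervalNorm (chain c i u) ≤ B) → ∀ i ≤ n, intervalNorm (chain c' i u) ≤ C * B := by
  have key : ∀ j, ∃ C : ℝ≥0, ∀ u : ℝ → ℂ, ContDiffOn ℝ ∞ u (Ioo 0 1) → ∀ B : ℝ≥0∞,
      (∀ i ≤ n, intervalNorm (chain c i u) ≤ B) → ∀ i, i + j ≤ n →
        intervalNorm (chain c' j (chain c i u)) ≤ C * B := by
    intro j
    induction j with
    | zero =>
      refine ⟨1, fun u _ B h i hi => ?_⟩
      simpa [chain] using h i hi
    | succ j ih =>
      obtain ⟨C, hC⟩ := ih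
      refine ⟨(∑ i ∈ Finset.range (n + 1), ‖((c' j - c i : ℝ) : ℂ)‖₊) * C + C,
        fun u hu B h i hi => ?_⟩
      have hs := smooth_chain hu c i
      have e : chain c' (j + 1) (chain c i u) = euler (c' j) (chain c' j (chain c i u)) := rfl
      have e2 : euler (c' j) (chain c i u) =
          ((c' j - c i : ℝ) : ℂ) • chain c i u + chain c (i + 1) u := by
        funext ρ
        simp only [euler, chain, Pi.add_apply, Pi.smul_apply, smul_eq_mul]
        push_cast
        ring
      rw [e, ← intervalNorm_congr (chain_euler hs c' j (c' j)), e2,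
        intervalNorm_congr (chain_comb hs (smooth_chain hu c (i + 1)) _ c' j)]
      have h1 := hC u hu B h i (by omega)
      have h2 := hC u hu B h (i + 1) (by omega)
      refine (intervalNorm_add_le ?_ (smooth_chain (smooth_chain hu c _) c' j).continuousOn).trans ?_
      · exact (smooth_chain hs c' j).continuousOn.const_smul _
      rw [intervalNorm_smul]
      have h3 : ‖((c' j - c i : ℝ) : ℂ)‖ₑ ≤
          ((∑ i ∈ Finset.range (n + 1), ‖((c' j - c i : ℝ) : ℂ)‖₊ : ℝ≥0) : ℝ≥0∞) := by
        rw [enorm_eq_nnnorm, ENNReal.coe_le_coe]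
        exact Finset.single_le_sum (f := fun i => ‖((c' j - c i : ℝ) : ℂ)‖₊)
          (fun _ _ => zero_le) (Finset.mem_range.2 (by omega))
      rw [ENNReal.coe_add, ENNReal.coe_mul, add_mul, mul_assoc]
      gcongr
  choose C hC using key
  refine ⟨∑ j ∈ Finset.range (n + 1), C j, fun u hu B h i hi => ?_⟩
  refine (hC i u hu B h 0 (by omega)).trans ?_
  gcongr
  exact Finset.single_le_sum (f := C) (fun _ _ => zero_le) (Finset.mem_range.2 (by omega))

/-- Iterated Hardy inequality for `c > 1/2`. The finiteness of the lower products is a hypothesis: it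
excludes the homogeneous solutions `ρ ^ (-c)` at the origin. -/
theorem chain_le_of_half_lt {c : ℕ → ℝ} (hc : ∀ i, 1 / 2 < c i) (n : ℕ) :
    ∃ C : ℝ≥0, ∀ u : ℝ → ℂ, ContDiffOn ℝ ∞ u (Ioo 0 1) →
      (∀ i < n, intervalNorm (chain c i u) ≠ ⊤) →
      ∀ i ≤ n, intervalNorm (chain c i u) ≤ C * intervalNorm (chain c n u) := by
  induction n with
  | zero =>
    refine ⟨1, fun u _ _ i hi => ?_⟩
    obtain rfl : i = 0 := by omega
    simp
  | succ n ih =>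
    obtain ⟨C, hC⟩ := ih
    refine ⟨C * Real.toNNReal (c n - 1 / 2)⁻¹ + 1, fun u hu hfin i hi => ?_⟩
    rcases Nat.lt_or_ge i (n + 1) with hin | hin
    · have h1 := hC u hu (fun i hi => hfin i (by omega)) i (by omega)
      have h2 := intervalNorm_le_euler (smooth_chain hu c n) (hc n) (hfin n (by omega))
      refine h1.trans ?_
      rw [ENNReal.coe_add, add_mul, ENNReal.coe_mul, mul_assoc]
      refine le_add_right ?_
      gcongr
      exact h2
    · obtain rfl : i = n + 1 := by omega
      rw [ENNReal.coe_add, add_mul]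
      exact le_add_left (by simp)

/-- Iterated Hardy inequality for `c ≤ 0`. The weights `ρ ^ M i` may be removed, as the highest product
is controlled without a weight. -/
theorem chain_le_of_nonpos {c : ℕ → ℝ} (hc : ∀ i, c i ≤ 0) (M : ℕ → ℕ) (n : ℕ) :
    ∃ C : ℝ≥0, ∀ u : ℝ → ℂ, ContDiffOn ℝ ∞ u (Ioo 0 1) → ∀ B : ℝ≥0∞,
      intervalNorm (chain c n u) ≤ B →
      (∀ i < n, intervalNorm (fun ρ => (ρ : ℂ) ^ M i * chain c i u ρ) ≤ B) →
      ∀ i ≤ n, intervalNorm (chain c i u) ≤ C * B := by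
  induction n with
  | zero =>
    refine ⟨1, fun u _ B h _ i hi => ?_⟩
    obtain rfl : i = 0 := by omega
    simpa using h
  | succ n ih =>
    obtain ⟨C, hC⟩ := ih
    refine ⟨C * (2 + 3 * 2 ^ M n) + 1, fun u hu B h1 h2 i hi => ?_⟩
    rcases Nat.lt_or_ge i (n + 1) with hin | hin
    · have h3 : intervalNorm (chain c n u) ≤ (2 + 3 * 2 ^ M n) * B := by
        have h := intervalNorm_le_euler_add (smooth_chain hu c n) (hc n) (M n)
        rw [← ENNReal.pow_le_pow_left_iff two_ne_zero]
        refine h.trans ?_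
        have h4 : ENNReal.ofReal (9 * 4 ^ M n) = 9 * 4 ^ M n := by
          rw [ENNReal.ofReal_mul (by norm_num), ENNReal.ofReal_pow (by norm_num)]
          simp
        rw [h4, mul_pow]
        calc 4 * intervalNorm (euler (c n) (chain c n u)) ^ 2 + 9 * 4 ^ M n *
              intervalNorm (fun ρ => (ρ : ℂ) ^ M n * chain c n u ρ) ^ 2
            ≤ 4 * B ^ 2 + 9 * 4 ^ M n * B ^ 2 := by
              gcongr
              · exact h1
              · exact h2 n (by omega)
          _ = (2 ^ 2 + (3 * 2 ^ M n) ^ 2) * B ^ 2 := by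
              rw [mul_pow, ← pow_mul, mul_comm (M n) 2, pow_mul]
              norm_num
              ring
          _ ≤ (2 + 3 * 2 ^ M n) ^ 2 * B ^ 2 := by
              gcongr
              rw [add_sq]
              gcongr
              exact le_add_right (le_refl ((2 : ℝ≥0∞) ^ 2))
      have hK : (1 : ℝ≥0∞) ≤ 2 + 3 * 2 ^ M n :=
        (by norm_num : (1 : ℝ≥0∞) ≤ 2).trans (le_add_right le_rfl)
      have h5 : B ≤ (2 + 3 * 2 ^ M n) * B := le_mul_of_one_le_left zero_le hK
      have h6 := hC u hu _ h3 (fun i hi => (h2 i (by omega)).trans h5) i (by omega)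
      refine h6.trans ?_
      push_cast
      rw [add_mul _ (1 : ℝ≥0∞) B, mul_assoc]
      exact le_self_add
    · obtain rfl : i = n + 1 := by omega
      rw [ENNReal.coe_add, add_mul]
      exact h1.trans (le_add_left (by simp))

theorem iterate_invRhoDeriv_congr {f g : ℝ → ℂ} (h : EqOn f g (Ioo 0 1)) (n : ℕ) :
    EqOn (invRhoDeriv^[n] f) (invRhoDeriv^[n] g) (Ioo 0 1) := by
  induction n with
  | zero => exact h
  | succ n ih =>
    intro ρ hρ
    rw [Function.iterate_succ_apply', Function.iterate_succ_apply', invRhoDeriv, invRhoDeriv,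
      eqOn_deriv ih hρ]

theorem smooth_iterate_invRhoDeriv {u : ℝ → ℂ} (hu : ContDiffOn ℝ ∞ u (Ioo 0 1)) (n : ℕ) :
    ContDiffOn ℝ ∞ (invRhoDeriv^[n] u) (Ioo 0 1) := by
  induction n with
  | zero => exact hu
  | succ n ih =>
    rw [Function.iterate_succ_apply']
    exact smooth_invRhoDeriv ih

theorem smooth_ofReal_pow (n : ℕ) :
    ContDiffOn ℝ ∞ (fun ρ : ℝ => (ρ : ℂ) ^ n) (Ioo 0 1) :=
  (Complex.ofRealCLM.contDiff.pow n).contDiffOn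

theorem hasDerivAt_pow_mul {u : ℝ → ℂ} (hu : ContDiffOn ℝ ∞ u (Ioo 0 1)) (n : ℕ) {ρ : ℝ}
    (hρ : ρ ∈ Ioo (0 : ℝ) 1) :
    HasDerivAt (fun ρ : ℝ => (ρ : ℂ) ^ (n + 1) * u ρ) ((ρ : ℂ) ^ n * euler (n + 1) u ρ) ρ := by
  have h1 : HasDerivAt (fun ρ : ℝ => (ρ : ℂ) ^ (n + 1)) (((n + 1 : ℕ) : ℂ) * (ρ : ℂ) ^ n) ρ :=
    (hasDerivAt_pow (n + 1) (ρ : ℂ)).comp_ofReal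
  refine (h1.mul (smooth_diffAt hu hρ).hasDerivAt).congr_deriv ?_
  simp only [euler]
  push_cast
  ring

/-- `D_d u` in terms of Euler operators: each `ρ⁻¹ d/dρ` turns a factor `ρ ^ (m + 1)` into
`ρ ^ (m - 1)` times a shifted Euler operator. -/
theorem iterate_invRhoDeriv_pow_mul {u : ℝ → ℂ} (hu : ContDiffOn ℝ ∞ u (Ioo 0 1)) (n : ℕ) :
    EqOn (invRhoDeriv^[n] fun ρ => (ρ : ℂ) ^ (2 * n + 1) * u ρ)
      (fun ρ => ρ * chain (fun i => 2 * i + 3) n u ρ) (Ioo 0 1) := by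
  induction n generalizing u with
  | zero => intro ρ _; simp [chain]
  | succ n ih =>
    have h1 : EqOn (invRhoDeriv fun ρ => (ρ : ℂ) ^ (2 * (n + 1) + 1) * u ρ)
        (fun ρ => (ρ : ℂ) ^ (2 * n + 1) * euler (2 * n + 3) u ρ) (Ioo 0 1) := by
      intro ρ hρ
      have h := (hasDerivAt_pow_mul hu (2 * n + 2) hρ).deriv
      have h0 : (ρ : ℂ) ≠ 0 := Complex.ofReal_ne_zero.2 hρ.1.ne'
      simp only [invRhoDeriv]
      rw [show 2 * (n + 1) + 1 = 2 * n + 2 + 1 by ring, h]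
      have : ((2 * n + 2 : ℕ) : ℝ) + 1 = 2 * n + 3 := by push_cast; ring
      rw [this]
      field_simp
      ring
    rw [Function.iterate_succ_apply]
    refine (iterate_invRhoDeriv_congr h1 n).trans ((ih (smooth_euler hu _)).trans ?_)
    intro ρ hρ
    simp only
    rw [chain_euler hu _ n _ hρ]
    rfl

/-- `(D_d u)' = (E + 2 K + 1) ⋯ (E + 3) (E + 1) u` with `E = ρ d/dρ`. -/
theorem deriv_dOp {d K : ℕ} (hd : d = 2 * K + 3) {u : ℝ → ℂ} (hu : ContDiffOn ℝ ∞ u (Ioo 0 1)) :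
    EqOn (deriv (dOp d u)) (chain (fun i => 2 * i + 1) (K + 1) u) (Ioo 0 1) := by
  subst hd
  have e : EqOn (dOp (2 * K + 3) u)
      (fun ρ => (ρ : ℂ) ^ (0 + 1) * chain (fun i => 2 * i + 3) K u ρ) (Ioo 0 1) := by
    have := iterate_invRhoDeriv_pow_mul hu K
    rw [dOp, show 2 * K + 3 - 2 = 2 * K + 1 by omega, show (2 * K + 3 - 3) / 2 = K by omega]
    simpa using this
  intro ρ hρ
  rw [eqOn_deriv e hρ, (hasDerivAt_pow_mul (smooth_chain hu _ K) 0 hρ).deriv, pow_zero, one_mul,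
    chain_succ_eq]
  rw [← chain_euler hu _ K _ hρ]
  simp only [Nat.cast_add, Nat.cast_one, Nat.cast_zero, mul_zero, zero_add]
  congr 1
  funext i
  ring_nf

/-- `(D_d u)'' = (E + 2 K + 2) ⋯ (E + 4) (E + 2) u'` with `E = ρ d/dρ`. -/
theorem deriv_deriv_dOp {d K : ℕ} (hd : d = 2 * K + 3) {u : ℝ → ℂ}
    (hu : ContDiffOn ℝ ∞ u (Ioo 0 1)) :
    EqOn (deriv (deriv (dOp d u))) (chain (fun i => 2 * i + 2) (K + 1) (deriv u)) (Ioo 0 1) := by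
  refine (eqOn_deriv (deriv_dOp hd hu)).trans ((deriv_chain hu _ _).trans ?_)
  intro ρ _
  congr 1
  funext i
  ring

/-- The weighted derivatives `ρ ^ (2 j + θ) (ρ⁻¹ d/dρ)ʲ f` are products of Euler operators with
nonpositive shifts applied to `ρ ^ θ f`. -/
theorem chain_neg_eq {f : ℝ → ℂ} (hf : ContDiffOn ℝ ∞ f (Ioo 0 1)) (θ j : ℕ) :
    EqOn (chain (fun i => -(2 * i + θ)) j fun ρ => (ρ : ℂ) ^ θ * f ρ)
      (fun ρ => (ρ : ℂ) ^ (2 * j + θ) * invRhoDeriv^[j] f ρ) (Ioo 0 1) := by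
  induction j with
  | zero => intro ρ _; simp [chain]
  | succ j ih =>
    refine (euler_congr ih _).trans ?_
    intro ρ hρ
    have h0 : (ρ : ℂ) ≠ 0 := Complex.ofReal_ne_zero.2 hρ.1.ne'
    have hs := smooth_iterate_invRhoDeriv hf j
    have h1 : HasDerivAt (fun ρ : ℝ => (ρ : ℂ) ^ (2 * j + θ))
        (((2 * j + θ : ℕ) : ℂ) * (ρ : ℂ) ^ (2 * j + θ - 1)) ρ :=
      (hasDerivAt_pow (2 * j + θ) (ρ : ℂ)).comp_ofReal
    have h2 := (h1.mul (smooth_diffAt hs hρ).hasDerivAt).deriv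
    have h3 : (ρ : ℂ) * (((2 * j + θ : ℕ) : ℂ) * (ρ : ℂ) ^ (2 * j + θ - 1)) =
        ((2 * j + θ : ℕ) : ℂ) * (ρ : ℂ) ^ (2 * j + θ) := by
      rcases Nat.eq_zero_or_pos (2 * j + θ) with h | h
      · simp [h]
      · rw [mul_left_comm, mul_pow_sub_one h.ne']
    simp only [euler, Function.iterate_succ_apply']
    erw [h2]
    rw [mul_add, ← mul_assoc, h3, invRhoDeriv]
    push_cast
    field_simp
    ring

/-! ### Test functions and integration by parts -/

/-- Real-valued smooth functions with compact support in the set `Ω`. -/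
structure IsTest {d : ℕ} (Ω : Set (Space d)) (φ : Space d → ℝ) : Prop where
  contDiff : ContDiff ℝ ∞ φ
  compactSupport : HasCompactSupport φ
  tsupport_subset : tsupport φ ⊆ Ω

theorem IsTest.isTestFunction {d : ℕ} {Ω : Set (Space d)} {φ : Space d → ℝ} (h : IsTest Ω φ)
    (hΩ : Ω ⊆ unitBall d) : IsTestFunction φ :=
  ⟨h.1, h.2, h.3.trans hΩ⟩

theorem IsTestFunction.isTest {d : ℕ} {φ : Space d → ℝ} (h : IsTestFunction φ) :
    IsTest (unitBall d) φ :=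
  ⟨h.1, h.2, h.3⟩

theorem IsTest.partialDeriv {d : ℕ} {Ω : Set (Space d)} {φ : Space d → ℝ} (h : IsTest Ω φ)
    (i : Fin d) : IsTest Ω (partialDeriv i φ) :=
  ⟨(h.1.fderiv_right (m := ∞) le_rfl).clm_apply contDiff_const, h.2.fderiv_apply ℝ _,
    (tsupport_fderiv_apply_subset ℝ _).trans h.3⟩

theorem IsTest.iterate {d : ℕ} {Ω : Set (Space d)} {φ : Space d → ℝ} (h : IsTest Ω φ)
    (i : Fin d) (n : ℕ) : IsTest Ω ((LinearizedWave.partialDeriv i)^[n] φ) := by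
  induction n with
  | zero => exact h
  | succ n ih => rw [Function.iterate_succ_apply']; exact ih.partialDeriv i

theorem IsTest.foldr {d : ℕ} {Ω : Set (Space d)} {φ : Space d → ℝ} (h : IsTest Ω φ)
    (α : Fin d → ℕ) (l : List (Fin d)) :
    IsTest Ω (l.foldr (fun i ψ => (LinearizedWave.partialDeriv i)^[α i] ψ) φ) := by
  induction l with
  | nil => exact h
  | cons i l ih => exact ih.iterate i (α i)

theorem IsTest.multiDeriv {d : ℕ} {Ω : Set (Space d)} {φ : Space d → ℝ} (h : IsTest Ω φ)
    (α : Fin d → ℕ) : IsTest Ω (multiDeriv α φ) :=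
  h.foldr α _

theorem partialDeriv_comm {d : ℕ} {φ : Space d → ℝ} (h : ContDiff ℝ ∞ φ) (i j : Fin d) :
    partialDeriv i (partialDeriv j φ) = partialDeriv j (partialDeriv i φ) := by
  have hd : Differentiable ℝ (fderiv ℝ φ) :=
    (h.fderiv_right (m := ∞) le_rfl).differentiable (by simp)
  have key : ∀ (k l : Fin d) (x : Space d), partialDeriv k (partialDeriv l φ) x =
      fderiv ℝ (fderiv ℝ φ) x (EuclideanSpace.single k 1) (EuclideanSpace.single l 1) := by
    intro k l x
    have h1 : HasFDerivAt (fun y => fderiv ℝ φ y (EuclideanSpace.single l 1)) _ x :=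
      (hd x).hasFDerivAt.clm_apply (hasFDerivAt_const _ x)
    unfold partialDeriv
    rw [h1.fderiv]
    simp
  funext x
  rw [key, key]
  exact (h.contDiffAt.isSymmSndFDerivAt (by simpa using ENat.LEInfty.out)).eq _ _

theorem partialDeriv_iterate_comm {d : ℕ} {Ω : Set (Space d)} {φ : Space d → ℝ} (h : IsTest Ω φ)
    (i j : Fin d) (n : ℕ) :
    (partialDeriv i)^[n] (partialDeriv j φ) = partialDeriv j ((partialDeriv i)^[n] φ) := by
  induction n with
  | zero => rfl
  | succ n ih =>
    rw [Function.iterate_succ_apply', ih, Function.iterate_succ_apply',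
      partialDeriv_comm (h.iterate i n).contDiff]

/-- The order in which an iterated derivative of a test function is taken does not matter. -/
theorem multiDeriv_add_single {d : ℕ} {Ω : Set (Space d)} {φ : Space d → ℝ} (h : IsTest Ω φ)
    (α : Fin d → ℕ) (a : Fin d) :
    multiDeriv (α + Pi.single a 1) φ = partialDeriv a (multiDeriv α φ) := by
  have key : ∀ l : List (Fin d), l.Nodup →
      l.foldr (fun i ψ => (partialDeriv i)^[(α + Pi.single a 1 : Fin d → ℕ) i] ψ) φ =
        if a ∈ l then partialDeriv a (l.foldr (fun i ψ => (partialDeriv i)^[α i] ψ) φ)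
        else l.foldr (fun i ψ => (partialDeriv i)^[α i] ψ) φ := by
    intro l hl
    induction l with
    | nil => simp
    | cons i l ih =>
      rw [List.nodup_cons] at hl
      rw [List.foldr_cons, ih hl.2, List.foldr_cons]
      by_cases hia : i = a
      · subst hia
        simp only [hl.1, if_false, List.mem_cons, true_or, if_true, Pi.add_apply, Pi.single_eq_same]
        rw [Function.iterate_succ_apply']
      · have : a ≠ i := fun h => hia h.symm
        simp only [List.mem_cons, this, false_or, Pi.add_apply, Pi.single_apply, hia, if_false,
          add_zero]
        split_ifs
        · exact partialDeriv_iterate_comm (h.foldr α l) i a (α i)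
        · rfl
  rw [multiDeriv, key _ (List.nodup_finRange d), if_pos (List.mem_finRange a)]
  rfl

theorem partialDeriv_multiDeriv {d : ℕ} {Ω : Set (Space d)} {φ : Space d → ℝ} (h : IsTest Ω φ)
    (α : Fin d → ℕ) (a : Fin d) :
    multiDeriv α (partialDeriv a φ) = partialDeriv a (multiDeriv α φ) := by
  unfold multiDeriv
  induction List.finRange d with
  | nil => rfl
  | cons i l ih =>
    rw [List.foldr_cons, ih, List.foldr_cons, partialDeriv_iterate_comm (h.foldr α l)]

theorem multiDeriv_zero {d : ℕ} (φ : Space d → ℝ) : multiDeriv 0 φ = φ := by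
  unfold multiDeriv
  induction List.finRange d with
  | nil => rfl
  | cons i l ih => rw [List.foldr_cons, ih]; rfl

theorem setIntegral_test {d : ℕ} {Ω : Set (Space d)} (hΩ : Ω ⊆ unitBall d) {φ : Space d → ℝ}
    (h : IsTest Ω φ) (f : Space d → ℂ) :
    ∫ x, φ x • f x ∂ballMeasure d = ∫ x, φ x • f x := by
  refine setIntegral_eq_integral_of_forall_compl_eq_zero fun x hx => ?_
  have : φ x = 0 := by
    by_contra hne
    exact hx (hΩ (h.3 (subset_tsupport _ hne)))
  rw [this, zero_smul]

theorem continuous_test_smul {d : ℕ} {Ω : Set (Space d)} (hΩ : IsOpen Ω) {φ : Space d → ℝ}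
    (h : IsTest Ω φ) {f : Space d → ℂ} (hf : ContinuousOn f Ω) :
    Continuous (fun x => φ x • f x) := by
  refine continuous_of_tsupport fun x hx => ?_
  have hx' : x ∈ Ω := h.3 (closure_mono (Function.support_smul_subset_left φ f) hx)
  exact h.1.continuous.continuousAt.smul (hf.continuousAt (hΩ.mem_nhds hx'))

theorem integrable_test_smul {d : ℕ} {Ω : Set (Space d)} (hΩ : IsOpen Ω) {φ : Space d → ℝ}
    (h : IsTest Ω φ) {f : Space d → ℂ} (hf : ContinuousOn f Ω) :
    Integrable (fun x => φ x • f x) :=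
  (continuous_test_smul hΩ h hf).integrable_of_hasCompactSupport h.2.smul_right

/-- Integration by parts against a test function on an open subset of the ball. -/
theorem integral_partialDeriv_smul {d : ℕ} {Ω : Set (Space d)} (hΩ : IsOpen Ω)
    (hΩ' : Ω ⊆ unitBall d) {φ : Space d → ℝ} (h : IsTest Ω φ) {f : Space d → ℂ}
    (hf : ContDiffOn ℝ 1 f Ω) (a : Fin d) :
    ∫ x, partialDeriv a φ x • f x ∂ballMeasure d =
      -∫ x, φ x • fderiv ℝ f x (EuclideanSpace.single a 1) ∂ballMeasure d := by
  rw [setIntegral_test hΩ' (h.partialDeriv a), setIntegral_test hΩ' h]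
  have hf' : ContinuousOn (fun x => fderiv ℝ f x (EuclideanSpace.single a 1)) Ω :=
    (hf.continuousOn_fderiv_of_isOpen hΩ le_rfl).clm_apply continuousOn_const
  have := integral_smul_fderiv_eq_neg_fderiv_smul_of_integrable
    (f := φ) (g := f) (v := EuclideanSpace.single a (1 : ℝ)) (μ := (volume : Measure (Space d)))
    (integrable_test_smul hΩ (h.partialDeriv a) hf.continuousOn)
    (integrable_test_smul hΩ h hf') (integrable_test_smul hΩ h hf.continuousOn)
    (fun x _ => h.1.differentiable (by simp) x)
    (fun x hx => (hf.contDiffAt (hΩ.mem_nhds (h.3 hx))).differentiableAt one_ne_zero)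
  rw [this, neg_neg]
  rfl

instance {d : ℕ} : IsFiniteMeasure (ballMeasure d) :=
  ⟨by rw [Measure.restrict_apply_univ]; exact measure_ball_lt_top⟩

theorem integrable_Lp {d : ℕ} (u : Lp ℂ 2 (ballMeasure d)) : Integrable u (ballMeasure d) :=
  (Lp.memLp u).integrable (by norm_num)

/-- Locally integrable functions are determined almost everywhere by test functions. -/
theorem ae_eq_of_integral_test {d : ℕ} {Ω : Set (Space d)} (hΩ : IsOpen Ω) (hΩ' : Ω ⊆ unitBall d)
    {f g : Space d → ℂ} (hf : LocallyIntegrableOn f Ω) (hg : LocallyIntegrableOn g Ω)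
    (h : ∀ φ, IsTest Ω φ → ∫ x, φ x • f x ∂ballMeasure d = ∫ x, φ x • g x ∂ballMeasure d) :
    ∀ᵐ x : Space d, x ∈ Ω → f x = g x := by
  have key := hΩ.ae_eq_zero_of_integral_contDiff_smul_eq_zero (μ := (volume : Measure (Space d)))
    (f := f - g) (hf.sub hg) fun φ h1 h2 h3 => ?_
  · filter_upwards [key] with x hx hxΩ
    exact sub_eq_zero.1 (hx hxΩ)
  · have hφ : IsTest Ω φ := ⟨h1, h2, h3⟩
    have hi : ∀ {k : Space d → ℂ}, LocallyIntegrableOn k Ω → Integrable (fun x => φ x • k x) := by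
      intro k hk
      refine (integrableOn_iff_integrable_of_support_subset
        ((Function.support_smul_subset_left φ k).trans (subset_tsupport φ))).1 ?_
      exact (hk.integrableOn_compact_subset h3 h2).continuousOn_smul h1.continuous.continuousOn h2
    have e := h φ hφ
    rw [setIntegral_test hΩ' hφ, setIntegral_test hΩ' hφ] at e
    simp only [Pi.sub_apply, smul_sub]
    rw [integral_sub (hi hf) (hi hg), e, sub_self]

/-! ### Radial functions -/

/-- The punctured unit ball. -/
def puncturedBall (d : ℕ) : Set (Space d) := unitBall d \ {0}

theorem isOpen_puncturedBall (d : ℕ) : IsOpen (puncturedBall d) :=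
  Metric.isOpen_ball.sdiff isClosed_singleton

theorem norm_mem_of_mem_puncturedBall {d : ℕ} {x : Space d} (hx : x ∈ puncturedBall d) :
    ‖x‖ ∈ Ioo (0 : ℝ) 1 :=
  ⟨norm_pos_iff.2 hx.2, by simpa using hx.1⟩

theorem contDiffOn_radial {d : ℕ} {u : ℝ → ℂ} (hu : ContDiffOn ℝ ∞ u (Ioo 0 1)) :
    ContDiffOn ℝ ∞ (fun x : Space d => u ‖x‖) (puncturedBall d) :=
  hu.comp (fun _ hx => (contDiffAt_norm ℝ hx.2).contDiffWithinAt)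
    fun _ hx => norm_mem_of_mem_puncturedBall hx

theorem fderiv_radial {d : ℕ} {u : ℝ → ℂ} (hu : ContDiffOn ℝ ∞ u (Ioo 0 1)) {x : Space d}
    (hx : x ∈ puncturedBall d) (a : Fin d) :
    fderiv ℝ (fun x : Space d => u ‖x‖) x (EuclideanSpace.single a 1) =
      (x a : ℂ) * invRhoDeriv u ‖x‖ := by
  have hρ := norm_mem_of_mem_puncturedBall hx
  have h1 : HasFDerivAt (fun x : Space d => ‖x‖) (‖x‖⁻¹ • innerSL ℝ x) x := by
    have h := (hasStrictFDerivAt_norm_sq x).hasFDerivAt.sqrt (by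
      have := hρ.1; positivity)
    have e : (fun y : Space d => √(‖y‖ ^ 2)) = fun y => ‖y‖ := by
      funext y; exact Real.sqrt_sq (norm_nonneg y)
    rw [e, Real.sqrt_sq (norm_nonneg x)] at h
    refine h.congr_fderiv ?_
    ext y
    simp
    ring
  have h2 := (smooth_diffAt hu hρ).hasDerivAt.hasFDerivAt.comp x h1
  have h3 : fderiv ℝ (fun x : Space d => u ‖x‖) x = _ := h2.fderiv
  rw [h3]
  simp [invRhoDeriv, EuclideanSpace.inner_single_right]
  ring

/-- The complex coordinate `x_a + i x_b`. -/
def zCoord {d : ℕ} (a b : Fin d) (x : Space d) : ℂ := (x a : ℂ) + Complex.I * (x b : ℂ)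

theorem contDiff_zCoord {d : ℕ} (a b : Fin d) : ContDiff ℝ ∞ (zCoord a b) := by
  have h : ∀ i : Fin d, ContDiff ℝ ∞ (fun x : Space d => (x i : ℂ)) := fun i =>
    Complex.ofRealCLM.contDiff.comp (EuclideanSpace.proj (𝕜 := ℝ) i).contDiff
  exact (h a).add (contDiff_const.mul (h b))

theorem hasFDerivAt_zCoord {d : ℕ} (a b : Fin d) (x : Space d) :
    HasFDerivAt (zCoord a b)
      (Complex.ofRealCLM ∘L (EuclideanSpace.proj (𝕜 := ℝ) a : Space d →L[ℝ] ℝ) +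
        Complex.I • (Complex.ofRealCLM ∘L (EuclideanSpace.proj (𝕜 := ℝ) b : Space d →L[ℝ] ℝ))) x := by
  have h : ∀ i : Fin d, HasFDerivAt (fun x : Space d => (x i : ℂ))
      (Complex.ofRealCLM ∘L (EuclideanSpace.proj (𝕜 := ℝ) i : Space d →L[ℝ] ℝ)) x := fun i =>
    (Complex.ofRealCLM ∘L (EuclideanSpace.proj (𝕜 := ℝ) i : Space d →L[ℝ] ℝ)).hasFDerivAt
  exact (h a).add ((h b).const_mul Complex.I)

/-- The function `(x_a + i x_b)ʲ (δʲ u)(|x|)` with `δ = ρ⁻¹ d/dρ`; it is what `j` applications of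
`∂_a + i ∂_b` make out of `u(|x|)`. -/
def zRadial {d : ℕ} (a b : Fin d) (u : ℝ → ℂ) (j : ℕ) (x : Space d) : ℂ :=
  zCoord a b x ^ j * invRhoDeriv^[j] u ‖x‖

theorem contDiffOn_zRadial {d : ℕ} (a b : Fin d) {u : ℝ → ℂ} (hu : ContDiffOn ℝ ∞ u (Ioo 0 1))
    (j : ℕ) : ContDiffOn ℝ ∞ (zRadial a b u j) (puncturedBall d) :=
  ((contDiff_zCoord a b).pow j).contDiffOn.mul
    (contDiffOn_radial (smooth_iterate_invRhoDeriv hu j))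

/-- `(∂_a + i ∂_b) (zʲ δʲ u) = zʲ⁺¹ δʲ⁺¹ u`, as `(∂_a + i ∂_b) z = 0`. -/
theorem fderiv_zRadial {d : ℕ} {a b : Fin d} (hab : a ≠ b) {u : ℝ → ℂ}
    (hu : ContDiffOn ℝ ∞ u (Ioo 0 1)) (j : ℕ) {x : Space d} (hx : x ∈ puncturedBall d) :
    fderiv ℝ (zRadial a b u j) x (EuclideanSpace.single a 1) +
      Complex.I * fderiv ℝ (zRadial a b u j) x (EuclideanSpace.single b 1) =
        zRadial a b u (j + 1) x := by
  have hs := smooth_iterate_invRhoDeriv hu j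
  have h1 := (hasFDerivAt_zCoord a b x).pow j
  have h2 : DifferentiableAt ℝ (fun x : Space d => invRhoDeriv^[j] u ‖x‖) x :=
    ((contDiffOn_radial hs).contDiffAt ((isOpen_puncturedBall d).mem_nhds hx)).differentiableAt
      (by simp)
  have h3 : fderiv ℝ (zRadial a b u j) x = _ := (h1.mul h2.hasFDerivAt).fderiv
  have hproj : ∀ k l : Fin d, (EuclideanSpace.proj (𝕜 := ℝ) k : Space d →L[ℝ] ℝ)
      (EuclideanSpace.single l (1 : ℝ)) = if k = l then 1 else 0 := by
    intro k l
    simp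
  rw [h3]
  simp only [_root_.add_apply, _root_.smul_apply, fderiv_radial hs hx,
    ContinuousLinearMap.comp_apply, Complex.ofRealCLM_apply, hproj, smul_eq_mul,
    hab, hab.symm, if_true, if_false, zRadial, Function.iterate_succ_apply']
  simp only [Complex.ofReal_one, Complex.ofReal_zero, mul_zero, add_zero, zero_add, mul_one, pow_succ]
  have hI : Complex.I * Complex.I = -1 := Complex.I_mul_I
  simp only [zCoord, nsmul_eq_mul]
  linear_combination ((invRhoDeriv^[j] u ‖x‖) * (j : ℂ) * ((x a : ℂ) + Complex.I * (x b : ℂ)) ^ (j - 1)) * hI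

/-! ### Polar coordinates -/

/-- The surface measure of the unit sphere. -/
def sphereArea (d : ℕ) : ℝ≥0∞ := (volume : Measure (Space d)).toSphere univ

theorem sphereArea_ne_top (d : ℕ) : sphereArea d ≠ ⊤ := measure_ne_top _ _

theorem sphereArea_ne_zero {d : ℕ} (hd : d ≠ 0) : sphereArea d ≠ 0 := by
  have : Nonempty (Fin d) := ⟨⟨0, Nat.pos_of_ne_zero hd⟩⟩
  rw [sphereArea, Ne, Measure.measure_univ_eq_zero]
  exact Measure.toSphere_ne_zero _

/-- Integration of a radial function over the ball in polar coordinates. -/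
theorem lintegral_ball_norm {d : ℕ} (hd : d ≠ 0) {g : ℝ → ℝ≥0∞} (hg : Measurable g) :
    ∫⁻ x, g ‖x‖ ∂ballMeasure d =
      sphereArea d * ∫⁻ ρ in Ioo (0 : ℝ) 1, ENNReal.ofReal (ρ ^ (d - 1)) * g ρ := by
  set G : ℝ → ℝ≥0∞ := (Ioo (0 : ℝ) 1).indicator g with hG
  have hGm : Measurable G := hg.indicator measurableSet_Ioo
  have : Nonempty (Fin d) := ⟨⟨0, Nat.pos_of_ne_zero hd⟩⟩
  calc ∫⁻ x, g ‖x‖ ∂ballMeasure d = ∫⁻ x : Space d in {0}ᶜ, G ‖x‖ := by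
        rw [restrict_compl_singleton, ballMeasure, ← lintegral_indicator measurableSet_ball]
        refine lintegral_congr_ae ?_
        have h0 : ∀ᵐ x : Space d, x ≠ 0 := by simp [ae_iff]
        filter_upwards [h0] with x hx
        have hx' : 0 < ‖x‖ := norm_pos_iff.2 hx
        by_cases h : ‖x‖ < 1 <;> simp [hG, indicator, h, hx']
    _ = ∫⁻ x : ({0}ᶜ : Set (Space d)), G ‖x.1‖ ∂(volume.comap Subtype.val) := by
        rw [lintegral_subtype_comap (measurableSet_singleton _).compl fun x => G ‖x‖]
    _ = ∫⁻ y, G y.2 ∂((volume : Measure (Space d)).toSphere.prod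
          (Measure.volumeIoiPow (Module.finrank ℝ (Space d) - 1))) := by
        have := (volume : Measure (Space d)).measurePreserving_homeomorphUnitSphereProd.lintegral_comp_emb
          (Homeomorph.measurableEmbedding _) (fun y => G y.2)
        rw [← this]
        simp
    _ = sphereArea d * ∫⁻ y : Ioi (0 : ℝ), G y
          ∂(Measure.volumeIoiPow (Module.finrank ℝ (Space d) - 1)) := by
        rw [lintegral_prod _ (by fun_prop)]
        simp [sphereArea, mul_comm]
    _ = _ := by
        rw [Measure.volumeIoiPow, lintegral_withDensity_eq_lintegral_mul _ (by fun_prop)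
          (by fun_prop), finrank_euclideanSpace_fin]
        have := lintegral_subtype_comap (μ := (volume : Measure ℝ)) (measurableSet_Ioi (a := (0 : ℝ)))
          (fun y => ENNReal.ofReal (y ^ (d - 1)) * G y)
        simp only [Pi.mul_apply]
        rw [this, ← lintegral_indicator measurableSet_Ioi, ← lintegral_indicator measurableSet_Ioo]
        congr 1
        refine lintegral_congr fun ρ => ?_
        by_cases h0 : 0 < ρ <;> by_cases h1 : ρ < 1 <;> simp [hG, indicator, h0, h1]

/-- Null sets of `(0, 1)` pull back to null sets of the ball under the norm. -/
theorem ae_norm_of_ae {d : ℕ} (hd : d ≠ 0) {p : ℝ → Prop} (h : ∀ᵐ ρ ∂volume.restrict (Ioo (0 : ℝ) 1), p ρ) :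
    ∀ᵐ x ∂ballMeasure d, p ‖x‖ := by
  set s := toMeasurable (volume.restrict (Ioo (0 : ℝ) 1)) {ρ | ¬ p ρ}
  have hs : MeasurableSet s := measurableSet_toMeasurable _ _
  have hs0 : volume.restrict (Ioo (0 : ℝ) 1) s = 0 := by
    rw [measure_toMeasurable]; exact h
  have e := lintegral_ball_norm hd (g := s.indicator 1) (measurable_one.indicator hs)
  have e1 : ∫⁻ ρ in Ioo (0 : ℝ) 1, ENNReal.ofReal (ρ ^ (d - 1)) * s.indicator 1 ρ = 0 := by
    rw [lintegral_eq_zero_iff (by have := measurable_one.indicator hs (β := ℝ≥0∞); fun_prop)]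
    have : ∀ᵐ ρ ∂volume.restrict (Ioo (0 : ℝ) 1), ρ ∉ s := by
      rw [ae_iff]; simpa using hs0
    filter_upwards [this] with ρ hρ
    simp [hρ]
  rw [e1, mul_zero, lintegral_eq_zero_iff (f := fun x : Space d => s.indicator 1 ‖x‖)
    ((measurable_one.indicator hs).comp measurable_norm)] at e
  filter_upwards [e] with x hx
  by_contra hp
  have : ‖x‖ ∈ s := subset_toMeasurable _ _ hp
  simp [this] at hx

theorem lintegral_ball_norm' {d : ℕ} (hd : d ≠ 0) {g : ℝ → ℝ≥0∞}
    (hg : AEMeasurable g (volume.restrict (Ioo (0 : ℝ) 1))) :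
    ∫⁻ x, g ‖x‖ ∂ballMeasure d =
      sphereArea d * ∫⁻ ρ in Ioo (0 : ℝ) 1, ENNReal.ofReal (ρ ^ (d - 1)) * g ρ := by
  have h1 : ∀ᵐ x ∂ballMeasure d, g ‖x‖ = hg.mk g ‖x‖ := ae_norm_of_ae hd hg.ae_eq_mk
  rw [lintegral_congr_ae h1, lintegral_ball_norm hd hg.measurable_mk]
  congr 1
  refine lintegral_congr_ae ?_
  filter_upwards [hg.ae_eq_mk] with ρ hρ
  rw [hρ]

theorem lintegral_radial_sq {d K : ℕ} (hd : d = 2 * K + 3) {f : ℝ → ℂ}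
    (hf : AEStronglyMeasurable f (volume.restrict (Ioo (0 : ℝ) 1))) :
    ∫⁻ x, ‖f ‖x‖‖ₑ ^ 2 ∂ballMeasure d =
      sphereArea d * intervalNorm (fun ρ => (ρ : ℂ) ^ (K + 1) * f ρ) ^ 2 := by
  rw [lintegral_ball_norm' (g := fun ρ => ‖f ρ‖ₑ ^ 2) (by omega) (hf.enorm.pow_const 2), intervalNorm_sq]
  congr 1
  refine setLIntegral_congr_fun measurableSet_Ioo fun ρ hρ => ?_
  rw [enorm_mul, mul_pow, show d - 1 = (K + 1) * 2 by omega, pow_mul,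
    ENNReal.ofReal_pow (pow_nonneg hρ.1.le _), enorm_pow]
  congr 2
  rw [ENNReal.ofReal_pow hρ.1.le, ← ofReal_norm (ρ : ℂ), Complex.norm_real,
    Real.norm_of_nonneg hρ.1.le]

/-- The `L²` norm of a radial function on the ball; the weight `ρ ^ (d - 1)` is the square of
`ρ ^ (K + 1)`. -/
theorem eLpNorm_radial {d K : ℕ} (hd : d = 2 * K + 3) {f : ℝ → ℂ}
    (hf : AEStronglyMeasurable f (volume.restrict (Ioo (0 : ℝ) 1))) :
    eLpNorm (fun x => f ‖x‖) 2 (ballMeasure d) ^ 2 =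
      sphereArea d * intervalNorm (fun ρ => (ρ : ℂ) ^ (K + 1) * f ρ) ^ 2 := by
  rw [← lintegral_radial_sq hd hf, eLpNorm_two_sq]

/-! ### Sobolev functions that are smooth in the radial variable -/

theorem norm_component_le {d m : ℕ} (U : radialSobolev d m) (α : multiIndices d m) :
    ‖U.1 α‖ ≤ ‖U‖ := PiLp.norm_apply_le U.1 α

theorem sum_add_single {d : ℕ} (α : Fin d → ℕ) (a : Fin d) :
    ∑ i, (α + Pi.single a 1 : Fin d → ℕ) i = ∑ i, α i + 1 := by
  simp [Finset.sum_add_distrib]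

/-- The function `(∂_a + i ∂_b)ʲ u(|x|)`, a combination of weak derivatives of order `j`. -/
theorem exists_weak_zRadial {d m : ℕ} {a b : Fin d} (hab : a ≠ b) {u : ℝ → ℂ}
    (hu : ContDiffOn ℝ ∞ u (Ioo 0 1)) {U : radialSobolev d m} (hU : Represents u U) (j : ℕ) :
    ∀ α : Fin d → ℕ, ∑ i, α i + j ≤ m → ∃ V : Lp ℂ 2 (ballMeasure d), ‖V‖ ≤ 2 ^ j * ‖U‖ ∧
      ∀ φ, IsTest (puncturedBall d) φ →
        ∫ x, φ x • V x ∂ballMeasure d =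
          (-1) ^ (∑ i, α i) * ∫ x, multiDeriv α φ x • zRadial a b u j x ∂ballMeasure d := by
  induction j with
  | zero =>
    intro α hα
    refine ⟨U.1 ⟨α, mem_multiIndices.2 hα⟩, by simpa using norm_component_le U _, fun φ hφ => ?_⟩
    have h := U.2.1 ⟨α, mem_multiIndices.2 hα⟩ φ (hφ.isTestFunction sdiff_subset)
    have e : ∫ x, multiDeriv α φ x • zRadial a b u 0 x ∂ballMeasure d =
        ∫ x, multiDeriv α φ x • (U.1 (zeroIndex d m) : Space d → ℂ) x ∂ballMeasure d := by
      refine integral_congr_ae ?_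
      filter_upwards [hU] with x hx
      rw [hx]
      simp [zRadial]
    rw [e, h, ← mul_assoc, ← mul_pow]
    simp
  | succ j ih =>
    intro α hα
    obtain ⟨V, hV, hV'⟩ := ih (α + Pi.single a 1) (by rw [sum_add_single]; omega)
    obtain ⟨W, hW, hW'⟩ := ih (α + Pi.single b 1) (by rw [sum_add_single]; omega)
    refine ⟨V + Complex.I • W, ?_, fun φ hφ => ?_⟩
    · refine (norm_add_le _ _).trans ?_
      rw [norm_smul, Complex.norm_I, one_mul, pow_succ]
      linarith
    · have hΩ := isOpen_puncturedBall d
      have hs := contDiffOn_zRadial a b hu j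
      have hs1 : ContDiffOn ℝ 1 (zRadial a b u j) (puncturedBall d) := hs.of_le (by simp)
      have hψ := hφ.multiDeriv α
      have hφc := hφ.contDiff.continuous
      have e1 : ∫ x, φ x • (V + Complex.I • W : Lp ℂ 2 (ballMeasure d)) x ∂ballMeasure d =
          ∫ x, φ x • V x ∂ballMeasure d + Complex.I * ∫ x, φ x • W x ∂ballMeasure d := by
        rw [← integral_const_mul, ← integral_add (integrable_smul_Lp hφc hφ.2 V)
          ((integrable_smul_Lp hφc hφ.2 W).const_mul _)]
        refine integral_congr_ae ?_
        filter_upwards [Lp.coeFn_add V (Complex.I • W), Lp.coeFn_smul Complex.I W] with x h1 h2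
        rw [h1, Pi.add_apply, h2, Pi.smul_apply, smul_add, smul_eq_mul, mul_smul_comm]
      rw [e1, hV' φ hφ, hW' φ hφ, sum_add_single, sum_add_single, multiDeriv_add_single hφ,
        multiDeriv_add_single hφ,
        integral_partialDeriv_smul hΩ sdiff_subset hψ hs1 a,
        integral_partialDeriv_smul hΩ sdiff_subset hψ hs1 b]
      have hcf : ∀ i : Fin d, ContinuousOn (fun x => fderiv ℝ (zRadial a b u j) x
          (EuclideanSpace.single i 1)) (puncturedBall d) := fun i =>
        (hs1.continuousOn_fderiv_of_isOpen hΩ le_rfl).clm_apply continuousOn_const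
      have hint : ∀ i : Fin d, Integrable (fun x => multiDeriv α φ x •
          fderiv ℝ (zRadial a b u j) x (EuclideanSpace.single i 1)) (ballMeasure d) := fun i =>
        (integrable_test_smul hΩ hψ (hcf i)).restrict
      have e2 : ∫ x, multiDeriv α φ x • zRadial a b u (j + 1) x ∂ballMeasure d =
          ∫ x, multiDeriv α φ x • fderiv ℝ (zRadial a b u j) x (EuclideanSpace.single a 1)
            ∂ballMeasure d + Complex.I * ∫ x, multiDeriv α φ x •
              fderiv ℝ (zRadial a b u j) x (EuclideanSpace.single b 1) ∂ballMeasure d := by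
        rw [← integral_const_mul, ← integral_add (hint a) ((hint b).const_mul _)]
        refine integral_congr_ae (ae_of_all _ fun x => ?_)
        simp only
        by_cases hx : x ∈ puncturedBall d
        · rw [← fderiv_zRadial hab hu j hx, smul_add, mul_smul_comm]
        · have : multiDeriv α φ x = 0 := by
            by_contra hne
            exact hx (hψ.3 (subset_tsupport _ hne))
          simp [this]
      rw [e2, pow_succ]
      ring

theorem locallyIntegrableOn_Lp {d : ℕ} (V : Lp ℂ 2 (ballMeasure d)) {Ω : Set (Space d)}
    (hΩ : Ω ⊆ unitBall d) : LocallyIntegrableOn V Ω := by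
  have h : IntegrableOn V (unitBall d) := integrable_Lp V
  exact (h.mono_set hΩ).locallyIntegrableOn

/-- The function `(x_a + i x_b)ʲ (ρ⁻¹ d/dρ)ʲ u` is a combination of weak derivatives off the origin,
which is a null set. -/
theorem lintegral_zRadial_le {d m : ℕ} {a b : Fin d} (hab : a ≠ b) {u : ℝ → ℂ}
    (hu : ContDiffOn ℝ ∞ u (Ioo 0 1)) {U : radialSobolev d m} (hU : Represents u U) {j : ℕ}
    (hj : j ≤ m) :
    eLpNorm (zRadial a b u j) 2 (ballMeasure d) ≤ 2 ^ j * ‖U‖ₑ := by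
  obtain ⟨V, hV, hV'⟩ := exists_weak_zRadial hab hu hU j 0 (by simpa using hj)
  have hΩ := isOpen_puncturedBall d
  have h1 : ∀ᵐ x : Space d, x ∈ puncturedBall d → V x = zRadial a b u j x := by
    refine ae_eq_of_integral_test hΩ sdiff_subset (locallyIntegrableOn_Lp V sdiff_subset)
      ((contDiffOn_zRadial a b hu j).continuousOn.locallyIntegrableOn hΩ.measurableSet) fun φ hφ => ?_
    rw [hV' φ hφ, multiDeriv_zero]
    simp
  have h0 : ∀ᵐ x : Space d, x ≠ 0 := by
    have : Nonempty (Fin d) := ⟨a⟩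
    simp [ae_iff]
  have h2 : V =ᵐ[ballMeasure d] zRadial a b u j := by
    filter_upwards [ae_restrict_of_ae h1, ae_restrict_of_ae h0, ae_restrict_mem measurableSet_ball]
      with x hx hx0 hxb
    exact hx ⟨hxb, hx0⟩
  rw [← eLpNorm_congr_ae h2, ← Lp.enorm_def, ← ofReal_norm, ← ofReal_norm]
  refine (ENNReal.ofReal_le_ofReal hV).trans (le_of_eq ?_)
  rw [ENNReal.ofReal_mul (by positivity), ENNReal.ofReal_pow (by norm_num), ENNReal.ofReal_ofNat]

/-- Control of the radial derivatives `δʲ u` of a Sobolev function that is smooth on `(0, 1)`. -/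
theorem intervalNorm_iterate_invRhoDeriv_le {d K : ℕ} (hd : d = 2 * K + 3) (j : ℕ) :
    ∃ C : ℝ≥0, ∀ m, j ≤ m → ∀ u : ℝ → ℂ, ContDiffOn ℝ ∞ u (Ioo 0 1) → ∀ U : radialSobolev d m,
      Represents u U →
      intervalNorm (fun ρ => (ρ : ℂ) ^ (j + K + 1) * invRhoDeriv^[j] u ρ) ≤ C * ‖U‖ₑ := by
  have : NeZero d := ⟨by omega⟩
  set A := sphereArea d
  have hA0 : A ≠ 0 := sphereArea_ne_zero (by omega)
  have hAt : A ≠ ⊤ := sphereArea_ne_top d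
  -- `B` is the constant for the squares
  set B : ℝ≥0∞ := A⁻¹ * (d ^ j * d * 4 ^ j) with hB
  have hBt : B ≠ ⊤ := by
    rw [hB]
    refine ENNReal.mul_ne_top (ENNReal.inv_ne_top.2 hA0) ?_
    exact_mod_cast ENNReal.natCast_ne_top (d ^ j * d * 4 ^ j)
  refine ⟨(B + 1).toNNReal, fun m hj u hu U hU => ?_⟩
  have hs := smooth_iterate_invRhoDeriv hu j
  set f : ℝ → ℂ := fun ρ => (ρ : ℂ) ^ j * invRhoDeriv^[j] u ρ with hf
  have hfc : ContinuousOn f (Ioo 0 1) := ((smooth_ofReal_pow j).mul hs).continuousOn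
  have e1 := lintegral_radial_sq hd (aestronglyMeasurable_of_continuousOn hfc)
  -- The pairs `(i, i + 1)` cover all coordinates, so `|x|²` is at most the sum of the
  -- `|x_i + i x_{i+1}|²`, and one of these is at least `|x|² / d`.
  let σ : Fin d → Fin d := fun i => i + 1
  have hσ : ∀ i, i ≠ σ i := by
    intro i h
    have : (1 : Fin d) = 0 := by simpa [σ] using h.symm
    have := congrArg Fin.val this
    rw [Fin.val_one', Fin.val_zero, Nat.mod_eq_of_lt (by omega)] at this
    omega
  have e2 : ∀ x : Space d, ‖f ‖x‖‖ₑ ^ 2 ≤ d ^ j * ∑ i, ‖zRadial i (σ i) u j x‖ₑ ^ 2 := by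
    intro x
    have h1 : ‖x‖ ^ 2 ≤ ∑ i, ‖zCoord i (σ i) x‖ ^ 2 := by
      rw [EuclideanSpace.norm_sq_eq]
      refine Finset.sum_le_sum fun i _ => ?_
      rw [zCoord, Complex.sq_norm, Complex.normSq_apply]
      simp
      nlinarith [mul_self_nonneg (x (σ i))]
    have h2 : ∑ i, ‖zCoord i (σ i) x‖ ^ 2 ≤ d * (Finset.univ.sup' ⟨0, Finset.mem_univ _⟩
        fun i => ‖zCoord i (σ i) x‖ ^ 2) := by
      have := Finset.sum_le_card_nsmul Finset.univ (fun i => ‖zCoord i (σ i) x‖ ^ 2)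
        (Finset.univ.sup' ⟨0, Finset.mem_univ _⟩ fun i => ‖zCoord i (σ i) x‖ ^ 2) (fun i hi => Finset.le_sup' (fun i => ‖zCoord i (σ i) x‖ ^ 2) hi)
      simpa using this
    obtain ⟨i, _, hi⟩ := Finset.exists_mem_eq_sup' (⟨0, Finset.mem_univ _⟩ : Finset.univ.Nonempty)
      fun i => ‖zCoord i (σ i) x‖ ^ 2
    have h3 : ‖x‖ ^ 2 ≤ d * ‖zCoord i (σ i) x‖ ^ 2 := by
      rw [← hi]; exact h1.trans h2
    have h4 : ‖f ‖x‖‖ ^ 2 ≤ d ^ j * ‖zRadial i (σ i) u j x‖ ^ 2 := by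
      simp only [hf, zRadial, norm_mul, norm_pow, mul_pow, Complex.norm_real, norm_norm]
      rw [← mul_assoc, ← pow_mul, mul_comm j 2, pow_mul, ← pow_mul ‖zCoord i (σ i) x‖,
        mul_comm j 2, pow_mul, ← mul_pow]
      gcongr
    have h5 : ‖f ‖x‖‖ₑ ^ 2 ≤ d ^ j * ‖zRadial i (σ i) u j x‖ₑ ^ 2 := by
      rw [← ofReal_norm, ← ofReal_norm, ← ENNReal.ofReal_pow (norm_nonneg _),
        ← ENNReal.ofReal_pow (norm_nonneg _), ← ENNReal.ofReal_natCast,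
        ← ENNReal.ofReal_pow (by positivity), ← ENNReal.ofReal_mul (by positivity)]
      exact ENNReal.ofReal_le_ofReal h4
    refine h5.trans ?_
    gcongr
    exact Finset.single_le_sum (f := fun i => ‖zRadial i (σ i) u j x‖ₑ ^ 2)
      (fun _ _ => zero_le) (Finset.mem_univ i)
  have hmeas : ∀ i, AEMeasurable (fun x => ‖zRadial i (σ i) u j x‖ₑ ^ 2) (ballMeasure d) := by
    intro i
    have h1 : AEStronglyMeasurable (zRadial i (σ i) u j) (volume.restrict (puncturedBall d)) :=
      (contDiffOn_zRadial i (σ i) hu j).continuousOn.aestronglyMeasurable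
        (isOpen_puncturedBall d).measurableSet
    have h2 : volume.restrict (puncturedBall d) = ballMeasure d := by
      have : Nonempty (Fin d) := ⟨0⟩
      exact Measure.restrict_congr_set (sdiff_null_ae_eq_self (by simp))
    rw [h2] at h1
    exact h1.enorm.pow_const 2
  have e3 : ∫⁻ x, ‖f ‖x‖‖ₑ ^ 2 ∂ballMeasure d ≤ d ^ j * d * 4 ^ j * ‖U‖ₑ ^ 2 := by
    calc ∫⁻ x, ‖f ‖x‖‖ₑ ^ 2 ∂ballMeasure d
        ≤ ∫⁻ x, d ^ j * ∑ i, ‖zRadial i (σ i) u j x‖ₑ ^ 2 ∂ballMeasure d := lintegral_mono e2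
      _ = d ^ j * ∑ i, ∫⁻ x, ‖zRadial i (σ i) u j x‖ₑ ^ 2 ∂ballMeasure d := by
          rw [lintegral_const_mul' _ _ (by exact_mod_cast ENNReal.natCast_ne_top (d ^ j)),
            lintegral_finsetSum' _ fun i _ => hmeas i]
      _ ≤ d ^ j * ∑ _i : Fin d, 4 ^ j * ‖U‖ₑ ^ 2 := by
          gcongr with i
          have h1 := lintegral_zRadial_le (hσ i) hu hU hj
          have h2 := pow_le_pow_left₀ zero_le h1 2
          rw [eLpNorm_two_sq, mul_pow, ← pow_mul, mul_comm j 2, pow_mul] at h2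
          norm_num at h2
          exact h2
      _ = _ := by
          simp only [Finset.sum_const, Finset.card_univ, Fintype.card_fin, nsmul_eq_mul]
          ring
  have e4 : intervalNorm (fun ρ => (ρ : ℂ) ^ (j + K + 1) * invRhoDeriv^[j] u ρ) ^ 2 ≤ B * ‖U‖ₑ ^ 2 := by
    have h1 : (fun ρ : ℝ => (ρ : ℂ) ^ (K + 1) * f ρ) =
        fun ρ : ℝ => (ρ : ℂ) ^ (j + K + 1) * invRhoDeriv^[j] u ρ := by
      funext ρ; simp only [hf]; ring
    rw [e1, h1] at e3
    rw [hB, mul_assoc, ← ENNReal.inv_mul_le_iff (ENNReal.inv_ne_zero.2 hAt) (ENNReal.inv_ne_top.2 hA0),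
      inv_inv]
    exact e3
  rw [ENNReal.coe_toNNReal (by simpa using hBt), ← ENNReal.pow_le_pow_left_iff two_ne_zero, mul_pow]
  refine e4.trans ?_
  gcongr
  calc B ≤ B + 1 := le_self_add
    _ = (B + 1) * 1 := (mul_one _).symm
    _ ≤ (B + 1) * (B + 1) := by gcongr; exact le_add_self
    _ = _ := (sq _).symm

/-- Weighted bounds on `(ρ⁻¹ d/dρ)ʲ f` give unweighted bounds on all products of at most `K + 1`
shifted Euler operators applied to `ρ ^ θ f`. -/
theorem chain_le_of_weighted (K θ : ℕ) (c : ℕ → ℝ) :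
    ∃ C : ℝ≥0, ∀ f : ℝ → ℂ, ContDiffOn ℝ ∞ f (Ioo 0 1) → ∀ B : ℝ≥0∞,
      (∀ j ≤ K + 1, intervalNorm (fun ρ => (ρ : ℂ) ^ (j + K + 1 + θ) * invRhoDeriv^[j] f ρ) ≤ B) →
      ∀ i ≤ K + 1, intervalNorm (chain c i fun ρ => (ρ : ℂ) ^ θ * f ρ) ≤ C * B := by
  obtain ⟨C₁, hC₁⟩ := chain_le_of_nonpos (c := fun i => -(2 * i + θ))
    (fun i => neg_nonpos.2 (by positivity)) (fun i => K + 1 - i) (K + 1)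
  obtain ⟨C₂, hC₂⟩ := chain_transfer (fun i => -(2 * i + θ)) c (K + 1)
  refine ⟨C₂ * C₁, fun f hf B hB i hi => ?_⟩
  have hs := (smooth_ofReal_pow θ).mul hf
  have h1 : ∀ j ≤ K + 1, intervalNorm (fun ρ => (ρ : ℂ) ^ (K + 1 - j) *
      chain (fun i => -(2 * i + θ)) j (fun ρ => (ρ : ℂ) ^ θ * f ρ) ρ) ≤ B := by
    intro j hj
    refine le_trans (le_of_eq (intervalNorm_congr fun ρ hρ => ?_)) (hB j hj)
    rw [chain_neg_eq hf θ j hρ, ← mul_assoc, ← pow_add]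
    congr 2
    omega
  rw [ENNReal.coe_mul, mul_assoc]
  refine hC₂ _ hs _ (hC₁ _ hs B ?_ fun j hj => h1 j hj.le) i hi
  simpa using h1 (K + 1) le_rfl

/-- A Sobolev function of order `K + 1` that is smooth on `(0, 1)` has `K + 1` Euler derivatives in
`L²(0, 1)` without weight; here `d = 2 K + 3`. -/
theorem chain_le_norm {d K : ℕ} (hd : d = 2 * K + 3) (c : ℕ → ℝ) :
    ∃ C : ℝ≥0, ∀ m, K + 1 ≤ m → ∀ u : ℝ → ℂ, ContDiffOn ℝ ∞ u (Ioo 0 1) →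
      ∀ U : radialSobolev d m, Represents u U →
        ∀ i ≤ K + 1, intervalNorm (chain c i u) ≤ C * ‖U‖ₑ := by
  obtain ⟨C, hC⟩ := chain_le_of_weighted K 0 c
  choose D hD using intervalNorm_iterate_invRhoDeriv_le hd
  refine ⟨C * ∑ j ∈ Finset.range (K + 2), D j, fun m hm u hu U hU i hi => ?_⟩
  have h := hC u hu ((∑ j ∈ Finset.range (K + 2), D j : ℝ≥0) * ‖U‖ₑ) (fun j hj => ?_) i hi
  · simpa [mul_assoc] using h
  · refine (hD j m (by omega) u hu U hU).trans ?_
    gcongr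
    exact Finset.single_le_sum (f := D) (fun _ _ => zero_le) (Finset.mem_range.2 (by omega))

/-- A Sobolev function of order `K + 2` that is smooth on `(0, 1)`: the same for its derivative. -/
theorem chain_deriv_le_norm {d K : ℕ} (hd : d = 2 * K + 3) (c : ℕ → ℝ) :
    ∃ C : ℝ≥0, ∀ m, K + 2 ≤ m → ∀ u : ℝ → ℂ, ContDiffOn ℝ ∞ u (Ioo 0 1) →
      ∀ U : radialSobolev d m, Represents u U →
        ∀ i ≤ K + 1, intervalNorm (chain c i (deriv u)) ≤ C * ‖U‖ₑ := by
  obtain ⟨C, hC⟩ := chain_le_of_weighted K 1 c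
  choose D hD using intervalNorm_iterate_invRhoDeriv_le hd
  refine ⟨C * ∑ j ∈ Finset.range (K + 3), D j, fun m hm u hu U hU i hi => ?_⟩
  have h := hC (invRhoDeriv u) (smooth_invRhoDeriv hu)
    ((∑ j ∈ Finset.range (K + 3), D j : ℝ≥0) * ‖U‖ₑ) (fun j hj => ?_) i hi
  · have e : EqOn (fun ρ : ℝ => (ρ : ℂ) ^ 1 * invRhoDeriv u ρ) (deriv u) (Ioo 0 1) := by
      intro ρ hρ
      simp only [pow_one, invRhoDeriv]
      exact mul_inv_cancel_left₀ (Complex.ofReal_ne_zero.2 hρ.1.ne') _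
    rw [intervalNorm_congr (chain_congr e c i)] at h
    simpa [mul_assoc] using h
  · refine le_trans (le_of_eq ?_) ((hD (j + 1) m (by omega) u hu U hU).trans ?_)
    · rw [Function.iterate_succ_apply]
      congr 1
      funext ρ
      ring
    gcongr
    exact Finset.single_le_sum (f := D) (fun _ _ => zero_le) (Finset.mem_range.2 (by omega))

/-! ### Polynomials in `ρ²` -/

/-- The function `ρ ↦ F(ρ²)`. -/
def polyFun (F : ℂ[X]) : ℝ → ℂ := fun ρ => F.eval ((ρ : ℂ) ^ 2)

/-- The action of `ρ d/dρ + c` on `F(ρ²)`. -/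
def polyEuler (c : ℝ) (F : ℂ[X]) : ℂ[X] := C 2 * (X * derivative F) + C (c : ℂ) * F

/-- The action of a product of shifted Euler operators on `F(ρ²)`. -/
def polyChain (c : ℕ → ℝ) : ℕ → ℂ[X] → ℂ[X]
  | 0, F => F
  | n + 1, F => polyEuler (c n) (polyChain c n F)

theorem hasDerivAt_polyFun (F : ℂ[X]) (ρ : ℝ) :
    HasDerivAt (polyFun F) (2 * ρ * polyFun (derivative F) ρ) ρ := by
  have h1 : HasDerivAt (fun z : ℂ => F.eval (z ^ 2))
      ((derivative F).eval ((ρ : ℂ) ^ 2) * (((2 : ℕ) : ℂ) * (ρ : ℂ) ^ (2 - 1))) (ρ : ℂ) :=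
    HasDerivAt.comp (h₂ := fun z => F.eval z) (ρ : ℂ) (F.hasDerivAt ((ρ : ℂ) ^ 2)) (hasDerivAt_pow 2 (ρ : ℂ))
  refine h1.comp_ofReal.congr_deriv ?_
  simp only [polyFun]
  norm_num
  ring

theorem deriv_polyFun (F : ℂ[X]) :
    deriv (polyFun F) = fun ρ => 2 * ρ * polyFun (derivative F) ρ :=
  funext fun ρ => (hasDerivAt_polyFun F ρ).deriv

theorem contDiff_polyFun (F : ℂ[X]) : ContDiff ℝ ∞ (polyFun F) := by
  have h : ContDiff ℂ ∞ (fun z : ℂ => F.eval z) := by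
    simpa using (Polynomial.contDiff_aeval (𝕜 := ℂ) F ∞)
  exact (h.restrict_scalars ℝ).comp (Complex.ofRealCLM.contDiff.pow 2)

theorem polyFun_add (F G : ℂ[X]) : polyFun (F + G) = polyFun F + polyFun G := by
  funext ρ; simp [polyFun]

theorem polyFun_smul (c : ℂ) (F : ℂ[X]) : polyFun (c • F) = c • polyFun F := by
  funext ρ; simp [polyFun]

theorem polyFun_sub (F G : ℂ[X]) : polyFun (F - G) = polyFun F - polyFun G := by
  funext ρ; simp [polyFun]

theorem euler_polyFun (c : ℝ) (F : ℂ[X]) : euler c (polyFun F) = polyFun (polyEuler c F) := by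
  funext ρ
  simp only [euler, deriv_polyFun, polyEuler, polyFun, eval_add, eval_mul, eval_C, eval_X]
  ring

theorem chain_polyFun (c : ℕ → ℝ) (n : ℕ) (F : ℂ[X]) :
    chain c n (polyFun F) = polyFun (polyChain c n F) := by
  induction n with
  | zero => rfl
  | succ n ih => rw [chain, ih, euler_polyFun]; rfl

theorem euler_mul_polyFun (c : ℝ) (F : ℂ[X]) :
    euler c (fun ρ => ρ * polyFun F ρ) = fun ρ => ρ * polyFun (polyEuler (c + 1) F) ρ := by
  funext ρ
  have h : HasDerivAt (fun ρ : ℝ => (ρ : ℂ) * polyFun F ρ) (1 * polyFun F ρ +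
      ρ * (2 * ρ * polyFun (derivative F) ρ)) ρ :=
    (Complex.ofRealCLM.hasDerivAt (x := ρ)).mul (hasDerivAt_polyFun F ρ)
  simp only [euler, h.deriv]
  simp only [polyEuler, polyFun, eval_add, eval_mul, eval_C, eval_X]
  push_cast
  ring

theorem chain_mul_polyFun (c : ℕ → ℝ) (n : ℕ) (F : ℂ[X]) :
    chain c n (fun ρ => ρ * polyFun F ρ) =
      fun ρ => ρ * polyFun (polyChain (fun i => c i + 1) n F) ρ := by
  induction n with
  | zero => rfl
  | succ n ih => rw [chain, ih, euler_mul_polyFun]; rfl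

theorem deriv_polyFun' (F : ℂ[X]) :
    deriv (polyFun F) = fun ρ : ℝ => (ρ : ℂ) * polyFun (C 2 * derivative F) ρ := by
  rw [deriv_polyFun]
  funext ρ
  simp only [polyFun, eval_mul, eval_C]
  ring

theorem invRhoDeriv_iterate_polyFun (F : ℂ[X]) (j : ℕ) :
    EqOn (invRhoDeriv^[j] (polyFun F)) ((2 : ℂ) ^ j • polyFun (derivative^[j] F)) (Ioo 0 1) := by
  induction j with
  | zero => intro ρ _; simp
  | succ j ih =>
    intro ρ hρ
    have h0 : (ρ : ℂ) ≠ 0 := Complex.ofReal_ne_zero.2 hρ.1.ne'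
    rw [Function.iterate_succ_apply', invRhoDeriv, eqOn_deriv ih hρ,
      ((hasDerivAt_polyFun _ ρ).const_smul _).deriv, Function.iterate_succ_apply']
    simp only [Pi.smul_apply, smul_eq_mul]
    field_simp
    ring

theorem intervalNorm_ne_top_of_continuous {f : ℝ → ℂ} (hf : Continuous f) : intervalNorm f ≠ ⊤ := by
  obtain ⟨C, hC⟩ := isCompact_Icc.exists_bound_of_continuousOn (s := Icc (0 : ℝ) 1) hf.continuousOn
  have h : ∀ᵐ ρ ∂volume.restrict (Ioo (0 : ℝ) 1), ‖f ρ‖ ≤ C :=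
    (ae_restrict_mem measurableSet_Ioo).mono fun ρ hρ => hC ρ (Ioo_subset_Icc_self hρ)
  exact (MemLp.of_bound hf.aestronglyMeasurable C h).2.ne

theorem continuous_polyFun (F : ℂ[X]) : Continuous (polyFun F) := (contDiff_polyFun F).continuous

theorem continuous_mul_polyFun (F : ℂ[X]) : Continuous (fun ρ : ℝ => (ρ : ℂ) * polyFun F ρ) :=
  Complex.continuous_ofReal.mul (continuous_polyFun F)

theorem intervalNorm_mono {f g : ℝ → ℂ} (h : ∀ ρ ∈ Ioo (0 : ℝ) 1, ‖f ρ‖ ≤ ‖g ρ‖) :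
    intervalNorm f ≤ intervalNorm g :=
  eLpNorm_mono_ae ((ae_restrict_mem measurableSet_Ioo).mono fun ρ hρ => h ρ hρ)

theorem intervalNorm_pow_mul_mono (f : ℝ → ℂ) {a b : ℕ} (hab : a ≤ b) :
    intervalNorm (fun ρ => (ρ : ℂ) ^ b * f ρ) ≤ intervalNorm (fun ρ => (ρ : ℂ) ^ a * f ρ) := by
  refine intervalNorm_mono fun ρ hρ => ?_
  rw [norm_mul, norm_mul, norm_pow, norm_pow, Complex.norm_real, Real.norm_of_nonneg hρ.1.le]
  exact mul_le_mul_of_nonneg_right (pow_le_pow_of_le_one hρ.1.le hρ.2.le hab) (norm_nonneg _)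

/-! ### Radial polynomials as elements of the Sobolev spaces -/

/-- Smooth functions that are positively homogeneous of degree `z`. (For `z < 0` only `0` is.) -/
def IsHomog {d : ℕ} (z : ℤ) (P : Space d → ℝ) : Prop :=
  ContDiff ℝ ∞ P ∧ ∀ t : ℝ, 0 < t → ∀ x, P (t • x) = t ^ z * P x

theorem IsHomog.partialDeriv {d : ℕ} {z : ℤ} {P : Space d → ℝ} (h : IsHomog z P) (i : Fin d) :
    IsHomog (z - 1) (partialDeriv i P) := by
  refine ⟨(h.1.fderiv_right (m := ∞) le_rfl).clm_apply contDiff_const, fun t ht x => ?_⟩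
  have hP : Differentiable ℝ P := h.1.differentiable (by simp)
  have h1 : HasFDerivAt (fun y => P (t • y)) ((fderiv ℝ P (t • x)).comp
      (t • ContinuousLinearMap.id ℝ (Space d))) x :=
    HasFDerivAt.comp (g := P) x (hP (t • x)).hasFDerivAt ((hasFDerivAt_id (𝕜 := ℝ) x).const_smul t)
  have h2 : HasFDerivAt (fun y => P (t • y)) (t ^ z • fderiv ℝ P x) x := by
    have : (fun y => P (t • y)) = fun y => t ^ z • P y := by
      funext y; rw [h.2 t ht y, smul_eq_mul]
    rw [this]
    exact (hP x).hasFDerivAt.const_smul (t ^ z)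
  have h3 := congrArg (fun L => L (EuclideanSpace.single i (1 : ℝ))) (h1.unique h2)
  simp only [ContinuousLinearMap.comp_apply, _root_.smul_apply, ContinuousLinearMap.id_apply,
    map_smul, smul_eq_mul] at h3
  rw [LinearizedWave.partialDeriv, LinearizedWave.partialDeriv, zpow_sub_one₀ ht.ne', mul_assoc,
    mul_comm t⁻¹, ← mul_assoc, ← h3]
  field_simp

theorem IsHomog.mul_coord {d : ℕ} {z : ℤ} {P : Space d → ℝ} (h : IsHomog z P) (i : Fin d) :
    IsHomog (z + 1) fun x => 2 * x i * P x := by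
  refine ⟨(contDiff_const.mul (EuclideanSpace.proj (𝕜 := ℝ) i).contDiff).mul h.1, fun t ht x => ?_⟩
  simp only [h.2 t ht x, PiLp.smul_apply, smul_eq_mul, zpow_add_one₀ ht.ne']
  ring

theorem IsHomog.add {d : ℕ} {z : ℤ} {P Q : Space d → ℝ} (hP : IsHomog z P) (hQ : IsHomog z Q) :
    IsHomog z (P + Q) :=
  ⟨hP.1.add hQ.1, fun t ht x => by simp only [Pi.add_apply, hP.2 t ht x, hQ.2 t ht x]; ring⟩

theorem isHomog_zero {d : ℕ} (z : ℤ) : IsHomog z (0 : Space d → ℝ) :=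
  ⟨contDiff_const, fun t _ x => by simp⟩

/-- Smoothness at the origin rules out negative degrees of homogeneity. This is why no negative powers
of `|x|` appear in the derivatives of radial polynomials. -/
theorem IsHomog.eq_zero {d : ℕ} {z : ℤ} {P : Space d → ℝ} (h : IsHomog z P) (hz : z < 0) : P = 0 := by
  funext x
  -- `t ^ (-z) * P (t x) = P x` for `t > 0`; let `t → 0`
  have h1 : Tendsto (fun t : ℝ => t ^ (-z) * P (t • x)) (𝓝[>] 0) (𝓝 0) := by
    obtain ⟨n, hn⟩ : ∃ n : ℕ, -z = n := ⟨(-z).toNat, by omega⟩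
    rw [hn]
    have h2 : Continuous (fun t : ℝ => t ^ n * P (t • x)) :=
      (continuous_pow n).mul (h.1.continuous.comp (continuous_id.smul continuous_const))
    have h3 := (h2.tendsto 0).mono_left (nhdsWithin_le_nhds (s := Ioi (0 : ℝ)))
    simp only [zpow_natCast]
    rwa [zero_pow (by omega), zero_mul] at h3
  have h2 : Tendsto (fun t : ℝ => t ^ (-z) * P (t • x)) (𝓝[>] 0) (𝓝 (P x)) := by
    refine tendsto_const_nhds.congr' ?_
    filter_upwards [self_mem_nhdsWithin] with t ht
    rw [h.2 t ht x, ← mul_assoc, ← zpow_add₀ (ne_of_gt ht)]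
    simp
  exact tendsto_nhds_unique h2 h1

theorem IsHomog.bound {d n : ℕ} {P : Space d → ℝ} (h : IsHomog (n : ℤ) P) :
    ∃ C : ℝ≥0, ∀ x, x ≠ 0 → ‖P x‖ ≤ C * ‖x‖ ^ n := by
  obtain ⟨C, hC⟩ := (isCompact_sphere (0 : Space d) 1).exists_bound_of_continuousOn
    h.1.continuous.continuousOn
  refine ⟨C.toNNReal, fun x hx => ?_⟩
  have hx' : 0 < ‖x‖ := norm_pos_iff.2 hx
  have h1 : x = ‖x‖ • (‖x‖⁻¹ • x) := by rw [smul_smul, mul_inv_cancel₀ hx'.ne', one_smul]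
  have h2 : ‖x‖⁻¹ • x ∈ Metric.sphere (0 : Space d) 1 := by
    simp [norm_smul, hx'.ne']
  rw [h1, h.2 _ hx', norm_mul, ← h1, mul_comm, zpow_natCast, norm_pow, norm_norm]
  gcongr
  exact (hC _ h2).trans (Real.le_coe_toNNReal C)

theorem contDiff_polyFun_norm {d : ℕ} (F : ℂ[X]) : ContDiff ℝ ∞ (fun x : Space d => polyFun F ‖x‖) := by
  have h : ContDiff ℂ ∞ (fun z : ℂ => F.eval z) := by
    simpa using (Polynomial.contDiff_aeval (𝕜 := ℂ) F ∞)
  have e : (fun x : Space d => polyFun F ‖x‖) = fun x => F.eval ((‖x‖ ^ 2 : ℝ) : ℂ) := by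
    funext x; simp [polyFun]
  rw [e]
  exact (h.restrict_scalars ℝ).comp (Complex.ofRealCLM.contDiff.comp (contDiff_norm_sq ℝ))

theorem fderiv_polyFun_norm {d : ℕ} (F : ℂ[X]) (x : Space d) (i : Fin d) :
    fderiv ℝ (fun x : Space d => polyFun F ‖x‖) x (EuclideanSpace.single i 1) =
      ((2 * x i : ℝ) : ℂ) * polyFun (derivative F) ‖x‖ := by
  have e : (fun x : Space d => polyFun F ‖x‖) = (fun t : ℝ => F.eval (t : ℂ)) ∘ fun x => ‖x‖ ^ 2 := by
    funext x; simp [polyFun]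
  have h1 : HasDerivAt (fun t : ℝ => F.eval (t : ℂ)) ((derivative F).eval ((‖x‖ ^ 2 : ℝ) : ℂ)) (‖x‖ ^ 2) :=
    (F.hasDerivAt _).comp_ofReal
  have h2 := h1.hasFDerivAt.comp x (hasStrictFDerivAt_norm_sq x).hasFDerivAt
  rw [e, h2.fderiv]
  simp [polyFun, EuclideanSpace.inner_single_right, mul_assoc]

/-- Every derivative `∂^α` of a radial polynomial `F(|x|²)` is a sum of terms `P_j(x) F⁽ʲ⁾(|x|²)` with
`P_j` homogeneous of degree `2 j - |α|`, independent of `F`. -/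
theorem exists_jetCoeff {d : ℕ} (n : ℕ) : ∀ α : Fin d → ℕ, ∑ i, α i = n →
    ∃ P : ℕ → Space d → ℝ, (∀ j : ℕ, IsHomog (2 * j - n : ℤ) (P j)) ∧ (∀ j, n < j → P j = 0) ∧
      (n = 0 → P 0 = 1) ∧ ∀ F : ℂ[X], IsWeakDeriv α (fun x => polyFun F ‖x‖)
        fun x => ∑ j ∈ Finset.range (n + 1), (P j x : ℂ) * polyFun (derivative^[j] F) ‖x‖ := by
  induction n with
  | zero =>
    intro α hα
    have hα0 : α = 0 := by
      funext i
      have := (Finset.sum_eq_zero_iff.1 hα) i (Finset.mem_univ i)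
      simpa using this
    subst hα0
    refine ⟨fun j => if j = 0 then 1 else 0, fun j => ?_, fun j hj => if_neg (by omega), fun _ => by simp,
      fun F φ hφ => ?_⟩
    · by_cases hj : j = 0
      · subst hj
        exact ⟨contDiff_const, fun t _ x => by simp⟩
      · simp only [hj, if_false]
        exact isHomog_zero _
    · simp [multiDeriv_zero]
  | succ n ih =>
    intro α hα
    obtain ⟨i, hi⟩ : ∃ i, α i ≠ 0 := by
      by_contra! h
      simp [h] at hα
    set β : Fin d → ℕ := α - Pi.single i 1 with hβ
    have hαβ : α = β + Pi.single i 1 := by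
      funext k
      by_cases hk : k = i
      · subst hk; simp [hβ]; omega
      · simp [hβ, hk]
    have hβn : ∑ i, β i = n := by
      have := sum_add_single β i
      rw [← hαβ] at this
      omega
    obtain ⟨P, hP1, hP2, -, hP4⟩ := ih β hβn
    -- By the product and chain rules, `∂_i (P_j F⁽ʲ⁾(|x|²))` is
    -- `(∂_i P_j) F⁽ʲ⁾(|x|²) + 2 x_i P_j F⁽ʲ⁺¹⁾(|x|²)`.
    refine ⟨fun j => partialDeriv i (P j) + if j = 0 then 0 else fun x => 2 * x i * P (j - 1) x,
      fun j => ?_, fun j hj => ?_, fun h => absurd h (by omega), fun F φ hφ => ?_⟩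
    · refine IsHomog.add ?_ ?_
      · have := (hP1 j).partialDeriv i
        push_cast
        rwa [show (2 * (j : ℤ) - (n + 1)) = 2 * j - n - 1 by ring]
      · split_ifs with hj
        · exact isHomog_zero _
        · have := (hP1 (j - 1)).mul_coord i
          rwa [show 2 * (((j - 1 : ℕ) : ℤ)) - n + 1 = 2 * j - ((n + 1 : ℕ) : ℤ) by
            push_cast [Nat.one_le_iff_ne_zero.2 hj]; ring] at this
    · simp only [show j ≠ 0 by omega, if_false]
      rw [hP2 j (by omega), hP2 (j - 1) (by omega)]
      funext x
      simp [partialDeriv]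
    · have hφ' := hφ.isTest
      set g : Space d → ℂ := fun x => ∑ j ∈ Finset.range (n + 1),
        (P j x : ℂ) * polyFun (derivative^[j] F) ‖x‖ with hg
      have hPc : ∀ j, ContDiff ℝ ∞ (fun x => (P j x : ℂ)) := fun j =>
        Complex.ofRealCLM.contDiff.comp (hP1 j).1
      have hgs : ContDiff ℝ ∞ g := ContDiff.sum fun j _ => (hPc j).mul (contDiff_polyFun_norm _)
      have h1 := hP4 F _ ((hφ'.partialDeriv i).isTestFunction subset_rfl)
      have h2 : ∫ x, multiDeriv α φ x • polyFun F ‖x‖ ∂ballMeasure d =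
          ∫ x, multiDeriv β (partialDeriv i φ) x • polyFun F ‖x‖ ∂ballMeasure d := by
        rw [hαβ, multiDeriv_add_single hφ', partialDeriv_multiDeriv hφ']
      rw [h2, h1, integral_partialDeriv_smul Metric.isOpen_ball subset_rfl hφ'
        (hgs.contDiffOn.of_le (by simp)) i, hβn, hα, pow_succ]
      have h3 : ∀ x, fderiv ℝ g x (EuclideanSpace.single i 1) = ∑ j ∈ Finset.range (n + 1 + 1),
          (((partialDeriv i (P j) + if j = 0 then 0 else fun x => 2 * x i * P (j - 1) x) x : ℝ) : ℂ) *
            polyFun (derivative^[j] F) ‖x‖ := by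
        intro x
        have hd1 : ∀ j, HasFDerivAt (fun x => (P j x : ℂ))
            (Complex.ofRealCLM.comp (fderiv ℝ (P j) x)) x := fun j =>
          Complex.ofRealCLM.hasFDerivAt.comp x ((hP1 j).1.differentiable (by simp) x).hasFDerivAt
        have hd2 : ∀ j, HasFDerivAt (fun x : Space d => polyFun (derivative^[j] F) ‖x‖) _ x := fun j =>
          ((contDiff_polyFun_norm (d := d) (derivative^[j] F)).differentiable (by simp) x).hasFDerivAt
        have hd3 : HasFDerivAt g _ x := HasFDerivAt.fun_sum fun j _ => (hd1 j).mul (hd2 j)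
        rw [hd3.fderiv]
        have e1 : ∀ j, (((P j x : ℂ) • fderiv ℝ (fun x : Space d => polyFun (derivative^[j] F) ‖x‖) x +
            polyFun (derivative^[j] F) ‖x‖ • Complex.ofRealCLM.comp (fderiv ℝ (P j) x) :
              Space d →L[ℝ] ℂ)) (EuclideanSpace.single i 1) =
            (partialDeriv i (P j) x : ℂ) * polyFun (derivative^[j] F) ‖x‖ +
              ((2 * x i * P j x : ℝ) : ℂ) * polyFun (derivative^[j + 1] F) ‖x‖ := by
          intro j
          simp only [_root_.add_apply, _root_.smul_apply, fderiv_polyFun_norm, smul_eq_mul,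
            ContinuousLinearMap.comp_apply, Complex.ofRealCLM_apply, Function.iterate_succ_apply',
            partialDeriv]
          push_cast
          ring
        have e2 : ∀ j, (((partialDeriv i (P j) +
            if j = 0 then 0 else fun x => 2 * x i * P (j - 1) x) x : ℝ) : ℂ) *
              polyFun (derivative^[j] F) ‖x‖ =
            (partialDeriv i (P j) x : ℂ) * polyFun (derivative^[j] F) ‖x‖ +
              (if j = 0 then 0 else ((2 * x i * P (j - 1) x : ℝ) : ℂ)) *
                polyFun (derivative^[j] F) ‖x‖ := by
          intro j
          split_ifs <;> simp [add_mul]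
        rw [_root_.sum_apply]
        rw [Finset.sum_congr rfl fun j _ => e1 j, Finset.sum_congr rfl fun j _ => e2 j,
          Finset.sum_add_distrib, Finset.sum_add_distrib]
        congr 1
        · rw [Finset.sum_range_succ _ (n + 1), hP2 (n + 1) (by omega)]
          simp [partialDeriv]
        · rw [Finset.sum_range_succ' _ (n + 1)]
          simp
      rw [integral_congr_ae (ae_of_all _ fun x => congrArg (fun z => φ x • z) (h3 x))]
      simp

/-- The homogeneous coefficients of `∂^α (F(|x|²))`. -/
def jetCoeff {d : ℕ} (α : Fin d → ℕ) : ℕ → Space d → ℝ :=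
  Classical.choose (exists_jetCoeff _ α rfl)

theorem jetCoeff_spec {d : ℕ} (α : Fin d → ℕ) :
    (∀ j : ℕ, IsHomog (2 * j - (∑ i, α i : ℕ) : ℤ) (jetCoeff α j)) ∧
      (∀ j, ∑ i, α i < j → jetCoeff α j = 0) ∧
      (∑ i, α i = 0 → jetCoeff α 0 = 1) ∧ ∀ F : ℂ[X], IsWeakDeriv α (fun x => polyFun F ‖x‖)
        fun x => ∑ j ∈ Finset.range (∑ i, α i + 1), (jetCoeff α j x : ℂ) * polyFun (derivative^[j] F) ‖x‖ :=
  Classical.choose_spec (exists_jetCoeff _ α rfl)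

/-- The derivative `∂^α` of `x ↦ F(|x|²)`. -/
def jetFun {d : ℕ} (α : Fin d → ℕ) (F : ℂ[X]) (x : Space d) : ℂ :=
  ∑ j ∈ Finset.range (∑ i, α i + 1), (jetCoeff α j x : ℂ) * polyFun (derivative^[j] F) ‖x‖

theorem continuous_jetFun {d : ℕ} (α : Fin d → ℕ) (F : ℂ[X]) : Continuous (jetFun α F) := by
  unfold jetFun
  refine continuous_finsetSum _ fun j _ => ?_
  exact (Complex.continuous_ofReal.comp ((jetCoeff_spec α).1 j).1.continuous).mul
    (contDiff_polyFun_norm _).continuous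

theorem memLp_of_continuous {d : ℕ} {f : Space d → ℂ} (hf : Continuous f) :
    MemLp f 2 (ballMeasure d) := by
  obtain ⟨C, hC⟩ := (isCompact_closedBall (0 : Space d) 1).exists_bound_of_continuousOn hf.continuousOn
  refine MemLp.of_bound hf.aestronglyMeasurable C ?_
  filter_upwards [ae_restrict_mem measurableSet_ball] with x hx
  exact hC x (Metric.ball_subset_closedBall hx)

theorem jetFun_add {d : ℕ} (α : Fin d → ℕ) (F G : ℂ[X]) :
    jetFun α (F + G) = jetFun α F + jetFun α G := by
  funext x
  simp only [jetFun, Pi.add_apply, ← Finset.sum_add_distrib]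
  refine Finset.sum_congr rfl fun j _ => ?_
  rw [iterate_map_add, polyFun_add, Pi.add_apply, mul_add]

theorem jetFun_smul {d : ℕ} (α : Fin d → ℕ) (c : ℂ) (F : ℂ[X]) :
    jetFun α (c • F) = c • jetFun α F := by
  funext x
  simp only [jetFun, Pi.smul_apply, smul_eq_mul, Finset.mul_sum]
  refine Finset.sum_congr rfl fun j _ => ?_
  rw [Polynomial.iterate_derivative_smul, polyFun_smul, Pi.smul_apply, smul_eq_mul]
  ring

theorem isWeakDeriv_congr {d : ℕ} {α : Fin d → ℕ} {u u' v v' : Space d → ℂ}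
    (h : IsWeakDeriv α u v) (hu : u =ᵐ[ballMeasure d] u') (hv : v =ᵐ[ballMeasure d] v') :
    IsWeakDeriv α u' v' := by
  intro φ hφ
  have h1 : ∫ x, multiDeriv α φ x • u' x ∂ballMeasure d = ∫ x, multiDeriv α φ x • u x ∂ballMeasure d :=
    integral_congr_ae (hu.mono fun x hx => by simp only [hx])
  have h2 : ∫ x, φ x • v' x ∂ballMeasure d = ∫ x, φ x • v x ∂ballMeasure d :=
    integral_congr_ae (hv.mono fun x hx => by simp only [hx])
  rw [h1, h2, h φ hφ]

theorem jetFun_zero {d : ℕ} (F : ℂ[X]) : jetFun (0 : Fin d → ℕ) F = fun x => polyFun F ‖x‖ := by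
  funext x
  have h := (jetCoeff_spec (0 : Fin d → ℕ)).2.2.1 (by simp)
  simp [jetFun, h]

/-- The radial polynomial `x ↦ F(|x|²)` as an element of the Sobolev space. -/
def polyJet (d m : ℕ) : ℂ[X] →ₗ[ℂ] radialSobolev d m where
  toFun F := ⟨WithLp.toLp 2 fun α => (memLp_of_continuous (continuous_jetFun α.1 F)).toLp _, by
    have h0 : (memLp_of_continuous (continuous_jetFun (zeroIndex d m).1 F)).toLp _
        =ᵐ[ballMeasure d] fun x => polyFun F ‖x‖ := by
      refine (MemLp.coeFn_toLp _).trans (ae_of_all _ fun x => ?_)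
      exact congrFun (jetFun_zero F) x
    refine ⟨fun α => ?_, polyFun F, h0⟩
    exact isWeakDeriv_congr (v := jetFun α.1 F) ((jetCoeff_spec α.1).2.2.2 F) h0.symm
      (MemLp.coeFn_toLp (memLp_of_continuous (continuous_jetFun α.1 F))).symm⟩
  map_add' F G := by
    apply Subtype.ext
    apply PiLp.ext
    intro α
    apply Lp.ext
    refine (MemLp.coeFn_toLp (memLp_of_continuous (continuous_jetFun α.1 (F + G)))).trans ?_
    refine EventuallyEq.trans ?_ (Lp.coeFn_add
      ((memLp_of_continuous (continuous_jetFun α.1 F)).toLp _)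
      ((memLp_of_continuous (continuous_jetFun α.1 G)).toLp _)).symm
    filter_upwards [MemLp.coeFn_toLp (memLp_of_continuous (continuous_jetFun α.1 F)),
      MemLp.coeFn_toLp (memLp_of_continuous (continuous_jetFun α.1 G))] with x h1 h2
    rw [jetFun_add, Pi.add_apply, Pi.add_apply]
    exact (congrArg₂ (· + ·) h1 h2).symm
  map_smul' c F := by
    apply Subtype.ext
    apply PiLp.ext
    intro α
    apply Lp.ext
    refine (MemLp.coeFn_toLp (memLp_of_continuous (continuous_jetFun α.1 (c • F)))).trans ?_
    refine EventuallyEq.trans ?_ (Lp.coeFn_smul c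
      ((memLp_of_continuous (continuous_jetFun α.1 F)).toLp _)).symm
    filter_upwards [MemLp.coeFn_toLp (memLp_of_continuous (continuous_jetFun α.1 F))] with x h1
    rw [jetFun_smul, Pi.smul_apply, Pi.smul_apply]
    exact (congrArg (c • ·) h1).symm

theorem polyJet_apply_ae {d m : ℕ} (F : ℂ[X]) (α : multiIndices d m) :
    (polyJet d m F).1 α =ᵐ[ballMeasure d] jetFun α.1 F :=
  MemLp.coeFn_toLp (memLp_of_continuous (continuous_jetFun α.1 F))

theorem represents_polyJet (d m : ℕ) (F : ℂ[X]) : Represents (polyFun F) (polyJet d m F) :=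
  (polyJet_apply_ae F (zeroIndex d m)).trans (ae_of_all _ fun x => congrFun (jetFun_zero F) x)

theorem enorm_le_sum_component {d m : ℕ} (U : radialSobolev d m) :
    ‖U‖ₑ ≤ ∑ α, ‖U.1 α‖ₑ := by
  have h : ‖U‖ ≤ ∑ α, ‖U.1 α‖ := by
    have h1 : ‖U‖ ^ 2 = ∑ α, ‖U.1 α‖ ^ 2 := PiLp.norm_sq_eq_of_L2 _ U.1
    rw [← abs_of_nonneg (norm_nonneg U), ← abs_of_nonneg (Finset.sum_nonneg
      fun α (_ : α ∈ Finset.univ) => norm_nonneg (U.1 α)), ← sq_le_sq, h1]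
    exact Finset.sum_sq_le_sq_sum_of_nonneg fun α _ => norm_nonneg _
  rw [← ofReal_norm]
  refine (ENNReal.ofReal_le_ofReal h).trans (le_of_eq ?_)
  rw [ENNReal.ofReal_sum_of_nonneg fun α _ => norm_nonneg _]
  exact Finset.sum_congr rfl fun α _ => ofReal_norm _

/-- The `L²` norm of `∂^α` of a radial polynomial; only the terms with `|α| ≤ 2 j` occur. -/
theorem eLpNorm_jetFun_le {d K : ℕ} (hd : d = 2 * K + 3) (α : Fin d → ℕ) :
    ∃ C : ℝ≥0, ∀ (F : ℂ[X]) (B : ℝ≥0∞),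
      (∀ j ≤ ∑ i, α i, ∑ i, α i ≤ 2 * j →
        intervalNorm (fun ρ => (ρ : ℂ) ^ (K + 1 + 2 * j - ∑ i, α i) *
          invRhoDeriv^[j] (polyFun F) ρ) ≤ B) →
      eLpNorm (jetFun α F) 2 (ballMeasure d) ≤ C * B := by
  set n := ∑ i, α i with hn
  have hd0 : d ≠ 0 := by omega
  have key : ∀ j, j ≤ n → ∃ C : ℝ≥0, ∀ (F : ℂ[X]) (B : ℝ≥0∞),
      (n ≤ 2 * j → intervalNorm (fun ρ => (ρ : ℂ) ^ (K + 1 + 2 * j - n) *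
          invRhoDeriv^[j] (polyFun F) ρ) ≤ B) →
      eLpNorm (fun x => (jetCoeff α j x : ℂ) * polyFun (derivative^[j] F) ‖x‖) 2 (ballMeasure d) ≤
        C * B := by
    intro j hj
    have hom := (jetCoeff_spec α).1 j
    rw [← hn] at hom
    by_cases h : n ≤ 2 * j
    · rw [show (2 * j - n : ℤ) = ((2 * j - n : ℕ) : ℤ) by omega] at hom
      obtain ⟨C, hC⟩ := hom.bound
      refine ⟨C * (sphereArea d + 1).toNNReal, fun F B hB => ?_⟩
      set f : ℝ → ℂ := fun ρ => (ρ : ℂ) ^ (2 * j - n) * invRhoDeriv^[j] (polyFun F) ρ with hf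
      have hfs : ContDiffOn ℝ ∞ f (Ioo 0 1) :=
        (smooth_ofReal_pow _).mul (smooth_iterate_invRhoDeriv (contDiff_polyFun F).contDiffOn j)
      have h1 : eLpNorm (fun x => (jetCoeff α j x : ℂ) * polyFun (derivative^[j] F) ‖x‖) 2
          (ballMeasure d) ≤ C * eLpNorm (fun x => f ‖x‖) 2 (ballMeasure d) := by
        refine eLpNorm_le_nnreal_smul_eLpNorm_of_ae_le_mul ?_ 2
        filter_upwards [ae_mem_Ioo hd0] with x hx
        rw [← NNReal.coe_le_coe]
        push_cast
        simp only [hf]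
        rw [invRhoDeriv_iterate_polyFun F j hx, norm_mul, norm_mul, Complex.norm_real, norm_pow,
          Complex.norm_real, norm_norm, Pi.smul_apply, norm_smul, ← mul_assoc]
        have h2 := hC x (norm_pos_iff.1 hx.1)
        have h3 : (1 : ℝ) ≤ ‖(2 : ℂ) ^ j‖ := by
          rw [norm_pow, Complex.norm_ofNat]; exact one_le_pow₀ (by norm_num)
        calc ‖jetCoeff α j x‖ * ‖polyFun (derivative^[j] F) ‖x‖‖
            ≤ (C * ‖x‖ ^ (2 * j - n)) * (1 * ‖polyFun (derivative^[j] F) ‖x‖‖) := by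
              rw [one_mul]; gcongr
          _ ≤ (C * ‖x‖ ^ (2 * j - n)) * (‖(2 : ℂ) ^ j‖ * ‖polyFun (derivative^[j] F) ‖x‖‖) := by
              gcongr
          _ = _ := by ring
      have h2 : eLpNorm (fun x => f ‖x‖) 2 (ballMeasure d) ≤ (sphereArea d + 1) * B := by
        rw [← ENNReal.pow_le_pow_left_iff two_ne_zero,
          eLpNorm_radial hd (aestronglyMeasurable_of_continuousOn hfs.continuousOn), mul_pow]
        have h4 : (fun ρ : ℝ => (ρ : ℂ) ^ (K + 1) * f ρ) = fun ρ : ℝ =>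
            (ρ : ℂ) ^ (K + 1 + 2 * j - n) * invRhoDeriv^[j] (polyFun F) ρ := by
          funext ρ
          simp only [hf]
          rw [← mul_assoc, ← pow_add]
          congr 2
          omega
        rw [h4]
        gcongr
        · calc sphereArea d ≤ (sphereArea d + 1) * 1 := by rw [mul_one]; exact le_self_add
            _ ≤ (sphereArea d + 1) * (sphereArea d + 1) := by gcongr; exact le_add_self
            _ = _ := (sq _).symm
        · exact hB h
      refine h1.trans ?_
      rw [ENNReal.coe_mul, ENNReal.coe_toNNReal (by simpa using sphereArea_ne_top d), mul_assoc]
      gcongr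
    -- For `2 j < |α|` the coefficient is homogeneous of negative degree.
    · have h0 : jetCoeff α j = 0 := hom.eq_zero (by omega)
      refine ⟨0, fun F B _ => ?_⟩
      simp [h0]
  choose! C hC using key
  refine ⟨∑ j ∈ Finset.range (n + 1), C j, fun F B hB => ?_⟩
  have h1 : jetFun α F = ∑ j ∈ Finset.range (n + 1),
      fun x => (jetCoeff α j x : ℂ) * polyFun (derivative^[j] F) ‖x‖ := by
    funext x
    simp [jetFun, hn]
  rw [h1]
  refine (eLpNorm_sum_le (fun j _ => ?_) (by norm_num)).trans ?_
  · exact ((Complex.continuous_ofReal.comp ((jetCoeff_spec α).1 j).1.continuous).mul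
      (contDiff_polyFun_norm _).continuous).aestronglyMeasurable
  · rw [ENNReal.ofNNReal_finsetSum, Finset.sum_mul]
    refine Finset.sum_le_sum fun j hj => ?_
    have hj' : j ≤ n := by simpa [Nat.lt_succ_iff] using hj
    exact hC j hj' F B fun h => hB j hj' h

/-- The Sobolev norm of a radial polynomial in terms of weighted derivatives on the interval. -/
theorem enorm_polyJet_le {d K : ℕ} (hd : d = 2 * K + 3) (m : ℕ) :
    ∃ C : ℝ≥0, ∀ (F : ℂ[X]) (B : ℝ≥0∞),
      (∀ n ≤ m, ∀ j ≤ n, n ≤ 2 * j → intervalNorm (fun ρ => (ρ : ℂ) ^ (K + 1 + 2 * j - n) *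
          invRhoDeriv^[j] (polyFun F) ρ) ≤ B) → ‖polyJet d m F‖ₑ ≤ C * B := by
  choose C hC using fun α : multiIndices d m => eLpNorm_jetFun_le hd α.1
  refine ⟨∑ α, C α, fun F B hB => ?_⟩
  refine (enorm_le_sum_component _).trans ?_
  rw [ENNReal.ofNNReal_finsetSum, Finset.sum_mul]
  refine Finset.sum_le_sum fun α _ => ?_
  rw [Lp.enorm_def, eLpNorm_congr_ae (polyJet_apply_ae F α)]
  exact hC α F B fun j hj h => hB _ (mem_multiIndices.1 α.2) j hj h

/-- The Sobolev norm of order `K + 1` of a radial polynomial, `d = 2 K + 3`, is controlled by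
`(D_d u)'` in `L²(0, 1)`. -/
theorem enorm_polyJet_fst_le {d K : ℕ} (hd : d = 2 * K + 3) :
    ∃ C : ℝ≥0, ∀ F : ℂ[X], ‖polyJet d (K + 1) F‖ₑ ≤
      C * intervalNorm (chain (fun i => 2 * i + 1) (K + 1) (polyFun F)) := by
  obtain ⟨C₁, hC₁⟩ := enorm_polyJet_le hd (K + 1)
  obtain ⟨C₂, hC₂⟩ := chain_transfer (fun i => 2 * i + 1) (fun i => -(2 * i + (0 : ℕ))) (K + 1)
  obtain ⟨C₃, hC₃⟩ := chain_le_of_half_lt (c := fun i => 2 * i + 1)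
    (fun i => by have : (0 : ℝ) ≤ i := by positivity
                 linarith) (K + 1)
  refine ⟨C₁ * (C₂ * C₃), fun F => ?_⟩
  have hs : ContDiffOn ℝ ∞ (polyFun F) (Ioo 0 1) := (contDiff_polyFun F).contDiffOn
  have h1 := hC₂ _ hs _ (hC₃ _ hs fun i _ => by
    rw [chain_polyFun]; exact intervalNorm_ne_top_of_continuous (continuous_polyFun _))
  rw [ENNReal.coe_mul, mul_assoc]
  refine hC₁ F _ fun n hn j hj hnj => ?_
  rw [ENNReal.coe_mul, mul_assoc]
  refine (intervalNorm_pow_mul_mono _ (show 2 * j ≤ K + 1 + 2 * j - n by omega)).trans ?_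
  refine le_trans (le_of_eq (intervalNorm_congr fun ρ hρ => ?_)) (h1 j (by omega))
  have := chain_neg_eq hs 0 j hρ
  simpa using this.symm

/-- The Sobolev norm of order `K + 2` of a radial polynomial, `d = 2 K + 3`, is controlled by
`(D_d u)''` in `L²(0, 1)` and lower order terms. -/
theorem enorm_polyJet_snd_le {d K : ℕ} (hd : d = 2 * K + 3) :
    ∃ C : ℝ≥0, ∀ F : ℂ[X], ‖polyJet d (K + 2) F‖ₑ ≤
      C * (intervalNorm (chain (fun i => 2 * i + 2) (K + 1) (deriv (polyFun F)))
        + intervalNorm (polyFun F)) := by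
  obtain ⟨C₁, hC₁⟩ := enorm_polyJet_le hd (K + 2)
  obtain ⟨C₂, hC₂⟩ := chain_transfer (fun i => 2 * i + 2) (fun i => -(2 * i + (1 : ℕ))) (K + 1)
  obtain ⟨C₃, hC₃⟩ := chain_le_of_half_lt (c := fun i => 2 * i + 2)
    (fun i => by have : (0 : ℝ) ≤ i := by positivity
                 linarith) (K + 1)
  refine ⟨C₁ * (C₂ * C₃ + 1), fun F => ?_⟩
  have hs : ContDiffOn ℝ ∞ (polyFun F) (Ioo 0 1) := (contDiff_polyFun F).contDiffOn
  have h1 := hC₂ _ (smooth_deriv hs) _ (hC₃ _ (smooth_deriv hs) fun i _ => by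
    rw [deriv_polyFun', chain_mul_polyFun]
    exact intervalNorm_ne_top_of_continuous (continuous_mul_polyFun _))
  set N := intervalNorm (chain (fun i => 2 * i + 2) (K + 1) (deriv (polyFun F)))
  rw [ENNReal.coe_mul, mul_assoc]
  refine hC₁ F _ fun n hn j hj hnj => ?_
  rw [ENNReal.coe_add, add_mul, ENNReal.coe_one, one_mul]
  rcases j with _ | j
  · refine le_trans ?_ le_add_self
    refine le_trans ?_ le_add_self
    refine (intervalNorm_pow_mul_mono _ (Nat.zero_le _)).trans (le_of_eq ?_)
    simp
  · refine le_trans ?_ le_self_add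
    rw [ENNReal.coe_mul, mul_assoc]
    refine le_trans ?_ (mul_le_mul_right (mul_le_mul_right (le_self_add (a := N)) _) _)
    refine (intervalNorm_pow_mul_mono _ (show 2 * j + 1 ≤ K + 1 + 2 * (j + 1) - n by omega)).trans ?_
    refine le_trans (le_of_eq (intervalNorm_congr fun ρ hρ => ?_)) (h1 j (by omega))
    have h2 := chain_neg_eq (smooth_invRhoDeriv hs) 1 j hρ
    have h3 : EqOn (fun ρ : ℝ => (ρ : ℂ) ^ 1 * invRhoDeriv (polyFun F) ρ) (deriv (polyFun F)) (Ioo 0 1) := by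
      intro ρ hρ
      simp only [pow_one, invRhoDeriv]
      exact mul_inv_cancel_left₀ (Complex.ofReal_ne_zero.2 hρ.1.ne') _
    rw [← chain_congr h3 _ j hρ, h2, Function.iterate_succ_apply]

/-! ### Completeness of the radial Sobolev spaces -/

/-- Integration against a continuous function, as a functional on `L²(𝔹ᵈ)`. -/
def testFunctional {d : ℕ} (ψ : Space d → ℝ) (hψ : Continuous ψ) :
    Lp ℂ 2 (ballMeasure d) →L[ℂ] ℂ :=
  innerSL ℂ ((memLp_of_continuous (Complex.continuous_ofReal.comp hψ)).toLp _)

theorem testFunctional_apply {d : ℕ} {ψ : Space d → ℝ} (hψ : Continuous ψ)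
    (u : Lp ℂ 2 (ballMeasure d)) : testFunctional ψ hψ u = ∫ x, ψ x • u x ∂ballMeasure d := by
  rw [testFunctional, innerSL_apply_apply, L2.inner_def]
  refine integral_congr_ae ?_
  filter_upwards [MemLp.coeFn_toLp (memLp_of_continuous (Complex.continuous_ofReal.comp hψ))]
    with x hx
  rw [hx]
  simp [mul_comm]

theorem isClosed_sobolev (d m : ℕ) : IsClosed (sobolev d m : Set (Jet d m)) := by
  have hc : ∀ β : multiIndices d m, Continuous fun U : Jet d m => U β := fun β =>
    PiLp.continuous_apply 2 _ β
  have : (sobolev d m : Set (Jet d m)) = ⋂ (α : multiIndices d m) (φ : Space d → ℝ)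
      (hφ : IsTestFunction φ), {U : Jet d m |
        testFunctional (multiDeriv α.1 φ) (hφ.isTest.multiDeriv α.1).contDiff.continuous
          (U (zeroIndex d m)) =
        (-1 : ℂ) ^ (∑ i, α.1 i) * testFunctional φ hφ.contDiff.continuous (U α)} := by
    ext U
    simp only [mem_iInter, mem_ofPred_eq, testFunctional_apply]
    exact Iff.rfl
  rw [this]
  refine isClosed_iInter fun α => isClosed_iInter fun φ => isClosed_iInter fun hφ => ?_
  exact isClosed_eq ((testFunctional _ _).continuous.comp (hc _))
    (continuous_const.mul ((testFunctional _ _).continuous.comp (hc _)))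

theorem isClosed_radialJet (d m : ℕ) : IsClosed (radialJet d m : Set (Jet d m)) := by
  refine isClosed_of_closure_subset fun U hU => ?_
  obtain ⟨V, hV, hVU⟩ := mem_closure_iff_seq_limit.1 hU
  choose v hv using hV
  have h1 : Tendsto (fun n => V n (zeroIndex d m)) atTop (𝓝 (U (zeroIndex d m))) :=
    ((PiLp.continuous_apply 2 _ (zeroIndex d m)).tendsto U).comp hVU
  obtain ⟨ns, -, hns⟩ := (tendstoInMeasure_of_tendsto_Lp h1).exists_seq_tendsto_ae
  refine ⟨fun ρ => limUnder atTop fun i => v (ns i) ρ, ?_⟩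
  filter_upwards [hns, ae_all_iff.2 hv] with x h2 h3
  refine (Tendsto.limUnder_eq ?_).symm
  simpa only [h3] using h2

instance completeSpace_radialSobolev (d m : ℕ) : CompleteSpace (radialSobolev d m) :=
  IsClosed.completeSpace_coe (hs := (isClosed_sobolev d m).inter (isClosed_radialJet d m))

/-! ### Pointwise bounds on the unit interval -/

theorem intervalNorm_le_of_forall {f : ℝ → ℂ} {B : ℝ≥0∞} (h : ∀ ρ ∈ Ioo (0 : ℝ) 1, ‖f ρ‖ₑ ≤ B) :
    intervalNorm f ≤ B := by
  rw [← ENNReal.pow_le_pow_left_iff two_ne_zero, intervalNorm_sq]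
  calc ∫⁻ ρ in Ioo (0 : ℝ) 1, ‖f ρ‖ₑ ^ 2 ≤ ∫⁻ _ in Ioo (0 : ℝ) 1, B ^ 2 := by
        refine setLIntegral_mono' measurableSet_Ioo fun ρ hρ => ?_
        gcongr
        exact h ρ hρ
    _ = B ^ 2 := by simp

theorem enorm_sub_le_of_lt {h : ℝ → ℂ} (hh : ContDiffOn ℝ ∞ h (Ioo 0 1)) {a b : ℝ} (ha : 0 < a)
    (hab : a ≤ b) (hb : b < 1) :
    ‖h b - h a‖ₑ ≤ ENNReal.ofReal (b - a) ^ (1 / 2 : ℝ) * intervalNorm (deriv h) := by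
  have hsub : Icc a b ⊆ Ioo (0 : ℝ) 1 := Icc_subset_unit ha hb
  have hc : ContinuousOn (deriv h) (Icc a b) := (smooth_deriv hh).continuousOn.mono hsub
  have h1 : ∫ ρ in a..b, deriv h ρ = h b - h a :=
    intervalIntegral.integral_deriv_eq_sub' _ rfl
      (fun x hx => smooth_diffAt hh (hsub (uIcc_of_le hab ▸ hx))) (by rwa [uIcc_of_le hab])
  rw [← h1, intervalIntegral.integral_of_le hab]
  refine (enorm_integral_le_lintegral_enorm _).trans ?_
  rw [← eLpNorm_one_eq_lintegral_enorm]
  have hm : AEStronglyMeasurable (deriv h) (volume.restrict (Ioc a b)) :=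
    (hc.mono Ioc_subset_Icc_self).aestronglyMeasurable measurableSet_Ioc
  refine (eLpNorm_le_eLpNorm_mul_rpow_measure_univ (q := 2) (by norm_num) hm).trans ?_
  rw [mul_comm]
  refine mul_le_mul' (le_of_eq ?_) ?_
  · rw [Measure.restrict_apply_univ, Real.volume_Ioc]
    norm_num
  · exact eLpNorm_mono_measure _ (Measure.restrict_mono (Ioc_subset_Icc_self.trans hsub) le_rfl)

/-- Hölder continuity of functions with derivative in `L²(0, 1)`. -/
theorem enorm_sub_le {h : ℝ → ℂ} (hh : ContDiffOn ℝ ∞ h (Ioo 0 1)) {a b : ℝ}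
    (ha : a ∈ Ioo (0 : ℝ) 1) (hb : b ∈ Ioo (0 : ℝ) 1) :
    ‖h b - h a‖ₑ ≤ ENNReal.ofReal |b - a| ^ (1 / 2 : ℝ) * intervalNorm (deriv h) := by
  rcases le_total a b with hab | hab
  · rw [abs_of_nonneg (sub_nonneg.2 hab)]
    exact enorm_sub_le_of_lt hh ha.1 hab hb.2
  · rw [abs_of_nonpos (sub_nonpos.2 hab), neg_sub, ← enorm_neg, neg_sub]
    exact enorm_sub_le_of_lt hh hb.1 hab ha.2

theorem enorm_sub_le_Icc {h : ℝ → ℂ} (hh : ContDiffOn ℝ ∞ h (Ioo 0 1))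
    (hc : ContinuousOn h (Icc 0 1)) {a b : ℝ} (ha : a ∈ Icc (0 : ℝ) 1) (hb : b ∈ Icc (0 : ℝ) 1) :
    ‖h b - h a‖ₑ ≤ intervalNorm (deriv h) := by
  have h1 : ∀ q ∈ Ioo (0 : ℝ) 1 ×ˢ Ioo (0 : ℝ) 1, ‖h q.2 - h q.1‖ₑ ≤ intervalNorm (deriv h) := by
    rintro ⟨a, b⟩ ⟨ha, hb⟩
    refine (enorm_sub_le hh ha hb).trans ?_
    refine mul_le_of_le_one_left zero_le (ENNReal.rpow_le_one ?_ (by norm_num))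
    rw [ENNReal.ofReal_le_one, abs_le]
    constructor <;> linarith [ha.1, ha.2, hb.1, hb.2]
  have hcl : (a, b) ∈ closure (Ioo (0 : ℝ) 1 ×ˢ Ioo (0 : ℝ) 1) := by
    rw [closure_prod_eq, closure_Ioo zero_ne_one]
    exact ⟨ha, hb⟩
  refine ContinuousWithinAt.closure_le (f := fun q : ℝ × ℝ => ‖h q.2 - h q.1‖ₑ)
    (g := fun _ => intervalNorm (deriv h)) hcl ?_ continuousWithinAt_const h1
  have c1 : ContinuousWithinAt (fun q : ℝ × ℝ => h q.2) (Ioo (0 : ℝ) 1 ×ˢ Ioo (0 : ℝ) 1) (a, b) :=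
    ContinuousWithinAt.comp (t := Icc 0 1) (hc b hb) continuousWithinAt_snd
      fun q hq => Ioo_subset_Icc_self hq.2
  have c2 : ContinuousWithinAt (fun q : ℝ × ℝ => h q.1) (Ioo (0 : ℝ) 1 ×ˢ Ioo (0 : ℝ) 1) (a, b) :=
    ContinuousWithinAt.comp (t := Icc 0 1) (hc a ha) continuousWithinAt_fst
      fun q hq => Ioo_subset_Icc_self hq.1
  exact continuous_enorm.continuousAt.comp_continuousWithinAt (c1.sub c2)

/-- A function vanishing at some point of `[0, 1]` is dominated by its derivative. -/
theorem intervalNorm_le_deriv {h : ℝ → ℂ} (hh : ContDiffOn ℝ ∞ h (Ioo 0 1)) {a : ℝ}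
    (ha : a ∈ Ioo (0 : ℝ) 1) (h0 : h a = 0) : intervalNorm h ≤ intervalNorm (deriv h) := by
  refine intervalNorm_le_of_forall fun ρ hρ => ?_
  have := enorm_sub_le hh ha hρ
  rw [h0, sub_zero] at this
  refine this.trans (mul_le_of_le_one_left zero_le (ENNReal.rpow_le_one ?_ (by norm_num)))
  rw [ENNReal.ofReal_le_one, abs_le]
  constructor <;> linarith [ha.1, ha.2, hρ.1, hρ.2]

theorem intervalNorm_le_deriv_Icc {h : ℝ → ℂ} (hh : ContDiffOn ℝ ∞ h (Ioo 0 1))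
    (hc : ContinuousOn h (Icc 0 1)) {a : ℝ} (ha : a ∈ Icc (0 : ℝ) 1) (h0 : h a = 0) :
    intervalNorm h ≤ intervalNorm (deriv h) := by
  refine intervalNorm_le_of_forall fun ρ hρ => ?_
  have := enorm_sub_le_Icc hh hc ha (Ioo_subset_Icc_self hρ)
  rwa [h0, sub_zero] at this

/-! ### Density of polynomials in `L²(0, 1)` -/

theorem exists_polynomial_near (g : ℝ → ℂ) (hg : Continuous g) {ε : ℝ} (hε : 0 < ε) :
    ∃ F : ℂ[X], ∀ t ∈ Icc (0 : ℝ) 1, ‖g t - F.eval (t : ℂ)‖ ≤ ε := by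
  obtain ⟨p, hp⟩ := exists_polynomial_near_of_continuousOn 0 1 (fun t => (g t).re)
    (Complex.continuous_re.comp hg).continuousOn (ε / 2) (by positivity)
  obtain ⟨q, hq⟩ := exists_polynomial_near_of_continuousOn 0 1 (fun t => (g t).im)
    (Complex.continuous_im.comp hg).continuousOn (ε / 2) (by positivity)
  refine ⟨p.map Complex.ofRealHom + C Complex.I * q.map Complex.ofRealHom, fun t ht => ?_⟩
  have ep : (p.map Complex.ofRealHom).eval (t : ℂ) = (p.eval t : ℝ) :=
    eval_map_apply (f := Complex.ofRealHom) t
  have eq : (q.map Complex.ofRealHom).eval (t : ℂ) = (q.eval t : ℝ) :=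
    eval_map_apply (f := Complex.ofRealHom) t
  rw [eval_add, eval_mul, eval_C, ep, eq]
  refine (Complex.norm_le_abs_re_add_abs_im _).trans ?_
  have h1 := hp t ht
  have h2 := hq t ht
  simp only [Complex.sub_re, Complex.add_re, Complex.ofReal_re, Complex.mul_re, Complex.I_re,
    Complex.I_im, Complex.ofReal_im, Complex.sub_im, Complex.add_im, Complex.mul_im]
  rw [abs_sub_comm] at h1 h2
  have e1 : (g t).re - (eval t p + (0 * eval t q - 1 * 0)) = (g t).re - eval t p := by ring
  have e2 : (g t).im - (0 + (0 * 0 + 1 * eval t q)) = (g t).im - eval t q := by ring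
  rw [e1, e2]
  linarith

/-- Even polynomials are dense in `L²(0, 1)`. -/
theorem exists_polyFun_near {f : ℝ → ℂ}
    (hf : AEStronglyMeasurable f (volume.restrict (Ioo (0 : ℝ) 1))) (hN : intervalNorm f ≠ ⊤)
    {ε : ℝ≥0∞} (hε : ε ≠ 0) : ∃ F : ℂ[X], intervalNorm (f - polyFun F) ≤ ε := by
  have hε2 : ε / 2 ≠ 0 := by simpa using hε
  have hm : MemLp f 2 (volume.restrict (Ioo (0 : ℝ) 1)) := ⟨hf, hN.lt_top⟩
  obtain ⟨g, hg, hg'⟩ := hm.exists_boundedContinuous_eLpNorm_sub_le (by norm_num) hε2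
  obtain ⟨δ, hδ, hδε⟩ : ∃ δ : ℝ, 0 < δ ∧ ENNReal.ofReal δ ≤ ε / 2 := by
    rcases eq_or_ne (ε / 2) ⊤ with h | h
    · exact ⟨1, one_pos, by rw [h]; exact le_top⟩
    · exact ⟨(ε / 2).toReal, ENNReal.toReal_pos hε2 h, by rw [ENNReal.ofReal_toReal h]⟩
  obtain ⟨F, hF⟩ := exists_polynomial_near (fun t => g (Real.sqrt t))
    (g.continuous.comp Real.continuous_sqrt) hδ
  refine ⟨F, ?_⟩
  have e : f - polyFun F = (f - g) + (g - polyFun F) := by abel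
  have h1 : intervalNorm ((g : ℝ → ℂ) - polyFun F) ≤ ε / 2 := by
    refine intervalNorm_le_of_forall fun ρ hρ => ?_
    have h2 := hF (ρ ^ 2) ⟨by positivity, by nlinarith [hρ.1, hρ.2]⟩
    rw [Real.sqrt_sq hρ.1.le] at h2
    refine le_trans ?_ hδε
    rw [← ofReal_norm]
    refine ENNReal.ofReal_le_ofReal ?_
    simpa [polyFun] using h2
  rw [e]
  refine (eLpNorm_add_le (hf.sub hg'.1) (hg'.1.sub (continuous_polyFun F).aestronglyMeasurable)
    (by norm_num)).trans ?_
  calc _ ≤ ε / 2 + ε / 2 := add_le_add hg h1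
    _ = ε := ENNReal.add_halves ε

/-- Odd polynomials are dense in `L²(0, 1)`: cut off near the origin and divide by `ρ`. -/
theorem exists_mul_polyFun_near {f : ℝ → ℂ}
    (hf : AEStronglyMeasurable f (volume.restrict (Ioo (0 : ℝ) 1))) (hN : intervalNorm f ≠ ⊤)
    {ε : ℝ≥0∞} (hε : ε ≠ 0) :
    ∃ F : ℂ[X], intervalNorm (f - fun ρ : ℝ => (ρ : ℂ) * polyFun F ρ) ≤ ε := by
  have hε2 : ε / 2 ≠ 0 := by simpa using hε
  have hm : MemLp f 2 (volume.restrict (Ioo (0 : ℝ) 1)) := ⟨hf, hN.lt_top⟩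
  set s : ℕ → Set ℝ := fun n => Iic (1 / ((n : ℝ) + 1)) with hs
  have hlim : Tendsto (fun n => intervalNorm ((s n).indicator f)) atTop (𝓝 0) := by
    have h1 : Tendsto (fun n => ∫⁻ ρ in Ioo (0 : ℝ) 1, ‖(s n).indicator f ρ‖ₑ ^ 2) atTop
        (𝓝 (∫⁻ ρ in Ioo (0 : ℝ) 1, 0)) := by
      refine tendsto_lintegral_of_dominated_convergence' (fun ρ => ‖f ρ‖ₑ ^ 2) (fun n => ?_)
        (fun n => ?_) ?_ ?_
      · exact ((hf.indicator measurableSet_Iic).enorm.pow_const 2)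
      · refine ae_of_all _ fun ρ => ?_
        by_cases h : ρ ∈ s n
        · simp [indicator_of_mem h]
        · simp [indicator_of_notMem h]
      · rw [← intervalNorm_sq]
        exact ENNReal.pow_ne_top hN
      · filter_upwards [ae_restrict_mem measurableSet_Ioo] with ρ hρ
        refine tendsto_const_nhds.congr' ?_
        have : ∀ᶠ n : ℕ in atTop, 1 / ((n : ℝ) + 1) < ρ :=
          tendsto_one_div_add_atTop_nhds_zero_nat.eventually_lt_const hρ.1
        filter_upwards [this] with n hn
        rw [indicator_of_notMem (by simpa [hs] using hn)]
        simp
    simp only [lintegral_zero, ← intervalNorm_sq] at h1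
    have h2 := ENNReal.continuous_rpow_const (y := 1 / 2) |>.tendsto 0 |>.comp h1
    simp only [Function.comp_def, ← ENNReal.rpow_natCast, ← ENNReal.rpow_mul] at h2
    simpa using h2
  obtain ⟨n, hn⟩ := (hlim.eventually_le_const (pos_iff_ne_zero.2 hε2)).exists
  -- Away from the origin `f / ρ` is square integrable; approximate it by an even polynomial.
  set g : ℝ → ℂ := fun ρ => (ρ : ℂ)⁻¹ * (s n)ᶜ.indicator f ρ with hg
  have hgm : AEStronglyMeasurable g (volume.restrict (Ioo (0 : ℝ) 1)) :=
    (Complex.measurable_ofReal.inv.aestronglyMeasurable).mul (hf.indicator measurableSet_Iic.compl)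
  have hgN : intervalNorm g ≠ ⊤ := by
    have h1 : intervalNorm g ≤ intervalNorm (((n : ℂ) + 1) • f) := by
      refine intervalNorm_mono fun ρ hρ => ?_
      simp only [hg, norm_mul, norm_inv, Complex.norm_real, Pi.smul_apply, norm_smul]
      by_cases h : ρ ∈ s n
      · rw [indicator_of_notMem (by simpa using h), norm_zero, mul_zero]
        positivity
      · rw [indicator_of_mem (by simpa using h)]
        gcongr
        rw [Real.norm_of_nonneg hρ.1.le]
        have h2 : 1 / ((n : ℝ) + 1) < ρ := by simpa [hs] using h
        have h3 : ‖(n : ℂ) + 1‖ = (n : ℝ) + 1 := by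
          have : (n : ℂ) + 1 = ((n + 1 : ℕ) : ℂ) := by push_cast; ring
          rw [this, Complex.norm_natCast]; push_cast; ring
        rw [h3]
        rw [one_div] at h2
        exact inv_le_of_inv_le₀ (by positivity) h2.le
    refine ne_top_of_le_ne_top ?_ h1
    rw [intervalNorm_smul]
    exact ENNReal.mul_ne_top (by simp) hN
  obtain ⟨F, hF⟩ := exists_polyFun_near hgm hgN hε2
  refine ⟨F, ?_⟩
  set w : ℝ → ℂ := fun ρ => (ρ : ℂ) * (g ρ - polyFun F ρ) with hw
  have e : EqOn (f - fun ρ : ℝ => (ρ : ℂ) * polyFun F ρ) ((s n).indicator f + w) (Ioo 0 1) := by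
    intro ρ hρ
    have h0 : (ρ : ℂ) ≠ 0 := Complex.ofReal_ne_zero.2 hρ.1.ne'
    have h1 := congrFun (indicator_self_add_compl (s n) f) ρ
    simp only [Pi.add_apply] at h1
    simp only [hw, hg, Pi.sub_apply, Pi.add_apply]
    rw [mul_sub, mul_inv_cancel_left₀ h0, ← h1]
    ring
  rw [intervalNorm_congr e]
  have hwN : intervalNorm w ≤ ε / 2 := by
    refine (intervalNorm_mono (g := g - polyFun F) fun ρ hρ => ?_).trans hF
    rw [hw, norm_mul, Complex.norm_real, Real.norm_of_nonneg hρ.1.le]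
    exact mul_le_of_le_one_left (norm_nonneg _) hρ.2.le
  refine (eLpNorm_add_le (hf.indicator measurableSet_Iic) ?_ (by norm_num)).trans ?_
  · exact Complex.measurable_ofReal.aestronglyMeasurable.mul
      (hgm.sub (continuous_polyFun F).aestronglyMeasurable)
  · calc _ ≤ ε / 2 + ε / 2 := add_le_add hn hwN
      _ = ε := ENNReal.add_halves ε

/-! ### Inverting Euler operators on polynomials -/

theorem polyEuler_add (c : ℝ) (F G : ℂ[X]) :
    polyEuler c (F + G) = polyEuler c F + polyEuler c G := by
  simp only [polyEuler, derivative_add]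
  ring

/-- On `F(ρ²)` a shifted Euler operator is diagonal in the basis of monomials, with eigenvalues
`2 n + c`. -/
theorem polyEuler_surjective {c : ℝ} (hc : 0 < c) : Function.Surjective (polyEuler c) := by
  intro H
  induction H using Polynomial.induction_on' with
  | add p q hp hq =>
    obtain ⟨F, rfl⟩ := hp
    obtain ⟨G, rfl⟩ := hq
    exact ⟨F + G, polyEuler_add c F G⟩
  | monomial n a =>
    have h0 : (2 * n + c : ℂ) ≠ 0 := by
      have : (0 : ℝ) < 2 * n + c := by positivity
      exact_mod_cast this.ne'
    refine ⟨monomial n (a / (2 * n + c)), ?_⟩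
    rw [polyEuler, derivative_monomial, C_mul_monomial]
    rcases n with _ | n
    · simp only [Nat.cast_zero, mul_zero, zero_add, map_zero] at h0 ⊢
      rw [mul_div_cancel₀ _ h0]
    · rw [X_mul_monomial, C_mul_monomial, Nat.add_sub_cancel, ← map_add]
      congr 1
      field_simp

theorem polyChain_surjective {c : ℕ → ℝ} (hc : ∀ i, 0 < c i) (n : ℕ) :
    Function.Surjective (polyChain c n) := by
  induction n with
  | zero => exact Function.surjective_id
  | succ n ih => exact (polyEuler_surjective (hc n)).comp ih

theorem exists_derivative_eq (G : ℂ[X]) (a c : ℂ) : ∃ F : ℂ[X], derivative F = G ∧ F.eval a = c := by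
  have : ∃ F : ℂ[X], derivative F = G := by
    induction G using Polynomial.induction_on' with
    | add p q hp hq =>
      obtain ⟨F, rfl⟩ := hp
      obtain ⟨G, rfl⟩ := hq
      exact ⟨F + G, derivative_add⟩
    | monomial n b =>
      refine ⟨monomial (n + 1) (b / (n + 1)), ?_⟩
      rw [derivative_monomial, Nat.add_sub_cancel]
      congr 1
      have : (n + 1 : ℂ) ≠ 0 := by exact_mod_cast n.succ_ne_zero
      push_cast
      field_simp
  obtain ⟨F, hF⟩ := this
  exact ⟨F + C (c - F.eval a), by simp [hF], by simp⟩

/-! ### Norms of smooth radial functions and approximation by polynomials -/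

theorem intervalNorm_sub_le {f g : ℝ → ℂ} (hf : ContinuousOn f (Ioo 0 1))
    (hg : ContinuousOn g (Ioo 0 1)) :
    intervalNorm (f - g) ≤ intervalNorm f + intervalNorm g :=
  eLpNorm_sub_le (aestronglyMeasurable_of_continuousOn hf)
    (aestronglyMeasurable_of_continuousOn hg) (by norm_num)

theorem intervalNorm_chain_sub_le {u v : ℝ → ℂ} (hu : ContDiffOn ℝ ∞ u (Ioo 0 1))
    (hv : ContDiffOn ℝ ∞ v (Ioo 0 1)) (c : ℕ → ℝ) (n : ℕ) :
    intervalNorm (chain c n (u - v)) ≤ intervalNorm (chain c n u) + intervalNorm (chain c n v) := by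
  rw [intervalNorm_congr (chain_sub hu hv c n)]
  exact intervalNorm_sub_le (smooth_chain hu c n).continuousOn (smooth_chain hv c n).continuousOn

theorem deriv_sub_eqOn {u v : ℝ → ℂ} (hu : ContDiffOn ℝ ∞ u (Ioo 0 1))
    (hv : ContDiffOn ℝ ∞ v (Ioo 0 1)) : EqOn (deriv (u - v)) (deriv u - deriv v) (Ioo 0 1) :=
  fun _ hρ => deriv_sub (smooth_diffAt hu hρ) (smooth_diffAt hv hρ)

theorem smooth_sub {u v : ℝ → ℂ} (hu : ContDiffOn ℝ ∞ u (Ioo 0 1))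
    (hv : ContDiffOn ℝ ∞ v (Ioo 0 1)) : ContDiffOn ℝ ∞ (u - v) (Ioo 0 1) := hu.sub hv

theorem smooth_polyFun (F : ℂ[X]) : ContDiffOn ℝ ∞ (polyFun F) (Ioo 0 1) :=
  (contDiff_polyFun F).contDiffOn

theorem eq_of_zeroIndex_eq {d m : ℕ} {U V : radialSobolev d m}
    (h : U.1 (zeroIndex d m) = V.1 (zeroIndex d m)) : U = V := by
  refine sub_eq_zero.1 (Represents.eq_zero ?_)
  have : (U - V).1 (zeroIndex d m) = 0 := sub_eq_zero.2 h
  unfold Represents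
  rw [this]
  exact Lp.coeFn_zero ℂ 2 (ballMeasure d)

theorem enorm_zeroIndex_sub_le {d K m : ℕ} (hd : d = 2 * K + 3) {u v : ℝ → ℂ}
    (hu : ContDiffOn ℝ ∞ u (Ioo 0 1)) (hv : ContDiffOn ℝ ∞ v (Ioo 0 1)) {U V : radialSobolev d m}
    (hU : Represents u U) (hV : Represents v V) :
    ‖U.1 (zeroIndex d m) - V.1 (zeroIndex d m)‖ₑ ^ 2 ≤ sphereArea d * intervalNorm (u - v) ^ 2 := by
  have h1 : (U.1 (zeroIndex d m) - V.1 (zeroIndex d m) : Lp ℂ 2 (ballMeasure d))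
      =ᵐ[ballMeasure d] fun x => (u - v) ‖x‖ := by
    refine (Lp.coeFn_sub _ _).trans ?_
    unfold Represents at hU hV
    filter_upwards [hU, hV] with x h1 h2
    rw [Pi.sub_apply, h1, h2, Pi.sub_apply]
  rw [Lp.enorm_def, eLpNorm_congr_ae h1, eLpNorm_radial hd
    (aestronglyMeasurable_of_continuousOn (smooth_sub hu hv).continuousOn)]
  gcongr
  refine (intervalNorm_pow_mul_mono (u - v) (Nat.zero_le (K + 1))).trans (le_of_eq ?_)
  simp only [pow_zero, one_mul]

/-- If the polynomials near `u` have nearby jets, then the jet of `u` is their limit. -/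
theorem approx_of_bound {d K m : ℕ} (hd : d = 2 * K + 3) {u : ℝ → ℂ}
    (hu : ContDiffOn ℝ ∞ u (Ioo 0 1)) {U : radialSobolev d m} (hU : Represents u U)
    (φ : ℂ[X] → ℝ≥0∞) (C : ℝ≥0) (B : ℝ≥0∞)
    (h1 : ∀ F G, ‖polyJet d m (F - G)‖ₑ ≤ C * (φ F + φ G))
    (h2 : ∀ F, ‖polyJet d m F‖ₑ ≤ C * (B + φ F))
    (h3 : ∀ ε : ℝ≥0∞, ε ≠ 0 → ∃ F, φ F ≤ ε ∧ intervalNorm (u - polyFun F) ≤ ε) :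
    U ∈ closure (range (polyJet d m)) ∧ ‖U‖ₑ ≤ C * B := by
  have h0 : ∀ n : ℕ, ((n : ℝ≥0∞) + 1)⁻¹ ≠ 0 := fun n => by simp
  have hlim : Tendsto (fun n : ℕ => ((n : ℝ≥0∞) + 1)⁻¹) atTop (𝓝 0) := by
    have := (tendsto_add_atTop_iff_nat (f := fun n : ℕ => (n : ℝ≥0∞)⁻¹) 1).2
      ENNReal.tendsto_inv_nat_nhds_zero
    simpa using this
  choose F hF1 hF2 using fun n : ℕ => h3 _ (h0 n)
  have hφ : Tendsto (fun n => φ (F n)) atTop (𝓝 0) :=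
    tendsto_of_tendsto_of_tendsto_of_le_of_le tendsto_const_nhds hlim (fun _ => zero_le) hF1
  have hN : Tendsto (fun n => intervalNorm (u - polyFun (F n))) atTop (𝓝 0) :=
    tendsto_of_tendsto_of_tendsto_of_le_of_le tendsto_const_nhds hlim (fun _ => zero_le) hF2
  have hcau : CauchySeq fun n => polyJet d m (F n) := by
    have hb : Tendsto (fun q : ℕ × ℕ => C * (φ (F q.1) + φ (F q.2))) atTop (𝓝 0) := by
      rw [← prod_atTop_atTop_eq]
      have e := ENNReal.Tendsto.const_mul (a := (C : ℝ≥0∞)) ((hφ.comp tendsto_fst).add (hφ.comp tendsto_snd) :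
        Tendsto (fun q : ℕ × ℕ => φ (F q.1) + φ (F q.2)) (atTop ×ˢ atTop) (𝓝 (0 + 0)))
        (Or.inr ENNReal.coe_ne_top)
      simpa using e
    rw [cauchySeq_iff_tendsto, uniformity_eq_comap_nhds_zero, tendsto_comap_iff]
    rw [tendsto_zero_iff_enorm_tendsto_zero]
    refine tendsto_of_tendsto_of_tendsto_of_le_of_le tendsto_const_nhds hb (fun _ => zero_le) ?_
    rintro ⟨i, j⟩
    have := h1 (F j) (F i)
    rw [map_sub] at this
    change ‖polyJet d m (F j) - polyJet d m (F i)‖ₑ ≤ C * (φ (F i) + φ (F j))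
    rwa [add_comm (φ (F i))]
  obtain ⟨V, hV⟩ := cauchySeq_tendsto_of_complete hcau
  have hc : Continuous fun W : radialSobolev d m => W.1 (zeroIndex d m) :=
    (PiLp.continuous_apply 2 _ (zeroIndex d m)).comp continuous_subtype_val
  have hUV : U = V := by
    refine eq_of_zeroIndex_eq (tendsto_nhds_unique ?_ ((hc.tendsto V).comp hV))
    rw [tendsto_iff_enorm_sub_tendsto_zero]
    have e1 : Tendsto (fun n => (sphereArea d * intervalNorm (u - polyFun (F n)) ^ 2) ^ (1 / 2 : ℝ))
        atTop (𝓝 0) := by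
      have e2 := ENNReal.Tendsto.const_mul (a := sphereArea d)
        (((ENNReal.continuous_pow 2).tendsto 0).comp hN) (Or.inr (sphereArea_ne_top d))
      have e3 := (ENNReal.continuous_rpow_const (y := 1 / 2)).tendsto _ |>.comp e2
      simpa [Function.comp_def] using e3
    refine tendsto_of_tendsto_of_tendsto_of_le_of_le tendsto_const_nhds e1 (fun _ => zero_le)
      fun n => ?_
    have e4 := enorm_zeroIndex_sub_le hd hu (smooth_polyFun (F n)) hU (represents_polyJet d m (F n))
    have e5 := ENNReal.rpow_le_rpow e4 (z := 1 / 2) (by norm_num)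
    rw [← ENNReal.rpow_natCast, ← ENNReal.rpow_mul] at e5
    norm_num at e5 ⊢
    rwa [← enorm_neg, neg_sub]
  subst hUV
  refine ⟨mem_closure_of_tendsto hV (Eventually.of_forall fun n => mem_range_self _), ?_⟩
  have e1 : Tendsto (fun n => C * (B + φ (F n))) atTop (𝓝 (C * (B + 0))) :=
    ENNReal.Tendsto.const_mul (tendsto_const_nhds.add hφ) (Or.inr ENNReal.coe_ne_top)
  rw [add_zero] at e1
  exact le_of_tendsto_of_tendsto' ((continuous_enorm.tendsto _).comp hV) e1 fun n => h2 (F n)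

/-- The Sobolev norm of order `K + 1` of a smooth radial function is controlled by `(D_d u)'` in
`L²(0, 1)`, and polynomials are dense among such functions. -/
theorem smooth_approx_fst {d K : ℕ} (hd : d = 2 * K + 3) :
    ∃ C : ℝ≥0, ∀ u : ℝ → ℂ, ContDiffOn ℝ ∞ u (Ioo 0 1) → ∀ U : radialSobolev d (K + 1),
      Represents u U → U ∈ closure (range (polyJet d (K + 1))) ∧
        ‖U‖ₑ ≤ C * intervalNorm (chain (fun i => 2 * i + 1) (K + 1) u) := by
  obtain ⟨C, hC⟩ := enorm_polyJet_fst_le hd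
  obtain ⟨C₁, hC₁⟩ := chain_le_norm hd fun i => 2 * i + 1
  obtain ⟨C₂, hC₂⟩ := chain_le_of_half_lt (c := fun i => 2 * i + 1)
    (fun i => by have : (0 : ℝ) ≤ i := by positivity
                 linarith) (K + 1)
  refine ⟨C, fun u hu U hU => approx_of_bound hd hu hU
    (fun F => intervalNorm (chain (fun i => 2 * i + 1) (K + 1) (u - polyFun F))) C _ (fun F G => ?_)
    (fun F => ?_) fun ε hε => ?_⟩
  · refine (hC _).trans (mul_le_mul_right ?_ _)
    have e : polyFun (F - G) = (u - polyFun G) - (u - polyFun F) := by rw [polyFun_sub]; abel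
    rw [e]
    exact (intervalNorm_chain_sub_le (smooth_sub hu (smooth_polyFun G))
      (smooth_sub hu (smooth_polyFun F)) _ _).trans_eq (add_comm _ _)
  · refine (hC _).trans (mul_le_mul_right ?_ _)
    have e : polyFun F = u - (u - polyFun F) := by abel
    conv_lhs => rw [e]
    exact intervalNorm_chain_sub_le hu (smooth_sub hu (smooth_polyFun F)) _ _
  · have hfin : ∀ i ≤ K + 1, intervalNorm (chain (fun i => 2 * i + 1) i u) ≠ ⊤ := fun i hi =>
      ne_top_of_le_ne_top (ENNReal.mul_ne_top ENNReal.coe_ne_top enorm_ne_top)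
        (hC₁ (K + 1) le_rfl u hu U hU i hi)
    have hε' : ε / (C₂ + 1) ≠ 0 := ENNReal.div_ne_zero.2 ⟨hε, by simp⟩
    have hle : (C₂ + 1) * (ε / (C₂ + 1)) ≤ ε := ENNReal.mul_div_le
    -- Approximate the highest product of Euler operators, and invert these operators on polynomials.
    obtain ⟨H, hH⟩ := exists_polyFun_near (aestronglyMeasurable_of_continuousOn
      (smooth_chain hu (fun i => 2 * i + 1) (K + 1)).continuousOn) (hfin _ le_rfl) hε'
    obtain ⟨F, rfl⟩ := polyChain_surjective (c := fun i => 2 * i + 1)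
      (fun i => by positivity) (K + 1) H
    have h1 : intervalNorm (chain (fun i => 2 * i + 1) (K + 1) (u - polyFun F)) ≤ ε / (C₂ + 1) := by
      rw [intervalNorm_congr (chain_sub hu (smooth_polyFun F) _ _), chain_polyFun]
      exact hH
    refine ⟨F, h1.trans ((le_mul_of_one_le_left zero_le le_add_self).trans hle), ?_⟩
    have h2 := hC₂ (u - polyFun F) (smooth_sub hu (smooth_polyFun F)) (fun i hi => ?_) 0 (Nat.zero_le _)
    · refine (h2.trans ?_).trans hle
      gcongr
      exact le_self_add
    · refine ne_top_of_le_ne_top ?_ (intervalNorm_chain_sub_le hu (smooth_polyFun F) _ _)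
      rw [chain_polyFun]
      exact ENNReal.add_ne_top.2 ⟨hfin i hi.le, intervalNorm_ne_top_of_continuous (continuous_polyFun _)⟩

/-- The Sobolev norm of order `K + 2` of a smooth radial function is controlled by `(D_d u)''` and
`u` in `L²(0, 1)`, and polynomials are dense among such functions. -/
theorem smooth_approx_snd {d K : ℕ} (hd : d = 2 * K + 3) :
    ∃ C : ℝ≥0, ∀ u : ℝ → ℂ, ContDiffOn ℝ ∞ u (Ioo 0 1) → ∀ U : radialSobolev d (K + 2),
      Represents u U → U ∈ closure (range (polyJet d (K + 2))) ∧
        ‖U‖ₑ ≤ C * (intervalNorm (chain (fun i => 2 * i + 2) (K + 1) (deriv u))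
          + intervalNorm u) := by
  obtain ⟨C, hC⟩ := enorm_polyJet_snd_le hd
  obtain ⟨C₁, hC₁⟩ := chain_deriv_le_norm hd fun i => 2 * i + 2
  obtain ⟨C₂, hC₂⟩ := chain_le_of_half_lt (c := fun i => 2 * i + 2)
    (fun i => by have : (0 : ℝ) ≤ i := by positivity
                 linarith) (K + 1)
  have hsub : ∀ u v : ℝ → ℂ, ContDiffOn ℝ ∞ u (Ioo 0 1) → ContDiffOn ℝ ∞ v (Ioo 0 1) →
      intervalNorm (chain (fun i => 2 * i + 2) (K + 1) (deriv (u - v))) + intervalNorm (u - v) ≤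
        (intervalNorm (chain (fun i => 2 * i + 2) (K + 1) (deriv u)) + intervalNorm u) +
        (intervalNorm (chain (fun i => 2 * i + 2) (K + 1) (deriv v)) + intervalNorm v) := by
    intro u v hu hv
    rw [intervalNorm_congr (chain_congr (deriv_sub_eqOn hu hv) _ _), add_add_add_comm]
    exact add_le_add (intervalNorm_chain_sub_le (smooth_deriv hu) (smooth_deriv hv) _ _)
      (intervalNorm_sub_le hu.continuousOn hv.continuousOn)
  refine ⟨C, fun u hu U hU => approx_of_bound hd hu hU
    (fun F => intervalNorm (chain (fun i => 2 * i + 2) (K + 1) (deriv (u - polyFun F)))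
      + intervalNorm (u - polyFun F)) C _ (fun F G => ?_)
    (fun F => ?_) fun ε hε => ?_⟩
  · refine (hC _).trans (mul_le_mul_right ?_ _)
    have e : polyFun (F - G) = (u - polyFun G) - (u - polyFun F) := by rw [polyFun_sub]; abel
    rw [e, add_comm (intervalNorm (chain _ _ (deriv (u - polyFun F))) + _)]
    exact hsub _ _ (smooth_sub hu (smooth_polyFun G)) (smooth_sub hu (smooth_polyFun F))
  · refine (hC _).trans (mul_le_mul_right ?_ _)
    have e : polyFun F = u - (u - polyFun F) := by abel
    conv_lhs => rw [e]
    exact hsub _ _ hu (smooth_sub hu (smooth_polyFun F))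
  · have hfin : ∀ i ≤ K + 1, intervalNorm (chain (fun i => 2 * i + 2) i (deriv u)) ≠ ⊤ :=
      fun i hi => ne_top_of_le_ne_top (ENNReal.mul_ne_top ENNReal.coe_ne_top enorm_ne_top)
        (hC₁ (K + 2) le_rfl u hu U hU i hi)
    have hε' : ε / (C₂ + 1) ≠ 0 := ENNReal.div_ne_zero.2 ⟨hε, by simp⟩
    have hle : (C₂ + 1) * (ε / (C₂ + 1)) ≤ ε := ENNReal.mul_div_le
    -- `(F(ρ²))'` is odd, so the products applied to `u'` are approximated by odd polynomials.
    obtain ⟨H, hH⟩ := exists_mul_polyFun_near (aestronglyMeasurable_of_continuousOn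
      (smooth_chain (smooth_deriv hu) (fun i => 2 * i + 2) (K + 1)).continuousOn)
      (hfin _ le_rfl) hε'
    obtain ⟨G, rfl⟩ := polyChain_surjective (c := fun i => 2 * i + 2 + 1)
      (fun i => by positivity) (K + 1) H
    -- The constant of integration is fixed by agreement with `u` at the interior point `1/2`.
    obtain ⟨F, hF, hF'⟩ := exists_derivative_eq (Polynomial.C (1 / 2) * G) (((1 / 2 : ℝ) : ℂ) ^ 2)
      (u (1 / 2))
    have hsF := smooth_polyFun F
    have hdF : deriv (polyFun F) = fun ρ : ℝ => (ρ : ℂ) * polyFun G ρ := by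
      rw [deriv_polyFun', hF, ← mul_assoc, ← C_mul]
      norm_num
    have hd' := deriv_sub_eqOn hu hsF
    have h1 : intervalNorm (chain (fun i => 2 * i + 2) (K + 1) (deriv (u - polyFun F)))
        ≤ ε / (C₂ + 1) := by
      rw [intervalNorm_congr (chain_congr hd' _ _),
        intervalNorm_congr (chain_sub (smooth_deriv hu) (smooth_deriv hsF) _ _), hdF,
        chain_mul_polyFun]
      exact hH
    have h2 := hC₂ (deriv (u - polyFun F)) (smooth_deriv (smooth_sub hu hsF)) (fun i hi => ?_) 0
      (Nat.zero_le _)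
    · have h3 : intervalNorm (u - polyFun F) ≤ C₂ * (ε / (C₂ + 1)) := by
        refine (intervalNorm_le_deriv (smooth_sub hu hsF) (a := 1 / 2) (by norm_num) ?_).trans
          (h2.trans (by gcongr))
        rw [show (u - polyFun F) (1 / 2) = u (1 / 2) - eval (((1 / 2 : ℝ) : ℂ) ^ 2) F from rfl, hF',
          sub_self]
      refine ⟨F, ?_, h3.trans ((mul_le_mul_left le_self_add _).trans hle)⟩
      calc _ ≤ ε / (C₂ + 1) + C₂ * (ε / (C₂ + 1)) := add_le_add h1 h3
        _ = (C₂ + 1) * (ε / (C₂ + 1)) := by ring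
        _ ≤ ε := hle
    · rw [intervalNorm_congr (chain_congr hd' _ _)]
      refine ne_top_of_le_ne_top ?_ (intervalNorm_chain_sub_le (smooth_deriv hu) (smooth_deriv hsF) _ _)
      rw [hdF, chain_mul_polyFun]
      exact ENNReal.add_ne_top.2 ⟨hfin i hi.le,
        intervalNorm_ne_top_of_continuous (continuous_mul_polyFun _)⟩

/-! ### Dilations of radial Sobolev functions -/

/-- The radial profile of an element of the Sobolev space may be chosen measurable: restrict a
measurable version to a generic ray. -/
theorem exists_measurable_represents {d m : ℕ} (hd : d ≠ 0) (U : radialSobolev d m) :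
    ∃ u : ℝ → ℂ, Measurable u ∧ Represents u U := by
  obtain ⟨u, hu⟩ := U.2.2
  have : Nonempty (Fin d) := ⟨⟨0, Nat.pos_of_ne_zero hd⟩⟩
  have hgm : Measurable (U.1 (zeroIndex d m) : Space d → ℂ) :=
    (Lp.stronglyMeasurable _).measurable
  set f : Space d → ℂ := (U.1 (zeroIndex d m) : Space d → ℂ) with hf
  set e := (homeomorphUnitSphereProd (Space d)).toMeasurableEquiv with he
  have hmp : MeasurePreserving e ((volume : Measure (Space d)).comap (↑))
      ((volume : Measure (Space d)).toSphere.prod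
        (Measure.volumeIoiPow (Module.finrank ℝ (Space d) - 1))) :=
    (volume : Measure (Space d)).measurePreserving_homeomorphUnitSphereProd
  have h1 : ∀ᵐ x : Space d, ‖x‖ < 1 → f x = u ‖x‖ := by
    have := (ae_restrict_iff' measurableSet_ball).1 hu
    filter_upwards [this] with x hx h
    exact hx (by simpa using h)
  rw [← restrict_compl_singleton (μ := (volume : Measure (Space d))) 0,
    ae_restrict_iff_subtype (measurableSet_singleton _).compl] at h1
  have h2 := (hmp.symm e).quasiMeasurePreserving.ae h1
  have h3 := Measure.ae_ae_of_ae_prod h2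
  have : NeZero (volume : Measure (Space d)).toSphere := ⟨Measure.toSphere_ne_zero _⟩
  obtain ⟨η, hη⟩ := h3.exists
  refine ⟨fun r => f (r • (η : Space d)), hgm.comp (measurable_id.smul_const _), ?_⟩
  have h4 := hmp.quasiMeasurePreserving.ae (Measure.quasiMeasurePreserving_snd.ae
    (μa := (volume : Measure (Space d)).toSphere.prod _) hη)
  have h5 := (ae_restrict_iff_subtype (measurableSet_singleton (0 : Space d)).compl
    (p := fun x : Space d => ‖x‖ < 1 → f (‖x‖ • (η : Space d)) = u ‖x‖)).2 (by
      filter_upwards [h4] with x hx h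
      have h6 : ‖‖(x : Space d)‖ • (η : Space d)‖ = ‖(x : Space d)‖ := by
        rw [norm_smul, norm_norm, norm_eq_of_mem_sphere, mul_one]
      have h8 : ((e.symm (η, (e x).2) : ({0}ᶜ : Set (Space d))) : Space d) =
          ‖(x : Space d)‖ • (η : Space d) := by
        simp [he]
      rw [h8, h6] at hx
      exact hx h)
  rw [restrict_compl_singleton] at h5
  change f =ᵐ[ballMeasure d] fun x => f (‖x‖ • (η : Space d))
  filter_upwards [hu, ae_restrict_of_ae h5, ae_restrict_mem measurableSet_ball] with x h6 h7 h8
  rw [h6, h7 (by simpa using h8)]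

theorem partialDeriv_comp_smul {d : ℕ} (i : Fin d) (φ : Space d → ℝ) (c : ℝ) :
    partialDeriv i (fun x => φ (c • x)) = fun x => c * partialDeriv i φ (c • x) := by
  funext x
  rw [partialDeriv, fderiv_comp_smul]
  rfl

theorem partialDeriv_const_mul {d : ℕ} (i : Fin d) (φ : Space d → ℝ) (c : ℝ) :
    partialDeriv i (fun x => c * φ x) = fun x => c * partialDeriv i φ x := by
  funext x
  have : (fun x => c * φ x) = c • φ := rfl
  rw [partialDeriv, this, fderiv_const_smul_field]
  rfl

theorem multiDeriv_comp_smul {d : ℕ} (α : Fin d → ℕ) (φ : Space d → ℝ) (c : ℝ) :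
    multiDeriv α (fun x => φ (c • x)) = fun x => c ^ (∑ i, α i) * multiDeriv α φ (c • x) := by
  have h1 : ∀ (i : Fin d) (n k : ℕ) (ψ : Space d → ℝ),
      (partialDeriv i)^[n] (fun x => c ^ k * ψ (c • x)) =
        fun x => c ^ (n + k) * (partialDeriv i)^[n] ψ (c • x) := by
    intro i n k ψ
    induction n with
    | zero => simp
    | succ n ih =>
      rw [Function.iterate_succ_apply', Function.iterate_succ_apply', ih, partialDeriv_const_mul,
        partialDeriv_comp_smul]
      funext x
      ring
  have h2 : ∀ l : List (Fin d), l.foldr (fun i ψ => (partialDeriv i)^[α i] ψ) (fun x => φ (c • x)) =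
      fun x => c ^ (l.map α).sum * l.foldr (fun i ψ => (partialDeriv i)^[α i] ψ) φ (c • x) := by
    intro l
    induction l with
    | nil => simp
    | cons i l ih => rw [List.foldr_cons, ih, h1]; simp
  unfold multiDeriv
  rw [h2, ← List.ofFn_eq_map, List.sum_ofFn]

theorem map_smul_ballMeasure_le {d : ℕ} {σ : ℝ} (h0 : 0 < σ) (h1 : σ ≤ 1) :
    (ballMeasure d).map (fun x => σ • x) ≤ ENNReal.ofReal ((σ ^ d)⁻¹) • ballMeasure d := by
  have hm : Measurable fun x : Space d => σ • x := measurable_const_smul σ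
  refine Measure.le_iff.2 fun s hs => ?_
  rw [Measure.map_apply hm hs, Measure.smul_apply, ballMeasure, Measure.restrict_apply (hm hs),
    Measure.restrict_apply hs, smul_eq_mul]
  have e := congrArg (fun ν : Measure (Space d) => ν (s ∩ unitBall d))
    (Measure.map_addHaar_smul (volume : Measure (Space d)) h0.ne')
  simp only [Measure.smul_apply, smul_eq_mul, finrank_euclideanSpace_fin] at e
  rw [Measure.map_apply hm (hs.inter measurableSet_ball), abs_of_pos (by positivity)] at e
  rw [← e]
  refine measure_mono fun x hx => ⟨hx.1, ?_⟩
  have : ‖x‖ < 1 := by simpa using hx.2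
  have h2 : ‖σ • x‖ < 1 := by
    rw [norm_smul, Real.norm_of_nonneg h0.le]
    calc σ * ‖x‖ ≤ 1 * ‖x‖ := by gcongr
      _ < 1 := by linarith
  simpa using h2

/-- The contraction factor `e^{-|t|}`. -/
def scale (t : ℝ) : ℝ := Real.exp (-|t|)

theorem scale_pos (t : ℝ) : 0 < scale t := Real.exp_pos _

theorem scale_le_one (t : ℝ) : scale t ≤ 1 := Real.exp_le_one_iff.2 (by simp)

theorem continuous_scale : Continuous scale := by unfold scale; fun_prop

theorem ae_scale {d : ℕ} (t : ℝ) {p : Space d → Prop} (h : ∀ᵐ x ∂ballMeasure d, p x) :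
    ∀ᵐ x ∂ballMeasure d, p (scale t • x) := by
  refine ae_of_ae_map (measurable_const_smul (scale t)).aemeasurable ?_
  refine Measure.absolutelyContinuous_of_le_smul
    (map_smul_ballMeasure_le (scale_pos t) (scale_le_one t)) |>.ae_le h

theorem lintegral_scale_le {d : ℕ} (t : ℝ) {g : Space d → ℝ≥0∞} (hg : Measurable g) :
    ∫⁻ x, g (scale t • x) ∂ballMeasure d ≤
      ENNReal.ofReal ((scale t ^ d)⁻¹) * ∫⁻ x, g x ∂ballMeasure d := by
  rw [← lintegral_map hg (measurable_const_smul (scale t)), ← smul_eq_mul, ← lintegral_smul_measure]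
  exact lintegral_mono' (map_smul_ballMeasure_le (scale_pos t) (scale_le_one t)) le_rfl

theorem eLpNorm_scale_le {d : ℕ} (t : ℝ) {f : Space d → ℂ} (hf : Measurable f) :
    eLpNorm (fun x => f (scale t • x)) 2 (ballMeasure d) ^ 2 ≤
      ENNReal.ofReal ((scale t ^ d)⁻¹) * eLpNorm f 2 (ballMeasure d) ^ 2 := by
  rw [eLpNorm_two_sq, eLpNorm_two_sq]
  exact lintegral_scale_le t (g := fun x => ‖f x‖ₑ ^ 2) (by fun_prop)

theorem memLp_scale {d : ℕ} (t : ℝ) (f : Lp ℂ 2 (ballMeasure d)) :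
    MemLp (fun x => f (scale t • x)) 2 (ballMeasure d) := by
  have hm : Measurable f := (Lp.stronglyMeasurable f).measurable
  refine ⟨(hm.comp (measurable_const_smul (scale t))).aestronglyMeasurable, ?_⟩
  have := eLpNorm_scale_le t hm
  have h2 : ENNReal.ofReal ((scale t ^ d)⁻¹) * eLpNorm f 2 (ballMeasure d) ^ 2 ≠ ⊤ :=
    ENNReal.mul_ne_top ENNReal.ofReal_ne_top (ENNReal.pow_ne_top (Lp.eLpNorm_ne_top f))
  have h3 := ne_top_of_le_ne_top h2 this
  rw [lt_top_iff_ne_top]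
  intro h
  rw [h] at h3
  simp at h3

/-- The dilation `f ↦ f(e^{-|t|} ·)` on `L²(𝔹ᵈ)`. -/
def dilateLp {d : ℕ} (t : ℝ) (f : Lp ℂ 2 (ballMeasure d)) : Lp ℂ 2 (ballMeasure d) :=
  (memLp_scale t f).toLp _

theorem dilateLp_ae {d : ℕ} (t : ℝ) (f : Lp ℂ 2 (ballMeasure d)) :
    dilateLp t f =ᵐ[ballMeasure d] fun x => f (scale t • x) := MemLp.coeFn_toLp (memLp_scale t f)

theorem dilateLp_sub {d : ℕ} (t : ℝ) (f g : Lp ℂ 2 (ballMeasure d)) :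
    dilateLp t (f - g) = dilateLp t f - dilateLp t g := by
  apply Lp.ext
  filter_upwards [dilateLp_ae t f, dilateLp_ae t g, dilateLp_ae t (f - g),
    Lp.coeFn_sub (dilateLp t f) (dilateLp t g), ae_scale t (Lp.coeFn_sub f g)] with x h1 h2 h3 h4 h5
  rw [h3, h4, h5, Pi.sub_apply, Pi.sub_apply, h1, h2]

theorem enorm_dilateLp_le {d : ℕ} (t : ℝ) (f : Lp ℂ 2 (ballMeasure d)) :
    ‖dilateLp t f‖ₑ ^ 2 ≤ ENNReal.ofReal ((scale t ^ d)⁻¹) * ‖f‖ₑ ^ 2 := by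
  rw [Lp.enorm_def, Lp.enorm_def, eLpNorm_congr_ae (dilateLp_ae t f)]
  exact eLpNorm_scale_le t (Lp.stronglyMeasurable f).measurable

theorem norm_dilateLp_le {d : ℕ} (t : ℝ) (f : Lp ℂ 2 (ballMeasure d)) :
    ‖dilateLp t f‖ ≤ Real.exp (d * |t|) * ‖f‖ := by
  have h := enorm_dilateLp_le t f
  rw [← ofReal_norm, ← ofReal_norm, ← ENNReal.ofReal_pow (norm_nonneg _),
    ← ENNReal.ofReal_pow (norm_nonneg _), ← ENNReal.ofReal_mul (by have := scale_pos t; positivity),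
    ENNReal.ofReal_le_ofReal_iff (by have := scale_pos t; positivity)] at h
  have e : (scale t ^ d)⁻¹ = Real.exp (d * |t|) := by
    rw [scale, ← Real.exp_nat_mul, ← Real.exp_neg]
    congr 1
    ring
  rw [e] at h
  refine abs_le_of_sq_le_sq' ?_ (by positivity) |>.2
  refine h.trans ?_
  rw [mul_pow]
  gcongr
  have h1 : 1 ≤ Real.exp (d * |t|) := Real.one_le_exp (by positivity)
  nlinarith

/-- Dilations are strongly continuous. -/
theorem continuous_dilateLp {d : ℕ} (f : Lp ℂ 2 (ballMeasure d)) :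
    Continuous fun t => dilateLp t f := by
  refine continuous_of_locally_uniform_approx_of_continuousAt fun t₀ V hV => ?_
  obtain ⟨ε, hε, hεV⟩ := Metric.mem_uniformity_dist.1 hV
  set M := Real.exp (d * (|t₀| + 1)) with hM
  have hM0 : 0 < M := Real.exp_pos _
  obtain ⟨g, hg, hg'⟩ := (Lp.memLp f).exists_boundedContinuous_eLpNorm_sub_le (by norm_num)
    (ε := ENNReal.ofReal (ε / (2 * M))) (by simp; positivity)
  refine ⟨Metric.ball t₀ 1, Metric.ball_mem_nhds _ one_pos, fun t => dilateLp t (hg'.toLp _), ?_, ?_⟩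
  · rw [ContinuousAt, tendsto_iff_enorm_sub_tendsto_zero]
    have key : ∀ t, ‖dilateLp t (hg'.toLp _) - dilateLp t₀ (hg'.toLp _)‖ₑ ^ 2 =
        ∫⁻ x, ‖g (scale t • x) - g (scale t₀ • x)‖ₑ ^ 2 ∂ballMeasure d := by
      intro t
      rw [Lp.enorm_def, eLpNorm_two_sq]
      refine lintegral_congr_ae ?_
      filter_upwards [Lp.coeFn_sub (dilateLp t (hg'.toLp _)) (dilateLp t₀ (hg'.toLp _)),
        dilateLp_ae t (hg'.toLp _), dilateLp_ae t₀ (hg'.toLp _), ae_scale t hg'.coeFn_toLp,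
        ae_scale t₀ hg'.coeFn_toLp] with x h1 h2 h3 h4 h5
      rw [h1, Pi.sub_apply, h2, h3, h4, h5]
    have h1 : Tendsto (fun t => ∫⁻ x, ‖g (scale t • x) - g (scale t₀ • x)‖ₑ ^ 2 ∂ballMeasure d)
        (𝓝 t₀) (𝓝 (∫⁻ _, 0 ∂ballMeasure d)) := by
      refine tendsto_lintegral_filter_of_dominated_convergence
        (fun _ => (‖(2 * ‖g‖ : ℝ)‖ₑ) ^ 2) ?_ ?_ ?_ ?_
      · refine Eventually.of_forall fun t => ?_
        have := g.continuous
        fun_prop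
      · refine Eventually.of_forall fun t => ae_of_all _ fun x => ?_
        gcongr
        rw [enorm_le_iff_norm_le, Real.norm_of_nonneg (by positivity)]
        calc _ ≤ ‖g (scale t • x)‖ + ‖g (scale t₀ • x)‖ := norm_sub_le _ _
          _ ≤ ‖g‖ + ‖g‖ := add_le_add (g.norm_coe_le_norm _) (g.norm_coe_le_norm _)
          _ = _ := by ring
      · rw [lintegral_const]
        exact ENNReal.mul_ne_top (ENNReal.pow_ne_top enorm_ne_top) (measure_ne_top _ _)
      · refine ae_of_all _ fun x => ?_
        have hc : Continuous fun t => ‖g (scale t • x) - g (scale t₀ • x)‖ₑ ^ 2 := by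
          have := g.continuous
          have := continuous_scale
          fun_prop
        have := hc.tendsto t₀
        simpa using this
    simp only [lintegral_zero, ← key] at h1
    have h2 := (ENNReal.continuous_rpow_const (y := 1 / 2)).tendsto 0 |>.comp h1
    simp only [Function.comp_def, ← ENNReal.rpow_natCast, ← ENNReal.rpow_mul] at h2
    simpa using h2
  · intro t ht
    refine hεV ?_
    rw [dist_eq_norm, ← dilateLp_sub]
    refine (norm_dilateLp_le t _).trans_lt ?_
    have h1 : |t| ≤ |t₀| + 1 := by
      have h2 : |t - t₀| < 1 := by simpa [Real.dist_eq] using ht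
      have h3 := abs_sub_abs_le_abs_sub t t₀
      linarith
    have h2 : ‖f - hg'.toLp _‖ ≤ ε / (2 * M) := by
      have : f - hg'.toLp _ = ((Lp.memLp f).sub hg').toLp _ := by
        rw [MemLp.toLp_sub (Lp.memLp f) hg', Lp.toLp_coeFn]
      rw [this, Lp.norm_toLp]
      exact ENNReal.toReal_le_of_le_ofReal (by positivity) hg
    calc Real.exp (d * |t|) * ‖f - hg'.toLp _‖ ≤ M * (ε / (2 * M)) := by
          rw [hM]; gcongr
      _ = ε / 2 := by field_simp
      _ < ε := by linarith

theorem integral_test_scale {d : ℕ} {σ : ℝ} (h0 : 0 < σ) (h1 : σ ≤ 1) {φ : Space d → ℝ}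
    (hφ : IsTest (unitBall d) φ) (f : Space d → ℂ) :
    IsTest (unitBall d) (fun x => φ (σ⁻¹ • x)) ∧ ∫ x, φ x • f (σ • x) ∂ballMeasure d =
      ((σ ^ d)⁻¹ : ℝ) • ∫ x, φ (σ⁻¹ • x) • f x ∂ballMeasure d := by
  have ht : IsTest (unitBall d) (fun x => φ (σ⁻¹ • x)) := by
    have e : tsupport (fun x => φ (σ⁻¹ • x)) = (fun x => σ⁻¹ • x) ⁻¹' tsupport φ :=
      tsupport_comp_eq_preimage φ (Homeomorph.smulOfNeZero σ⁻¹ (inv_ne_zero h0.ne'))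
    refine ⟨hφ.1.comp (contDiff_const_smul _), ?_, fun x hx => ?_⟩
    · exact hφ.2.comp_homeomorph (Homeomorph.smulOfNeZero σ⁻¹ (inv_ne_zero h0.ne'))
    · rw [e] at hx
      have h2 : ‖σ⁻¹ • x‖ < 1 := by simpa using hφ.3 hx
      rw [norm_smul, norm_inv, Real.norm_of_nonneg h0.le] at h2
      have h3 : ‖x‖ < 1 := by
        calc ‖x‖ = σ * (σ⁻¹ * ‖x‖) := by field_simp
          _ ≤ 1 * (σ⁻¹ * ‖x‖) := by gcongr
          _ < 1 := by linarith
      simpa using h3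
  refine ⟨ht, ?_⟩
  rw [setIntegral_test subset_rfl hφ, setIntegral_test subset_rfl ht]
  have := Measure.integral_comp_smul (volume : Measure (Space d)) (fun x => φ (σ⁻¹ • x) • f x) σ
  rw [finrank_euclideanSpace_fin, abs_of_pos (by positivity)] at this
  rw [← this]
  refine integral_congr_ae (ae_of_all _ fun x => ?_)
  simp only [inv_smul_smul₀ h0.ne']

/-- The dilation `u ↦ u(e^{-|t|} ·)` on the radial Sobolev space. -/
def dilateJet {d m : ℕ} (t : ℝ) (U : radialSobolev d m) : radialSobolev d m :=
  ⟨WithLp.toLp 2 fun α => ((scale t ^ (∑ i, α.1 i) : ℝ) : ℂ) • dilateLp t (U.1 α), by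
    have h0 : ((scale t ^ (∑ i, (zeroIndex d m).1 i) : ℝ) : ℂ) • dilateLp t (U.1 (zeroIndex d m)) =
        dilateLp t (U.1 (zeroIndex d m)) := by simp [zeroIndex]
    refine ⟨fun α => ?_, ?_⟩
    · have h1 : IsWeakDeriv α.1 (fun x => (U.1 (zeroIndex d m) : Space d → ℂ) (scale t • x))
          fun x => ((scale t ^ (∑ i, α.1 i) : ℝ) : ℂ) • (U.1 α : Space d → ℂ) (scale t • x) := by
        intro φ hφ
        have hs := (scale_pos t).ne'
        have e1 := integral_test_scale (scale_pos t) (scale_le_one t) (hφ.isTest.multiDeriv α.1)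
          (U.1 (zeroIndex d m) : Space d → ℂ)
        have e2 := integral_test_scale (scale_pos t) (scale_le_one t) hφ.isTest
          (U.1 α : Space d → ℂ)
        have e3 := U.2.1 α _ (e2.1.isTestFunction subset_rfl)
        rw [multiDeriv_comp_smul] at e3
        simp only [mul_smul, integral_smul] at e3
        rw [e1.2]
        simp only [smul_comm (_ : ℝ) (_ : ℂ)]
        rw [integral_smul, e2.2]
        have e4 : ∫ x, multiDeriv α.1 φ ((scale t)⁻¹ • x) • (U.1 (zeroIndex d m) : Space d → ℂ) x
            ∂ballMeasure d = (scale t ^ (∑ i, α.1 i) : ℝ) • ((-1 : ℂ) ^ (∑ i, α.1 i) *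
              ∫ x, φ ((scale t)⁻¹ • x) • (U.1 α : Space d → ℂ) x ∂ballMeasure d) := by
          rw [← e3, smul_smul, ← mul_pow, mul_inv_cancel₀ hs, one_pow, one_smul]
        rw [e4]
        simp only [Complex.real_smul, smul_eq_mul]
        ring
      refine isWeakDeriv_congr h1 ?_ ?_
      · exact (h0 ▸ dilateLp_ae t (U.1 (zeroIndex d m))).symm
      · refine EventuallyEq.symm ((Lp.coeFn_smul (((scale t ^ (∑ i, α.1 i) : ℝ) : ℂ))
          (dilateLp t (U.1 α))).trans ?_)
        filter_upwards [dilateLp_ae t (U.1 α)] with x hx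
        rw [Pi.smul_apply, hx]
    · obtain ⟨u, hu⟩ := U.2.2
      refine ⟨fun ρ => u (scale t * ρ), ?_⟩
      refine (h0 ▸ dilateLp_ae t (U.1 (zeroIndex d m)) :).trans ?_
      filter_upwards [ae_scale t hu] with x hx
      rw [hx, norm_smul, Real.norm_of_nonneg (scale_pos t).le]⟩

theorem represents_dilateJet {d m : ℕ} (t : ℝ) {u : ℝ → ℂ} {U : radialSobolev d m}
    (hU : Represents u U) : Represents (fun ρ => u (scale t * ρ)) (dilateJet t U) := by
  have h0 : (dilateJet t U).1 (zeroIndex d m) = dilateLp t (U.1 (zeroIndex d m)) := by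
    change ((scale t ^ (∑ i, (zeroIndex d m).1 i) : ℝ) : ℂ) • dilateLp t (U.1 (zeroIndex d m)) = _
    simp [zeroIndex]
  unfold Represents at hU ⊢
  rw [h0]
  filter_upwards [dilateLp_ae t (U.1 (zeroIndex d m)), ae_scale t hU] with x h1 h2
  rw [h1, h2, norm_smul, Real.norm_of_nonneg (scale_pos t).le]

theorem continuous_dilateJet {d m : ℕ} (U : radialSobolev d m) :
    Continuous fun t => dilateJet t U := by
  refine Continuous.subtype_mk ?_ _
  refine (PiLp.continuous_toLp 2 _).comp (continuous_pi fun α => ?_)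
  exact (Complex.continuous_ofReal.comp (continuous_scale.pow _)).smul (continuous_dilateLp _)

theorem dilateJet_zero {d m : ℕ} (U : radialSobolev d m) : dilateJet 0 U = U := by
  obtain ⟨u, hu⟩ := U.2.2
  have h1 := represents_dilateJet 0 (U := U) hu
  refine eq_of_zeroIndex_eq (Lp.ext ?_)
  unfold Represents at h1
  refine h1.trans ?_
  filter_upwards [hu] with x hx
  rw [hx]
  simp [scale]

/-! ### Regularization and density of polynomials -/

theorem lintegral_profile_ne_top {d m : ℕ} (hd : d ≠ 0) {u : ℝ → ℂ} (hu : Measurable u)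
    {U : radialSobolev d m} (hU : Represents u U) :
    ∫⁻ x, ‖u ‖x‖‖ₑ ∂ballMeasure d ≠ ⊤ ∧
      ∫⁻ ρ in Ioo (0 : ℝ) 1, ENNReal.ofReal (ρ ^ (d - 1)) * ‖u ρ‖ₑ ≠ ⊤ := by
  have h1 : ∫⁻ x, ‖u ‖x‖‖ₑ ∂ballMeasure d ≠ ⊤ := by
    have h2 := (integrable_Lp (U.1 (zeroIndex d m))).2
    rw [HasFiniteIntegral] at h2
    refine ne_of_lt (lt_of_le_of_lt (le_of_eq (lintegral_congr_ae ?_)) h2)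
    unfold Represents at hU
    filter_upwards [hU] with x hx
    rw [hx]
  refine ⟨h1, fun h => h1 ?_⟩
  rw [lintegral_ball_norm hd (g := fun ρ => ‖u ρ‖ₑ) hu.enorm, h,
    ENNReal.mul_top (sphereArea_ne_zero hd)]

/-- The profile of a Sobolev function in the logarithmic variable is locally integrable. -/
theorem locallyIntegrable_log_profile {d m : ℕ} (hd : d ≠ 0) {u : ℝ → ℂ} (hu : Measurable u)
    {U : radialSobolev d m} (hU : Represents u U) :
    LocallyIntegrable ((Ioi (0 : ℝ)).indicator fun τ => u (Real.exp (-τ))) := by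
  have hm : Measurable ((Ioi (0 : ℝ)).indicator fun τ => u (Real.exp (-τ))) :=
    (hu.comp (by fun_prop)).indicator measurableSet_Ioi
  have key : ∀ A : ℝ, ∫⁻ τ in Ioo 0 A, ‖u (Real.exp (-τ))‖ₑ ≠ ⊤ := by
    intro A
    have e := lintegral_image_eq_lintegral_abs_deriv_mul (s := Ioo 0 A)
      (f := fun τ => Real.exp (-τ)) (f' := fun τ => -Real.exp (-τ)) measurableSet_Ioo
      (fun τ _ => by
        simpa using ((hasDerivAt_neg τ).exp).hasDerivWithinAt)
      (fun a _ b _ h => by simpa using h) fun ρ => ENNReal.ofReal (ρ ^ (d - 1)) * ‖u ρ‖ₑ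
    have h1 : ∫⁻ ρ in (fun τ => Real.exp (-τ)) '' Ioo 0 A, ENNReal.ofReal (ρ ^ (d - 1)) * ‖u ρ‖ₑ
        ≠ ⊤ := by
      refine ne_top_of_le_ne_top (lintegral_profile_ne_top hd hu hU).2 (lintegral_mono_set ?_)
      rintro _ ⟨τ, hτ, rfl⟩
      exact ⟨Real.exp_pos _, Real.exp_lt_one_iff.2 (by linarith [hτ.1])⟩
    rw [e] at h1
    have h2 : ENNReal.ofReal (Real.exp (-(d * A))) * ∫⁻ τ in Ioo 0 A, ‖u (Real.exp (-τ))‖ₑ ≤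
        ∫⁻ τ in Ioo 0 A, ENNReal.ofReal |-Real.exp (-τ)| *
          (ENNReal.ofReal (Real.exp (-τ) ^ (d - 1)) * ‖u (Real.exp (-τ))‖ₑ) := by
      rw [← lintegral_const_mul _ (by fun_prop)]
      refine setLIntegral_mono' measurableSet_Ioo fun τ hτ => ?_
      rw [← mul_assoc, abs_neg, abs_of_pos (Real.exp_pos _), ← ENNReal.ofReal_mul (Real.exp_pos _).le,
        ← pow_succ', Nat.sub_add_cancel (Nat.pos_of_ne_zero hd), ← Real.exp_nat_mul]
      gcongr
      have : (d : ℝ) * τ ≤ d * A := by gcongr; exact hτ.2.le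
      linarith
    intro h
    rw [h, ENNReal.mul_top (by simpa using Real.exp_pos _)] at h2
    exact h1 (top_le_iff.1 h2)
  rw [locallyIntegrable_iff]
  intro K hK
  obtain ⟨A, hA⟩ := hK.isBounded.subset_ball 0
  refine ⟨hm.aestronglyMeasurable, ?_⟩
  rw [HasFiniteIntegral]
  refine lt_of_le_of_lt ?_ (key A).lt_top
  calc ∫⁻ τ in K, ‖(Ioi (0 : ℝ)).indicator (fun τ => u (Real.exp (-τ))) τ‖ₑ
      ≤ ∫⁻ τ in Metric.ball 0 A, ‖(Ioi (0 : ℝ)).indicator (fun τ => u (Real.exp (-τ))) τ‖ₑ :=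
        lintegral_mono_set hA
    _ = ∫⁻ τ in Metric.ball 0 A, (Ioi (0 : ℝ)).indicator (fun τ => ‖u (Real.exp (-τ))‖ₑ) τ := by
        refine lintegral_congr fun τ => ?_
        rw [enorm_indicator_eq_indicator_enorm]
    _ = ∫⁻ τ in Ioi 0 ∩ Metric.ball 0 A, ‖u (Real.exp (-τ))‖ₑ := by
        rw [lintegral_indicator measurableSet_Ioi, Measure.restrict_restrict measurableSet_Ioi]
    _ ≤ _ := by
        refine lintegral_mono_set fun τ hτ => ⟨hτ.1, ?_⟩
        have := hτ.2
        rw [mem_ball_zero_iff, Real.norm_eq_abs] at this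
        exact (le_abs_self τ).trans_lt this

/-- Averages of a radial profile over dilations are smooth. -/
theorem smooth_average {u : ℝ → ℂ} {k : ℝ → ℝ} {δ : ℝ} (hk : ContDiff ℝ ∞ k)
    (hks : ∀ t, δ ≤ |t| → k t = 0) (hδ : 0 < δ)
    (hu : LocallyIntegrable ((Ioi (0 : ℝ)).indicator fun τ => u (Real.exp (-τ)))) :
    ContDiffOn ℝ ∞ (fun ρ => ∫ t, k t • u (scale (2 * δ - t) * ρ)) (Ioo 0 1) := by
  have hc : HasCompactSupport k := by
    refine HasCompactSupport.of_support_subset_isCompact (isCompact_closedBall (0 : ℝ) δ) ?_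
    intro t ht
    rw [mem_closedBall_zero_iff, Real.norm_eq_abs]
    by_contra h
    exact ht (hks t (not_le.1 h).le)
  -- In the variable `τ = -log ρ` the average is a convolution; the shift `2 δ` keeps the argument
  -- positive on the support of `k`.
  have hconv : ContDiff ℝ ∞ (k ⋆[ContinuousLinearMap.lsmul ℝ ℝ]
      ((Ioi (0 : ℝ)).indicator fun τ => u (Real.exp (-τ)))) :=
    hc.contDiff_convolution_left _ hk hu
  refine ((hconv.comp_contDiffOn (s := Ioo 0 1) (f := fun ρ => 2 * δ - Real.log ρ) ?_)).congr ?_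
  · exact contDiffOn_const.sub (Real.contDiffOn_log.mono fun ρ hρ => hρ.1.ne')
  · intro ρ hρ
    simp only [Function.comp_apply, convolution_def, ContinuousLinearMap.lsmul_apply]
    refine integral_congr_ae (ae_of_all _ fun t => ?_)
    by_cases ht : δ ≤ |t|
    · simp [hks t ht]
    · have h1 := abs_lt.1 (not_le.1 ht)
      have h2 : Real.log ρ < 0 := Real.log_neg hρ.1 hρ.2
      have h3 : 2 * δ - Real.log ρ - t ∈ Ioi (0 : ℝ) := by
        rw [mem_Ioi]; linarith
      simp only [indicator_of_mem h3]
      congr 2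
      rw [scale, abs_of_pos (by linarith), show -(2 * δ - Real.log ρ - t) =
        -(2 * δ - t) + Real.log ρ by ring, Real.exp_add, Real.exp_log hρ.1]

/-- The average of the dilates of `U` is the dilation average of its profile. -/
theorem represents_average {d m : ℕ} (hd : d ≠ 0) {u : ℝ → ℂ} (hu : Measurable u)
    {U : radialSobolev d m} (hU : Represents u U) {k : ℝ → ℝ} {δ : ℝ} (hk : ContDiff ℝ ∞ k)
    (hks : ∀ t, δ ≤ |t| → k t = 0) (hδ : 0 < δ) :
    Represents (fun ρ => ∫ t, k t • u (scale (2 * δ - t) * ρ))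
      (∫ t, k t • dilateJet (2 * δ - t) U) := by
  have hc : HasCompactSupport k := by
    refine HasCompactSupport.of_support_subset_isCompact (isCompact_closedBall (0 : ℝ) δ) ?_
    intro t ht
    rw [mem_closedBall_zero_iff, Real.norm_eq_abs]
    by_contra h
    exact ht (hks t (not_le.1 h).le)
  set w : ℝ → ℂ := fun ρ => ∫ t, k t • u (scale (2 * δ - t) * ρ) with hw
  set W : radialSobolev d m := ∫ t, k t • dilateJet (2 * δ - t) U with hW
  have hs : ContDiffOn ℝ ∞ w (Ioo 0 1) :=
    smooth_average hk hks hδ (locallyIntegrable_log_profile hd hu hU)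
  have hgc : Continuous fun t => k t • dilateJet (2 * δ - t) U :=
    hk.continuous.smul ((continuous_dilateJet U).comp (continuous_const.sub continuous_id))
  have hgi : Integrable fun t => k t • dilateJet (2 * δ - t) U :=
    hgc.integrable_of_hasCompactSupport hc.smul_right
  have key : ∀ᵐ x : Space d, x ∈ puncturedBall d →
      (W.1 (zeroIndex d m) : Space d → ℂ) x = w ‖x‖ := by
    -- Both sides are tested against test functions, where the two integrals may be exchanged.
    refine ae_eq_of_integral_test (isOpen_puncturedBall d) sdiff_subset
      (locallyIntegrableOn_Lp _ sdiff_subset)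
      ((contDiffOn_radial hs).continuousOn.locallyIntegrableOn
        (isOpen_puncturedBall d).measurableSet) fun ψ hψ => ?_
    set L : radialSobolev d m →L[ℂ] ℂ := testFunctional ψ hψ.contDiff.continuous ∘L
      (PiLp.proj 2 (fun _ : multiIndices d m => Lp ℂ 2 (ballMeasure d)) (zeroIndex d m) ∘L
        (radialSobolev d m).subtypeL) with hL
    have hLx : ∀ V : radialSobolev d m, L V =
        ∫ x, ψ x • (V.1 (zeroIndex d m) : Space d → ℂ) x ∂ballMeasure d := fun V =>
      testFunctional_apply hψ.contDiff.continuous _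
    have h1 : ∀ t, L (k t • dilateJet (2 * δ - t) U) =
        ∫ x, k t • ψ x • u (scale (2 * δ - t) * ‖x‖) ∂ballMeasure d := by
      intro t
      rw [L.map_smul_of_tower, hLx, ← integral_smul]
      refine integral_congr_ae ?_
      have := represents_dilateJet (2 * δ - t) hU
      unfold Represents at this
      filter_upwards [this] with x hx
      rw [hx]
    rw [← hLx, hW, ← L.integral_comp_comm hgi]
    simp only [h1]
    rw [integral_integral_swap]
    · refine integral_congr_ae (ae_of_all _ fun x => ?_)
      simp only [hw]
      rw [← integral_smul]
      refine integral_congr_ae (ae_of_all _ fun t => ?_)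
      exact smul_comm _ _ _
    · have hkm : Measurable k := hk.continuous.measurable
      have hψm : Measurable ψ := hψ.contDiff.continuous.measurable
      have hsm : Measurable scale := continuous_scale.measurable
      have hmeas : Measurable (Function.uncurry fun (t : ℝ) (x : Space d) =>
          k t • ψ x • u (scale (2 * δ - t) * ‖x‖)) := by
        refine (hkm.comp measurable_fst).smul ((hψm.comp measurable_snd).smul (hu.comp ?_))
        exact (hsm.comp (measurable_const.sub measurable_fst)).mul measurable_snd.norm
      refine ⟨hmeas.aestronglyMeasurable, ?_⟩
      rw [HasFiniteIntegral, lintegral_prod _ hmeas.enorm.aemeasurable]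
      obtain ⟨M, hM⟩ := hψ.compactSupport.exists_bound_of_continuous hψ.contDiff.continuous
      set A := ∫⁻ x, ‖u ‖x‖‖ₑ ∂ballMeasure d with hA
      have hb : ∀ t, ∫⁻ x, ‖k t • ψ x • u (scale (2 * δ - t) * ‖x‖)‖ₑ ∂ballMeasure d ≤
          ‖k t * (scale (2 * δ - t) ^ d)⁻¹‖ₑ * (ENNReal.ofReal M * A) := by
        intro t
        calc _ ≤ ∫⁻ x, ‖k t‖ₑ * ENNReal.ofReal M * ‖u ‖scale (2 * δ - t) • x‖‖ₑ ∂ballMeasure d := by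
              refine lintegral_mono fun x => ?_
              rw [enorm_smul, enorm_smul, ← mul_assoc, norm_smul,
                Real.norm_of_nonneg (scale_pos _).le]
              gcongr
              rw [← ofReal_norm]
              exact ENNReal.ofReal_le_ofReal (hM x)
          _ = ‖k t‖ₑ * ENNReal.ofReal M * ∫⁻ x, ‖u ‖scale (2 * δ - t) • x‖‖ₑ ∂ballMeasure d :=
              lintegral_const_mul _ (hu.comp (by fun_prop)).enorm
          _ ≤ ‖k t‖ₑ * ENNReal.ofReal M *
              (ENNReal.ofReal ((scale (2 * δ - t) ^ d)⁻¹) * A) := by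
              gcongr
              exact lintegral_scale_le _ (g := fun x : Space d => ‖u ‖x‖‖ₑ)
                (hu.comp measurable_norm).enorm
          _ = _ := by
              rw [enorm_mul, Real.enorm_of_nonneg (r := (scale (2 * δ - t) ^ d)⁻¹)
                (by have := scale_pos (2 * δ - t); positivity)]
              ring
      refine (lintegral_mono hb).trans_lt ?_
      have hcc : Continuous fun t => k t * (scale (2 * δ - t) ^ d)⁻¹ := by
        refine hk.continuous.mul (Continuous.inv₀ ?_ fun t => (pow_pos (scale_pos _) d).ne')
        exact (continuous_scale.comp (continuous_const.sub continuous_id)).pow d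
      rw [lintegral_mul_const _ hcc.measurable.enorm]
      refine ENNReal.mul_lt_top ?_ (ENNReal.mul_lt_top ENNReal.ofReal_lt_top
        (lintegral_profile_ne_top hd hu hU).1.lt_top)
      exact (hcc.integrable_of_hasCompactSupport hc.mul_right).2
  have h0 : ∀ᵐ x : Space d, x ≠ 0 := by
    have : Nonempty (Fin d) := ⟨⟨0, Nat.pos_of_ne_zero hd⟩⟩
    simp [ae_iff]
  unfold Represents
  filter_upwards [ae_restrict_of_ae key, ae_restrict_of_ae h0, ae_restrict_mem measurableSet_ball]
    with x h1 h2 h3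
  exact h1 ⟨h3, h2⟩

/-- Radial Sobolev functions that are smooth on `(0, 1)` are dense. -/
theorem exists_smooth_near {d m : ℕ} (hd : d ≠ 0) (U : radialSobolev d m) {ε : ℝ} (hε : 0 < ε) :
    ∃ (w : ℝ → ℂ) (W : radialSobolev d m), ContDiffOn ℝ ∞ w (Ioo 0 1) ∧ Represents w W ∧
      dist W U ≤ ε := by
  obtain ⟨u, hu, hU⟩ := exists_measurable_represents hd U
  obtain ⟨r, hr, hrU⟩ := Metric.continuous_iff.1 (continuous_dilateJet U) 0 (ε / 4) (by positivity)
  rw [dilateJet_zero] at hrU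
  set δ := r / 3 with hδ
  have hδ0 : 0 < δ := by positivity
  let φ : ContDiffBump (0 : ℝ) := ⟨δ / 2, δ, by positivity, by linarith⟩
  have hks : ∀ t, δ ≤ |t| → φ.normed volume t = 0 := by
    intro t ht
    by_contra h
    have : t ∈ Function.support (φ.normed volume) := h
    rw [φ.support_normed_eq, mem_ball_zero_iff, Real.norm_eq_abs] at this
    exact absurd this (not_lt.2 ht)
  refine ⟨_, _, smooth_average φ.contDiff_normed hks hδ0 (locallyIntegrable_log_profile hd hu hU),
    represents_average hd hu hU φ.contDiff_normed hks hδ0, ?_⟩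
  have h1 : dist ((φ.normed volume ⋆[ContinuousLinearMap.lsmul ℝ ℝ]
      fun t => dilateJet t U) (2 * δ)) (dilateJet (2 * δ) U) ≤ ε / 2 := by
    have : SecondCountableTopologyEither ℝ (radialSobolev d m) := ⟨Or.inl inferInstance⟩
    refine φ.dist_normed_convolution_le (continuous_dilateJet U).aestronglyMeasurable fun t ht => ?_
    have ht' : |t - 2 * δ| < δ := by simpa [Real.dist_eq] using ht
    rw [abs_lt] at ht'
    have h2 := hrU t (by rw [Real.dist_eq, sub_zero, abs_lt]; constructor <;> linarith)
    have h3 := hrU (2 * δ) (by rw [Real.dist_eq, sub_zero, abs_lt]; constructor <;> linarith)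
    have := dist_triangle_right (dilateJet t U) (dilateJet (2 * δ) U) U
    linarith
  have h3 := hrU (2 * δ) (by rw [Real.dist_eq, sub_zero, abs_lt]; constructor <;> linarith)
  simp only [convolution_def, ContinuousLinearMap.lsmul_apply] at h1
  refine (dist_triangle _ (dilateJet (2 * δ) U) _).trans ?_
  linarith

/-- By density of the smooth profiles, it suffices to approximate these by polynomials. -/
theorem denseRange_of_smooth {d m : ℕ} (hd : d ≠ 0)
    (h : ∀ u : ℝ → ℂ, ContDiffOn ℝ ∞ u (Ioo 0 1) → ∀ U : radialSobolev d m,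
      Represents u U → U ∈ closure (range (polyJet d m))) : DenseRange (polyJet d m) := by
  intro U
  rw [← closure_closure]
  refine Metric.mem_closure_iff.2 fun ε hε => ?_
  obtain ⟨w, W, hw, hW, hd⟩ := exists_smooth_near hd U (half_pos hε)
  exact ⟨W, h w hw W hW, by rw [dist_comm]; linarith⟩

/-! ### Conjugation of the free operator to the half line -/

/-- The decay rate `2 / (p - 1)`. -/
def rate (p : ℝ) : ℝ := 2 / (p - 1)

theorem freeFst_eq (p : ℝ) (u₁ u₂ : ℝ → ℂ) : freeFst p u₁ u₂ = u₂ - euler (rate p) u₁ := by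
  funext ρ
  simp only [freeFst, dilation, euler, rate, Pi.sub_apply]
  push_cast
  ring

theorem freeSnd_eq (d : ℕ) {p : ℝ} (hp : p ≠ 1) (u₁ u₂ : ℝ → ℂ) :
    freeSnd d p u₁ u₂ = radialLaplacian d u₁ - euler (rate p + 1) u₂ := by
  have h : (p : ℂ) - 1 ≠ 0 := sub_ne_zero.2 (by exact_mod_cast hp)
  funext ρ
  simp only [freeSnd, dilation, euler, rate, Pi.sub_apply]
  push_cast
  field_simp
  ring

/-- `D_d u = ρ (E + 2 K + 1) ⋯ (E + 5) (E + 3) u` with `E = ρ d/dρ`. -/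
theorem dOp_eq {d K : ℕ} (hd : d = 2 * K + 3) {u : ℝ → ℂ} (hu : ContDiffOn ℝ ∞ u (Ioo 0 1)) :
    EqOn (dOp d u) (fun ρ => ρ * chain (fun i => 2 * i + 3) K u ρ) (Ioo 0 1) := by
  subst hd
  have := iterate_invRhoDeriv_pow_mul hu K
  rw [dOp, show (2 * K + 3 - 3) / 2 = K by omega, show 2 * K + 3 - 2 = 2 * K + 1 by omega]
  exact this

theorem smooth_mul_self {u : ℝ → ℂ} (hu : ContDiffOn ℝ ∞ u (Ioo 0 1)) :
    ContDiffOn ℝ ∞ (fun ρ : ℝ => (ρ : ℂ) * u ρ) (Ioo 0 1) :=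
  Complex.ofRealCLM.contDiff.contDiffOn.mul hu

theorem smooth_dOp (d : ℕ) {u : ℝ → ℂ} (hu : ContDiffOn ℝ ∞ u (Ioo 0 1)) :
    ContDiffOn ℝ ∞ (dOp d u) (Ioo 0 1) :=
  smooth_iterate_invRhoDeriv ((smooth_ofReal_pow _).mul hu) _

theorem dOp_sub (d : ℕ) {u v : ℝ → ℂ} (hu : ContDiffOn ℝ ∞ u (Ioo 0 1))
    (hv : ContDiffOn ℝ ∞ v (Ioo 0 1)) :
    EqOn (dOp d (u - v)) (dOp d u - dOp d v) (Ioo 0 1) := by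
  intro ρ hρ
  have e : u - v = (-1 : ℂ) • v + u := by rw [neg_one_smul]; abel
  rw [e, dOp_comb d hv hu (-1) hρ]
  simp only [Pi.add_apply, Pi.smul_apply, Pi.sub_apply, smul_eq_mul]
  ring

theorem euler_mul_self {u : ℝ → ℂ} (hu : ContDiffOn ℝ ∞ u (Ioo 0 1)) (a : ℝ) :
    EqOn (euler (a - 1) fun ρ => ρ * u ρ) (fun ρ => ρ * euler a u ρ) (Ioo 0 1) := by
  intro ρ hρ
  have h1 : HasDerivAt (fun ρ : ℝ => (ρ : ℂ) * u ρ) (1 * u ρ + ρ * deriv u ρ) ρ :=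
    (Complex.ofRealCLM.hasDerivAt (x := ρ)).mul (smooth_diffAt hu hρ).hasDerivAt
  simp only [euler, h1.deriv]
  push_cast
  ring

theorem chain_mul_self {u : ℝ → ℂ} (hu : ContDiffOn ℝ ∞ u (Ioo 0 1)) (c : ℕ → ℝ) (n : ℕ) :
    EqOn (chain (fun i => c i - 1) n fun ρ => ρ * u ρ) (fun ρ => ρ * chain c n u ρ) (Ioo 0 1) := by
  induction n with
  | zero => exact fun _ _ => rfl
  | succ n ih => exact (euler_congr ih _).trans (euler_mul_self (smooth_chain hu c n) (c n))

theorem dOp_euler {d K : ℕ} (hd : d = 2 * K + 3) {u : ℝ → ℂ} (hu : ContDiffOn ℝ ∞ u (Ioo 0 1))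
    (a : ℝ) : EqOn (dOp d (euler a u)) (euler (a - 1) (dOp d u)) (Ioo 0 1) := by
  refine (dOp_eq hd (smooth_euler hu a)).trans ?_
  refine EqOn.trans ?_ (euler_congr (dOp_eq hd hu) (a - 1)).symm
  refine EqOn.trans ?_ (euler_mul_self (smooth_chain hu _ K) a).symm
  intro ρ hρ
  simp only [chain_euler hu _ K a hρ]

theorem smooth_radialLaplacian (d : ℕ) {u : ℝ → ℂ} (hu : ContDiffOn ℝ ∞ u (Ioo 0 1)) :
    ContDiffOn ℝ ∞ (radialLaplacian d u) (Ioo 0 1) := by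
  have h : ContDiffOn ℝ ∞ (fun ρ : ℝ => (ρ : ℂ)⁻¹) (Ioo 0 1) := by
    refine ContDiffOn.inv Complex.ofRealCLM.contDiff.contDiffOn ?_
    intro ρ hρ
    exact Complex.ofReal_ne_zero.2 hρ.1.ne'
  unfold radialLaplacian
  simp only [div_eq_mul_inv]
  exact (smooth_deriv (smooth_deriv hu)).add
    (ContDiffOn.mul (ContDiffOn.mul contDiffOn_const h) (smooth_deriv hu))

/-- The operator `D_d` conjugates the radial Laplacian in odd dimension `d` to `d²/dρ²`. -/
theorem dOp_radialLaplacian {d K : ℕ} (hd : d = 2 * K + 3) {u : ℝ → ℂ}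
    (hu : ContDiffOn ℝ ∞ u (Ioo 0 1)) :
    EqOn (dOp d (radialLaplacian d u)) (deriv (deriv (dOp d u))) (Ioo 0 1) := by
  have h1 : EqOn (fun ρ : ℝ => (ρ : ℂ) * radialLaplacian d u ρ) (euler (2 * K + 2) (deriv u))
      (Ioo 0 1) := by
    intro ρ hρ
    have h0 : (ρ : ℂ) ≠ 0 := Complex.ofReal_ne_zero.2 hρ.1.ne'
    simp only [radialLaplacian, euler, hd]
    push_cast
    field_simp
    ring
  refine (dOp_eq hd (smooth_radialLaplacian d hu)).trans ?_
  refine (chain_mul_self (smooth_radialLaplacian d hu) _ K).symm.trans ?_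
  refine (chain_congr h1 _ K).trans ?_
  refine (chain_euler (smooth_deriv hu) _ K _).trans ?_
  refine EqOn.trans (fun ρ hρ => ?_) (deriv_deriv_dOp hd hu).symm
  have : (fun i : ℕ => 2 * (i : ℝ) + 3 - 1) = fun i : ℕ => 2 * (i : ℝ) + 2 := by funext i; ring
  rw [this]
  rfl

/-- The first component of the free operator, transformed by `D_d`. The shift of the Euler operator
drops by one, as `D_d` carries a factor `ρ`. -/
theorem dOp_freeFst {d K : ℕ} (hd : d = 2 * K + 3) (p : ℝ) {u₁ u₂ : ℝ → ℂ}
    (h₁ : ContDiffOn ℝ ∞ u₁ (Ioo 0 1)) (h₂ : ContDiffOn ℝ ∞ u₂ (Ioo 0 1)) :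
    EqOn (dOp d (freeFst p u₁ u₂)) (dOp d u₂ - euler (rate p - 1) (dOp d u₁)) (Ioo 0 1) := by
  rw [freeFst_eq]
  refine (dOp_sub d h₂ (smooth_euler h₁ _)).trans fun ρ hρ => ?_
  rw [Pi.sub_apply, Pi.sub_apply, dOp_euler hd h₁ _ hρ]

theorem dOp_freeSnd {d K : ℕ} (hd : d = 2 * K + 3) {p : ℝ} (hp : p ≠ 1) {u₁ u₂ : ℝ → ℂ}
    (h₁ : ContDiffOn ℝ ∞ u₁ (Ioo 0 1)) (h₂ : ContDiffOn ℝ ∞ u₂ (Ioo 0 1)) :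
    EqOn (dOp d (freeSnd d p u₁ u₂)) (deriv (deriv (dOp d u₁)) - euler (rate p) (dOp d u₂))
      (Ioo 0 1) := by
  rw [freeSnd_eq d hp]
  refine (dOp_sub d (smooth_radialLaplacian d h₁) (smooth_euler h₂ _)).trans fun ρ hρ => ?_
  rw [Pi.sub_apply, Pi.sub_apply, dOp_euler hd h₂ _ hρ, dOp_radialLaplacian hd h₁ hρ,
    add_sub_cancel_right]

theorem deriv_sub_euler {f g : ℝ → ℂ} (hf : ContDiffOn ℝ ∞ f (Ioo 0 1))
    (hg : ContDiffOn ℝ ∞ g (Ioo 0 1)) (a : ℝ) :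
    EqOn (deriv (f - euler a g)) (deriv f - euler (a + 1) (deriv g)) (Ioo 0 1) := by
  refine (deriv_sub_eqOn hf (smooth_euler hg a)).trans fun ρ hρ => ?_
  rw [Pi.sub_apply, Pi.sub_apply, deriv_euler hg a hρ]

theorem deriv_dOp_freeFst {d K : ℕ} (hd : d = 2 * K + 3) (p : ℝ) {u₁ u₂ : ℝ → ℂ}
    (h₁ : ContDiffOn ℝ ∞ u₁ (Ioo 0 1)) (h₂ : ContDiffOn ℝ ∞ u₂ (Ioo 0 1)) :
    EqOn (deriv (dOp d (freeFst p u₁ u₂)))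
      (deriv (dOp d u₂) - euler (rate p) (deriv (dOp d u₁))) (Ioo 0 1) := by
  have := (eqOn_deriv (dOp_freeFst hd p h₁ h₂)).trans
    (deriv_sub_euler (smooth_dOp d h₂) (smooth_dOp d h₁) _)
  rwa [sub_add_cancel] at this

theorem deriv_deriv_dOp_freeFst {d K : ℕ} (hd : d = 2 * K + 3) (p : ℝ) {u₁ u₂ : ℝ → ℂ}
    (h₁ : ContDiffOn ℝ ∞ u₁ (Ioo 0 1)) (h₂ : ContDiffOn ℝ ∞ u₂ (Ioo 0 1)) :
    EqOn (deriv (deriv (dOp d (freeFst p u₁ u₂))))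
      (deriv (deriv (dOp d u₂)) - euler (rate p + 1) (deriv (deriv (dOp d u₁)))) (Ioo 0 1) :=
  (eqOn_deriv (deriv_dOp_freeFst hd p h₁ h₂)).trans
    (deriv_sub_euler (smooth_deriv (smooth_dOp d h₂)) (smooth_deriv (smooth_dOp d h₁)) _)

theorem deriv_dOp_freeSnd {d K : ℕ} (hd : d = 2 * K + 3) {p : ℝ} (hp : p ≠ 1) {u₁ u₂ : ℝ → ℂ}
    (h₁ : ContDiffOn ℝ ∞ u₁ (Ioo 0 1)) (h₂ : ContDiffOn ℝ ∞ u₂ (Ioo 0 1)) :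
    EqOn (deriv (dOp d (freeSnd d p u₁ u₂)))
      (deriv (deriv (deriv (dOp d u₁))) - euler (rate p + 1) (deriv (dOp d u₂))) (Ioo 0 1) :=
  (eqOn_deriv (dOp_freeSnd hd hp h₁ h₂)).trans
    (deriv_sub_euler (smooth_deriv (smooth_deriv (smooth_dOp d h₁))) (smooth_dOp d h₂) _)

/-! ### The energy estimate on the half line -/

theorem intervalNorm_sq_of_continuous {f : ℝ → ℂ} (hf : Continuous f) :
    intervalNorm f ^ 2 = ENNReal.ofReal (∫ ρ in (0 : ℝ)..1, ‖f ρ‖ ^ 2) := by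
  rw [intervalNorm_sq, intervalIntegral.integral_of_le zero_le_one, integral_Ioc_eq_integral_Ioo,
    ofReal_integral_eq_lintegral_ofReal]
  · refine lintegral_congr fun ρ => ?_
    rw [← ofReal_norm, ENNReal.ofReal_pow (norm_nonneg _)]
  · exact ((by fun_prop : Continuous fun ρ => ‖f ρ‖ ^ 2).integrableOn_Icc (a := 0) (b := 1)).mono_set
      Ioo_subset_Icc_self
  · exact ae_of_all _ fun _ => by positivity

/-- Dissipativity of the wave system in self-similar variables: multiply by `conj z` and integrate;
the boundary term at `ρ = 1` is `|z₁ - z₂|² / 2 ≥ 0`, and the one at `ρ = 0` vanishes. -/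
theorem wave_energy_estimate {z₁ z₂ : ℝ → ℂ} (h₁ : ContDiff ℝ ∞ z₁) (h₂ : ContDiff ℝ ∞ z₂)
    (h0 : z₁ 0 = 0) {b : ℂ} {a : ℝ} (ha : 0 < a) (hab : b.re - 1 / 2 = a) :
    ENNReal.ofReal (a ^ 2) * (intervalNorm z₁ ^ 2 + intervalNorm z₂ ^ 2) ≤
      intervalNorm (fun ρ => b * z₁ ρ + ρ * deriv z₁ ρ - deriv z₂ ρ) ^ 2 +
      intervalNorm (fun ρ => b * z₂ ρ + ρ * deriv z₂ ρ - deriv z₁ ρ) ^ 2 := by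
  have c1 : Continuous z₁ := h₁.continuous
  have c2 : Continuous z₂ := h₂.continuous
  have d1 : Continuous (deriv z₁) := h₁.continuous_deriv (by simp)
  have d2 : Continuous (deriv z₂) := h₂.continuous_deriv (by simp)
  set f₁ : ℝ → ℂ := fun ρ => b * z₁ ρ + ρ * deriv z₁ ρ - deriv z₂ ρ with hf₁
  set f₂ : ℝ → ℂ := fun ρ => b * z₂ ρ + ρ * deriv z₂ ρ - deriv z₁ ρ with hf₂
  have e1 : Continuous f₁ := by rw [hf₁]; fun_prop
  have e2 : Continuous f₂ := by rw [hf₂]; fun_prop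
  have hr : ∀ f : ℝ → ℂ, Continuous f → 0 ≤ ∫ ρ in (0 : ℝ)..1, ‖f ρ‖ ^ 2 := fun f _ =>
    intervalIntegral.integral_nonneg zero_le_one fun _ _ => by positivity
  rw [intervalNorm_sq_of_continuous c1, intervalNorm_sq_of_continuous c2,
    intervalNorm_sq_of_continuous e1, intervalNorm_sq_of_continuous e2,
    ← ENNReal.ofReal_add (hr _ c1) (hr _ c2), ← ENNReal.ofReal_add (hr _ e1) (hr _ e2),
    ← ENNReal.ofReal_mul (by positivity)]
  refine ENNReal.ofReal_le_ofReal ?_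
  set Φ : ℝ → ℝ := fun ρ => ρ / 2 * ((z₁ ρ).re ^ 2 + (z₁ ρ).im ^ 2 + (z₂ ρ).re ^ 2 + (z₂ ρ).im ^ 2)
    - ((z₁ ρ).re * (z₂ ρ).re + (z₁ ρ).im * (z₂ ρ).im) with hΦ
  set Φ' : ℝ → ℝ := fun ρ => (conj (z₁ ρ) * f₁ ρ).re + (conj (z₂ ρ) * f₂ ρ).re
    - a * (‖z₁ ρ‖ ^ 2 + ‖z₂ ρ‖ ^ 2) with hΦ'
  have hd : ∀ ρ, HasDerivAt Φ (Φ' ρ) ρ := by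
    intro ρ
    have a1 : HasDerivAt z₁ (deriv z₁ ρ) ρ := (h₁.differentiable (by simp) ρ).hasDerivAt
    have a2 : HasDerivAt z₂ (deriv z₂ ρ) ρ := (h₂.differentiable (by simp) ρ).hasDerivAt
    have r1 : HasDerivAt (fun ρ => (z₁ ρ).re) (deriv z₁ ρ).re ρ :=
      Complex.reCLM.hasFDerivAt.comp_hasDerivAt ρ a1
    have i1 : HasDerivAt (fun ρ => (z₁ ρ).im) (deriv z₁ ρ).im ρ :=
      Complex.imCLM.hasFDerivAt.comp_hasDerivAt ρ a1
    have r2 : HasDerivAt (fun ρ => (z₂ ρ).re) (deriv z₂ ρ).re ρ :=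
      Complex.reCLM.hasFDerivAt.comp_hasDerivAt ρ a2
    have i2 : HasDerivAt (fun ρ => (z₂ ρ).im) (deriv z₂ ρ).im ρ :=
      Complex.imCLM.hasFDerivAt.comp_hasDerivAt ρ a2
    have := (((hasDerivAt_id ρ).div_const 2).mul
      ((((r1.pow 2).add (i1.pow 2)).add (r2.pow 2)).add (i2.pow 2))).sub ((r1.mul r2).add (i1.mul i2))
    refine this.congr_deriv ?_
    simp only [hΦ', hf₁, hf₂, Complex.mul_re, Complex.conj_re, Complex.conj_im, Complex.sub_re,
      Complex.add_re, Complex.sub_im, Complex.add_im, Complex.mul_im, Complex.ofReal_re,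
      Complex.ofReal_im, ← Complex.normSq_eq_norm_sq, Complex.normSq_apply, ← hab, id]
    push_cast
    simp only [Pi.add_apply, Pi.pow_apply]
    ring
  have hΦc : Continuous Φ' := by rw [hΦ']; fun_prop
  have h1 : ∫ ρ in (0 : ℝ)..1, Φ' ρ = Φ 1 - Φ 0 :=
    intervalIntegral.integral_eq_sub_of_hasDerivAt (fun ρ _ => hd ρ) (hΦc.intervalIntegrable _ _)
  have h2 : Φ 0 = 0 := by simp [hΦ, h0]
  have h3 : 0 ≤ Φ 1 := by
    simp only [hΦ]
    nlinarith [sq_nonneg ((z₁ 1).re - (z₂ 1).re), sq_nonneg ((z₁ 1).im - (z₂ 1).im)]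
  have h4 : ∫ ρ in (0 : ℝ)..1, Φ' ρ ≤ ∫ ρ in (0 : ℝ)..1,
      ((2 * a)⁻¹ * (‖f₁ ρ‖ ^ 2 + ‖f₂ ρ‖ ^ 2) - a / 2 * (‖z₁ ρ‖ ^ 2 + ‖z₂ ρ‖ ^ 2)) := by
    refine intervalIntegral.integral_mono_on zero_le_one (hΦc.intervalIntegrable _ _)
      (Continuous.intervalIntegrable (by fun_prop) _ _) fun ρ _ => ?_
    have k : ∀ z w : ℂ, (conj z * w).re ≤ a / 2 * ‖z‖ ^ 2 + (2 * a)⁻¹ * ‖w‖ ^ 2 := by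
      intro z w
      have := two_re_mul_le z w ha
      have h5 := (le_abs_self _).trans this
      have h6 : (2 * a)⁻¹ = a⁻¹ / 2 := by rw [mul_inv]; ring
      rw [h6]
      linarith
    have k1 := k (z₁ ρ) (f₁ ρ)
    have k2 := k (z₂ ρ) (f₂ ρ)
    simp only [hΦ']
    linarith
  have i1 : ∀ f : ℝ → ℂ, Continuous f →
      IntervalIntegrable (fun ρ => ‖f ρ‖ ^ 2) volume 0 1 := fun f hf =>
    Continuous.intervalIntegrable (by fun_prop) _ _
  clear_value Φ'
  rw [intervalIntegral.integral_sub (Continuous.intervalIntegrable (by fun_prop) _ _)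
    (Continuous.intervalIntegrable (by fun_prop) _ _), intervalIntegral.integral_const_mul,
    intervalIntegral.integral_const_mul, intervalIntegral.integral_add (i1 _ e1) (i1 _ e2),
    intervalIntegral.integral_add (i1 _ c1) (i1 _ c2)] at h4
  set I := (∫ ρ in (0 : ℝ)..1, ‖z₁ ρ‖ ^ 2) + ∫ ρ in (0 : ℝ)..1, ‖z₂ ρ‖ ^ 2
  set J := (∫ ρ in (0 : ℝ)..1, ‖f₁ ρ‖ ^ 2) + ∫ ρ in (0 : ℝ)..1, ‖f₂ ρ‖ ^ 2
  have h5 : 0 ≤ (2 * a)⁻¹ * J - a / 2 * I := by linarith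
  have h6 : 0 ≤ 2 * a * ((2 * a)⁻¹ * J - a / 2 * I) := by positivity
  have h7 : 2 * a * ((2 * a)⁻¹ * J - a / 2 * I) = J - a ^ 2 * I := by field_simp
  linarith

/-! ### Perturbation of an operator with a polynomial core -/

section Abstract

variable {H : Type*} [NormedAddCommGroup H] [InnerProductSpace ℂ H]

/-- If the adjoint of `T` is compact, then `1 - T` is invertible as soon as its range is dense. -/
theorem isUnit_one_sub_of_denseRange [CompleteSpace H] {T : H →L[ℂ] H}
    (hT : IsCompactOperator (ContinuousLinearMap.adjoint T)) (hd : DenseRange (1 - T : H →L[ℂ] H)) :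
    IsUnit (1 - T) := by
  have h1 : ¬ Module.End.HasEigenvalue (ContinuousLinearMap.adjoint T : Module.End ℂ H) 1 := by
    intro h
    obtain ⟨v, hv⟩ := h.exists_hasEigenvector
    have hv1 : ContinuousLinearMap.adjoint T v = v := by
      simpa using hv.apply_eq_smul
    refine hv.2 ?_
    have h2 : ∀ w : H, inner ℂ w v = 0 := fun w => by
      refine hd.induction_on w (isClosed_eq (by fun_prop) continuous_const) fun w => ?_
      rw [_root_.sub_apply, inner_sub_left, one_apply_eq_self,
        ← ContinuousLinearMap.adjoint_inner_right, hv1, sub_self]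
    exact inner_self_eq_zero.1 (h2 v)
  have h2 := (hT.hasEigenvalue_or_mem_resolventSet one_ne_zero).resolve_left h1
  rw [spectrum.mem_resolventSet_iff, map_one] at h2
  have h3 := h2.star
  rwa [star_sub, star_one, ← ContinuousLinearMap.star_eq_adjoint, star_star] at h3

/-- An operator that is small on the orthogonal complements of suitable finite-dimensional spaces
has a compact adjoint. -/
theorem isCompactOperator_adjoint [CompleteSpace H] {B : H →L[ℂ] H}
    (h : ∀ ε > 0, ∃ S : Submodule ℂ H, FiniteDimensional ℂ S ∧ ∀ x ∈ Sᗮ, ‖B x‖ ≤ ε * ‖x‖) :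
    IsCompactOperator (ContinuousLinearMap.adjoint B) := by
  have key : ∀ n : ℕ, ∃ G : H →L[ℂ] H, IsCompactOperator G ∧
      ‖ContinuousLinearMap.adjoint B - G‖ ≤ 1 / ((n : ℝ) + 1) := by
    intro n
    obtain ⟨S, hS, hB⟩ := h (1 / ((n : ℝ) + 1)) (by positivity)
    have hc : IsCompactOperator (S.starProjection) := by
      have : ProperSpace S := FiniteDimensional.proper ℂ S
      have : IsCompactOperator (S.subtypeL) := isCompactOperator_of_locallyCompactSpace_rng S.subtypeL
      exact this.comp_clm S.orthogonalProjectionOnto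
    refine ⟨S.starProjection ∘L ContinuousLinearMap.adjoint B, hc.comp_clm _, ?_⟩
    have e : ContinuousLinearMap.adjoint B - S.starProjection ∘L ContinuousLinearMap.adjoint B =
        ContinuousLinearMap.adjoint (B - B ∘L S.starProjection) := by
      rw [map_sub, ContinuousLinearMap.adjoint_comp,
        (ContinuousLinearMap.isSelfAdjoint_iff').1 (isSelfAdjoint_starProjection S)]
    rw [e, LinearIsometryEquiv.norm_map]
    refine ContinuousLinearMap.opNorm_le_bound _ (by positivity) fun x => ?_
    have h2 : x - S.starProjection x ∈ Sᗮ := S.sub_starProjection_mem_orthogonal x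
    have h3 : ‖x - S.starProjection x‖ ≤ ‖x‖ := by
      rw [← S.starProjection_orthogonal_val]
      exact Sᗮ.norm_starProjection_apply_le x
    calc ‖(B - B ∘L S.starProjection) x‖ = ‖B (x - S.starProjection x)‖ := by simp
      _ ≤ 1 / ((n : ℝ) + 1) * ‖x - S.starProjection x‖ := hB _ h2
      _ ≤ _ := by gcongr
  choose G hG hG' using key
  refine isCompactOperator_of_tendsto (l := atTop) (F := G) ?_ (Eventually.of_forall hG)
  rw [tendsto_iff_norm_sub_tendsto_zero]
  refine squeeze_zero (fun _ => norm_nonneg _) (fun n => ?_) tendsto_one_div_add_atTop_nhds_zero_nat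
  rw [norm_sub_rev]
  exact hG' n

variable {P : Type*} [AddCommGroup P] [Module ℂ P]

/-- The operator `T` has the core `ι P`, a dense subspace on which it acts as `A : P → P`; the
operators `μ - A`, `Re μ > a`, are invertible on `P` with a resolvent estimate. -/
structure HasResolventCore (T : H →ₗ.[ℂ] H) (ι : P →ₗ[ℂ] H) (A : P →ₗ[ℂ] P) (a C : ℝ) : Prop where
  dense : DenseRange ι
  mem_graph : ∀ p, (ι p, ι (A p)) ∈ T.graph
  graph_subset : (T.graph : Set (H × H)) ⊆ closure (range fun p => (ι p, ι (A p)))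
  surjective : ∀ μ : ℂ, a < μ.re → Function.Surjective fun p => μ • p - A p
  bound : ∀ μ : ℂ, a < μ.re → ∀ p, ‖ι p‖ ≤ C / (μ.re - a) * ‖ι (μ • p - A p)‖

namespace HasResolventCore

variable {T : H →ₗ.[ℂ] H} {ι : P →ₗ[ℂ] H} {A : P →ₗ[ℂ] P} {a C : ℝ}

theorem closure_graph (h : HasResolventCore T ι A a C) :
    (T.graph.topologicalClosure : Set (H × H)) = closure (range fun p => (ι p, ι (A p))) := by
  rw [Submodule.topologicalClosure_coe]
  refine subset_antisymm (closure_minimal h.graph_subset isClosed_closure) (closure_mono ?_)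
  rintro _ ⟨p, rfl⟩
  exact h.mem_graph p

theorem denseRange (h : HasResolventCore T ι A a C) {μ : ℂ} (hμ : a < μ.re) :
    DenseRange (ι ∘ₗ (μ • LinearMap.id - A)) := by
  have : range (ι ∘ₗ (μ • LinearMap.id - A)) = range ι := by
    rw [LinearMap.coe_comp]
    exact (h.surjective μ hμ).range_comp ι
  rw [DenseRange, this]
  exact h.dense

variable [CompleteSpace H]

/-- The resolvent of the closure of `T`, extended by continuity from the core. -/
def resolvent (ι : P →ₗ[ℂ] H) (A : P →ₗ[ℂ] P) (μ : ℂ) : H →L[ℂ] H :=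
  ι.extendOfNorm (ι ∘ₗ (μ • LinearMap.id - A))

theorem resolvent_apply (h : HasResolventCore T ι A a C) {μ : ℂ} (hμ : a < μ.re) (p : P) :
    resolvent ι A μ (ι (μ • p - A p)) = ι p :=
  LinearMap.extendOfNorm_eq (h.denseRange hμ) ⟨_, h.bound μ hμ⟩ p

theorem norm_resolvent_le (h : HasResolventCore T ι A a C) {μ : ℂ} (hμ : a < μ.re) (y : H) :
    ‖resolvent ι A μ y‖ ≤ C / (μ.re - a) * ‖y‖ :=
  LinearMap.norm_extendOfNorm_apply_le (h.denseRange hμ) _ (h.bound μ hμ) y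

theorem resolvent_sub (h : HasResolventCore T ι A a C) {μ : ℂ} (hμ : a < μ.re) {x y : H}
    (hxy : (x, y) ∈ T.graph.topologicalClosure) : resolvent ι A μ (μ • x - y) = x := by
  have h1 : (x, y) ∈ closure (range fun p => (ι p, ι (A p))) := h.closure_graph ▸ hxy
  have hcl : IsClosed {q : H × H | resolvent ι A μ (μ • q.1 - q.2) = q.1} :=
    isClosed_eq (by fun_prop) (by fun_prop)
  refine closure_minimal ?_ hcl h1
  rintro _ ⟨p, rfl⟩
  have := h.resolvent_apply hμ p
  rwa [map_sub, map_smul] at this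

theorem resolvent_mem (h : HasResolventCore T ι A a C) {μ : ℂ} (hμ : a < μ.re) (y : H) :
    (resolvent ι A μ y, μ • resolvent ι A μ y - y) ∈ T.graph.topologicalClosure := by
  have hcl : IsClosed {y : H | (resolvent ι A μ y, μ • resolvent ι A μ y - y) ∈
      T.graph.topologicalClosure} :=
    T.graph.isClosed_topologicalClosure.preimage (by fun_prop)
  refine (h.denseRange hμ).induction_on y hcl fun p => ?_
  change (resolvent ι A μ (ι (μ • p - A p)), μ • resolvent ι A μ (ι (μ • p - A p))
    - ι (μ • p - A p)) ∈ _
  rw [h.resolvent_apply hμ, map_sub, map_smul, sub_sub_cancel]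
  exact T.graph.le_topologicalClosure (h.mem_graph p)

/-- If `(0, y)` is in the closure of the graph, then `R(ν) y = 0` for all large `ν`; but
`ν R(ν) → 1` strongly. -/
theorem isClosable (h : HasResolventCore T ι A a C) : T.IsClosable := by
  refine ⟨T.graph.topologicalClosure.toLinearPMap, (Submodule.toLinearPMap_graph_eq _ ?_).symm⟩
  rintro ⟨x, y⟩ hxy (rfl : x = 0)
  change y = 0
  have h0 : ∀ ν : ℝ, a < ν → resolvent ι A ν y = 0 := by
    intro ν hν
    have := h.resolvent_sub (μ := ν) hν hxy
    rwa [smul_zero, zero_sub, map_neg, neg_eq_zero] at this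
  have hlim : Tendsto (fun ν : ℝ => ν - a) atTop atTop := tendsto_atTop_add_const_right _ _ tendsto_id
  -- `ν R(ν) → 1` strongly as `ν → ∞`, with uniform bounds, so that `R(ν) y = 0` forces `y = 0`
  have key : ∀ p, ‖ι p‖ ≤ C * ‖ι p - y‖ := by
    intro p
    have h1 : ∀ᶠ ν : ℝ in atTop, ‖ι p‖ ≤
        (1 + a / (ν - a)) * C * ‖ι p - y‖ + C / (ν - a) * ‖ι (A p)‖ := by
      filter_upwards [eventually_gt_atTop a, eventually_gt_atTop 0] with ν hν hν0
      have e1 : ι p = (ν : ℂ) • resolvent ι A ν (ι p - y) - resolvent ι A ν (ι (A p)) := by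
        rw [map_sub, h0 ν hν, sub_zero, ← map_smul, ← map_sub, ← map_smul, ← map_sub,
          h.resolvent_apply (μ := ν) hν]
      have h2 := h.norm_resolvent_le (μ := ν) hν (ι p - y)
      have h3 := h.norm_resolvent_le (μ := ν) hν (ι (A p))
      rw [Complex.ofReal_re] at h2 h3
      have h4 : (1 + a / (ν - a)) = ν / (ν - a) := by
        have : ν - a ≠ 0 := by linarith
        field_simp
        ring
      calc ‖ι p‖ ≤ ‖(ν : ℂ) • resolvent ι A ν (ι p - y)‖ + ‖resolvent ι A ν (ι (A p))‖ := by
            conv_lhs => rw [e1]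
            exact norm_sub_le _ _
        _ ≤ ν * (C / (ν - a) * ‖ι p - y‖) + C / (ν - a) * ‖ι (A p)‖ := by
            rw [norm_smul, Complex.norm_real, Real.norm_of_nonneg hν0.le]
            gcongr
        _ = _ := by rw [h4]; ring
    have h2 : Tendsto (fun ν : ℝ => (1 + a / (ν - a)) * C * ‖ι p - y‖ + C / (ν - a) * ‖ι (A p)‖)
        atTop (𝓝 ((1 + 0) * C * ‖ι p - y‖ + 0 * ‖ι (A p)‖)) :=
      ((((hlim.const_div_atTop a).const_add 1).mul_const C).mul_const _).add
        ((hlim.const_div_atTop C).mul_const _)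
    simpa using ge_of_tendsto h2 h1
  have key' : ∀ z : H, ‖z‖ ≤ C * ‖z - y‖ := fun z =>
    h.dense.induction_on z (isClosed_le (by fun_prop) (by fun_prop)) key
  have := key' y
  simpa using this

theorem mem_closure (h : HasResolventCore T ι A a C) {x y : H} :
    (x, y) ∈ T.closure.graph ↔ (x, y) ∈ T.graph.topologicalClosure := by
  rw [h.isClosable.graph_closure_eq_closure_graph]

theorem mem_graph_vadd (h : HasResolventCore T ι A a C) (B : H →L[ℂ] H) {x y : H} :
    (x, y) ∈ ((B : H →ₗ[ℂ] H) +ᵥ T.closure).graph ↔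
      (x, y - B x) ∈ T.graph.topologicalClosure := by
  rw [← h.mem_closure, LinearPMap.mem_graph_iff, LinearPMap.mem_graph_iff]
  constructor
  · rintro ⟨z, rfl, rfl⟩
    exact ⟨z, rfl, by simp [LinearPMap.vadd_apply]⟩
  · rintro ⟨z, rfl, hz⟩
    exact ⟨z, rfl, by simp [LinearPMap.vadd_apply, hz]⟩

/-- The range of `1 - B R(μ)` is dense if `μ - A - b` is onto, where `b` is the action of `B` on
the core. -/
theorem isUnit_one_sub (h : HasResolventCore T ι A a C) {B : H →L[ℂ] H} {b : P →ₗ[ℂ] P}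
    (hB : IsCompactOperator (ContinuousLinearMap.adjoint B)) (hb : ∀ p, B (ι p) = ι (b p)) {μ : ℂ}
    (hμ : a < μ.re) (hs : Function.Surjective fun p => μ • p - A p - b p) :
    IsUnit (1 - B ∘L resolvent ι A μ) := by
  refine isUnit_one_sub_of_denseRange ?_ (h.dense.mono ?_)
  · rw [ContinuousLinearMap.adjoint_comp]
    exact hB.clm_comp (ContinuousLinearMap.adjoint (resolvent ι A μ))
  · rintro _ ⟨q, rfl⟩
    obtain ⟨p, rfl⟩ := hs q
    refine ⟨ι (μ • p - A p), ?_⟩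
    simp only [_root_.sub_apply, one_apply_eq_self,
      ContinuousLinearMap.comp_apply]
    rw [h.resolvent_apply hμ, hb, ← map_sub]

/-- The resolvent of the perturbed operator is `R(μ) (1 - B R(μ))⁻¹`. -/
theorem inResolventSet (h : HasResolventCore T ι A a C) {B : H →L[ℂ] H} {b : P →ₗ[ℂ] P}
    (hB : IsCompactOperator (ContinuousLinearMap.adjoint B)) (hb : ∀ p, B (ι p) = ι (b p)) {μ : ℂ}
    (hμ : a < μ.re) (hs : Function.Surjective fun p => μ • p - A p - b p) :
    InResolventSet ((B : H →ₗ[ℂ] H) +ᵥ T.closure) μ := by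
  obtain ⟨W, hW⟩ := h.isUnit_one_sub hB hb hμ hs
  have h1 : ∀ y, (W⁻¹.1 : H →L[ℂ] H) (y - B (resolvent ι A μ y)) = y := by
    intro y
    have := congrArg (fun G : H →L[ℂ] H => G y) W.inv_mul
    rw [hW] at this
    simpa using this
  have h2 : ∀ y, (W⁻¹.1 : H →L[ℂ] H) y - B (resolvent ι A μ ((W⁻¹.1 : H →L[ℂ] H) y)) = y := by
    intro y
    have := congrArg (fun G : H →L[ℂ] H => G y) W.mul_inv
    rw [hW] at this
    simpa using this
  refine ⟨resolvent ι A μ ∘L W⁻¹.1, fun x => ?_, fun y => ?_⟩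
  · have hx : ((x : H), ((B : H →ₗ[ℂ] H) +ᵥ T.closure) x) ∈
        ((B : H →ₗ[ℂ] H) +ᵥ T.closure).graph := LinearPMap.mem_graph _ x
    rw [h.mem_graph_vadd] at hx
    have h3 := h.resolvent_sub hμ hx
    rw [ContinuousLinearMap.comp_apply]
    set Y := μ • (x : H) - (((B : H →ₗ[ℂ] H) +ᵥ T.closure) x - B x) with hY
    have h4 : μ • (x : H) - ((B : H →ₗ[ℂ] H) +ᵥ T.closure) x = Y - B (resolvent ι A μ Y) := by
      rw [h3, hY]; abel
    rw [h4, h1, h3]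
  · set z := (W⁻¹.1 : H →L[ℂ] H) y with hz
    have h3 : (resolvent ι A μ z, μ • resolvent ι A μ z - z + B (resolvent ι A μ z)) ∈
        ((B : H →ₗ[ℂ] H) +ᵥ T.closure).graph := by
      rw [h.mem_graph_vadd, add_sub_cancel_right]
      exact h.resolvent_mem hμ z
    obtain ⟨x, hx1, hx2⟩ := LinearPMap.mem_graph_iff _ |>.1 h3
    refine ⟨x, hx1, ?_⟩
    rw [hx1, hx2]
    have := h2 y
    rw [← hz] at this
    have e : ∀ u v w : H, u - (u - v + w) = v - w := fun u v w => by abel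
    exact (e _ _ _).trans this

/-- If a rank one perturbation of `μ - A - b` by `ℓ(·) q` is onto, then an eigenvector `x` with
`ℓ x = 0` vanishes. -/
theorem eq_zero_of_mem_eigenspace (h : HasResolventCore T ι A a C) {B : H →L[ℂ] H} {b : P →ₗ[ℂ] P}
    (hB : IsCompactOperator (ContinuousLinearMap.adjoint B)) (hb : ∀ p, B (ι p) = ι (b p)) {μ : ℂ}
    (hμ : a < μ.re) (g : H) (q : P)
    (hs : Function.Surjective fun p => μ • p - A p - (b p + inner ℂ g (ι p) • q)) {x : H}
    (hx : x ∈ eigenspaceOf ((B : H →ₗ[ℂ] H) +ᵥ T.closure) μ) (hgx : inner ℂ g x = 0) : x = 0 := by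
  set J : H →L[ℂ] H := (innerSL ℂ g).smulRight (ι q) with hJ
  have hJx : ∀ x, J x = inner ℂ g x • ι q := fun x => by simp [hJ]
  have hJc : IsCompactOperator (ContinuousLinearMap.adjoint J) := by
    refine isCompactOperator_adjoint fun ε hε => ⟨Submodule.span ℂ {g}, inferInstance, fun y hy => ?_⟩
    rw [hJx, Submodule.mem_orthogonal_singleton_iff_inner_right.1 hy, zero_smul, norm_zero]
    positivity
  have hBJ : IsCompactOperator (ContinuousLinearMap.adjoint (B + J)) := by
    rw [map_add]
    exact hB.add hJc
  obtain ⟨W, hW⟩ := h.isUnit_one_sub (B := B + J)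
    (b := b + ((innerSL ℂ g).toLinearMap ∘ₗ ι).smulRight q) hBJ
    (fun p => by simp [hb, hJx]) hμ (by simpa using hs)
  have hx' : (x, μ • x) ∈ ((B : H →ₗ[ℂ] H) +ᵥ T.closure).graph := hx
  rw [h.mem_graph_vadd] at hx'
  have h3 := h.resolvent_sub hμ hx'
  rw [sub_sub_cancel] at h3
  have h4 : W.1 (B x) = 0 := by
    rw [hW]
    simp [h3, hJx, hgx]
  have h5 : B x = 0 := by
    have h6 : (W⁻¹.1 : H →L[ℂ] H) (W.1 (B x)) = B x := by
      rw [← mul_apply_eq_comp, W.inv_mul, one_apply_eq_self]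
    rw [← h6, h4, map_zero]
  rw [← h3, h5, map_zero]

theorem mem_eigenspace (h : HasResolventCore T ι A a C) {B : H →L[ℂ] H} {b : P →ₗ[ℂ] P}
    (hb : ∀ p, B (ι p) = ι (b p)) {μ : ℂ} {q : P} (hq : A q + b q = μ • q) :
    ι q ∈ eigenspaceOf ((B : H →ₗ[ℂ] H) +ᵥ T.closure) μ := by
  change (ι q, μ • ι q) ∈ ((B : H →ₗ[ℂ] H) +ᵥ T.closure).graph
  rw [h.mem_graph_vadd, hb, ← map_smul, ← map_sub, ← eq_sub_of_add_eq hq]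
  exact Submodule.le_topologicalClosure _ (h.mem_graph _)

/-- If a rank one perturbation by `⟪g, ·⟫ q` makes `μ - A - b` onto, then the eigenspace is spanned by
the eigenvector `g`: subtract from `x` its projection to `g`. -/
theorem eigenspace_eq_span (h : HasResolventCore T ι A a C) {B : H →L[ℂ] H} {b : P →ₗ[ℂ] P}
    (hB : IsCompactOperator (ContinuousLinearMap.adjoint B)) (hb : ∀ p, B (ι p) = ι (b p)) {μ : ℂ}
    (hμ : a < μ.re) {g : H} (q : P) (hg0 : inner ℂ g g ≠ (0 : ℂ))
    (hg : g ∈ eigenspaceOf ((B : H →ₗ[ℂ] H) +ᵥ T.closure) μ)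
    (hs : Function.Surjective fun p => μ • p - A p - (b p + inner ℂ g (ι p) • q)) :
    eigenspaceOf ((B : H →ₗ[ℂ] H) +ᵥ T.closure) μ = Submodule.span ℂ {g} := by
  refine le_antisymm (fun x hx => ?_) ((Submodule.span_singleton_le_iff_mem _ _).2 hg)
  have h0 : x - (inner ℂ g x / inner ℂ g g) • g = 0 := by
    refine h.eq_zero_of_mem_eigenspace hB hb hμ g q hs
      (Submodule.sub_mem _ hx (Submodule.smul_mem _ _ hg)) ?_
    rw [inner_sub_right, inner_smul_right, div_mul_cancel₀ _ hg0, sub_self]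
  rw [sub_eq_zero.1 h0]
  exact Submodule.smul_mem _ _ (Submodule.mem_span_singleton_self _)

end HasResolventCore

end Abstract

/-! ### The wave operator on polynomials in `ρ²` -/

theorem polyEuler_sub (c : ℝ) (F G : ℂ[X]) :
    polyEuler c (F - G) = polyEuler c F - polyEuler c G := by
  simp only [polyEuler, derivative_sub]
  ring

theorem polyEuler_smul (c : ℝ) (a : ℂ) (F : ℂ[X]) :
    polyEuler c (a • F) = a • polyEuler c F := by
  simp only [polyEuler, derivative_smul, mul_smul_comm, smul_add]

theorem polyEuler_comm (a b : ℝ) (F : ℂ[X]) :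
    polyEuler a (polyEuler b F) = polyEuler b (polyEuler a F) := by
  simp only [polyEuler, derivative_add, derivative_mul, derivative_C, derivative_X]
  ring

theorem polyEuler_derivative (c : ℝ) (F : ℂ[X]) :
    polyEuler (c + 2) (derivative F) = derivative (polyEuler c F) := by
  simp only [polyEuler, derivative_add, derivative_mul, derivative_C, derivative_X]
  push_cast
  rw [C_add, show C (2 : ℂ) = 2 from C_ofNat 2]
  ring

theorem polyChain_add (c : ℕ → ℝ) (n : ℕ) (F G : ℂ[X]) :
    polyChain c n (F + G) = polyChain c n F + polyChain c n G := by
  induction n with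
  | zero => rfl
  | succ n ih => rw [polyChain, ih, polyEuler_add]; rfl

theorem polyChain_sub (c : ℕ → ℝ) (n : ℕ) (F G : ℂ[X]) :
    polyChain c n (F - G) = polyChain c n F - polyChain c n G := by
  induction n with
  | zero => rfl
  | succ n ih => rw [polyChain, ih, polyEuler_sub]; rfl

theorem polyChain_smul (c : ℕ → ℝ) (n : ℕ) (a : ℂ) (F : ℂ[X]) :
    polyChain c n (a • F) = a • polyChain c n F := by
  induction n with
  | zero => rfl
  | succ n ih => rw [polyChain, ih, polyEuler_smul]; rfl

theorem polyChain_polyEuler (c : ℕ → ℝ) (n : ℕ) (a : ℝ) (F : ℂ[X]) :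
    polyChain c n (polyEuler a F) = polyEuler a (polyChain c n F) := by
  induction n with
  | zero => rfl
  | succ n ih => rw [polyChain, ih, polyEuler_comm]; rfl

theorem polyChain_derivative (c : ℕ → ℝ) (n : ℕ) (F : ℂ[X]) :
    polyChain (fun i => c i + 2) n (derivative F) = derivative (polyChain c n F) := by
  induction n with
  | zero => rfl
  | succ n ih => rw [polyChain, ih, polyEuler_derivative]; rfl

theorem polyChain_succ_eq (c : ℕ → ℝ) (n : ℕ) (F : ℂ[X]) :
    polyChain c (n + 1) F = polyEuler (c 0) (polyChain (fun i => c (i + 1)) n F) := by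
  induction n with
  | zero => rfl
  | succ n ih => rw [polyChain, ih, polyEuler_comm]; rfl

/-- The radial Laplace operator, acting on `F` in `F(ρ²)`. -/
def polyLaplacian (d : ℕ) (F : ℂ[X]) : ℂ[X] :=
  C 4 * (X * derivative (derivative F)) + C (2 * d : ℂ) * derivative F

theorem polyLaplacian_add (d : ℕ) (F G : ℂ[X]) :
    polyLaplacian d (F + G) = polyLaplacian d F + polyLaplacian d G := by
  simp only [polyLaplacian, derivative_add]
  ring

theorem polyLaplacian_smul (d : ℕ) (a : ℂ) (F : ℂ[X]) :
    polyLaplacian d (a • F) = a • polyLaplacian d F := by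
  simp only [polyLaplacian, derivative_smul, mul_smul_comm, smul_add]

theorem polyLaplacian_eq {d K : ℕ} (hd : d = 2 * K + 3) (F : ℂ[X]) :
    polyLaplacian d F = C 2 * derivative (polyEuler (2 * K + 1) F) := by
  simp only [polyLaplacian, polyEuler, derivative_add, derivative_mul, derivative_C, derivative_X,
    hd]
  push_cast
  simp only [C_add, C_mul, show C (2 : ℂ) = 2 from C_ofNat 2, show C (3 : ℂ) = 3 from C_ofNat 3,
    show C (4 : ℂ) = 4 from C_ofNat 4, C_1]
  ring

theorem radialLaplacian_polyFun (d : ℕ) (F : ℂ[X]) :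
    EqOn (radialLaplacian d (polyFun F)) (polyFun (polyLaplacian d F)) (Ioo 0 1) := by
  intro ρ hρ
  have h0 : (ρ : ℂ) ≠ 0 := Complex.ofReal_ne_zero.2 hρ.1.ne'
  have h : HasDerivAt (fun ρ : ℝ => 2 * (ρ : ℂ) * polyFun (derivative F) ρ)
      (2 * 1 * polyFun (derivative F) ρ +
        2 * ρ * (2 * ρ * polyFun (derivative (derivative F)) ρ)) ρ :=
    ((Complex.ofRealCLM.hasDerivAt (x := ρ)).const_mul 2).mul (hasDerivAt_polyFun (derivative F) ρ)
  simp only [radialLaplacian, deriv_polyFun, h.deriv]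
  simp only [polyLaplacian, polyFun, eval_add, eval_mul, eval_C, eval_X]
  field_simp
  ring

/-- The polynomial `P` with `(D_d u)'(ρ) = P(ρ²)` for `u(ρ) = F(ρ²)`. -/
def derivDPoly (K : ℕ) (F : ℂ[X]) : ℂ[X] := polyChain (fun i => 2 * i + 1) (K + 1) F

/-- The polynomial `Q` with `D_d u(ρ) = ρ Q(ρ²)` for `u(ρ) = F(ρ²)`. -/
def dPoly (K : ℕ) (F : ℂ[X]) : ℂ[X] := polyChain (fun i => 2 * i + 3) K F

theorem derivDPoly_eq (K : ℕ) (F : ℂ[X]) : derivDPoly K F = polyEuler 1 (dPoly K F) := by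
  have h : (fun i : ℕ => 2 * ((i + 1 : ℕ) : ℝ) + 1) = fun i : ℕ => 2 * (i : ℝ) + 3 := by
    funext i
    push_cast
    ring
  rw [derivDPoly, polyChain_succ_eq, h]
  simp [dPoly]

/-- The counterpart of `dOp_radialLaplacian` on polynomials: with `u = F(ρ²)` and
`(D_d u)' = P(ρ²)` one has `(D_d u)'' = ρ (2 P')(ρ²)`. -/
theorem dPoly_polyLaplacian {d K : ℕ} (hd : d = 2 * K + 3) (F : ℂ[X]) :
    dPoly K (polyLaplacian d F) = C 2 * derivative (derivDPoly K F) := by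
  have h : (fun i : ℕ => 2 * (i : ℝ) + 3) = fun i : ℕ => (2 * (i : ℝ) + 1) + 2 := by
    funext i
    ring
  rw [polyLaplacian_eq hd, ← smul_eq_C_mul, ← smul_eq_C_mul, dPoly, polyChain_smul, h,
    polyChain_derivative (fun i : ℕ => 2 * (i : ℝ) + 1), polyChain_polyEuler]
  rfl

theorem dOp_polyFun {d K : ℕ} (hd : d = 2 * K + 3) (F : ℂ[X]) :
    EqOn (dOp d (polyFun F)) (fun ρ => ρ * polyFun (dPoly K F) ρ) (Ioo 0 1) := by
  intro ρ hρ
  rw [dOp_eq hd (smooth_polyFun F) hρ, chain_polyFun]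
  rfl

theorem deriv_mul_polyFun (F : ℂ[X]) :
    deriv (fun ρ : ℝ => (ρ : ℂ) * polyFun F ρ) = polyFun (polyEuler 1 F) := by
  funext ρ
  have h : HasDerivAt (fun ρ : ℝ => (ρ : ℂ) * polyFun F ρ) (1 * polyFun F ρ +
      ρ * (2 * ρ * polyFun (derivative F) ρ)) ρ :=
    (Complex.ofRealCLM.hasDerivAt (x := ρ)).mul (hasDerivAt_polyFun F ρ)
  rw [h.deriv]
  simp only [polyEuler, polyFun, eval_add, eval_mul, eval_C, eval_X]
  push_cast
  ring

theorem contDiff_mul_polyFun (F : ℂ[X]) : ContDiff ℝ ∞ fun ρ : ℝ => (ρ : ℂ) * polyFun F ρ :=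
  Complex.ofRealCLM.contDiff.mul (contDiff_polyFun F)

/-- The free operator on pairs of polynomials in `ρ²`; `s = 2 / (p - 1)`. -/
def polyFree (d : ℕ) (s : ℝ) : ℂ[X] × ℂ[X] →ₗ[ℂ] ℂ[X] × ℂ[X] where
  toFun P := (P.2 - polyEuler s P.1, polyLaplacian d P.1 - polyEuler (s + 1) P.2)
  map_add' P Q := by
    simp only [Prod.fst_add, Prod.snd_add, polyEuler_add, polyLaplacian_add, Prod.mk_add_mk]
    congr 1 <;> ring
  map_smul' a P := by
    simp only [Prod.smul_fst, Prod.smul_snd, polyEuler_smul, polyLaplacian_smul, Prod.smul_mk,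
      RingHom.id_apply, smul_sub]

/-- The potential on pairs of polynomials in `ρ²`. -/
def polyPotential (κ : ℂ) : ℂ[X] × ℂ[X] →ₗ[ℂ] ℂ[X] × ℂ[X] where
  toFun P := (0, κ • P.1)
  map_add' P Q := by simp
  map_smul' a P := by simp [smul_comm κ a]

/-- A pair of polynomials in `ρ²` as an element of the energy space. -/
def energyJet (d : ℕ) : ℂ[X] × ℂ[X] →ₗ[ℂ] EnergySpace d where
  toFun P := WithLp.toLp 2 (polyJet d (order d) P.1, polyJet d (order d - 1) P.2)
  map_add' P Q := by simp only [Prod.fst_add, Prod.snd_add, map_add, ← WithLp.toLp_add, Prod.mk_add_mk]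
  map_smul' a P := by
    simp only [Prod.smul_fst, Prod.smul_snd, map_smul, ← WithLp.toLp_smul, Prod.smul_mk,
      RingHom.id_apply]

theorem representsPair_energyJet (d : ℕ) (P : ℂ[X] × ℂ[X]) :
    RepresentsPair (polyFun P.1) (polyFun P.2) (energyJet d P) :=
  ⟨represents_polyJet d _ P.1, represents_polyJet d _ P.2⟩

theorem freeFst_polyFun (d : ℕ) (p : ℝ) (P : ℂ[X] × ℂ[X]) :
    freeFst p (polyFun P.1) (polyFun P.2) = polyFun (polyFree d (rate p) P).1 := by
  rw [freeFst_eq, euler_polyFun, ← polyFun_sub]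
  rfl

theorem freeSnd_polyFun (d : ℕ) {p : ℝ} (hp : p ≠ 1) (P : ℂ[X] × ℂ[X]) :
    EqOn (freeSnd d p (polyFun P.1) (polyFun P.2)) (polyFun (polyFree d (rate p) P).2)
      (Ioo 0 1) := by
  intro ρ hρ
  rw [freeSnd_eq d hp, euler_polyFun, Pi.sub_apply, radialLaplacian_polyFun d P.1 hρ,
    ← Pi.sub_apply, ← polyFun_sub]
  rfl

/-! ### The energy of a pair of polynomials -/

theorem enorm_le_add {E F : Type*} [SeminormedAddCommGroup E] [SeminormedAddCommGroup F]
    (x : WithLp 2 (E × F)) : ‖x‖ₑ ≤ ‖x.fst‖ₑ + ‖x.snd‖ₑ := by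
  rw [← ofReal_norm, ← ofReal_norm, ← ofReal_norm, ← ENNReal.ofReal_add (norm_nonneg _) (norm_nonneg _)]
  refine ENNReal.ofReal_le_ofReal ?_
  rw [WithLp.prod_norm_eq_of_L2]
  refine Real.sqrt_le_iff.2 ⟨by positivity, ?_⟩
  nlinarith [norm_nonneg x.fst, norm_nonneg x.snd]

/-- For `u₁ = F(ρ²)`, `u₂ = G(ρ²)` and `qⱼ = D_d uⱼ`, the quantity
`‖q₁''‖ + ‖q₂'‖ + |q₁'(1) + q₂(1)|`, an equivalent norm on the polynomial pairs that is adapted to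
the wave equation on the half line. -/
def waveEnergy (K : ℕ) (P : ℂ[X] × ℂ[X]) : ℝ≥0∞ :=
  intervalNorm (deriv (polyFun (derivDPoly K P.1))) + intervalNorm (polyFun (derivDPoly K P.2))
    + ‖(derivDPoly K P.1).eval 1 + (dPoly K P.2).eval 1‖ₑ

/-- The resolvent estimate in the energy: `wave_energy_estimate` for the two derivatives, and the
fact that the boundary functional is multiplied by `μ + s`. -/
theorem waveEnergy_resolvent_le {d K : ℕ} (hd : d = 2 * K + 3) {s : ℝ} {μ : ℂ} (hμ : -s < μ.re)
    (P : ℂ[X] × ℂ[X]) :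
    ENNReal.ofReal (μ.re - -s) * waveEnergy K P ≤ 2 * waveEnergy K (μ • P - polyFree d s P) := by
  set y := derivDPoly K P.1 with hy
  set q := dPoly K P.2 with hq
  have e1 : derivDPoly K (μ • P - polyFree d s P).1 = μ • y - polyEuler 1 q + polyEuler s y := by
    change derivDPoly K (μ • P.1 - (P.2 - polyEuler s P.1)) = _
    rw [hq, ← derivDPoly_eq, hy]
    simp only [derivDPoly, polyChain_sub, polyChain_smul, polyChain_polyEuler]
    ring
  have e2 : dPoly K (μ • P - polyFree d s P).2 =
      μ • q - C 2 * derivative y + polyEuler (s + 1) q := by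
    change dPoly K (μ • P.2 - (polyLaplacian d P.1 - polyEuler (s + 1) P.2)) = _
    rw [hy, ← dPoly_polyLaplacian hd, hq]
    simp only [dPoly, polyChain_sub, polyChain_smul, polyChain_polyEuler]
    ring
  -- The boundary functional is an eigenfunctional: the derivatives at `ρ = 1` cancel.
  have e3 : (derivDPoly K (μ • P - polyFree d s P).1).eval 1 +
      (dPoly K (μ • P - polyFree d s P).2).eval 1 = (μ + s) * (y.eval 1 + q.eval 1) := by
    rw [e1, e2]
    simp only [polyEuler, eval_add, eval_sub, eval_mul, eval_smul, eval_C, eval_X, smul_eq_mul]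
    push_cast
    ring
  have hz1 : ∀ ρ, HasDerivAt (polyFun y) (deriv (polyFun y) ρ) ρ := fun ρ =>
    ((contDiff_polyFun y).differentiable (by simp) ρ).hasDerivAt
  have d1 : ContDiff ℝ ∞ (deriv (polyFun y)) := by
    rw [deriv_polyFun']
    exact contDiff_mul_polyFun _
  set z₂ := polyFun (polyEuler 1 q) with hz2
  have e4 : deriv (polyFun (derivDPoly K (μ • P - polyFree d s P).1)) =
      fun ρ : ℝ => (μ + s + 1) * deriv (polyFun y) ρ + ρ * deriv (deriv (polyFun y)) ρ
        - deriv z₂ ρ := by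
    rw [e1, polyFun_add, polyFun_sub, polyFun_smul, ← euler_polyFun s, ← hz2]
    funext ρ
    have h1 := ((Complex.ofRealCLM.hasDerivAt (x := ρ)).mul
      ((d1.differentiable (by simp) ρ).hasDerivAt)).add ((hz1 ρ).const_mul (s : ℂ))
    have h2 : HasDerivAt z₂ (deriv z₂ ρ) ρ :=
      ((contDiff_polyFun _).differentiable (by simp) ρ).hasDerivAt
    have h3 := (((hz1 ρ).const_smul μ).sub h2).add h1
    refine (h3.congr_deriv ?_).deriv
    simp only [smul_eq_mul, Complex.ofRealCLM_apply]
    push_cast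
    ring
  have e5 : polyFun (derivDPoly K (μ • P - polyFree d s P).2) =
      fun ρ : ℝ => (μ + s + 1) * z₂ ρ + ρ * deriv z₂ ρ - deriv (deriv (polyFun y)) ρ := by
    rw [derivDPoly_eq, e2, deriv_polyFun' y, deriv_mul_polyFun, polyEuler_add, polyEuler_sub,
      polyEuler_smul, polyEuler_comm 1 (s + 1), polyFun_add, polyFun_sub, polyFun_smul,
      ← euler_polyFun (s + 1), ← hz2]
    funext ρ
    simp only [euler, Pi.add_apply, Pi.sub_apply, Pi.smul_apply, smul_eq_mul]
    push_cast
    ring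
  have key := wave_energy_estimate (z₂ := z₂) d1 (contDiff_polyFun _)
    (by rw [deriv_polyFun]; simp) (b := μ + s + 1) (a := μ.re + s + 1 / 2) (by linarith)
    (by simp; ring)
  rw [← e4, ← e5] at key
  set f₁ := intervalNorm (deriv (polyFun (derivDPoly K (μ • P - polyFree d s P).1)))
  set f₂ := intervalNorm (polyFun (derivDPoly K (μ • P - polyFree d s P).2))
  have hsum : f₁ ^ 2 + f₂ ^ 2 ≤ (f₁ + f₂) ^ 2 := by
    rw [add_sq]
    exact add_le_add_left le_self_add _
  have hpos : (0 : ℝ) ≤ μ.re - -s := by linarith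
  have hle : ∀ x : ℝ≥0∞, x ^ 2 ≤ intervalNorm (deriv (polyFun y)) ^ 2 + intervalNorm z₂ ^ 2 →
      ENNReal.ofReal (μ.re - -s) * x ≤ f₁ + f₂ := by
    intro x hx
    rw [← ENNReal.pow_le_pow_left_iff two_ne_zero, mul_pow, ← ENNReal.ofReal_pow hpos]
    refine le_trans (mul_le_mul' (ENNReal.ofReal_le_ofReal ?_) hx) (key.trans hsum)
    nlinarith
  have h1 := hle _ le_self_add
  have h2 := hle (intervalNorm z₂) le_add_self
  have h3 : ENNReal.ofReal (μ.re - -s) * ‖y.eval 1 + q.eval 1‖ₑ ≤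
      ‖(derivDPoly K (μ • P - polyFree d s P).1).eval 1 +
        (dPoly K (μ • P - polyFree d s P).2).eval 1‖ₑ := by
    rw [e3, enorm_mul]
    gcongr
    rw [← ofReal_norm]
    refine ENNReal.ofReal_le_ofReal (le_trans ?_ (Complex.re_le_norm _))
    simp
  have e6 : waveEnergy K P = intervalNorm (deriv (polyFun y)) + intervalNorm z₂ +
      ‖y.eval 1 + q.eval 1‖ₑ := by
    rw [waveEnergy, derivDPoly_eq K P.2]
  rw [e6, mul_add, mul_add, waveEnergy]
  refine (add_le_add (add_le_add h1 h2) (h3.trans (le_mul_of_one_le_left' one_le_two))).trans ?_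
  exact le_of_eq (by ring)

/-! ### Equivalence of the energy with the norm of the energy space -/

theorem order_eq {d K : ℕ} (hd : d = 2 * K + 3) : order d = K + 2 := by
  rw [order]
  omega

theorem enorm_eval_one_le {f : ℝ → ℂ} (hf : ContDiff ℝ ∞ f) :
    ‖f 1‖ₑ ≤ intervalNorm f + intervalNorm (deriv f) := by
  have h1 : intervalNorm (fun _ => f 1) = ‖f 1‖ₑ := by
    have : NeZero (volume.restrict (Ioo (0 : ℝ) 1)) := ⟨by simp⟩
    rw [intervalNorm, eLpNorm_const _ two_ne_zero (NeZero.ne _)]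
    simp
  have h2 : intervalNorm (fun ρ => f 1 - f ρ) ≤ intervalNorm (deriv f) :=
    intervalNorm_le_of_forall fun ρ hρ => enorm_sub_le_Icc hf.contDiffOn hf.continuous.continuousOn
      (Ioo_subset_Icc_self hρ) ⟨zero_le_one, le_rfl⟩
  have h3 := intervalNorm_add_le (f := f) (g := fun ρ => f 1 - f ρ) hf.continuous.continuousOn
    (continuous_const.sub hf.continuous).continuousOn
  have e : (f + fun ρ => f 1 - f ρ) = fun _ => f 1 := by
    funext ρ
    simp
  rw [e, h1] at h3
  exact h3.trans (add_le_add_right h2 _)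

theorem intervalNorm_le_eval_one {f : ℝ → ℂ} (hf : ContDiff ℝ ∞ f) :
    intervalNorm f ≤ ‖f 1‖ₑ + intervalNorm (deriv f) := by
  refine intervalNorm_le_of_forall fun ρ hρ => ?_
  have h := enorm_sub_le_Icc hf.contDiffOn hf.continuous.continuousOn
    (⟨zero_le_one, le_rfl⟩ : (1 : ℝ) ∈ Icc (0 : ℝ) 1) (Ioo_subset_Icc_self hρ)
  calc ‖f ρ‖ₑ = ‖f 1 + (f ρ - f 1)‖ₑ := by rw [add_sub_cancel]
    _ ≤ ‖f 1‖ₑ + ‖f ρ - f 1‖ₑ := enorm_add_le _ _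
    _ ≤ _ := by gcongr

theorem enorm_dPoly_eval_one_le (K : ℕ) (G : ℂ[X]) :
    ‖(dPoly K G).eval 1‖ₑ ≤ intervalNorm (polyFun (derivDPoly K G)) := by
  have h := enorm_sub_le_Icc (contDiff_mul_polyFun (dPoly K G)).contDiffOn
    (contDiff_mul_polyFun _).continuous.continuousOn
    (⟨le_rfl, zero_le_one⟩ : (0 : ℝ) ∈ Icc (0 : ℝ) 1) ⟨zero_le_one, le_rfl⟩
  rw [deriv_mul_polyFun, ← derivDPoly_eq] at h
  simpa [polyFun] using h

theorem polyFun_one (F : ℂ[X]) : polyFun F 1 = F.eval 1 := by simp [polyFun]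

theorem chain_deriv_polyFun (K : ℕ) (F : ℂ[X]) :
    intervalNorm (chain (fun i => 2 * i + 2) (K + 1) (deriv (polyFun F))) =
      intervalNorm (deriv (polyFun (derivDPoly K F))) := by
  refine intervalNorm_congr fun ρ hρ => ?_
  have := deriv_chain (smooth_polyFun F) (fun i => 2 * i + 1) (K + 1) hρ
  rw [chain_polyFun] at this
  rw [derivDPoly, this]
  congr 2
  funext i
  ring

theorem intervalNorm_polyFun_le (K : ℕ) : ∃ C : ℝ≥0, ∀ F : ℂ[X],
    intervalNorm (polyFun F) ≤ C * intervalNorm (polyFun (derivDPoly K F)) := by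
  obtain ⟨C, hC⟩ := chain_le_of_half_lt (c := fun i => 2 * i + 1)
    (fun i => by have : (0 : ℝ) ≤ i := by positivity
                 linarith) (K + 1)
  refine ⟨C, fun F => ?_⟩
  have := hC (polyFun F) (smooth_polyFun F) (fun i _ => ?_) 0 (Nat.zero_le _)
  · rwa [chain_polyFun _ (K + 1)] at this
  · rw [chain_polyFun]
    exact intervalNorm_ne_top_of_continuous (continuous_polyFun _)

theorem enorm_polyJet_order_le {d K : ℕ} (hd : d = 2 * K + 3) : ∃ C : ℝ≥0, ∀ F : ℂ[X],
    ‖polyJet d (order d) F‖ₑ ≤ C * (intervalNorm (deriv (polyFun (derivDPoly K F)))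
      + intervalNorm (polyFun F)) := by
  obtain ⟨C, hC⟩ := enorm_polyJet_snd_le hd
  refine ⟨C, fun F => ?_⟩
  rw [order_eq hd, ← chain_deriv_polyFun]
  exact hC F

theorem enorm_polyJet_order_sub_one_le {d K : ℕ} (hd : d = 2 * K + 3) : ∃ C : ℝ≥0, ∀ F : ℂ[X],
    ‖polyJet d (order d - 1) F‖ₑ ≤ C * intervalNorm (polyFun (derivDPoly K F)) := by
  obtain ⟨C, hC⟩ := enorm_polyJet_fst_le hd
  refine ⟨C, fun F => ?_⟩
  rw [order_eq hd, derivDPoly, ← chain_polyFun]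
  exact hC F

theorem intervalNorm_derivDPoly_le {d K : ℕ} (hd : d = 2 * K + 3) : ∃ C : ℝ≥0,
    ∀ m, K + 1 ≤ m → ∀ F : ℂ[X],
      intervalNorm (polyFun (derivDPoly K F)) ≤ C * ‖polyJet d m F‖ₑ := by
  obtain ⟨C, hC⟩ := chain_le_norm hd fun i => 2 * i + 1
  refine ⟨C, fun m hm F => ?_⟩
  rw [derivDPoly, ← chain_polyFun]
  exact hC m hm _ (smooth_polyFun F) _ (represents_polyJet d m F) (K + 1) le_rfl

theorem intervalNorm_deriv_derivDPoly_le {d K : ℕ} (hd : d = 2 * K + 3) : ∃ C : ℝ≥0,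
    ∀ F : ℂ[X], intervalNorm (deriv (polyFun (derivDPoly K F))) ≤
      C * ‖polyJet d (order d) F‖ₑ := by
  obtain ⟨C, hC⟩ := chain_deriv_le_norm hd fun i => 2 * i + 2
  refine ⟨C, fun F => ?_⟩
  rw [← chain_deriv_polyFun]
  exact hC _ (order_eq hd).ge _ (smooth_polyFun F) _ (represents_polyJet d _ F) (K + 1) le_rfl

/-- The energy controls the norm. The boundary functional bounds `(D_d u₁)'(1)`, as `(D_d u₂)(1)` is
bounded by the norm of `(D_d u₂)'`, because `D_d u₂` vanishes at the origin. -/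
theorem enorm_energyJet_le {d K : ℕ} (hd : d = 2 * K + 3) :
    ∃ C : ℝ≥0, ∀ P, ‖energyJet d P‖ₑ ≤ C * waveEnergy K P := by
  obtain ⟨C₁, h₁⟩ := enorm_polyJet_order_le hd
  obtain ⟨C₂, h₂⟩ := enorm_polyJet_order_sub_one_le hd
  obtain ⟨C₃, h₃⟩ := intervalNorm_polyFun_le K
  refine ⟨C₁ * (1 + C₃) + C₂, fun P => (enorm_le_add _).trans ?_⟩
  have hy : intervalNorm (polyFun (derivDPoly K P.1)) ≤ waveEnergy K P := by
    refine (intervalNorm_le_eval_one (contDiff_polyFun _)).trans ?_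
    have h4 := enorm_dPoly_eval_one_le K P.2
    have h5 : ‖(derivDPoly K P.1).eval 1‖ₑ ≤
        ‖(derivDPoly K P.1).eval 1 + (dPoly K P.2).eval 1‖ₑ + ‖(dPoly K P.2).eval 1‖ₑ := by
      refine le_trans (le_of_eq ?_) (_root_.enorm_sub_le (a := (derivDPoly K P.1).eval 1 +
        (dPoly K P.2).eval 1) (b := (dPoly K P.2).eval 1))
      rw [add_sub_cancel_right]
    rw [polyFun_one, waveEnergy]
    refine (add_le_add_left (h5.trans (add_le_add_right h4 _)) _).trans (le_of_eq ?_)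
    ring
  have hz : intervalNorm (deriv (polyFun (derivDPoly K P.1))) ≤ waveEnergy K P := by
    rw [waveEnergy, add_assoc]
    exact le_self_add
  have hz2 : intervalNorm (polyFun (derivDPoly K P.2)) ≤ waveEnergy K P := by
    rw [waveEnergy, add_right_comm]
    exact le_add_self
  calc _ ≤ C₁ * (waveEnergy K P + C₃ * waveEnergy K P) + C₂ * waveEnergy K P :=
        add_le_add ((h₁ P.1).trans (by gcongr; exact (h₃ P.1).trans (by gcongr)))
          ((h₂ P.2).trans (by gcongr))
    _ = _ := by push_cast; ring

/-- The norm controls the energy, by the trace inequality `enorm_eval_one_le` at `ρ = 1`. -/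
theorem waveEnergy_le {d K : ℕ} (hd : d = 2 * K + 3) :
    ∃ C : ℝ≥0, ∀ P, waveEnergy K P ≤ C * ‖energyJet d P‖ₑ := by
  obtain ⟨C₁, h₁⟩ := intervalNorm_deriv_derivDPoly_le hd
  obtain ⟨C₂, h₂⟩ := intervalNorm_derivDPoly_le hd
  refine ⟨C₁ + C₂ + ((C₂ + C₁) + C₂), fun P => ?_⟩
  have ho := order_eq hd
  have n1 : ‖polyJet d (order d) P.1‖ₑ ≤ ‖energyJet d P‖ₑ :=
    WithLp.enorm_fst_le _ (energyJet d P)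
  have n2 : ‖polyJet d (order d - 1) P.2‖ₑ ≤ ‖energyJet d P‖ₑ :=
    WithLp.enorm_snd_le _ (energyJet d P)
  have b1 := (h₁ P.1).trans (mul_le_mul_right n1 _)
  have b2 := (h₂ (order d - 1) (by omega) P.2).trans (mul_le_mul_right n2 _)
  have b3 := (h₂ (order d) (by omega) P.1).trans (mul_le_mul_right n1 _)
  have b4 := enorm_eval_one_le (contDiff_polyFun (derivDPoly K P.1))
  rw [polyFun_one] at b4
  have b5 := (enorm_dPoly_eval_one_le K P.2).trans b2
  rw [waveEnergy]
  refine (add_le_add (add_le_add b1 b2) ((enorm_add_le _ _).trans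
    (add_le_add (b4.trans (add_le_add b3 b1)) b5))).trans (le_of_eq ?_)
  push_cast
  ring

/-- The dissipative estimate for the free operator on polynomial pairs. -/
theorem norm_energyJet_le {d K : ℕ} (hd : d = 2 * K + 3) (s : ℝ) :
    ∃ C : ℝ, ∀ μ : ℂ, -s < μ.re → ∀ P,
      ‖energyJet d P‖ ≤ C / (μ.re - -s) * ‖energyJet d (μ • P - polyFree d s P)‖ := by
  obtain ⟨C₁, h₁⟩ := enorm_energyJet_le hd
  obtain ⟨C₂, h₂⟩ := waveEnergy_le hd
  refine ⟨C₁ * (2 * C₂), fun μ hμ P => ?_⟩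
  have hpos : 0 < μ.re - -s := by linarith
  have h : ENNReal.ofReal (μ.re - -s) * ‖energyJet d P‖ₑ ≤
      (C₁ * (2 * C₂) : ℝ≥0) * ‖energyJet d (μ • P - polyFree d s P)‖ₑ :=
    calc _ ≤ ENNReal.ofReal (μ.re - -s) * (C₁ * waveEnergy K P) := by gcongr; exact h₁ P
      _ = C₁ * (ENNReal.ofReal (μ.re - -s) * waveEnergy K P) := by ring
      _ ≤ C₁ * (2 * (C₂ * ‖energyJet d (μ • P - polyFree d s P)‖ₑ)) := by
        refine mul_le_mul_right ((waveEnergy_resolvent_le hd hμ P).trans ?_) _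
        exact mul_le_mul_right (h₂ _) _
      _ = _ := by push_cast; ring
  rw [← ofReal_norm, ← ofReal_norm, ← ENNReal.ofReal_coe_nnreal, ← ENNReal.ofReal_mul hpos.le,
    ← ENNReal.ofReal_mul (NNReal.coe_nonneg _), ENNReal.ofReal_le_ofReal_iff (by positivity)] at h
  rw [div_mul_eq_mul_div, le_div_iff₀ hpos, mul_comm]
  exact_mod_cast h

/-! ### The resolvent equation on polynomials -/

/-- The second order operator obtained from `μ - L` by eliminating the second component. -/
def polySpectral (d : ℕ) (s : ℝ) (κ μ : ℂ) : ℂ[X] →ₗ[ℂ] ℂ[X] where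
  toFun F := μ • (μ • F + polyEuler s F) + polyEuler (s + 1) (μ • F + polyEuler s F)
    - polyLaplacian d F - κ • F
  map_add' F G := by
    simp only [polyEuler_add, polyLaplacian_add, smul_add]
    abel
  map_smul' a F := by
    simp only [polyEuler_smul, polyLaplacian_smul, RingHom.id_apply, smul_sub, smul_add,
      polyEuler_add, smul_comm μ a, smul_comm κ a]

theorem polyEuler_X_pow (c : ℝ) (n : ℕ) : polyEuler c (X ^ n) = (2 * n + c : ℂ) • X ^ n := by
  rw [polyEuler, smul_eq_C_mul, derivative_X_pow]
  rcases n with _ | n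
  · simp
  · rw [Nat.add_sub_cancel, C_add, C_mul]
    ring

/-- In the basis of monomials the operator is triangular, with these diagonal entries. -/
theorem polySpectral_X_pow (d : ℕ) (s : ℝ) (κ μ : ℂ) (n : ℕ) :
    ∃ c : ℂ, polySpectral d s κ μ (X ^ (n + 1)) =
      ((2 * (n + 1 : ℕ) + μ + s + 1) * (2 * (n + 1 : ℕ) + μ + s) - κ) • X ^ (n + 1) - c • X ^ n := by
  refine ⟨4 * ((n + 1 : ℂ) * n) + 2 * d * (n + 1), ?_⟩
  have h : polyLaplacian d (X ^ (n + 1)) =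
      (4 * ((n + 1 : ℂ) * n) + 2 * d * (n + 1)) • X ^ n := by
    rw [polyLaplacian, derivative_X_pow, Nat.add_sub_cancel, derivative_C_mul, derivative_X_pow,
      smul_eq_C_mul]
    rcases n with _ | n
    · simp
    · rw [Nat.add_sub_cancel]
      simp only [C_add, C_mul, Nat.cast_add, Nat.cast_one, C_1]
      ring
  change μ • (μ • X ^ (n + 1) + polyEuler s (X ^ (n + 1))) +
    polyEuler (s + 1) (μ • X ^ (n + 1) + polyEuler s (X ^ (n + 1)))
    - polyLaplacian d (X ^ (n + 1)) - κ • X ^ (n + 1) = _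
  rw [h, polyEuler_X_pow, polyEuler_add, polyEuler_smul, polyEuler_smul, polyEuler_X_pow]
  push_cast
  module

theorem polySpectral_one (d : ℕ) (s : ℝ) (κ μ : ℂ) :
    polySpectral d s κ μ 1 = ((μ + s + 1) * (μ + s) - κ) • 1 := by
  change μ • (μ • 1 + polyEuler s 1) + polyEuler (s + 1) (μ • 1 + polyEuler s 1)
    - polyLaplacian d 1 - κ • 1 = _
  have h := fun c => polyEuler_X_pow c 0
  simp only [pow_zero, Nat.cast_zero, mul_zero, zero_add] at h
  have h' : polyLaplacian d 1 = 0 := by simp [polyLaplacian]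
  rw [h', h, polyEuler_add, polyEuler_smul, polyEuler_smul, h]
  push_cast
  module

/-- A triangular operator is onto modulo constants if its diagonal entries beyond the zeroth do not
vanish. -/
theorem eq_top_of_polySpectral {d : ℕ} {s : ℝ} {κ μ : ℂ}
    (hD : ∀ k : ℕ, (2 * (k + 1 : ℕ) + μ + s + 1) * (2 * (k + 1 : ℕ) + μ + s) ≠ κ)
    {V : Submodule ℂ ℂ[X]} (hV : ∀ F, polySpectral d s κ μ F ∈ V) (h1 : (1 : ℂ[X]) ∈ V) (F : ℂ[X]) :
    F ∈ V := by
  have hX : ∀ n : ℕ, (X ^ n : ℂ[X]) ∈ V := by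
    intro n
    induction n with
    | zero => simpa using h1
    | succ n ih =>
      obtain ⟨c, hc⟩ := polySpectral_X_pow d s κ μ n
      have h2 := V.add_mem (hV (X ^ (n + 1))) (V.smul_mem c ih)
      rw [hc, sub_add_cancel] at h2
      exact (V.smul_mem_iff (sub_ne_zero.2 (hD n))).1 h2
  induction F using Polynomial.induction_on' with
  | add p q hp hq => exact V.add_mem hp hq
  | monomial n a =>
    rw [← C_mul_X_pow_eq_monomial, ← smul_eq_C_mul]
    exact V.smul_mem a (hX n)

/-- Elimination of the second component from the resolvent equation. -/
theorem resolvent_eq_of_polySpectral {d : ℕ} {s : ℝ} {κ μ : ℂ} {F f g : ℂ[X]}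
    (h : polySpectral d s κ μ F = g + (μ • f + polyEuler (s + 1) f)) :
    μ • (F, μ • F + polyEuler s F - f) - polyFree d s (F, μ • F + polyEuler s F - f)
      - polyPotential κ (F, μ • F + polyEuler s F - f) = (f, g) := by
  refine Prod.ext ?_ ?_
  · change μ • F - (μ • F + polyEuler s F - f - polyEuler s F) - 0 = f
    abel
  · change μ • (μ • F + polyEuler s F - f) -
      (polyLaplacian d F - polyEuler (s + 1) (μ • F + polyEuler s F - f)) - κ • F = g
    have h' : polySpectral d s κ μ F = μ • (μ • F + polyEuler s F) +
      polyEuler (s + 1) (μ • F + polyEuler s F) - polyLaplacian d F - κ • F := rfl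
    rw [h'] at h
    rw [polyEuler_sub, smul_sub]
    linear_combination (exp := 1) h

/-- The resolvent equation is solvable on polynomials if no diagonal entry vanishes. -/
theorem surjective_resolvent {d : ℕ} {s : ℝ} {κ μ : ℂ}
    (hD : ∀ k : ℕ, (2 * k + μ + s + 1) * (2 * k + μ + s) ≠ κ) :
    Function.Surjective fun P => μ • P - polyFree d s P - polyPotential κ P := by
  rintro ⟨f, g⟩
  have h1 : (1 : ℂ[X]) ∈ LinearMap.range (polySpectral d s κ μ) := by
    have h0 := sub_ne_zero.2 (hD 0)
    simp only [Nat.cast_zero, mul_zero, zero_add] at h0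
    rw [← Submodule.smul_mem_iff _ h0, ← polySpectral_one]
    exact LinearMap.mem_range_self _ _
  obtain ⟨F, hF⟩ := eq_top_of_polySpectral (fun k => hD (k + 1)) (LinearMap.mem_range_self _) h1
    (g + (μ • f + polyEuler (s + 1) f))
  exact ⟨_, resolvent_eq_of_polySpectral hF⟩

theorem surjective_resolvent_free {d : ℕ} {s : ℝ} {μ : ℂ} (hμ : -s < μ.re) :
    Function.Surjective fun P => μ • P - polyFree d s P := by
  have h := surjective_resolvent (d := d) (s := s) (κ := 0) (μ := μ) fun k => by
    have hk : (0 : ℝ) ≤ k := Nat.cast_nonneg k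
    refine mul_ne_zero (fun h => ?_) fun h => ?_
    · have := congrArg Complex.re h
      simp at this
      linarith
    · have := congrArg Complex.re h
      simp at this
      linarith
  intro y
  obtain ⟨P, hP⟩ := h y
  refine ⟨P, ?_⟩
  have h0 : polyPotential 0 P = 0 := by
    change ((0 : ℂ[X]), (0 : ℂ) • P.1) = 0
    rw [zero_smul]
    rfl
  rw [← hP]
  simp only [h0, sub_zero]

/-- The diagonal entry factors as `(μ + 2 k - 1) (μ + 2 k + 2 s + 2)`; in the half plane considered
only `k = 0`, `μ = 1` gives zero. -/
theorem spectral_diagonal_ne {s : ℝ} {μ : ℂ} (hμ : -s < μ.re) (hμ' : -1 < μ.re) (hs : 0 < s) (k : ℕ)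
    (hk : k ≠ 0 ∨ μ ≠ 1) : (2 * k + μ + s + 1) * (2 * k + μ + s) ≠ ((s + 1) * (s + 2) : ℂ) := by
  intro h
  have e : (μ + 2 * k - 1) * (μ + 2 * k + 2 * s + 2) = 0 := by linear_combination h
  rcases mul_eq_zero.1 e with h1 | h1
  · rcases Nat.eq_zero_or_pos k with rfl | hk'
    · rcases hk with hk | hk
      · exact hk rfl
      · exact hk (by linear_combination h1)
    · have h2 := congrArg Complex.re h1
      have h3 : (1 : ℝ) ≤ k := by exact_mod_cast hk'
      simp at h2
      linarith
  · have h2 := congrArg Complex.re h1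
    have h3 : (0 : ℝ) ≤ k := Nat.cast_nonneg k
    simp at h2
    linarith

/-- At `μ = 1` the only obstruction is the constant mode, which a rank one perturbation removes. -/
theorem surjective_resolvent_one {d : ℕ} {s : ℝ} (hs : 0 < s) (l : ℂ[X] × ℂ[X] →ₗ[ℂ] ℂ)
    (hl : l (1, C (s + 1 : ℂ)) ≠ 0) :
    Function.Surjective fun P => (1 : ℂ) • P - polyFree d s P -
      (polyPotential ((s + 1) * (s + 2)) P + l P • ((0, 1) : ℂ[X] × ℂ[X])) := by
  rintro ⟨f, g⟩
  set κ : ℂ := (s + 1) * (s + 2) with hκ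
  set W : ℂ[X] × ℂ[X] →ₗ[ℂ] ℂ[X] × ℂ[X] := (1 : ℂ) • LinearMap.id - polyFree d s - polyPotential κ
    with hW
  have hker : W (1, C (s + 1 : ℂ)) = 0 := by
    have h0 : polySpectral d s κ 1 1 = 0 + ((1 : ℂ) • 0 + polyEuler (s + 1) 0) := by
      rw [polySpectral_one, hκ]
      simp only [polyEuler, derivative_zero, mul_zero, add_zero, smul_zero]
      rw [show ((1 : ℂ) + s + 1) * (1 + s) - (s + 1) * (s + 2) = 0 by ring, zero_smul]
    have h1 := resolvent_eq_of_polySpectral h0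
    have h2 : (1 : ℂ) • (1 : ℂ[X]) + polyEuler s 1 - 0 = C (s + 1 : ℂ) := by
      simp [polyEuler, add_comm]
    rw [h2] at h1
    exact h1
  -- The equation is solvable up to a constant `c` in the second component; adding a multiple of the
  -- kernel element adjusts `l P` to `-c`.
  obtain ⟨F, c, hc⟩ : ∃ F, ∃ c : ℂ,
      polySpectral d s κ 1 F + c • 1 = g + ((1 : ℂ) • f + polyEuler (s + 1) f) := by
    have hmem := eq_top_of_polySpectral (d := d) (s := s) (κ := κ) (μ := 1)
      (V := LinearMap.range (polySpectral d s κ 1) ⊔ Submodule.span ℂ {1})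
      (fun k => by
        have := spectral_diagonal_ne (s := s) (μ := 1) (by simp; linarith) (by simp) hs
          (k + 1) (Or.inl k.succ_ne_zero)
        exact this)
      (fun F => Submodule.mem_sup_left (LinearMap.mem_range_self _ _))
      (Submodule.mem_sup_right (Submodule.mem_span_singleton_self _))
      (g + ((1 : ℂ) • f + polyEuler (s + 1) f))
    obtain ⟨_, ⟨F, rfl⟩, z, hz, hFz⟩ := Submodule.mem_sup.1 hmem
    obtain ⟨c, rfl⟩ := Submodule.mem_span_singleton.1 hz
    exact ⟨F, c, hFz⟩
  have h2 : polySpectral d s κ 1 F = (g - c • 1) + ((1 : ℂ) • f + polyEuler (s + 1) f) := by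
    rw [sub_add_eq_add_sub, ← hc, add_sub_cancel_right]
  have h3 := resolvent_eq_of_polySpectral h2
  set P : ℂ[X] × ℂ[X] := (F, (1 : ℂ) • F + polyEuler s F - f) with hP
  have h4 : W P = (f, g - c • 1) := h3
  refine ⟨P - ((c + l P) / l (1, C (s + 1 : ℂ))) • (1, C (s + 1 : ℂ)), ?_⟩
  set t := (c + l P) / l (1, C (s + 1 : ℂ)) with ht
  have h5 : l (P - t • (1, C (s + 1 : ℂ))) = -c := by
    rw [map_sub, map_smul, smul_eq_mul, ht, div_mul_cancel₀ _ hl]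
    ring
  have h6 : W (P - t • (1, C (s + 1 : ℂ))) = (f, g - c • 1) := by
    rw [map_sub, map_smul, hker, smul_zero, sub_zero, h4]
  have h7 : ∀ Q, (1 : ℂ) • Q - polyFree d s Q - (polyPotential κ Q + l Q • ((0, 1) : ℂ[X] × ℂ[X])) =
      W Q - l Q • ((0, 1) : ℂ[X] × ℂ[X]) := by
    intro Q
    simp only [hW, LinearMap.sub_apply, LinearMap.smul_apply, LinearMap.id_apply]
    abel
  change (1 : ℂ) • (P - t • ((1 : ℂ[X]), C (s + 1 : ℂ))) - _ - _ = _
  rw [h7, h6, h5]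
  refine Prod.ext ?_ ?_
  · simp
  · simp

/-! ### Density of the polynomial pairs -/

theorem denseRange_polyJet_order {d K : ℕ} (hd : d = 2 * K + 3) :
    DenseRange (polyJet d (order d)) := by
  rw [order_eq hd]
  obtain ⟨C, hC⟩ := smooth_approx_snd hd
  exact denseRange_of_smooth (by omega) fun u hu U hU => (hC u hu U hU).1

theorem denseRange_polyJet_order_sub_one {d K : ℕ} (hd : d = 2 * K + 3) :
    DenseRange (polyJet d (order d - 1)) := by
  rw [order_eq hd]
  obtain ⟨C, hC⟩ := smooth_approx_fst hd
  exact denseRange_of_smooth (by omega) fun u hu U hU => (hC u hu U hU).1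

/-- The polynomial pairs are dense in the energy space. -/
theorem denseRange_energyJet {d K : ℕ} (hd : d = 2 * K + 3) : DenseRange (energyJet d) := by
  have h := (denseRange_polyJet_order hd).prodMap (denseRange_polyJet_order_sub_one hd)
  exact (WithLp.toLp_surjective 2).denseRange.comp h (WithLp.prod_continuous_toLp 2 _ _)

/-! ### The potential -/

theorem rate_pos {p : ℝ} (hp : 1 < p) : 0 < rate p := div_pos two_pos (sub_pos.2 hp)

/-- The potential strength `p c_p ^ (p - 1)` in terms of `s = 2 / (p - 1)`. -/
theorem potential_const {p : ℝ} (hp : 1 < p) :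
    p * profileConst p ^ (p - 1) = (rate p + 1) * (rate p + 2) := by
  have h : 0 < p - 1 := sub_pos.2 hp
  rw [profileConst, ← Real.rpow_mul (by positivity), one_div_mul_cancel h.ne', Real.rpow_one, rate]
  field_simp
  ring

theorem continuous_inclusion (d : ℕ) {n m : ℕ} (h : n ≤ m) : Continuous (inclusion d h) := by
  refine Continuous.subtype_mk ?_ _
  refine (PiLp.continuous_toLp 2 _).comp (continuous_pi fun α => ?_)
  exact (PiLp.continuous_apply 2 _ _).comp continuous_subtype_val

theorem continuous_potentialOp (d : ℕ) (p : ℝ) : Continuous (potentialOp d p) := by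
  refine (WithLp.prod_continuous_toLp 2 _ _).comp (continuous_const.prodMk ?_)
  have h : Continuous fun U : EnergySpace d => U.fst := continuous_fst.comp
    (WithLp.prod_continuous_ofLp 2 (radialSobolev d (order d)) (radialSobolev d (order d - 1)))
  exact Continuous.const_smul (c := ((p * profileConst p ^ (p - 1) : ℝ) : ℂ))
    ((continuous_inclusion d (Nat.sub_le (order d) 1)).comp h)

/-- The potential as a bounded operator. -/
def potentialCLM (d : ℕ) (p : ℝ) : EnergySpace d →L[ℂ] EnergySpace d :=
  ⟨potentialOp d p, continuous_potentialOp d p⟩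

theorem potentialCLM_energyJet {d : ℕ} {p : ℝ} (hp : 1 < p) (P : ℂ[X] × ℂ[X]) :
    potentialCLM d p (energyJet d P) =
      energyJet d (polyPotential ((rate p + 1) * (rate p + 2)) P) := by
  change WithLp.toLp 2 ((0 : radialSobolev d (order d)),
    ((p * profileConst p ^ (p - 1) : ℝ) : ℂ) • polyJet d (order d - 1) P.1) =
      WithLp.toLp 2 (polyJet d (order d) 0, polyJet d (order d - 1) (_ • P.1))
  rw [map_zero, map_smul, potential_const hp]
  push_cast
  rfl

/-! ### Compactness of the potential -/

/-- The value of `(D_d u₁)'` at `a`. -/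
def derivDEval (K : ℕ) (a : ℝ) : ℂ[X] × ℂ[X] →ₗ[ℂ] ℂ where
  toFun P := polyFun (derivDPoly K P.1) a
  map_add' P Q := by
    rw [Prod.fst_add, derivDPoly, polyChain_add, polyFun_add]
    rfl
  map_smul' c P := by
    rw [Prod.smul_fst, derivDPoly, polyChain_smul, polyFun_smul]
    rfl

theorem exists_near_grid {n : ℕ} (hn : 0 < n) {ρ : ℝ} (hρ : ρ ∈ Ioo (0 : ℝ) 1) :
    ∃ i : Fin n, ((i : ℝ) + 1 / 2) / n ∈ Ioo (0 : ℝ) 1 ∧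
      |ρ - ((i : ℝ) + 1 / 2) / n| ≤ 1 / n := by
  have hn' : (0 : ℝ) < n := Nat.cast_pos.2 hn
  have h1 : ⌊ρ * n⌋₊ < n := by
    rw [Nat.floor_lt (by nlinarith [hρ.1])]
    nlinarith [hρ.2]
  have h2 := Nat.floor_le (a := ρ * n) (by nlinarith [hρ.1])
  have h3 := Nat.lt_floor_add_one (ρ * n)
  have h4 : ((⌊ρ * n⌋₊ : ℝ) + 1) ≤ n := by exact_mod_cast h1
  refine ⟨⟨⌊ρ * n⌋₊, h1⟩, ⟨by positivity, ?_⟩, ?_⟩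
  · rw [div_lt_one hn']
    simp only
    linarith
  · have e : ρ - ((⌊ρ * n⌋₊ : ℝ) + 1 / 2) / n = (ρ * n - (⌊ρ * n⌋₊ + 1 / 2)) / n := by
      field_simp
    simp only
    rw [e, abs_div, abs_of_pos hn']
    refine div_le_div_of_nonneg_right ?_ hn'.le
    rw [abs_le]
    constructor <;> linarith

theorem grid_mem {n : ℕ} (i : Fin n) : ((i : ℝ) + 1 / 2) / n ∈ Ioo (0 : ℝ) 1 := by
  have h : ((i : ℝ) + 1) ≤ n := by exact_mod_cast i.2
  have hn : (0 : ℝ) < n := by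
    have : (0 : ℝ) ≤ i := Nat.cast_nonneg _
    linarith
  refine ⟨by positivity, ?_⟩
  rw [div_lt_one hn]
  linarith

/-- A function with small values on a grid of mesh `1 / n` is small up to `n^{-1/2}` times the
norm of its derivative. -/
theorem intervalNorm_le_grid {f : ℝ → ℂ} (hf : ContDiff ℝ ∞ f) {n : ℕ} (hn : 0 < n) :
    intervalNorm f ≤ (∑ i : Fin n, ‖f (((i : ℝ) + 1 / 2) / n)‖ₑ) +
      ENNReal.ofReal (1 / n) ^ (1 / 2 : ℝ) * intervalNorm (deriv f) := by
  refine intervalNorm_le_of_forall fun ρ hρ => ?_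
  obtain ⟨i, hi, hi'⟩ := exists_near_grid hn hρ
  have h1 := enorm_sub_le hf.contDiffOn hi hρ
  calc ‖f ρ‖ₑ = ‖f (((i : ℝ) + 1 / 2) / n) + (f ρ - f (((i : ℝ) + 1 / 2) / n))‖ₑ := by
        rw [add_sub_cancel]
    _ ≤ ‖f (((i : ℝ) + 1 / 2) / n)‖ₑ + ‖f ρ - f (((i : ℝ) + 1 / 2) / n)‖ₑ := enorm_add_le _ _
    _ ≤ _ := by
      refine add_le_add (Finset.single_le_sum (f := fun i : Fin n => ‖f (((i : ℝ) + 1 / 2) / n)‖ₑ)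
        (fun _ _ => zero_le) (Finset.mem_univ i)) (h1.trans ?_)
      gcongr

/-- The point values of `(D_d u₁)'` are bounded functionals on the energy space. -/
theorem exists_derivDEval_extension {d K : ℕ} (hd : d = 2 * K + 3) {a : ℝ} (ha : a ∈ Icc (0 : ℝ) 1) :
    ∃ l : EnergySpace d →L[ℂ] ℂ, ∀ P, l (energyJet d P) = derivDEval K a P := by
  obtain ⟨C₁, h₁⟩ := intervalNorm_deriv_derivDPoly_le hd
  obtain ⟨C₂, h₂⟩ := intervalNorm_derivDPoly_le hd
  refine ⟨(derivDEval K a).extendOfNorm (energyJet d), fun P =>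
    LinearMap.extendOfNorm_eq (denseRange_energyJet hd) ⟨(C₂ + C₁ + C₁ : ℝ≥0), fun P => ?_⟩ P⟩
  have n1 : ‖polyJet d (order d) P.1‖ₑ ≤ ‖energyJet d P‖ₑ :=
    WithLp.enorm_fst_le _ (energyJet d P)
  have b1 := (h₁ P.1).trans (mul_le_mul_right n1 _)
  have b3 := (h₂ (order d) (by rw [order_eq hd]; omega) P.1).trans (mul_le_mul_right n1 _)
  set y := polyFun (derivDPoly K P.1) with hy
  have hs : ContDiff ℝ ∞ y := contDiff_polyFun _
  have b4 := enorm_eval_one_le hs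
  have b5 := enorm_sub_le_Icc hs.contDiffOn hs.continuous.continuousOn
    (⟨zero_le_one, le_rfl⟩ : (1 : ℝ) ∈ Icc (0 : ℝ) 1) ha
  have b6 : ‖y a‖ₑ ≤ (C₂ + C₁ + C₁ : ℝ≥0) * ‖energyJet d P‖ₑ :=
    calc ‖y a‖ₑ = ‖y 1 + (y a - y 1)‖ₑ := by rw [add_sub_cancel]
      _ ≤ ‖y 1‖ₑ + ‖y a - y 1‖ₑ := enorm_add_le _ _
      _ ≤ (C₂ * ‖energyJet d P‖ₑ + C₁ * ‖energyJet d P‖ₑ) + C₁ * ‖energyJet d P‖ₑ :=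
        add_le_add (b4.trans (add_le_add b3 b1)) (b5.trans b1)
      _ = _ := by push_cast; ring
  rw [← ofReal_norm, ← ofReal_norm, ← ENNReal.ofReal_coe_nnreal,
    ← ENNReal.ofReal_mul (NNReal.coe_nonneg _), ENNReal.ofReal_le_ofReal_iff (by positivity)] at b6
  exact b6

/-- An inequality of Ehrling type: the potential is controlled by finitely many point values of
`(D_d u₁)'`, up to a small multiple of the norm. -/
theorem enorm_potential_le {d K : ℕ} (hd : d = 2 * K + 3) (p : ℝ) :
    ∃ C₁ C₂ : ℝ≥0, ∀ n : ℕ, 0 < n → ∀ P, ‖potentialCLM d p (energyJet d P)‖ₑ ≤ C₁ *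
      ((∑ i : Fin n, ‖derivDEval K (((i : ℝ) + 1 / 2) / n) P‖ₑ) +
        ENNReal.ofReal (1 / n) ^ (1 / 2 : ℝ) * (C₂ * ‖energyJet d P‖ₑ)) := by
  obtain ⟨C₁, h₁⟩ := enorm_polyJet_order_sub_one_le hd
  obtain ⟨C₂, h₂⟩ := intervalNorm_deriv_derivDPoly_le hd
  set k : ℂ := ((p * profileConst p ^ (p - 1) : ℝ) : ℂ) with hk
  refine ⟨‖k‖₊ * C₁, C₂, fun n hn P => ?_⟩
  have e : potentialCLM d p (energyJet d P) = WithLp.toLp 2 ((0 : radialSobolev d (order d)),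
    k • polyJet d (order d - 1) P.1) := rfl
  have n1 : ‖polyJet d (order d) P.1‖ₑ ≤ ‖energyJet d P‖ₑ :=
    WithLp.enorm_fst_le _ (energyJet d P)
  have h3 : intervalNorm (polyFun (derivDPoly K P.1)) ≤
      (∑ i : Fin n, ‖derivDEval K (((i : ℝ) + 1 / 2) / n) P‖ₑ) +
        ENNReal.ofReal (1 / n) ^ (1 / 2 : ℝ) * (C₂ * ‖energyJet d P‖ₑ) :=
    (intervalNorm_le_grid (contDiff_polyFun _) hn).trans
      (add_le_add_right (mul_le_mul_right ((h₂ P.1).trans (mul_le_mul_right n1 _)) _) _)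
  rw [e]
  refine (enorm_le_add _).trans ?_
  have hz : ‖(0 : radialSobolev d (order d))‖ₑ = 0 := by rw [← ofReal_norm, norm_zero]; simp
  change ‖(0 : radialSobolev d (order d))‖ₑ + ‖k • polyJet d (order d - 1) P.1‖ₑ ≤ _
  rw [hz, zero_add, enorm_smul, ENNReal.coe_mul, mul_assoc]
  exact mul_le_mul_right ((h₁ P.1).trans (mul_le_mul_right h3 _)) _

theorem norm_potential_le {d K : ℕ} (hd : d = 2 * K + 3) (p : ℝ) :
    ∃ C₁ C₂ : ℝ≥0, ∀ n : ℕ, 0 < n → ∀ P, ‖potentialCLM d p (energyJet d P)‖ ≤ C₁ *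
      ((∑ i : Fin n, ‖derivDEval K (((i : ℝ) + 1 / 2) / n) P‖) +
        (1 / (n : ℝ)) ^ (1 / 2 : ℝ) * (C₂ * ‖energyJet d P‖)) := by
  obtain ⟨C₁, C₂, h⟩ := enorm_potential_le hd p
  refine ⟨C₁, C₂, fun n hn P => ?_⟩
  have h1 := h n hn P
  have e : ∀ (a : ℝ≥0) (b : ℝ), 0 ≤ b → (a : ℝ≥0∞) * ENNReal.ofReal b = ENNReal.ofReal (a * b) := by
    intro a b _
    rw [ENNReal.ofReal_mul (NNReal.coe_nonneg _), ENNReal.ofReal_coe_nnreal]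
  have h0 : (0 : ℝ) ≤ (1 / (n : ℝ)) ^ (1 / 2 : ℝ) := by positivity
  rw [← ofReal_norm, ← ofReal_norm, e _ _ (norm_nonneg _),
    ENNReal.ofReal_rpow_of_nonneg (by positivity) (by norm_num), ← ENNReal.ofReal_mul h0] at h1
  simp only [← ofReal_norm] at h1
  rw [← ENNReal.ofReal_sum_of_nonneg fun _ _ => norm_nonneg _,
    ← ENNReal.ofReal_add (Finset.sum_nonneg fun _ _ => norm_nonneg _) (by positivity),
    e _ _ (by positivity), ENNReal.ofReal_le_ofReal_iff (by positivity)] at h1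
  exact h1

/-- The potential loses one derivative, so it is a compact operator. -/
theorem isCompactOperator_adjoint_potential {d K : ℕ} (hd : d = 2 * K + 3) (p : ℝ) :
    IsCompactOperator (ContinuousLinearMap.adjoint (potentialCLM d p)) := by
  obtain ⟨C₁, C₂, key⟩ := norm_potential_le hd p
  refine isCompactOperator_adjoint fun ε hε => ?_
  have hlim : Tendsto (fun n : ℕ => C₁ * ((1 / (n : ℝ)) ^ (1 / 2 : ℝ) * C₂)) atTop
      (𝓝 (C₁ * ((0 : ℝ) ^ (1 / 2 : ℝ) * C₂))) := by
    refine (((Real.continuousAt_rpow_const 0 (1 / 2) (Or.inr (by norm_num))).tendsto.comp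
      tendsto_one_div_atTop_nhds_zero_nat).mul_const _).const_mul _
  rw [Real.zero_rpow (by norm_num), zero_mul, mul_zero] at hlim
  obtain ⟨n, hn0, hn⟩ := ((eventually_gt_atTop 0).and (hlim.eventually_le_const hε)).exists
  choose l hl using fun i : Fin n =>
    exists_derivDEval_extension hd (Ioo_subset_Icc_self (grid_mem i))
  -- On the orthogonal complement of the Riesz representatives all point values vanish.
  refine ⟨Submodule.span ℂ (range fun i => (InnerProductSpace.toDual ℂ (EnergySpace d)).symm (l i)),
    FiniteDimensional.span_of_finite ℂ (finite_range _), fun x hx => ?_⟩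
  have h0 : ∀ i, l i x = 0 := by
    intro i
    rw [← InnerProductSpace.toDual_symm_apply]
    exact (Submodule.mem_orthogonal _ _).1 hx _ (Submodule.subset_span (mem_range_self i))
  have hx' : ‖potentialCLM d p x‖ ≤ C₁ * ((∑ i, ‖l i x‖) +
      (1 / (n : ℝ)) ^ (1 / 2 : ℝ) * (C₂ * ‖x‖)) := by
    refine (denseRange_energyJet hd).induction_on x
      (isClosed_le (by fun_prop) (by fun_prop)) fun P => ?_
    simp only [hl]
    exact key n hn0 P
  simp only [h0, norm_zero, Finset.sum_const_zero, zero_add] at hx'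
  calc _ ≤ _ := hx'
    _ = (C₁ * ((1 / (n : ℝ)) ^ (1 / 2 : ℝ) * C₂)) * ‖x‖ := by ring
    _ ≤ _ := by gcongr

/-! ### Approximation of the domain by polynomials in the graph norm -/

theorem contDiff_mul_polyFun_nat (F : ℂ[X]) (n : ℕ) :
    ContDiff ℝ n fun ρ : ℝ => (ρ : ℂ) * polyFun F ρ :=
  contDiff_infty.1 (contDiff_mul_polyFun F) n

theorem isFreePair_energyJet {d K : ℕ} (hd : d = 2 * K + 3) {p : ℝ} (hp : p ≠ 1)
    (P : ℂ[X] × ℂ[X]) :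
    IsFreePair d p (energyJet d P) (energyJet d (polyFree d (rate p) P)) := by
  have hd0 : d ≠ 0 := by omega
  refine ⟨polyFun P.1, polyFun P.2, ⟨smooth_polyFun _, smooth_polyFun _, ?_, ?_⟩,
    representsPair_energyJet d P, ?_, ?_⟩
  · refine ⟨fun ρ => ρ * polyFun (dPoly K P.1) ρ, (dOp_polyFun hd P.1).symm,
      (contDiff_mul_polyFun_nat _ 3).contDiffOn, ?_⟩
    rw [iteratedDerivWithin_eq_iteratedDeriv (uniqueDiffOn_Icc zero_lt_one)
      (contDiff_mul_polyFun_nat _ 2).contDiffAt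
      (left_mem_Icc.2 zero_le_one), iteratedDeriv_succ, iteratedDeriv_one, deriv_mul_polyFun,
      deriv_polyFun]
    simp
  · exact ⟨fun ρ => ρ * polyFun (dPoly K P.2) ρ, (dOp_polyFun hd P.2).symm,
      (contDiff_mul_polyFun_nat _ 2).contDiffOn⟩
  · rw [freeFst_polyFun d]
    exact represents_polyJet d _ _
  · exact (represents_polyJet d _ _).congr hd0 (freeSnd_polyFun d hp P).symm

theorem enorm_le_of_represents_fst {d K : ℕ} (hd : d = 2 * K + 3) : ∃ C : ℝ≥0,
    ∀ u : ℝ → ℂ, ContDiffOn ℝ ∞ u (Ioo 0 1) → ∀ U : radialSobolev d (order d), Represents u U →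
      ‖U‖ₑ ≤ C * (intervalNorm (deriv (deriv (dOp d u))) + intervalNorm u) := by
  rw [order_eq hd]
  obtain ⟨C, hC⟩ := smooth_approx_snd hd
  refine ⟨C, fun u hu U hU => ?_⟩
  rw [intervalNorm_congr (deriv_deriv_dOp hd hu)]
  exact (hC u hu U hU).2

theorem enorm_le_of_represents_snd {d K : ℕ} (hd : d = 2 * K + 3) : ∃ C : ℝ≥0,
    ∀ u : ℝ → ℂ, ContDiffOn ℝ ∞ u (Ioo 0 1) → ∀ U : radialSobolev d (order d - 1),
      Represents u U → ‖U‖ₑ ≤ C * intervalNorm (deriv (dOp d u)) := by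
  rw [order_eq hd]
  obtain ⟨C, hC⟩ := smooth_approx_fst hd
  refine ⟨C, fun u hu U hU => ?_⟩
  rw [intervalNorm_congr (deriv_dOp hd hu)]
  exact (hC u hu U hU).2

/-- Membership in the Sobolev space supplies the finiteness that Hardy's inequality needs. -/
theorem intervalNorm_deriv_le_of_represents {d K : ℕ} (hd : d = 2 * K + 3) : ∃ C : ℝ≥0,
    ∀ u : ℝ → ℂ, ContDiffOn ℝ ∞ u (Ioo 0 1) → ∀ U : radialSobolev d (order d), Represents u U →
      intervalNorm (deriv u) ≤ C * intervalNorm (deriv (deriv (dOp d u))) := by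
  obtain ⟨C, hC⟩ := chain_le_of_half_lt (c := fun i => 2 * i + 2)
    (fun i => by have : (0 : ℝ) ≤ i := by positivity
                 linarith) (K + 1)
  obtain ⟨C', hC'⟩ := chain_deriv_le_norm hd fun i => 2 * i + 2
  refine ⟨C, fun u hu U hU => ?_⟩
  rw [intervalNorm_congr (deriv_deriv_dOp hd hu)]
  refine hC _ (smooth_deriv hu) (fun i hi => ?_) 0 (Nat.zero_le _)
  exact ne_top_of_le_ne_top (ENNReal.mul_ne_top (by simp) (by simp))
    (hC' _ (order_eq hd).ge u hu U hU i hi.le)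

theorem intervalNorm_le_of_represents {d K : ℕ} (hd : d = 2 * K + 3) : ∃ C : ℝ≥0,
    ∀ u : ℝ → ℂ, ContDiffOn ℝ ∞ u (Ioo 0 1) → ∀ U : radialSobolev d (order d - 1),
      Represents u U → intervalNorm u ≤ C * intervalNorm (deriv (dOp d u)) := by
  obtain ⟨C, hC⟩ := chain_le_of_half_lt (c := fun i => 2 * i + 1)
    (fun i => by have : (0 : ℝ) ≤ i := by positivity
                 linarith) (K + 1)
  obtain ⟨C', hC'⟩ := chain_le_norm hd fun i => 2 * i + 1
  refine ⟨C, fun u hu U hU => ?_⟩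
  rw [intervalNorm_congr (deriv_dOp hd hu)]
  refine hC _ hu (fun i hi => ?_) 0 (Nat.zero_le _)
  exact ne_top_of_le_ne_top (ENNReal.mul_ne_top (by simp) (by simp))
    (hC' (order d - 1) (by rw [order_eq hd]; omega) u hu U hU i hi.le)

theorem intervalNorm_euler_le {u : ℝ → ℂ} (hu : ContDiffOn ℝ ∞ u (Ioo 0 1)) (c : ℝ) :
    intervalNorm (euler c u) ≤ intervalNorm (deriv u) + ‖c‖ₑ * intervalNorm u := by
  have e : euler c u = (fun ρ : ℝ => (ρ : ℂ) * deriv u ρ) + (c : ℂ) • u := rfl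
  have h := intervalNorm_add_le (smooth_mul_self (smooth_deriv hu)).continuousOn
    (hu.continuousOn.const_smul (c : ℂ))
  rw [intervalNorm_smul] at h
  rw [e]
  refine h.trans (add_le_add (intervalNorm_mono fun ρ hρ => ?_) (le_of_eq ?_))
  · rw [norm_mul, Complex.norm_real, Real.norm_of_nonneg hρ.1.le]
    exact mul_le_of_le_one_left (norm_nonneg _) hρ.2.le
  · congr 1
    rw [← ofReal_norm, ← ofReal_norm, Complex.norm_real]

/-- For smooth pairs whose transforms vanish suitably at the origin, the graph norm is controlled
by the derivatives of `(D_d h₁)''` and `(D_d h₂)'`. -/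
theorem graph_norm_le {d K : ℕ} (hd : d = 2 * K + 3) {p : ℝ} (hp : 1 < p) : ∃ C : ℝ≥0,
    ∀ h₁ h₂ z₁ z₂ : ℝ → ℂ, ContDiffOn ℝ ∞ h₁ (Ioo 0 1) → ContDiffOn ℝ ∞ h₂ (Ioo 0 1) →
      ∀ X Y : EnergySpace d, RepresentsPair h₁ h₂ X →
      RepresentsPair (freeFst p h₁ h₂) (freeSnd d p h₁ h₂) Y → h₁ (1 / 2) = 0 →
      EqOn z₁ (deriv (deriv (dOp d h₁))) (Ioo 0 1) → EqOn z₂ (deriv (dOp d h₂)) (Ioo 0 1) →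
      ContinuousOn z₁ (Icc 0 1) → ContinuousOn z₂ (Icc 0 1) → z₁ 0 = 0 → z₂ 0 = 0 →
      ‖X‖ₑ ≤ C * (intervalNorm (deriv z₁) + intervalNorm (deriv z₂)) ∧
      ‖Y‖ₑ ≤ C * (intervalNorm (deriv z₁) + intervalNorm (deriv z₂)) := by
  obtain ⟨A₁, hA₁⟩ := enorm_le_of_represents_fst hd
  obtain ⟨A₂, hA₂⟩ := enorm_le_of_represents_snd hd
  obtain ⟨B₁, hB₁⟩ := intervalNorm_deriv_le_of_represents hd
  obtain ⟨B₂, hB₂⟩ := intervalNorm_le_of_represents hd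
  set s := rate p with hs
  refine ⟨(A₁ * (1 + B₁) + A₂) + (A₁ * ((2 + ‖s + 1‖₊) + (B₂ + (B₁ + ‖s‖₊ * B₁))) +
    A₂ * (2 + ‖s + 1‖₊)), ?_⟩
  intro h₁ h₂ z₁ z₂ hs₁ hs₂ X Y hX hY h0 e₁ e₂ c₁ c₂ v₁ v₂
  have sd₁ : ContDiffOn ℝ ∞ (dOp d h₁) (Ioo 0 1) := smooth_dOp d hs₁
  have sd₂ : ContDiffOn ℝ ∞ (dOp d h₂) (Ioo 0 1) := smooth_dOp d hs₂
  have sz₁ : ContDiffOn ℝ ∞ z₁ (Ioo 0 1) := (smooth_deriv (smooth_deriv sd₁)).congr e₁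
  have sz₂ : ContDiffOn ℝ ∞ z₂ (Ioo 0 1) := (smooth_deriv sd₂).congr e₂
  have hl : (0 : ℝ) ∈ Icc (0 : ℝ) 1 := left_mem_Icc.2 zero_le_one
  set B := intervalNorm (deriv z₁) + intervalNorm (deriv z₂) with hB
  have n₁ : intervalNorm z₁ ≤ B := (intervalNorm_le_deriv_Icc sz₁ c₁ hl v₁).trans le_self_add
  have n₂ : intervalNorm z₂ ≤ B := (intervalNorm_le_deriv_Icc sz₂ c₂ hl v₂).trans le_add_self
  have d₁ : intervalNorm (deriv z₁) ≤ B := le_self_add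
  have d₂ : intervalNorm (deriv z₂) ≤ B := le_add_self
  have f₁ : intervalNorm (deriv h₁) ≤ B₁ * B := by
    refine (hB₁ h₁ hs₁ X.fst hX.1).trans ?_
    rw [← intervalNorm_congr e₁]
    gcongr
  have f₂ : intervalNorm h₁ ≤ B₁ * B :=
    (intervalNorm_le_deriv hs₁ ⟨by norm_num, by norm_num⟩ h0).trans f₁
  have f₃ : intervalNorm h₂ ≤ B₂ * B := by
    refine (hB₂ h₂ hs₂ X.snd hX.2).trans ?_
    rw [← intervalNorm_congr e₂]
    gcongr
  have gX : ‖X‖ₑ ≤ (A₁ * (1 + B₁) + A₂) * B := by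
    refine (enorm_le_add X).trans ?_
    have a₁ := hA₁ h₁ hs₁ X.fst hX.1
    have a₂ := hA₂ h₂ hs₂ X.snd hX.2
    rw [← intervalNorm_congr e₁] at a₁
    rw [← intervalNorm_congr e₂] at a₂
    calc _ ≤ A₁ * (B + B₁ * B) + A₂ * B := add_le_add
          (a₁.trans (mul_le_mul_right (add_le_add n₁ f₂) _)) (a₂.trans (mul_le_mul_right n₂ _))
      _ = _ := by ring
  have sF : ContDiffOn ℝ ∞ (freeFst p h₁ h₂) (Ioo 0 1) := by
    rw [freeFst_eq]
    exact smooth_sub hs₂ (smooth_euler hs₁ _)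
  have sG : ContDiffOn ℝ ∞ (freeSnd d p h₁ h₂) (Ioo 0 1) := by
    rw [freeSnd_eq d hp.ne']
    exact smooth_sub (smooth_radialLaplacian d hs₁) (smooth_euler hs₂ _)
  have k₁ : intervalNorm (freeFst p h₁ h₂) ≤ B₂ * B + (B₁ * B + ‖s‖ₑ * (B₁ * B)) := by
    rw [freeFst_eq]
    refine (intervalNorm_sub_le hs₂.continuousOn (smooth_euler hs₁ _).continuousOn).trans ?_
    refine add_le_add f₃ ((intervalNorm_euler_le hs₁ _).trans ?_)
    exact add_le_add f₁ (mul_le_mul_right f₂ _)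
  have k₂ : intervalNorm (deriv (deriv (dOp d (freeFst p h₁ h₂)))) ≤
      B + (B + ‖s + 1‖ₑ * B) := by
    have e : EqOn (deriv (deriv (dOp d (freeFst p h₁ h₂)))) (deriv z₂ - euler (s + 1) z₁)
        (Ioo 0 1) := by
      refine (deriv_deriv_dOp_freeFst hd p hs₁ hs₂).trans fun ρ hρ => ?_
      rw [Pi.sub_apply, Pi.sub_apply, eqOn_deriv e₂ hρ, euler_congr e₁ _ hρ]
    rw [intervalNorm_congr e]
    refine (intervalNorm_sub_le (smooth_deriv sz₂).continuousOn
      (smooth_euler sz₁ _).continuousOn).trans (add_le_add d₂ ?_)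
    exact (intervalNorm_euler_le sz₁ _).trans (add_le_add d₁ (mul_le_mul_right n₁ _))
  have k₃ : intervalNorm (deriv (dOp d (freeSnd d p h₁ h₂))) ≤ B + (B + ‖s + 1‖ₑ * B) := by
    have e : EqOn (deriv (dOp d (freeSnd d p h₁ h₂))) (deriv z₁ - euler (s + 1) z₂)
        (Ioo 0 1) := by
      refine (deriv_dOp_freeSnd hd hp.ne' hs₁ hs₂).trans fun ρ hρ => ?_
      rw [Pi.sub_apply, Pi.sub_apply, eqOn_deriv e₁ hρ, euler_congr e₂ _ hρ]
    rw [intervalNorm_congr e]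
    refine (intervalNorm_sub_le (smooth_deriv sz₁).continuousOn
      (smooth_euler sz₂ _).continuousOn).trans (add_le_add d₁ ?_)
    exact (intervalNorm_euler_le sz₂ _).trans (add_le_add d₂ (mul_le_mul_right n₂ _))
  have gY : ‖Y‖ₑ ≤ (A₁ * ((2 + ‖s + 1‖ₑ) + (B₂ + (B₁ + ‖s‖ₑ * B₁))) +
      A₂ * (2 + ‖s + 1‖ₑ)) * B := by
    refine (enorm_le_add Y).trans ?_
    calc _ ≤ A₁ * ((B + (B + ‖s + 1‖ₑ * B)) + (B₂ * B + (B₁ * B + ‖s‖ₑ * (B₁ * B)))) +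
          A₂ * (B + (B + ‖s + 1‖ₑ * B)) := add_le_add
          ((hA₁ _ sF Y.fst hY.1).trans (mul_le_mul_right (add_le_add k₂ k₁) _))
          ((hA₂ _ sG Y.snd hY.2).trans (mul_le_mul_right k₃ _))
      _ = _ := by ring
  push_cast
  exact ⟨gX.trans (mul_le_mul_left le_self_add _), gY.trans (mul_le_mul_left le_add_self _)⟩

/-- If `f` on `(0, 1)` extends to a `Cⁿ⁺¹` function on `[0, 1]`, then its `n`-th derivative extends
continuously, with a square integrable derivative. -/
theorem exists_continuous_extension_iterate_deriv {f w : ℝ → ℂ} (n : ℕ) (h : EqOn w f (Ioo 0 1))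
    (hw : ContDiffOn ℝ (n + 1 : ℕ) w (Icc 0 1)) :
    EqOn (iteratedDerivWithin n w (Icc 0 1)) (deriv^[n] f) (Ioo 0 1) ∧
      ContinuousOn (iteratedDerivWithin n w (Icc 0 1)) (Icc 0 1) ∧
      intervalNorm (deriv (iteratedDerivWithin n w (Icc 0 1))) ≠ ⊤ := by
  have hU : UniqueDiffOn ℝ (Icc (0 : ℝ) 1) := uniqueDiffOn_Icc zero_lt_one
  have e : ∀ k, EqOn (iteratedDerivWithin k w (Icc 0 1)) (deriv^[k] f) (Ioo 0 1) := by
    intro k ρ hρ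
    have h1 : (Icc (0 : ℝ) 1 : Set ℝ) =ᶠ[𝓝 ρ] Ioo 0 1 := by
      filter_upwards [isOpen_Ioo.mem_nhds hρ] with x hx
      exact propext ⟨fun _ => hx, fun _ => Ioo_subset_Icc_self hx⟩
    rw [iteratedDerivWithin, iteratedFDerivWithin_congr_set h1, ← iteratedDerivWithin,
      iteratedDerivWithin_of_isOpen isOpen_Ioo hρ,
      ← iteratedDeriv_eq_iterate]
    exact (h.eventuallyEq_of_mem (isOpen_Ioo.mem_nhds hρ)).iteratedDeriv_eq k
  refine ⟨e n, hw.continuousOn_iteratedDerivWithin (by exact_mod_cast Nat.le_succ n) hU, ?_⟩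
  have hc := hw.continuousOn_iteratedDerivWithin (m := n + 1) le_rfl hU
  obtain ⟨C, hC⟩ := isCompact_Icc.exists_bound_of_continuousOn hc
  refine ne_top_of_le_ne_top ENNReal.ofReal_ne_top (intervalNorm_le_of_forall
    (B := ENNReal.ofReal C) fun ρ hρ => ?_)
  have h2 : deriv (iteratedDerivWithin n w (Icc 0 1)) ρ =
      iteratedDerivWithin (n + 1) w (Icc 0 1) ρ := by
    rw [eqOn_deriv (e n) hρ, e (n + 1) hρ, Function.iterate_succ_apply']
  rw [h2, ← ofReal_norm]
  exact ENNReal.ofReal_le_ofReal (hC ρ (Ioo_subset_Icc_self hρ))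

/-- A polynomial whose transform `(D_d ·)''` has derivative close to that of `z`, with prescribed value
at `1/2`: invert all Euler operators on an even polynomial close to `z'`. -/
theorem exists_polynomial_fst (K : ℕ) {z : ℝ → ℂ} (hz : ContDiffOn ℝ ∞ z (Ioo 0 1))
    (hN : intervalNorm (deriv z) ≠ ⊤) (c : ℂ) {ε : ℝ≥0∞} (hε : ε ≠ 0) :
    ∃ F : ℂ[X], polyFun F (1 / 2) = c ∧
      intervalNorm (deriv (z - deriv (polyFun (derivDPoly K F)))) ≤ ε := by
  obtain ⟨H, hH⟩ := exists_polyFun_near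
    (aestronglyMeasurable_of_continuousOn (smooth_deriv hz).continuousOn) hN hε
  obtain ⟨J, rfl⟩ := polyEuler_surjective one_pos H
  obtain ⟨E, hE⟩ := polyChain_surjective (c := fun i => 2 * i + 1 + 2) (fun i => by positivity)
    (K + 1) (C (1 / 2) * J)
  obtain ⟨F, hF, hFc⟩ := exists_derivative_eq E (1 / 4) c
  refine ⟨F, ?_, ?_⟩
  · rw [← hFc, polyFun]
    congr 1
    norm_num
  · have h1 : deriv (polyFun (derivDPoly K F)) = fun ρ : ℝ => (ρ : ℂ) * polyFun J ρ := by
      rw [deriv_polyFun', derivDPoly,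
        ← polyChain_derivative (fun i : ℕ => 2 * (i : ℝ) + 1), hF, hE, ← mul_assoc, ← C_mul]
      norm_num
    rw [h1]
    refine le_trans (le_of_eq (intervalNorm_congr ?_)) hH
    refine (deriv_sub_eqOn hz (contDiff_mul_polyFun J).contDiffOn).trans fun ρ _ => ?_
    rw [deriv_mul_polyFun]

/-- A polynomial whose transform `(D_d ·)'` has derivative close to that of `z`, with prescribed value
of the transform at the origin. -/
theorem exists_polynomial_snd (K : ℕ) {z : ℝ → ℂ} (hz : ContDiffOn ℝ ∞ z (Ioo 0 1))
    (hN : intervalNorm (deriv z) ≠ ⊤) (c : ℂ) {ε : ℝ≥0∞} (hε : ε ≠ 0) :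
    ∃ G : ℂ[X], polyFun (derivDPoly K G) 0 = c ∧
      intervalNorm (deriv (z - polyFun (derivDPoly K G))) ≤ ε := by
  obtain ⟨H, hH⟩ := exists_mul_polyFun_near
    (aestronglyMeasurable_of_continuousOn (smooth_deriv hz).continuousOn) hN hε
  obtain ⟨R, hR, hRc⟩ := exists_derivative_eq (C (1 / 2) * H) 0 c
  obtain ⟨G, hG⟩ := polyChain_surjective (c := fun i => 2 * i + 1) (fun i => by positivity)
    (K + 1) R
  refine ⟨G, ?_, ?_⟩
  · rw [← hRc, polyFun, derivDPoly, hG]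
    simp
  · rw [derivDPoly, hG]
    refine le_trans (le_of_eq (intervalNorm_congr ?_)) hH
    refine (deriv_sub_eqOn hz (smooth_polyFun R)).trans fun ρ _ => ?_
    rw [deriv_polyFun', hR, ← mul_assoc, ← C_mul]
    norm_num

/-- The polynomial pairs are a core of the closure of the free operator. -/
theorem graph_freeOp_subset {d K : ℕ} [NeZero d] (hd : d = 2 * K + 3) {p : ℝ} (hp : 1 < p) :
    ((freeOp d p).graph : Set (EnergySpace d × EnergySpace d)) ⊆
      closure (range fun P => (energyJet d P, energyJet d (polyFree d (rate p) P))) := by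
  rintro ⟨U, V⟩ hUV
  obtain ⟨u₁, u₂, hu, hU, hV⟩ := mem_graph_freeOp.1 hUV
  obtain ⟨w₁, ew₁, hw₁, h0⟩ := hu.dOp_fst
  obtain ⟨w₂, ew₂, hw₂⟩ := hu.dOp_snd
  obtain ⟨e₁, c₁, N₁⟩ := exists_continuous_extension_iterate_deriv 2 ew₁ hw₁
  obtain ⟨e₂, c₂, N₂⟩ := exists_continuous_extension_iterate_deriv 1 ew₂ hw₂
  set z₁ := iteratedDerivWithin 2 w₁ (Icc 0 1) with hz₁
  set z₂ := iteratedDerivWithin 1 w₂ (Icc 0 1) with hz₂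
  have sd₁ := smooth_dOp d hu.smooth_fst
  have sd₂ := smooth_dOp d hu.smooth_snd
  have sz₁ : ContDiffOn ℝ ∞ z₁ (Ioo 0 1) := (smooth_deriv (smooth_deriv sd₁)).congr e₁
  have sz₂ : ContDiffOn ℝ ∞ z₂ (Ioo 0 1) := (smooth_deriv sd₂).congr e₂
  obtain ⟨C, hC⟩ := graph_norm_le hd hp
  have hd0 : d ≠ 0 := NeZero.ne d
  rw [Metric.mem_closure_iff]
  intro δ hδ
  obtain ⟨ε, hε, hεδ⟩ : ∃ ε : ℝ, 0 < ε ∧ C * (ε + ε) < δ := by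
    refine ⟨δ / (2 * (C + 1) * 2), by positivity, ?_⟩
    have hC0 : (0 : ℝ) ≤ C := C.2
    rw [← add_div, ← two_mul, mul_div_assoc', div_lt_iff₀ (by positivity)]
    nlinarith
  have hε' : ENNReal.ofReal ε ≠ 0 := by simpa using hε
  -- After subtraction of the polynomials, `u₁` vanishes at `1/2` and both transforms vanish at the
  -- origin; for `(D_d u₁)''` this is the boundary condition in the domain.
  obtain ⟨F, hF, hF'⟩ := exists_polynomial_fst K sz₁ N₁ (u₁ (1 / 2)) hε'
  obtain ⟨G, hG, hG'⟩ := exists_polynomial_snd K sz₂ N₂ (z₂ 0) hε'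
  refine ⟨_, mem_range_self (F, G), ?_⟩
  obtain ⟨f₁, f₂, hf, hX, hY⟩ : ∃ f₁ f₂, (f₁ = u₁ - polyFun F ∧ f₂ = u₂ - polyFun G) ∧
      RepresentsPair f₁ f₂ (U - energyJet d (F, G)) ∧
      RepresentsPair (freeFst p f₁ f₂) (freeSnd d p f₁ f₂)
        (V - energyJet d (polyFree d (rate p) (F, G))) := by
    refine ⟨(-1 : ℂ) • polyFun F + u₁, (-1 : ℂ) • polyFun G + u₂, ⟨?_, ?_⟩, ?_⟩
    · rw [neg_one_smul]; abel
    · rw [neg_one_smul]; abel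
    have hP := representsPair_energyJet d (F, G)
    have eU : U - energyJet d (F, G) = (-1 : ℂ) • energyJet d (F, G) + U := by
      rw [neg_one_smul]; abel
    have eV : V - energyJet d (polyFree d (rate p) (F, G)) =
        (-1 : ℂ) • energyJet d (polyFree d (rate p) (F, G)) + V := by
      rw [neg_one_smul]; abel
    rw [eU, eV]
    have hQ1 := represents_polyJet d (order d) (polyFree d (rate p) (F, G)).1
    have hQ2 := represents_polyJet d (order d - 1) (polyFree d (rate p) (F, G)).2
    rw [← freeFst_polyFun d] at hQ1
    have hQ2' := hQ2.congr hd0 (freeSnd_polyFun d hp.ne' (F, G)).symm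
    exact ⟨⟨hP.1.comb hU.1 (-1), hP.2.comb hU.2 (-1)⟩,
      (hQ1.comb hV.1 (-1)).congr hd0 (freeFst_comb p (smooth_polyFun F) hu.smooth_fst (-1)),
      (hQ2'.comb hV.2 (-1)).congr hd0 (freeSnd_comb d p (smooth_polyFun F) (smooth_polyFun G)
        hu.smooth_fst hu.smooth_snd (-1))⟩
  obtain ⟨rfl, rfl⟩ := hf
  have key := hC _ _ (z₁ - deriv (polyFun (derivDPoly K F))) (z₂ - polyFun (derivDPoly K G))
    (smooth_sub hu.smooth_fst (smooth_polyFun F)) (smooth_sub hu.smooth_snd (smooth_polyFun G))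
    _ _ hX hY (by rw [Pi.sub_apply, hF, sub_self]) ?_ ?_ ?_ ?_ ?_ ?_
  · rw [Prod.dist_eq]
    have b : ∀ x : ℝ≥0∞, x ≤ C * (intervalNorm (deriv (z₁ - deriv (polyFun (derivDPoly K F)))) +
        intervalNorm (deriv (z₂ - polyFun (derivDPoly K G)))) → x < ENNReal.ofReal δ := by
      intro x hx
      refine (hx.trans (mul_le_mul_right (add_le_add hF' hG') _)).trans_lt ?_
      rw [← ENNReal.ofReal_add hε.le hε.le, ← ENNReal.ofReal_coe_nnreal,
        ← ENNReal.ofReal_mul (NNReal.coe_nonneg _)]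
      exact (ENNReal.ofReal_lt_ofReal_iff hδ).2 hεδ
    have b1 := b _ key.1
    have b2 := b _ key.2
    rw [← ofReal_norm, ENNReal.ofReal_lt_ofReal_iff hδ, ← dist_eq_norm] at b1 b2
    exact max_lt b1 b2
  · have h1 := (eqOn_deriv (eqOn_deriv (dOp_sub d hu.smooth_fst (smooth_polyFun F)))).trans
      ((eqOn_deriv (deriv_sub_eqOn sd₁ (smooth_dOp d (smooth_polyFun F)))).trans
        (deriv_sub_eqOn (smooth_deriv sd₁) (smooth_deriv (smooth_dOp d (smooth_polyFun F)))))
    have h2 := eqOn_deriv (eqOn_deriv (dOp_polyFun hd F))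
    rw [deriv_mul_polyFun, ← derivDPoly_eq] at h2
    intro ρ hρ
    rw [h1 hρ, Pi.sub_apply, Pi.sub_apply, h2 hρ, e₁ hρ]
    rfl
  · have h1 := (eqOn_deriv (dOp_sub d hu.smooth_snd (smooth_polyFun G))).trans
      (deriv_sub_eqOn sd₂ (smooth_dOp d (smooth_polyFun G)))
    have h2 := eqOn_deriv (dOp_polyFun hd G)
    rw [deriv_mul_polyFun, ← derivDPoly_eq] at h2
    intro ρ hρ
    rw [h1 hρ, Pi.sub_apply, Pi.sub_apply, h2 hρ, e₂ hρ]
    rfl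
  · rw [deriv_polyFun']
    exact c₁.sub (continuous_mul_polyFun _).continuousOn
  · exact c₂.sub (continuous_polyFun _).continuousOn
  · rw [Pi.sub_apply, h0, deriv_polyFun']
    simp
  · rw [Pi.sub_apply, hG, sub_self]

/-- The free operator with its polynomial core satisfies the abstract hypotheses. -/
theorem hasResolventCore {d K : ℕ} [NeZero d] (hd : d = 2 * K + 3) {p : ℝ} (hp : 1 < p) :
    ∃ C, HasResolventCore (freeOp d p) (energyJet d) (polyFree d (rate p)) (-rate p) C := by
  obtain ⟨C, hC⟩ := norm_energyJet_le hd (rate p)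
  exact ⟨C, denseRange_energyJet hd, fun P => mem_graph_freeOp.2 (isFreePair_energyJet hd hp.ne' P),
    graph_freeOp_subset hd hp, fun μ hμ => surjective_resolvent_free hμ, hC⟩

/-! ### The spectrum of the linearized operator -/

theorem inResolventSet_linearizedOp {d K : ℕ} [NeZero d] (hd : d = 2 * K + 3) {p : ℝ} (hp : 1 < p)
    {μ : ℂ} (h1 : μ ≠ 1) (hμ : max (-rate p) (-1) < μ.re) :
    InResolventSet (linearizedOp d p) μ := by
  obtain ⟨hμ1, hμ2⟩ := max_lt_iff.1 hμ
  obtain ⟨C, hT⟩ := hasResolventCore hd hp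
  exact hT.inResolventSet (isCompactOperator_adjoint_potential hd p) (potentialCLM_energyJet hp) hμ1
    (surjective_resolvent fun k => spectral_diagonal_ne hμ1 hμ2 (rate_pos hp) k (Or.inr h1))

/-- The polynomial pair of the eigenfunction `(1, (p + 1) / (p - 1))`. -/
def polyMode (s : ℝ) : ℂ[X] × ℂ[X] := (1, C (s + 1 : ℂ))

theorem polyFree_add_polyPotential_polyMode (d : ℕ) (s : ℝ) :
    polyFree d s (polyMode s) + polyPotential ((s + 1) * (s + 2)) (polyMode s) = polyMode s := by
  refine Prod.ext ?_ ?_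
  · change C (s + 1 : ℂ) - polyEuler s 1 + 0 = 1
    simp [polyEuler]
  · change polyLaplacian d 1 - polyEuler (s + 1) (C (s + 1 : ℂ)) +
      ((s + 1) * (s + 2) : ℂ) • 1 = C (s + 1 : ℂ)
    simp only [polyLaplacian, polyEuler, derivative_one, derivative_C, mul_zero, add_zero, zero_add,
      smul_eq_C_mul, mul_one, derivative_zero, ← C_mul, zero_sub, neg_add_eq_sub, ← C_sub]
    congr 1
    push_cast
    ring

theorem representsPair_polyMode (d : ℕ) {p : ℝ} (hp : 1 < p) :
    RepresentsPair (fun _ => 1) (fun _ => ((p : ℂ) + 1) / ((p : ℂ) - 1))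
      (energyJet d (polyMode (rate p))) := by
  have h := representsPair_energyJet d (polyMode (rate p))
  have h0 : (p : ℂ) - 1 ≠ 0 := sub_ne_zero.2 (by exact_mod_cast hp.ne')
  have e1 : polyFun (polyMode (rate p)).1 = fun _ => 1 := by
    funext ρ
    simp [polyFun, polyMode]
  have e2 : polyFun (polyMode (rate p)).2 = fun _ => ((p : ℂ) + 1) / ((p : ℂ) - 1) := by
    funext ρ
    simp only [polyFun, polyMode, eval_C, rate]
    push_cast
    field_simp
    ring
  rwa [e1, e2] at h

theorem energyJet_polyMode_ne_zero {d : ℕ} (hd : d ≠ 0) {p : ℝ} (hp : 1 < p) :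
    energyJet d (polyMode (rate p)) ≠ 0 := by
  intro h
  have h1 := (representsPair_polyMode d hp).1
  rw [h] at h1
  have h2 := Represents.eqOn_zero hd continuousOn_const h1
    (show (1 / 2 : ℝ) ∈ Ioo (0 : ℝ) 1 by constructor <;> norm_num)
  exact one_ne_zero h2

theorem energyJet_polyMode_mem_eigenspace {d K : ℕ} [NeZero d] (hd : d = 2 * K + 3) {p : ℝ}
    (hp : 1 < p) : energyJet d (polyMode (rate p)) ∈ eigenspaceOf (linearizedOp d p) 1 := by
  obtain ⟨C, hT⟩ := hasResolventCore hd hp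
  exact hT.mem_eigenspace (potentialCLM_energyJet hp)
    ((polyFree_add_polyPotential_polyMode d (rate p)).trans (one_smul ℂ _).symm)

theorem eigenspace_linearizedOp {d K : ℕ} [NeZero d] (hd : d = 2 * K + 3) {p : ℝ} (hp : 1 < p) :
    eigenspaceOf (linearizedOp d p) 1 = Submodule.span ℂ {energyJet d (polyMode (rate p))} := by
  obtain ⟨C, hT⟩ := hasResolventCore hd hp
  have hg0 : inner ℂ (energyJet d (polyMode (rate p))) (energyJet d (polyMode (rate p))) ≠ (0 : ℂ) :=
    inner_self_ne_zero.2 (energyJet_polyMode_ne_zero (NeZero.ne d) hp)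
  refine hT.eigenspace_eq_span (isCompactOperator_adjoint_potential hd p)
    (potentialCLM_energyJet hp) ?_ (0, 1) hg0 (energyJet_polyMode_mem_eigenspace hd hp)
    (surjective_resolvent_one (d := d) (rate_pos hp)
      ((innerSL ℂ (energyJet d (polyMode (rate p))) : EnergySpace d →ₗ[ℂ] ℂ) ∘ₗ energyJet d) hg0)
  have := rate_pos hp
  simp only [Complex.one_re]
  linarith

end

end LinearizedWave

theorem lemma4p8 (d : ℕ) [NeZero d] (hd : 5 ≤ d) (hodd : Odd d) (p : ℝ)
    (hp : ((d : ℝ) + 3) / ((d : ℝ) - 1) < p) :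
    (LinearizedWave.freeOp d p).IsClosable ∧
    (∀ μ ∈ LinearizedWave.spectrumOf (LinearizedWave.linearizedOp d p),
      μ = 1 ∨ μ.re ≤ max (-(2 / (p - 1))) (-1)) ∧
    ∃ g : LinearizedWave.EnergySpace d,
      LinearizedWave.RepresentsPair (fun _ => 1) (fun _ => ((p : ℂ) + 1) / ((p : ℂ) - 1)) g ∧
      LinearizedWave.IsEigenvalue (LinearizedWave.linearizedOp d p) 1 ∧
      LinearizedWave.eigenspaceOf (LinearizedWave.linearizedOp d p) 1 = Submodule.span ℂ {g} := by
  obtain ⟨K, hK⟩ : ∃ K, d = 2 * K + 3 := by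
    obtain ⟨k, rfl⟩ := hodd
    exact ⟨k - 1, by omega⟩
  have hp1 : 1 < p := by
    refine lt_of_le_of_lt ?_ hp
    have hd' : (5 : ℝ) ≤ d := by exact_mod_cast hd
    rw [le_div_iff₀ (by linarith)]
    linarith
  refine ⟨?_, fun μ hμ => ?_, LinearizedWave.energyJet d (LinearizedWave.polyMode
    (LinearizedWave.rate p)), LinearizedWave.representsPair_polyMode d hp1, ?_,
    LinearizedWave.eigenspace_linearizedOp hK hp1⟩
  · obtain ⟨C, hT⟩ := LinearizedWave.hasResolventCore hK hp1
    exact hT.isClosable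
  · by_contra! h
    exact hμ (LinearizedWave.inResolventSet_linearizedOp hK hp1 h.1 h.2)
  · exact ⟨_, LinearizedWave.energyJet_polyMode_mem_eigenspace hK hp1,
      LinearizedWave.energyJet_polyMode_ne_zero (NeZero.ne d) hp1⟩
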